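/- Let $N=2M\geq 8$ be an even integer that is not a multiple of $3$, and consider the potential $$V_\gamma(x)=\sum_{i=1}^N\Bigl(\tfrac14x_i^4-\tfrac12x_i^2\Bigr)+\frac\gamma4\sum_{i=1}^N(x_{i+1}-x_i)^2,\qquad x_{N+1}=x_1,\ \gamma\ge 0,$$ restricted to the hyperplane $S=\{x\in\mathbb R^N:\sum_i x_i=0\}$. All stationary points, indices, gradient flows and paths below refer to $V_\gamma$ on $S$. *Local minima* and *$1$-saddles* are the nondegenerate stationary points of index $0$ and $1$. The *transition graph* at $\gamma$ joins two distinct local minima by an edge if some $1$-saddle has an unstable manifold whose two branches converge to these two minima. A stationary point of $V_0$ has triple $(a_0,a_1,a_2)$ if its coordinates are among three distinct roots of an equation $\xi^3-\xi=\lambda$, occurring $a_0,a_1,a_2$ times. Let $B_0$, $B_1$ be the sets of local minima of $V_0$ with triples $(0,M,M)$, $(0,M-1,M+1)$, and $C_1$ the set of $1$-saddles of $V_0$ with triple $(1,M-1,M)$. Points of $B_0$ have $M$ coordinates $+1$ (particles) and $M$ coordinates $-1$ (holes). For a stationary point $a=a(0)$ of $V_0$ write $a(\gamma)$ for its continuation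 along a continuous branch of nondegenerate stationary points of $V_{\gamma'}$, $0\le\gamma'\le\gamma$, and $B_k(\gamma)$ for the set of all $a(\gamma)$, $a\in B_k$. For $a\in B_0$ let $I(a)=\#\{i: a_i\ne a_{i+1}\}$ be its number of interfaces, and $\eta_i(a)=1_{\{a_{i-1}\ne a_i\}}+1_{\{a_i\ne a_{i+1}\}}\in\{0,1,2\}$ its number of interfaces at site $i$; site $i$ is isolated if $\eta_i(a)=2$. A *transition* between two distinct points of $B_0(\gamma)$ is possible if they have a common neighbour in $B_1(\gamma)$ in the transition graph at $\gamma$. The *communication height* from $x$ to $y$ is $$H(x,y)=\inf_{\phi}\sup_{t\in[0,1]}V_\gamma(\phi(t))-V_\gamma(x),$$ the infimum being over all continuous paths $\phi:[0,1]\to S$ from $x$ to $y$; for $x,y\in B_0(\gamma)$ the *communication height of the transition*, $H_{\mathrm{tr}}(x,y)$, is the same quantity with the infimum restricted to paths that do not meet the basin of attraction (under the gradient flow $\dot u=-\nabla V_\gamma(u)$ on $S$) of any element of $B_0(\gamma)\setminus\{x,y\}$. **Proposition.** For all $b\in B_0$, $c\in C_1$, $$V_0(c)-V_0(b)=H^{(0)}:=\frac{M(M-1)}{4(M^2-3M+3)}.$$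 Moreover there are constants $\gamma_0>0$ and $K$, depending only on $M$, such that for every $\gamma\in[0,\gamma_0)$ each $a\in B_0$ has exactly one continuation $a(\gamma)$, and for all $a_1,a_2\in B_0$ the following hold, with $p=I(a_1)$. 1. A transition between $a_1(\gamma)$ and $a_2(\gamma)$ is possible if and only if $a_2$ is obtained from $a_1$ by interchanging a particle (at some site $i$) and a hole (at some site $j$). 2. In that case $I(a_2)\in\{p-4,p-2,p,p+2,p+4\}$. 3. In that case the transition has exactly one of the following types, determined by $\eta=(\eta_i(a_1),\eta_j(a_1))$ and by whether $i,j$ are nearest neighbours; the table gives $\Delta p=I(a_2)-I(a_1)$ and the coefficient $H^{(1)}$, with $D=4(M^2-3M+3)$: | Type | $i,j$ not neighbours: $\eta$ | $i,j$ neighbours: $\eta$ | $\Delta p$ | $H^{(1)}$ | |---|---|---|---|---| | I | $(0,0)$ | – | $+4$ | $(10M^2-36M+36-3p)/D$ | | II | $(0,1),(1,0)$ | $(1,1)$ | $+2$ | $(2(M-3)^2-3p)/D$ | | III | $(1,1)$ | – | $0$ | $(-2M^2+6M-3p)/D$ | | IV | $(0,2),(2,0)$ | $(1,2),(2,1)$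 | $0$ | $(-6M^2+12M-3p)/D$ | | V | $(1,2),(2,1)$ | $(2,2)$ | $-2$ | $(-6M^2+12M-3p)/D$ | | VI | $(2,2)$ | – | $-4$ | $(-6M^2+12M-3p)/D$ | and $$\bigl|H_{\mathrm{tr}}(a_1(\gamma),a_2(\gamma))-H^{(0)}-\gamma H^{(1)}\bigr|\le K\gamma^2 .$$ 4. The same expansion $\bigl|H(a_1(\gamma),a_2(\gamma))-H^{(0)}-\gamma H^{(1)}\bigr|\le K\gamma^2$ holds for the unrestricted communication height, unless the transition is of type III and both $a_1$ and $a_2$ have an isolated site. -/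

import Mathlib

noncomputable section

open Set Filter Topology

/-! ## Potential landscapes on a real Hilbert space -/

namespace Landscape

variable {E : Type*} [NormedAddCommGroup E] [InnerProductSpace ℝ E]

/-- The Hessian of `V` at `x`, as a bilinear form. -/
def hessian (V : E → ℝ) (x : E) : LinearMap.BilinForm ℝ E :=
  (fderiv ℝ (fderiv ℝ V) x).toBilinForm

/-- The Morse index: the maximal dimension of a subspace on which the Hessian is negative
definite, that is, the number of negative eigenvalues of the Hessian. -/
def morseIndex (V : E → ℝ) (x : E) : ℕ :=
  sigNeg (LinearMap.BilinMap.toQuadraticMap (hessian V x))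

variable [CompleteSpace E]

/-- `x` is a nondegenerate stationary point of `V`. -/
def IsNondegStationary (V : E → ℝ) (x : E) : Prop :=
  gradient V x = 0 ∧ (hessian V x).Nondegenerate

/-- The set of nondegenerate stationary points of index `k`. For `k = 0` these are the local minima
of the landscape, for `k = 1` the `1`-saddles. -/
def stationaryOfIndex (V : E → ℝ) (k : ℕ) : Set E :=
  {x | IsNondegStationary V x ∧ morseIndex V x = k}

/-- There is a full orbit of the gradient flow `u' = -∇V(u)` that comes from `z` at time `-∞`
(hence lies in the unstable manifold of `z`) and converges to `x` at time `+∞`. -/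
def HasOrbit (V : E → ℝ) (z x : E) : Prop :=
  ∃ u : ℝ → E, (∀ t, HasDerivAt u (-gradient V (u t)) t) ∧
    Tendsto u atBot (𝓝 z) ∧ Tendsto u atTop (𝓝 x)

/-- The transition graph: two distinct local minima are joined by an edge if the unstable manifold
of some `1`-saddle converges to these two local minima (one along each of its two branches). -/
def transitionGraph (V : E → ℝ) : SimpleGraph E where
  Adj x y := x ≠ y ∧ x ∈ stationaryOfIndex V 0 ∧ y ∈ stationaryOfIndex V 0 ∧
    ∃ z ∈ stationaryOfIndex V 1, HasOrbit V z x ∧ HasOrbit V z y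
  symm := ⟨fun _ _ ⟨hne, hx, hy, z, hz, h₁, h₂⟩ => ⟨hne.symm, hy, hx, z, hz, h₂, h₁⟩⟩
  loopless := ⟨fun _ h => h.1 rfl⟩

/-- The basin of attraction of `x` under the gradient flow `u' = -∇V(u)`. -/
def basin (V : E → ℝ) (x : E) : Set E :=
  {v | ∃ u : ℝ → E, u 0 = v ∧
    (∀ t ∈ Ici (0 : ℝ), HasDerivWithinAt u (-gradient V (u t)) (Ici 0) t) ∧
    Tendsto u atTop (𝓝 x)}

/-- The communication height from `x` to `A` along paths in `D`:
the infimum over all continuous paths in `D`, from `x` to a point of `A`, of the maximum of `V`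
along the path, minus `V x`. -/
def commHeightIn (V : E → ℝ) (D : Set E) (x : E) (A : Set E) : ℝ :=
  sInf {h | ∃ y ∈ A, ∃ p : Path x y, (∀ t, p t ∈ D) ∧ h = ⨆ t, V (p t)} - V x

/-- The communication height from `x` to `A` (all continuous paths are allowed). -/
def commHeight (V : E → ℝ) (x : E) (A : Set E) : ℝ := commHeightIn V univ x A

end Landscape

/-! ## The mass-conserving coupled system -/

namespace MassConserving

open Landscape

/-- The potential `V_γ` on `ℝ^N`; `finRotate N i` is the site `i + 1` of the periodic lattice. -/
def potential (N : ℕ) (γ : ℝ) (x : EuclideanSpace ℝ (Fin N)) : ℝ :=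
  ∑ i, ((x i) ^ 4 / 4 - (x i) ^ 2 / 2) + γ / 4 * ∑ i, (x (finRotate N i) - x i) ^ 2

/-- The subspace of vectors with zero sum. -/
def zeroSum (N : ℕ) : Submodule ℝ (EuclideanSpace ℝ (Fin N)) where
  carrier := {x | ∑ i, x i = 0}
  zero_mem' := by simp
  add_mem' := by
    intro a b ha hb
    simp_all [Finset.sum_add_distrib]
  smul_mem' := by
    intro c x hx
    simp_all [← Finset.mul_sum]

/-- The hyperplane `S` of vectors with zero sum, as a Euclidean space. -/
def S (N : ℕ) : Type := zeroSum N

instance (N : ℕ) : NormedAddCommGroup (S N) :=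
  inferInstanceAs (NormedAddCommGroup (zeroSum N))

instance (N : ℕ) : InnerProductSpace ℝ (S N) :=
  inferInstanceAs (InnerProductSpace ℝ (zeroSum N))

instance (N : ℕ) : FiniteDimensional ℝ (S N) :=
  inferInstanceAs (FiniteDimensional ℝ (zeroSum N))

instance (N : ℕ) : CompleteSpace (S N) := FiniteDimensional.complete ℝ (S N)

/-- The inclusion of the hyperplane into `ℝ^N`. -/
def incl (N : ℕ) : S N →ₗᵢ[ℝ] EuclideanSpace ℝ (Fin N) := (zeroSum N).subtypeₗᵢ

/-- The potential of the constrained system, the restriction of `V_γ` to `S`. -/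
def V (N : ℕ) (γ : ℝ) (x : S N) : ℝ := potential N γ (incl N x)

/-- The coordinate of a point of the hyperplane at a site. -/
def coord {N : ℕ} (x : S N) (i : Fin N) : ℝ := incl N x i

/-- The values of the coordinates of `x` are among three distinct roots `α 0, α 1, α 2`
of an equation `ξ³ - ξ = l`, and the root `α j` occurs exactly `a j` times. -/
def HasTriple {N : ℕ} (x : S N) (a : Fin 3 → ℕ) : Prop :=
  ∃ (l : ℝ) (α : Fin 3 → ℝ), Function.Injective α ∧ (∀ j, α j ^ 3 - α j = l) ∧
    (∀ i, ∃ j, coord x i = α j) ∧ ∀ j, {i | coord x i = α j}.ncard = a j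

/-- The family `B_k` of the uncoupled system with `N = 2M` sites:
local minima with triple `(0, M - k, M + k)`. -/
def B (M k : ℕ) : Set (S (2 * M)) :=
  {x | x ∈ stationaryOfIndex (V (2 * M) 0) 0 ∧ HasTriple x ![0, M - k, M + k]}

/-- The family `C_k` of the uncoupled system with `N = 2M` sites:
`1`-saddles with triple `(1, M - k, M + k - 1)`. -/
def C (M k : ℕ) : Set (S (2 * M)) :=
  {x | x ∈ stationaryOfIndex (V (2 * M) 0) 1 ∧ HasTriple x ![1, M - k, M + k - 1]}

/-- `x` is the point `a(γ)` reached at coupling `γ` by continuing the stationary point `a = a(0)`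
of the uncoupled system along a continuous branch of nondegenerate stationary points. -/
def IsContinuation {N : ℕ} (γ : ℝ) (a x : S N) : Prop :=
  ∃ ξ : ℝ → S N, ContinuousOn ξ (Icc 0 γ) ∧ ξ 0 = a ∧ ξ γ = x ∧
    ∀ g ∈ Icc 0 γ, IsNondegStationary (V N g) (ξ g)

/-- The family `B_k` at coupling `γ`. -/
def family (M k : ℕ) (γ : ℝ) : Set (S (2 * M)) := {x | ∃ a ∈ B M k, IsContinuation γ a x}

/-- A transition between the distinct configurations `x₁`, `x₂` is possible at coupling `γ`: in the
transition graph of `V_γ` they have a common neighbour in the family `B_1`. -/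
def TransitionPossible (M : ℕ) (γ : ℝ) (x₁ x₂ : S (2 * M)) : Prop :=
  x₁ ≠ x₂ ∧ ∃ y ∈ family M 1 γ, (transitionGraph (V (2 * M) γ)).Adj x₁ y ∧
    (transitionGraph (V (2 * M) γ)).Adj y x₂

/-- The points that do not lie in the basin of attraction of a configuration of the family `B_0`
other than `x₁` and `x₂`. -/
def directRegion (M : ℕ) (γ : ℝ) (x₁ x₂ : S (2 * M)) : Set (S (2 * M)) :=
  {v | ∀ x ∈ family M 0 γ, x ≠ x₁ → x ≠ x₂ → v ∉ basin (V (2 * M) γ) x}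

/-- The communication height of the (direct) transition from `x₁` to `x₂`: only paths are considered
that visit no third configuration of the family `B_0`. -/
def transitionHeight (M : ℕ) (γ : ℝ) (x₁ x₂ : S (2 * M)) : ℝ :=
  commHeightIn (V (2 * M) γ) (directRegion M γ x₁ x₂) x₁ {x₂}

/-- The number of interfaces. -/
def interfaces {N : ℕ} (x : S N) : ℕ := {i | coord x i ≠ coord x (finRotate N i)}.ncard

open Classical in
/-- The number of interfaces at the site `i`. -/
def interfacesAt {N : ℕ} (x : S N) (i : Fin N) : ℕ :=
  (if coord x ((finRotate N).symm i) ≠ coord x i then 1 else 0) +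
    (if coord x i ≠ coord x (finRotate N i) then 1 else 0)

/-- `x` has an isolated particle or hole. -/
def HasIsolatedSite {N : ℕ} (x : S N) : Prop := ∃ i, interfacesAt x i = 2

/-- `b` is obtained from `a` by interchanging the particle at site `i` and the hole at site `j`. -/
def IsInterchange {N : ℕ} (a b : S N) (i j : Fin N) : Prop :=
  coord a i = 1 ∧ coord a j = -1 ∧ ∀ k, coord b k = coord a (Equiv.swap i j k)

/-- Nearest neighbours of the periodic lattice. -/
def Neighbours {N : ℕ} (i j : Fin N) : Prop := j = finRotate N i ∨ i = finRotate N j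

/-- The six types of transitions. -/
inductive TransitionType
  | I | II | III | IV | V | VI

/-- The type of the transition that interchanges the particle at `i` and the hole at `j`, in terms
of the numbers of interfaces of the configuration `a` at these two sites. -/
def IsOfType {N : ℕ} (a : S N) (i j : Fin N) (T : TransitionType) : Prop :=
  let η : ℕ × ℕ := (interfacesAt a i, interfacesAt a j)
  match T with
  | .I => ¬ Neighbours i j ∧ η = (0, 0)
  | .II => (¬ Neighbours i j ∧ (η = (0, 1) ∨ η = (1, 0))) ∨ (Neighbours i j ∧ η = (1, 1))
  | .III => ¬ Neighbours i j ∧ η = (1, 1)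
  | .IV => (¬ Neighbours i j ∧ (η = (0, 2) ∨ η = (2, 0))) ∨
      (Neighbours i j ∧ (η = (1, 2) ∨ η = (2, 1)))
  | .V => (¬ Neighbours i j ∧ (η = (1, 2) ∨ η = (2, 1))) ∨ (Neighbours i j ∧ η = (2, 2))
  | .VI => ¬ Neighbours i j ∧ η = (2, 2)

/-- The change of the number of interfaces. -/
def TransitionType.deltaP : TransitionType → ℤ
  | .I => 4
  | .II => 2
  | .III => 0
  | .IV => 0
  | .V => -2
  | .VI => -4

/-- The zeroth-order term of the communication height. -/
def height0 (M : ℕ) : ℝ := (M * (M - 1)) / (4 * ((M : ℝ) ^ 2 - 3 * M + 3))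

/-- The first-order coefficient of the communication height, for an initial configuration with
`p` interfaces. -/
def TransitionType.height1 (M p : ℕ) : TransitionType → ℝ
  | .I => (10 * (M : ℝ) ^ 2 - 36 * M + 36 - 3 * p) / (4 * ((M : ℝ) ^ 2 - 3 * M + 3))
  | .II => (2 * ((M : ℝ) - 3) ^ 2 - 3 * p) / (4 * ((M : ℝ) ^ 2 - 3 * M + 3))
  | .III => (-2 * (M : ℝ) ^ 2 + 6 * M - 3 * p) / (4 * ((M : ℝ) ^ 2 - 3 * M + 3))
  | .IV | .V | .VI => (-6 * (M : ℝ) ^ 2 + 12 * M - 3 * p) / (4 * ((M : ℝ) ^ 2 - 3 * M + 3))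

end MassConserving

end

open Landscape MassConserving

noncomputable section

open Set Filter Topology

/-! ## Gradient flows -/

namespace GradFlow

open Metric NNReal

/-! ### Global flows of bounded Lipschitz vector fields -/

section Flow

variable {E : Type*} [NormedAddCommGroup E] [NormedSpace ℝ E]

/-! At `γ = 0` the landscape is explicit. On the zero-sum hyperplane a linear tilt `l * ∑ x_i`
vanishes, so `V_0` can be bounded below one coordinate at a time, each coordinate sitting in a
tilted double well (`V_zero_eq_sum_tilted`, `tilted_well_le`). This yields two kinds of regions
whose boundaries lie at or above the level of the saddles in `C_1`: `spinRegion a` around a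
configuration `a`, and `IsGenericSaddle.region` behind the saddle `saddle a k`, at which the
particle or hole at site `k` decays. Counting the coordinates at each root shows that below this
level each region contains at most one stationary point, namely `a`, respectively the point `product
a k` of `B_1` (`eq_of_mem_closedSpinRegion`, `eq_product_of_mem`). Hence one side of the saddle
flows to `a` and the other to `product a k`. The product state does not remember which of its `M +
1` majority sites was the decayed one, so two configurations share a product state exactly when they
differ by an interchange (`product_swap`, `exists_isInterchange_of_product_eq`).

For small `γ` the stationary points continue by the implicit function theorem
(`Family.exists_isBranch`). At a saddle the Hessian is positive on the slice where the special
coordinate is fixed. The slice is therefore an energy barrier between the two unstable branches: an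
orbit leaving a small sphere around the saddle loses a definite amount of energy before it can
change sides (`SaddleNbhd.eventually_drop`), and is then trapped in one of the two regions. Since
`3` does not divide `2M`, every stationary point of `V_0` is a nondegenerate minimum, a generic
saddle, or has two negative directions (`stationary_cases`). With the compactness of the set of
possible stationary points this excludes unexpected edges of the transition graph
(`eventually_exists_product_eq`).

The energy of a perturbed saddle is, to first order, its old energy plus `γ` times its interaction
energy. The latter depends only on the number `p` of interfaces and on the number `η` of interfaces
at the decaying site, and decreases with `η` (`couplingEnergy_saddle`, `saddleEnergy_le`). The upper
bound for the heights comes from the path that follows the unstable manifolds of two saddles through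
a common product state. For the lower bound, a path must leave the region of one endpoint. On the
boundary the quadratic growth of `V_0` away from the saddles beats the linear variation of the
interaction up to `O(γ²)` (`MassConserving.exists_front_bound`). Except for type III, the height is
that of a saddle with `η = 2` at one of the two configurations, and no exit can be cheaper. In type
III an isolated site may offer a cheaper exit. A path using it enters the region behind that saddle,
and at low energy the only ways out lead back or into the basin of a third configuration, so a
direct path gains nothing (`exists_le_of_direct`). -/

theorem exists_integral_curve_of_lipschitz [CompleteSpace E] {F : E → E} {K L : ℝ≥0}
    (hF : LipschitzWith K F) (hL : ∀ x, ‖F x‖ ≤ L) (x : E) :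
    ∃ u : ℝ → E, u 0 = x ∧ ∀ t, HasDerivAt u (F (u t)) t := by
  -- The bound `L` keeps the solution within distance `L * T` of `x`, so Picard–Lindelöf applies on
  -- every interval at once.
  have key : ∀ T : ℝ, 0 < T → ∃ u : ℝ → E, u 0 = x ∧
      ∀ t ∈ Icc (-T) T, HasDerivWithinAt u (F (u t)) (Icc (-T) T) t := by
    intro T hT
    have h0 : (0 : ℝ) ∈ Icc (-T) T := ⟨by linarith, hT.le⟩
    have hPL : IsPicardLindelof (fun _ ↦ F) (⟨0, h0⟩ : Icc (-T) T) x (L * ⟨T, hT.le⟩) 0 L K := by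
      apply IsPicardLindelof.of_time_independent (fun y _ ↦ hL y) hF.lipschitzOnWith
      simp only [sub_zero, zero_sub, neg_neg, max_self, NNReal.coe_zero]
      rfl
    obtain ⟨u, hu0, hu⟩ := hPL.exists_eq_forall_mem_Icc_hasDerivWithinAt (x := x) (by simp)
    exact ⟨u, hu0, hu⟩
  choose! u hu0 hu using key
  have hu' : ∀ T, 0 < T → ∀ t ∈ Ioo (-T) T, HasDerivAt (u T) (F (u T t)) t := fun T hT t ht ↦
    (hu T hT t (Ioo_subset_Icc_self ht)).hasDerivAt (Icc_mem_nhds ht.1 ht.2)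
  have agree : ∀ T T' : ℝ, 0 < T → T ≤ T' → ∀ t ∈ Ioo (-T) T, u T t = u T' t := by
    intro T T' hT hTT' t ht
    refine ODE_solution_unique_of_mem_Ioo (v := fun _ ↦ F) (s := fun _ ↦ univ) (K := K)
      (fun _ _ ↦ hF.lipschitzOnWith) (t₀ := 0) ⟨by linarith, hT⟩
      (fun s hs ↦ ⟨hu' T hT s hs, trivial⟩)
      (fun s hs ↦ ⟨hu' T' (hT.trans_le hTT') s ⟨by linarith [hs.1], by linarith [hs.2]⟩, trivial⟩)
      (by rw [hu0 T hT, hu0 T' (hT.trans_le hTT')]) ht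
  -- The margins `1` and `2` make the glued curve agree, on a neighbourhood of `t`, with the single
  -- solution on the interval of half-length `|t| + 2`.
  refine ⟨fun t ↦ u (|t| + 1) t, by simpa using hu0 1 one_pos, fun t ↦ ?_⟩
  have hT : 0 < |t| + 2 := by positivity
  have ht : t ∈ Ioo (-(|t| + 2)) (|t| + 2) :=
    ⟨by linarith [neg_abs_le t], by linarith [le_abs_self t]⟩
  have hd := hu' (|t| + 2) hT t ht
  have heq : ∀ s, |s| < |t| + 1 → u (|s| + 1) s = u (|t| + 2) s := by
    intro s hs
    exact agree _ _ (by positivity) (by linarith) s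
      ⟨by linarith [neg_abs_le s], by linarith [le_abs_self s]⟩
  simp only [heq t (by linarith)]
  refine hd.congr_of_eventuallyEq ?_
  have : ∀ᶠ s in 𝓝 t, |s| < |t| + 1 :=
    (continuous_abs.tendsto t).eventually_lt_const (by linarith)
  filter_upwards [this] with s hs using heq s hs

/-- `Φ` is a family of global integral curves of the vector field `F`. -/
structure IsFlow (F : E → E) (Φ : ℝ → E → E) : Prop where
  zero : ∀ x, Φ 0 x = x
  deriv : ∀ x t, HasDerivAt (fun s ↦ Φ s x) (F (Φ t x)) t

theorem exists_flow [CompleteSpace E] {F : E → E} {K L : ℝ≥0} (hF : LipschitzWith K F)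
    (hL : ∀ x, ‖F x‖ ≤ L) :
    ∃ Φ, IsFlow F Φ := by
  choose u hu0 hu using exists_integral_curve_of_lipschitz hF hL
  exact ⟨fun t x ↦ u x t, hu0, hu⟩

theorem IsFlow.add {F : E → E} {Φ : ℝ → E → E} {K : ℝ≥0} (h : IsFlow F Φ) (hF : LipschitzWith K F)
    (s t : ℝ) (x : E) : Φ (s + t) x = Φ s (Φ t x) := by
  have : (fun s ↦ Φ (s + t) x) = fun s ↦ Φ s (Φ t x) := by
    refine ODE_solution_unique_univ (v := fun _ ↦ F) (s := fun _ ↦ univ) (K := K)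
      (fun _ ↦ hF.lipschitzOnWith) (t₀ := 0) (fun s ↦ ⟨?_, trivial⟩)
      (fun s ↦ ⟨h.deriv _ s, trivial⟩) (by simp [h.zero])
    have := (h.deriv x (s + t)).scomp s ((hasDerivAt_id s).add_const t)
    simpa [Function.comp_def] using this
  exact congrFun this s

theorem IsFlow.dist_le {F : E → E} {Φ : ℝ → E → E} {K : ℝ≥0} (h : IsFlow F Φ)
    (hF : LipschitzWith K F) (t : ℝ) (x y : E) :
    dist (Φ t x) (Φ t y) ≤ dist x y * Real.exp (K * |t|) := by
  have pos : ∀ {F : E → E} {Φ : ℝ → E → E}, IsFlow F Φ → LipschitzWith K F → ∀ t ≥ 0,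
      dist (Φ t x) (Φ t y) ≤ dist x y * Real.exp (K * t) := by
    intro F Φ h hF t ht
    have := dist_le_of_trajectories_ODE (v := fun _ ↦ F) (f := fun s ↦ Φ s x)
      (g := fun s ↦ Φ s y) (a := 0) (b := t) (δ := dist x y) (fun _ ↦ hF)
      (fun s _ ↦ (h.deriv x s).continuousAt.continuousWithinAt)
      (fun s _ ↦ (h.deriv x s).hasDerivWithinAt)
      (fun s _ ↦ (h.deriv y s).continuousAt.continuousWithinAt)
      (fun s _ ↦ (h.deriv y s).hasDerivWithinAt) (by simp [h.zero]) t ⟨ht, le_rfl⟩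
    simpa using this
  rcases le_total 0 t with ht | ht
  · rw [abs_of_nonneg ht]; exact pos h hF t ht
  · rw [abs_of_nonpos ht]
    have h' : IsFlow (fun x ↦ -F x) (fun s x ↦ Φ (-s) x) := by
      refine ⟨fun x ↦ by simp [h.zero], fun x s ↦ ?_⟩
      have := (h.deriv x (-s)).scomp s (hasDerivAt_neg s)
      simpa [Function.comp_def] using this
    have := pos h' hF.neg (-t) (by linarith)
    simpa using this

end Flow

variable {E : Type*} [NormedAddCommGroup E] [InnerProductSpace ℝ E]

/-- A solution of the gradient flow equation `u' = -G u` on `[0, ∞)`. -/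
def FwdOrbit (G : E → E) (u : ℝ → E) : Prop :=
  ∀ t ∈ Ici (0 : ℝ), HasDerivWithinAt u (-G (u t)) (Ici 0) t

/-! ### Dissipation of energy along gradient orbits -/

section Basic

variable {G : E → E} {u : ℝ → E}

theorem FwdOrbit.continuousOn (h : FwdOrbit G u) : ContinuousOn u (Ici 0) :=
  fun t ht ↦ (h t ht).continuousWithinAt

theorem FwdOrbit.shift (h : FwdOrbit G u) {s : ℝ} (hs : 0 ≤ s) :
    FwdOrbit G (fun t ↦ u (s + t)) := by
  intro t ht
  have h1 := h (s + t) (add_nonneg hs ht)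
  have h2 : HasDerivWithinAt (fun t : ℝ ↦ s + t) 1 (Ici 0) t :=
    ((hasDerivAt_id t).const_add s).hasDerivWithinAt
  have := h1.scomp t h2 (fun r hr ↦ add_nonneg hs hr)
  simpa [Function.comp_def] using this

theorem fwdOrbit_of_hasDerivAt (h : ∀ t, HasDerivAt u (-G (u t)) t) : FwdOrbit G u :=
  fun t _ ↦ (h t).hasDerivWithinAt

/-- An orbit can only leave an open set through its boundary. -/
theorem FwdOrbit.mem_of_no_exit (h : FwdOrbit G u) {R Rc : Set E} (hR : IsOpen R)
    (hRc : IsClosed Rc) (hsub : R ⊆ Rc) (h0 : u 0 ∈ R) (hex : ∀ t ≥ 0, u t ∈ Rc → u t ∈ R) :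
    ∀ t ≥ 0, u t ∈ R := by
  intro T hT
  have hcl : IsClosed ({t | u t ∈ Rc} ∩ Icc 0 T) := by
    have := (h.continuousOn.mono (fun _ hr ↦ hr.1 : Icc 0 T ⊆ Ici 0)).preimage_isClosed_of_isClosed
      isClosed_Icc hRc
    rwa [inter_comm] at this
  have := hcl.Icc_subset_of_forall_mem_nhdsWithin (hsub h0) (fun t ht ↦ by
    have hin := hex t ht.2.1 ht.1
    have hc := (h.continuousOn t ht.2.1).mono (fun _ hr ↦ le_of_lt (lt_of_le_of_lt ht.2.1 hr) :
      Ioi t ⊆ Ici 0)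
    exact (hc.eventually (hR.mem_nhds hin)).mono fun s hs ↦ hsub hs)
  exact hex T hT (this ⟨hT, le_rfl⟩)

theorem le_of_hasDerivWithinAt_nonpos {f f' : ℝ → ℝ} {T : ℝ} (hT : 0 ≤ T)
    (hf : ∀ t ∈ Icc 0 T, HasDerivWithinAt f (f' t) (Icc 0 T) t) (hf' : ∀ t ∈ Icc 0 T, f' t ≤ 0) :
    f T ≤ f 0 := by
  refine antitoneOn_of_hasDerivWithinAt_nonpos (convex_Icc 0 T)
    (fun t ht ↦ (hf t ht).continuousWithinAt)
    (fun t ht ↦ (hf t (interior_subset ht)).mono interior_subset)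
    (fun t ht ↦ hf' t (interior_subset ht)) ⟨le_rfl, hT⟩ ⟨hT, le_rfl⟩ hT

variable [CompleteSpace E] {V : E → ℝ}

theorem FwdOrbit.hasDerivWithinAt_comp (h : FwdOrbit G u) (hV : ∀ x, HasGradientAt V (G x) x)
    {t : ℝ} (ht : 0 ≤ t) :
    HasDerivWithinAt (fun s ↦ V (u s)) (-‖G (u t)‖ ^ 2) (Ici 0) t := by
  have h1 := (hV (u t)).hasFDerivAt.comp_hasDerivWithinAt t (h t ht)
  convert! h1 using 1
  simp

theorem FwdOrbit.energy_le (h : FwdOrbit G u) (hV : ∀ x, HasGradientAt V (G x) x)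
    {t : ℝ} (ht : 0 ≤ t) : V (u t) ≤ V (u 0) :=
  le_of_hasDerivWithinAt_nonpos (f := fun s ↦ V (u s)) ht
    (fun s hs ↦ (h.hasDerivWithinAt_comp hV hs.1).mono (fun _ hr ↦ hr.1))
    (fun s _ ↦ by nlinarith [sq_nonneg ‖G (u s)‖])

theorem FwdOrbit.antitoneOn (h : FwdOrbit G u) (hV : ∀ x, HasGradientAt V (G x) x) :
    AntitoneOn (fun t ↦ V (u t)) (Ici 0) := by
  intro s hs t _ hst
  have := (h.shift hs).energy_le hV (t := t - s) (by linarith)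
  simpa using this

/-- The energy is lost at rate `‖G‖²`, which is at least `η` times the speed, so the loss is at
least `η` times the length travelled and hence `η` times the displacement. -/
theorem FwdOrbit.energy_le_sub_mul_norm (h : FwdOrbit G u) (hV : ∀ x, HasGradientAt V (G x) x)
    {T η : ℝ} (hT : 0 ≤ T) (hη0 : 0 ≤ η)
    (hη : ∀ s ∈ Icc 0 T, η ≤ ‖G (u s)‖) : V (u T) ≤ V (u 0) - η * ‖u T - u 0‖ := by
  set w := u T - u 0 with hw
  by_cases hw0 : ‖w‖ = 0
  · rw [hw0]; simpa using h.energy_le hV hT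
  have hpos : 0 < ‖w‖ := lt_of_le_of_ne (norm_nonneg _) (Ne.symm hw0)
  -- Only the component of the motion along `w` is tracked, which avoids arc length. The factor
  -- `‖w‖` avoids a division, and Cauchy–Schwarz bounds the derivative by `-‖w‖ ‖G‖ (‖G‖ - η)`.
  have key := le_of_hasDerivWithinAt_nonpos
    (f := fun s ↦ ‖w‖ * V (u s) + η * inner ℝ w (u s))
    (f' := fun s ↦ ‖w‖ * (-‖G (u s)‖ ^ 2) + η * inner ℝ w (-G (u s))) hT
    (fun s hs ↦ by
      refine HasDerivWithinAt.add ?_ ?_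
      · exact ((h.hasDerivWithinAt_comp hV hs.1).mono (fun _ hr ↦ hr.1)).const_mul _
      · refine HasDerivWithinAt.const_mul _ ?_
        exact (innerSL ℝ w).hasFDerivAt.comp_hasDerivWithinAt s
          ((h s hs.1).mono (fun _ hr ↦ hr.1)))
    (fun s hs ↦ by
      have h1 := hη s hs
      have h2 : -(‖w‖ * ‖G (u s)‖) ≤ inner ℝ w (G (u s)) :=
        (abs_le.1 (abs_real_inner_le_norm w (G (u s)))).1
      have h4 := norm_nonneg (G (u s))
      simp only [inner_neg_right]
      nlinarith [mul_nonneg (mul_nonneg hpos.le h4) (sub_nonneg.2 h1),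
          mul_nonneg hη0 (by linarith : 0 ≤ inner ℝ w (G (u s)) + ‖w‖ * ‖G (u s)‖)])
  have h5 : inner ℝ w (u T) - inner ℝ w (u 0) = ‖w‖ ^ 2 := by
    rw [← inner_sub_right, ← hw, real_inner_self_eq_norm_sq]
  have h6 : ‖w‖ * (V (u T) - V (u 0) + η * ‖w‖) ≤ 0 := by
    have : η * (inner ℝ w (u T) - inner ℝ w (u 0)) = η * ‖w‖ ^ 2 := by rw [h5]
    linarith
  linarith [nonpos_of_mul_nonpos_right h6 hpos]

theorem FwdOrbit.energy_le_sub_mul_time (h : FwdOrbit G u) (hV : ∀ x, HasGradientAt V (G x) x)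
    {T η : ℝ} (hT : 0 ≤ T) (hη0 : 0 ≤ η) (hη : ∀ s ∈ Icc 0 T, η ≤ ‖G (u s)‖) :
    V (u T) ≤ V (u 0) - η ^ 2 * T := by
  have key := le_of_hasDerivWithinAt_nonpos
    (f := fun s ↦ V (u s) + η ^ 2 * s) (f' := fun s ↦ -‖G (u s)‖ ^ 2 + η ^ 2) hT
    (fun s hs ↦ by
      refine HasDerivWithinAt.add ?_ ?_
      · exact ((h.hasDerivWithinAt_comp hV hs.1).mono (fun _ hr ↦ hr.1))
      · simpa using ((hasDerivAt_id s).const_mul (η ^ 2)).hasDerivWithinAt)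
    (fun s hs ↦ by nlinarith [hη s hs])
  simp only [mul_zero, add_zero] at key
  linarith

/-- If the gradient is bounded below on a ball around the starting point, then the energy drops by
a definite amount while the orbit is still in the ball. -/
theorem FwdOrbit.exists_drop (h : FwdOrbit G u) (hV : ∀ x, HasGradientAt V (G x) x)
    {ρ η : ℝ} (hρ : 0 < ρ) (hη0 : 0 < η) (hη : ∀ x ∈ closedBall (u 0) ρ, η ≤ ‖G x‖) :
    ∃ T ≥ 0, (∀ s ∈ Icc 0 T, u s ∈ closedBall (u 0) ρ) ∧ V (u T) ≤ V (u 0) - η * ρ := by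
  -- If the orbit stays in the ball for time `ρ / η`, the loss `η²` per unit time suffices.
  -- Otherwise, at the first time on the sphere, the displacement is `ρ` and the length estimate
  -- applies.
  by_cases hc : ∀ s ∈ Icc 0 (ρ / η), u s ∈ closedBall (u 0) ρ
  · refine ⟨ρ / η, by positivity, hc, ?_⟩
    have := h.energy_le_sub_mul_time hV (by positivity) hη0.le (fun s hs ↦ hη _ (hc s hs))
    have h2 : η ^ 2 * (ρ / η) = η * ρ := by field_simp
    linarith
  · push Not at hc
    obtain ⟨s, hs, hsρ⟩ := hc
    set A : Set ℝ := Icc 0 s ∩ (fun r ↦ dist (u r) (u 0)) ⁻¹' Ici ρ with hA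
    have hcont : ContinuousOn (fun r ↦ dist (u r) (u 0)) (Icc 0 s) :=
      fun r hr ↦ Filter.Tendsto.dist (h.continuousOn.mono Icc_subset_Ici_self r hr) tendsto_const_nhds
    have hAc : IsCompact A :=
      isCompact_Icc.of_isClosed_subset (hcont.preimage_isClosed_of_isClosed isClosed_Icc isClosed_Ici)
        inter_subset_left
    have hAn : A.Nonempty := ⟨s, ⟨hs.1, le_rfl⟩, by
      simp only [mem_closedBall, not_le] at hsρ; exact hsρ.le⟩
    obtain ⟨T, hTA, hTmin⟩ := hAc.exists_isLeast hAn
    have hT0 : 0 ≤ T := hTA.1.1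
    have hlt : ∀ r ∈ Ico 0 T, dist (u r) (u 0) < ρ := by
      intro r hr
      by_contra hcon
      exact absurd (hTmin ⟨⟨hr.1, hr.2.le.trans hTA.1.2⟩, not_lt.1 hcon⟩) (not_le.2 hr.2)
    have hTle : dist (u T) (u 0) ≤ ρ := by
      by_contra hcon
      push Not at hcon
      have hT1 : dist (u 0) (u 0) < ρ := by simpa using hρ
      obtain ⟨r, hr, hrρ⟩ := intermediate_value_Ioo hT0
        (hcont.mono (Icc_subset_Icc_right hTA.1.2)) (show ρ ∈ Ioo _ _ from ⟨hT1, hcon⟩)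
      exact absurd hrρ (hlt r ⟨hr.1.le, hr.2⟩).ne
    have hball : ∀ r ∈ Icc 0 T, u r ∈ closedBall (u 0) ρ := by
      intro r hr
      rcases hr.2.lt_or_eq with h1 | h1
      · exact (hlt r ⟨hr.1, h1⟩).le
      · rw [h1]; exact hTle
    refine ⟨T, hT0, hball, ?_⟩
    have := h.energy_le_sub_mul_norm hV hT0 hη0.le (fun s hs ↦ hη _ (hball s hs))
    have h2 : ρ ≤ ‖u T - u 0‖ := by rw [← dist_eq_norm]; exact hTA.2
    nlinarith

/-- LaSalle's principle: a bounded orbit near which there is only one stationary point converges. -/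
theorem FwdOrbit.tendsto (h : FwdOrbit G u) (hV : ∀ x, HasGradientAt V (G x) x)
    (hG : Continuous G) {K : Set E} (hK : IsCompact K) (huK : ∀ t ≥ 0, u t ∈ K) {m : E}
    (hm : ∀ x ∈ K, G x = 0 → x = m) : Tendsto u atTop (𝓝 m) := by
  refine hK.tendsto_nhds_of_unique_mapClusterPt
    ((eventually_ge_atTop 0).mono fun t ht ↦ huK t ht) (fun x hxK hx ↦ hm x hxK ?_)
  by_contra hGx
  have hVc : Continuous V :=
    continuous_iff_continuousAt.2 fun x ↦ (hV x).differentiableAt.continuousAt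
  obtain ⟨b, hb⟩ := (hK.image hVc).bddBelow
  have hbdd : ∀ t ≥ 0, b ≤ V (u t) := fun t ht ↦ hb ⟨_, huK t ht, rfl⟩
  -- the energy converges
  have hpos : 0 < ‖G x‖ := norm_pos_iff.2 hGx
  set η := ‖G x‖ / 2 with hηdef
  have hη : 0 < η := by positivity
  obtain ⟨r, hr, hball⟩ : ∃ r > 0, ∀ y ∈ closedBall x r, η ≤ ‖G y‖ := by
    have : ∀ᶠ y in 𝓝 x, η < ‖G y‖ :=
      (hG.norm.tendsto x).eventually_const_lt (by rw [hηdef]; linarith)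
    obtain ⟨r, hr, h⟩ := Metric.nhds_basis_closedBall.eventually_iff.1 this
    exact ⟨r, hr, fun y hy ↦ (h hy).le⟩
  -- After time `t₀` the energy is within `η * (r / 2)` of its infimum `ℓ`. If the orbit came back
  -- close to the nonstationary cluster point `x`, it would lose that much again and fall below `ℓ`.
  set ℓ := sInf ((fun t ↦ V (u t)) '' Ici 0) with hℓ
  have hbb : BddBelow ((fun t ↦ V (u t)) '' Ici 0) := ⟨b, by
    rintro _ ⟨t, ht, rfl⟩; exact hbdd t ht⟩
  obtain ⟨_, ⟨t₀, ht₀, rfl⟩, hlt⟩ := exists_lt_of_csInf_lt (s := (fun t ↦ V (u t)) '' Ici 0)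
    ⟨_, mem_image_of_mem _ (mem_Ici.2 le_rfl)⟩ (show ℓ < ℓ + η * (r / 2) by
      have : 0 < η * (r / 2) := by positivity
      linarith)
  have hfreq := hx.frequently (Metric.ball_mem_nhds x (half_pos hr))
  obtain ⟨t, ht, hut⟩ := (hfreq.and_eventually (eventually_ge_atTop t₀)).exists
  have ht0 : 0 ≤ t := le_trans ht₀ hut
  obtain ⟨T, hT, -, hdrop⟩ := (h.shift ht0).exists_drop hV (half_pos hr) hη (fun y hy ↦ by
    apply hball
    simp only [add_zero] at hy
    rw [mem_closedBall] at hy ⊢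
    have h1 : dist (u t) x < r / 2 := ht
    linarith [dist_triangle y (u t) x])
  simp only [add_zero] at hdrop
  have h1 : V (u t) ≤ V (u t₀) := h.antitoneOn hV ht₀ ht0 hut
  have h2 : ℓ ≤ V (u (t + T)) := csInf_le hbb ⟨t + T, add_nonneg ht0 hT, rfl⟩
  simp only at hlt
  linarith

end Basic

end GradFlow

/-! ### Unstable manifolds: existence and uniqueness of one-sided branches -/

namespace GradFlow

open Metric NNReal

variable {E : Type*} [NormedAddCommGroup E] [InnerProductSpace ℝ E] {G : E → E} {V : E → ℝ}

theorem exists_first_exit {φ : ℝ → ℝ} (hφ : Continuous φ) {δ a : ℝ}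
    (hbot : ∀ᶠ t in atBot, φ t < δ) (ha : δ ≤ φ a) :
    ∃ s ≤ a, φ s = δ ∧ ∀ t < s, φ t < δ := by
  obtain ⟨b, hb⟩ := eventually_atBot.1 hbot
  set A : Set ℝ := Icc b a ∩ φ ⁻¹' Ici δ
  have hba : b ≤ a := by
    by_contra hcon
    exact absurd (hb a (not_le.1 hcon).le) (not_lt.2 ha)
  have hA : IsCompact A := isCompact_Icc.inter_right (isClosed_Ici.preimage hφ)
  obtain ⟨s, hsA, hs⟩ := hA.exists_isLeast ⟨a, ⟨hba, le_rfl⟩, ha⟩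
  have hlt : ∀ t < s, φ t < δ := by
    intro t ht
    rcases le_total t b with h | h
    · exact hb t h
    · by_contra hcon
      exact absurd (hs ⟨⟨h, ht.le.trans hsA.1.2⟩, not_lt.1 hcon⟩) (not_le.2 ht)
  refine ⟨s, hsA.1.2, le_antisymm ?_ hsA.2, hlt⟩
  exact le_of_tendsto (hφ.continuousAt.tendsto.mono_left nhdsWithin_le_nhds)
    (eventually_nhdsWithin_of_forall fun t (ht : t ∈ Iio s) ↦ (hlt t ht).le)

theorem hasDerivAt_shift {u : ℝ → E} (hu : ∀ t, HasDerivAt u (-G (u t)) t) (s t : ℝ) :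
    HasDerivAt (fun t ↦ u (t + s)) (-G (u (t + s))) t := by
  have := (hu (t + s)).scomp t ((hasDerivAt_id t).add_const s)
  simpa [Function.comp_def] using this

theorem exists_lipschitz_of_contDiff_of_hasCompactSupport {F : E → E} (hF : ContDiff ℝ 1 F)
    (hc : HasCompactSupport F) : ∃ K L : ℝ≥0, LipschitzWith K F ∧ ∀ x, ‖F x‖ ≤ L := by
  obtain ⟨L, hL⟩ := hF.continuous.bounded_above_of_compact_support hc
  obtain ⟨K, hK⟩ := (hF.continuous_fderiv one_ne_zero).bounded_above_of_compact_support
    (hc.fderiv (𝕜 := ℝ))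
  refine ⟨⟨K, (norm_nonneg _).trans (hK 0)⟩, ⟨L, (norm_nonneg _).trans (hL 0)⟩, ?_, hL⟩
  exact lipschitzWith_of_nnnorm_fderiv_le (hF.differentiable one_ne_zero) fun x ↦ hK x

/-- Two orbits emanating from the same stationary point that are ordered like points of the stable
cone coincide. -/
theorem eq_of_backward_asymptotic {H : E →L[ℝ] E} (hH : ∀ x y, inner ℝ (H x) y = inner ℝ x (H y))
    {B : Set E} {κ : ℝ} (hκ : 0 < κ)
    (hmono : ∀ x ∈ B, ∀ y ∈ B, κ * ‖x - y‖ ^ 2 ≤ inner ℝ (H (x - y)) (G x - G y)) {u v : ℝ → E}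
    {z : E} (hu : ∀ t, HasDerivAt u (-G (u t)) t) (hv : ∀ t, HasDerivAt v (-G (v t)) t)
    (huB : ∀ t ≤ 0, u t ∈ B) (hvB : ∀ t ≤ 0, v t ∈ B) (huz : Tendsto u atBot (𝓝 z))
    (hvz : Tendsto v atBot (𝓝 z)) (h0 : 0 ≤ inner ℝ (H (u 0 - v 0)) (u 0 - v 0)) :
    u 0 = v 0 := by
  -- By monotonicity `φ` decreases at rate at least `2 * κ * ‖u - v‖²`. It tends to `0` at `-∞` and
  -- is nonnegative at `0`, so it vanishes identically on `(-∞, 0]`, and its zero derivative at `0`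
  -- forces `u 0 = v 0`.
  set φ : ℝ → ℝ := fun t ↦ inner ℝ (H (u t - v t)) (u t - v t) with hφ
  have hd : ∀ t, HasDerivAt φ (-2 * inner ℝ (H (u t - v t)) (G (u t) - G (v t))) t := by
    intro t
    have hw : HasDerivAt (fun t ↦ u t - v t) (-(G (u t) - G (v t))) t := by
      have := (hu t).sub (hv t)
      rwa [show -G (u t) - -G (v t) = -(G (u t) - G (v t)) by abel] at this
    have hHw : HasDerivAt (fun t ↦ H (u t - v t)) (H (-(G (u t) - G (v t)))) t :=
      H.hasFDerivAt.comp_hasDerivAt t hw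
    have := hHw.inner ℝ hw
    rw [hH (-(G (u t) - G (v t))), inner_neg_right, inner_neg_left,
      real_inner_comm (H (u t - v t)) (G (u t) - G (v t))] at this
    rwa [show ∀ a : ℝ, -2 * a = -a + -a from fun a ↦ by ring]
  have hanti : AntitoneOn φ (Iic 0) := by
    refine antitoneOn_of_hasDerivWithinAt_nonpos (convex_Iic 0)
      (fun t _ ↦ (hd t).continuousAt.continuousWithinAt)
      (fun t _ ↦ (hd t).hasDerivWithinAt) (fun t ht ↦ ?_)
    have ht0 := interior_subset ht
    nlinarith [hmono _ (huB t ht0) _ (hvB t ht0), sq_nonneg ‖u t - v t‖]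
  have hlim : Tendsto φ atBot (𝓝 0) := by
    have hw : Tendsto (fun t ↦ u t - v t) atBot (𝓝 0) := by simpa using huz.sub hvz
    have hc : Continuous fun x : E ↦ inner ℝ (H x) x := H.continuous.inner continuous_id
    have := (hc.tendsto 0).comp hw
    simp only [map_zero, inner_zero_right] at this
    exact this
  have hzero : ∀ t ≤ 0, φ t = 0 := by
    intro t ht
    refine le_antisymm ?_ (h0.trans (hanti ht (mem_Iic.2 le_rfl) ht))
    exact ge_of_tendsto hlim ((eventually_le_atBot t).mono fun s hs ↦ hanti (hs.trans ht) ht hs)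
  have hder : HasDerivWithinAt φ 0 (Iic 0) 0 :=
    (hasDerivWithinAt_const (0 : ℝ) (Iic 0) (0 : ℝ)).congr (fun t ht ↦ hzero t ht)
      (hzero 0 le_rfl)
  have h1 := (uniqueDiffWithinAt_Iic (0 : ℝ)).eq_deriv _ (hd 0).hasDerivWithinAt hder
  have h2 := hmono _ (huB 0 le_rfl) _ (hvB 0 le_rfl)
  have h3 : κ * ‖u 0 - v 0‖ ^ 2 ≤ 0 := by linarith
  have h4 : ‖u 0 - v 0‖ ^ 2 = 0 :=
    le_antisymm (nonpos_of_mul_nonpos_right h3 hκ) (sq_nonneg _)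
  exact sub_eq_zero.1 (norm_eq_zero.1 (pow_eq_zero_iff two_ne_zero |>.1 h4))

variable [FiniteDimensional ℝ E] [CompleteSpace E]

/-- The gradient flow, cut off outside a large ball. -/
theorem exists_truncated_flow (hV : ∀ x, HasGradientAt V (G x) x) (hG : ContDiff ℝ 1 G)
    (S : Set E) (hS : Bornology.IsBounded S) :
    ∃ (F : E → E) (Φ : ℝ → E → E) (K : ℝ≥0), LipschitzWith K F ∧ IsFlow F Φ ∧
      (∀ x ∈ S, F x = -G x) ∧ ∀ x, Antitone fun t ↦ V (Φ t x) := by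
  obtain ⟨R, hRpos, hR⟩ := hS.subset_closedBall_lt 0 0
  -- Multiplying `-G` by a bump function equal to `1` near `S` gives a bounded Lipschitz field. A
  -- nonnegative factor only slows the flow down, so `V` still decreases along it.
  let χ : ContDiffBump (0 : E) := ⟨R, R + 1, hRpos, by linarith⟩
  obtain ⟨K, L, hK, hL⟩ := exists_lipschitz_of_contDiff_of_hasCompactSupport
    (F := fun x ↦ χ x • (-G x)) (χ.contDiff.smul hG.neg) (χ.hasCompactSupport.smul_right)
  obtain ⟨Φ, hΦ⟩ := exists_flow hK hL
  refine ⟨_, Φ, K, hK, hΦ, fun x hx ↦ ?_, fun x ↦ ?_⟩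
  · simp [χ.one_of_mem_closedBall (hR hx)]
  · have hd : ∀ t, HasDerivAt (fun t ↦ V (Φ t x)) (-(χ (Φ t x) * ‖G (Φ t x)‖ ^ 2)) t := by
      intro t
      have := (hV (Φ t x)).hasFDerivAt.comp_hasDerivAt t (hΦ.deriv x t)
      convert! this using 1
      simp [inner_smul_right]
    exact antitone_of_hasDerivAt_nonpos hd fun t ↦
      neg_nonpos.2 (mul_nonneg χ.nonneg (sq_nonneg _))

/-- The field is only locally Lipschitz. On a bounded time interval both orbits stay in a bounded
set, where they solve the truncated equation, for which uniqueness is global. -/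
theorem FwdOrbit.eqOn {u v : ℝ → E} (hV : ∀ x, HasGradientAt V (G x) x) (hG : ContDiff ℝ 1 G)
    (hu : FwdOrbit G u) (hv : FwdOrbit G v) (h0 : u 0 = v 0) : ∀ t ≥ 0, u t = v t := by
  intro T hT
  have hb : Bornology.IsBounded (u '' Icc 0 T ∪ v '' Icc 0 T) :=
    ((isCompact_Icc.image_of_continuousOn (hu.continuousOn.mono Icc_subset_Ici_self)).union
      (isCompact_Icc.image_of_continuousOn (hv.continuousOn.mono Icc_subset_Ici_self))).isBounded
  obtain ⟨F, Φ, K, hF, hΦ, hFG, -⟩ := exists_truncated_flow hV hG _ hb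
  refine ODE_solution_unique (v := fun _ ↦ F) (fun _ ↦ hF)
    (hu.continuousOn.mono Icc_subset_Ici_self) (fun t ht ↦ ?_)
    (hv.continuousOn.mono Icc_subset_Ici_self) (fun t ht ↦ ?_) h0 ⟨hT, le_rfl⟩
  · rw [hFG _ (Or.inl ⟨t, Ico_subset_Icc_self ht, rfl⟩)]
    exact (hu t ht.1).mono (Ici_subset_Ici.2 ht.1)
  · rw [hFG _ (Or.inr ⟨t, Ico_subset_Icc_self ht, rfl⟩)]
    exact (hv t ht.1).mono (Ici_subset_Ici.2 ht.1)

/-- The truncated orbit never leaves the bounded sublevel set of its starting point, so it never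
sees the cutoff. -/
theorem exists_fwdOrbit (hV : ∀ x, HasGradientAt V (G x) x) (hG : ContDiff ℝ 1 G)
    (hb : ∀ ℓ, Bornology.IsBounded {x | V x ≤ ℓ}) (x : E) : ∃ u, u 0 = x ∧ FwdOrbit G u := by
  obtain ⟨F, Φ, K, hF, hΦ, hFG, hanti⟩ := exists_truncated_flow hV hG _ (hb (V x))
  refine ⟨fun t ↦ Φ t x, hΦ.zero x, fun t ht ↦ ?_⟩
  have : V (Φ t x) ≤ V x := by simpa [hΦ.zero] using hanti x (mem_Ici.1 ht)
  rw [← hFG _ this]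
  exact (hΦ.deriv x t).hasDerivWithinAt

/-- A one-sided branch of the unstable manifold of a stationary point `z`, when the energy on the
level set of `f` through `z` is at least that of `z`. -/
theorem exists_unstable_orbit (hV : ∀ x, HasGradientAt V (G x) x) (hG : ContDiff ℝ 1 G)
    (hb : ∀ ℓ, Bornology.IsBounded {x | V x ≤ ℓ}) {z c : E} {δ : ℝ} (f : E → ℝ) (hf : Continuous f)
    (hz : G z = 0) (hzB : z ∈ ball c δ) (huniq : ∀ x ∈ closedBall c δ, G x = 0 → x = z)
    (hslice : ∀ x ∈ closedBall c δ, f x = f z → x ≠ z → V z < V x)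
    (hp : ∀ ε > 0, ∃ p ∈ ball z ε, f z < f p ∧ V p < V z) :
    ∃ u : ℝ → E, (∀ t, HasDerivAt u (-G (u t)) t) ∧ Tendsto u atBot (𝓝 z) ∧
      u 0 ∈ sphere c δ ∧ f z < f (u 0) ∧ V (u 0) ≤ V z := by
  have hVc : Continuous V :=
    continuous_iff_continuousAt.2 fun x ↦ (hV x).differentiableAt.continuousAt
  obtain ⟨F, Φ, K, hF, hΦ, hFG, hanti⟩ := exists_truncated_flow hV hG
    ({x | V x ≤ V z} ∪ closedBall c δ) ((hb _).union isBounded_closedBall)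
  have hcont : ∀ x, Continuous fun t ↦ Φ t x := fun x ↦
    continuous_iff_continuousAt.2 fun t ↦ (hΦ.deriv x t).continuousAt
  have hcont' : ∀ t, Continuous (Φ t) := fun t ↦
    (LipschitzWith.of_dist_le_mul (K := ⟨Real.exp (K * |t|), (Real.exp_pos _).le⟩) fun x y ↦ by
      rw [mul_comm]; exact hΦ.dist_le hF t x y).continuous
  have hΦz : ∀ t, Φ t z = z := by
    intro t
    have hFz : F z = 0 := by rw [hFG z (Or.inl (le_refl (V z))), hz, neg_zero]
    have : (fun t ↦ Φ t z) = fun _ ↦ z := by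
      refine ODE_solution_unique_univ (v := fun _ ↦ F) (s := fun _ ↦ univ) (K := K)
        (fun _ ↦ hF.lipschitzOnWith) (t₀ := 0) (fun s ↦ ⟨hΦ.deriv _ s, trivial⟩)
        (fun s ↦ ⟨by rw [hFz]; exact hasDerivAt_const _ _, trivial⟩) (hΦ.zero z)
    exact congrFun this t
  -- The branch is obtained by shooting: orbits are started at points ever closer to `z` that lie on
  -- the chosen side and below the energy of `z`.
  choose p hpz hpf hpV using fun n : ℕ ↦ hp (1 / (n + 1 : ℝ)) (by positivity)
  have hpt : Tendsto p atTop (𝓝 z) := by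
    rw [tendsto_iff_dist_tendsto_zero]
    exact squeeze_zero (fun _ ↦ dist_nonneg) (fun n ↦ (hpz n).le)
      tendsto_one_div_add_atTop_nhds_zero_nat
  -- all the orbits started at the points `p n` leave the ball
  have hexit : ∀ n, p n ∈ ball c δ → ∃ T, 0 ≤ T ∧ dist (Φ T (p n)) c = δ ∧
      ∀ t, 0 ≤ t → t < T → dist (Φ t (p n)) c < δ := by
    intro n hn
    have hfw : FwdOrbit G (fun t ↦ Φ t (p n)) := by
      intro t ht
      have : V (Φ t (p n)) ≤ V z := by
        have := hanti (p n) (mem_Ici.1 ht)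
        simp only [hΦ.zero] at this
        exact this.trans (hpV n).le
      rw [← hFG _ (Or.inl this)]
      exact (hΦ.deriv _ t).hasDerivWithinAt
    have hout : ∃ a, 0 ≤ a ∧ δ ≤ dist (Φ a (p n)) c := by
      by_contra hcon
      push Not at hcon
      have hlim := hfw.tendsto hV hG.continuous (isCompact_closedBall c δ)
        (fun t ht ↦ (hcon t ht).le) huniq
      have hlim2 : Tendsto (fun t ↦ V (Φ t (p n))) atTop (𝓝 (V z)) :=
        (hVc.tendsto z).comp hlim
      have : V z ≤ V (p n) := le_of_tendsto hlim2 ((eventually_ge_atTop 0).mono fun t ht ↦ by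
        have := hanti (p n) ht
        simpa only [hΦ.zero] using this)
      exact absurd (hpV n) (not_lt.2 this)
    obtain ⟨a, ha0, ha⟩ := hout
    obtain ⟨T, -, hT, hlt⟩ := exists_first_exit (φ := fun t ↦ dist (Φ (max t 0) (p n)) c)
      (((hcont (p n)).comp (continuous_id.max continuous_const)).dist continuous_const)
      (δ := δ) (a := a) ((eventually_le_atBot 0).mono fun t ht ↦ by
        simpa [max_eq_right ht, hΦ.zero] using hn) (by simpa [max_eq_left ha0] using ha)
    have hT0 : 0 ≤ T := by
      by_contra hcon
      rw [max_eq_right (not_le.1 hcon).le, hΦ.zero] at hT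
      exact absurd hT (ne_of_lt hn)
    refine ⟨T, hT0, by simpa [max_eq_left hT0] using hT, fun t ht0 ht ↦ ?_⟩
    simpa [max_eq_left ht0] using hlt t ht
  obtain ⟨n₀, hn₀⟩ := eventually_atTop.1 (hpt.eventually (isOpen_ball.mem_nhds hzB))
  choose! T hT0 hTs hTlt using hexit
  have hnB : ∀ n, p (n + n₀) ∈ ball c δ := fun n ↦ hn₀ _ (by omega)
  -- the exit points stay on one side
  have hside : ∀ n, f z < f (Φ (T (n + n₀)) (p (n + n₀))) := by
    intro n
    by_contra hcon
    push Not at hcon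
    have hc : Continuous fun t ↦ f (Φ t (p (n + n₀))) := hf.comp (hcont _)
    obtain ⟨t, ht, hft⟩ := intermediate_value_Icc' (hT0 _ (hnB n)) hc.continuousOn
      (show f z ∈ Icc _ _ from ⟨hcon, by rw [hΦ.zero]; exact (hpf _).le⟩)
    have hVt : V (Φ t (p (n + n₀))) < V z := by
      have := hanti (p (n + n₀)) ht.1
      simp only [hΦ.zero] at this
      exact this.trans_lt (hpV _)
    have hB : Φ t (p (n + n₀)) ∈ closedBall c δ := by
      rcases ht.2.lt_or_eq with h | h
      · exact (hTlt _ (hnB n) t ht.1 h).le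
      · rw [h]; exact (hTs _ (hnB n)).le
    by_cases hzt : Φ t (p (n + n₀)) = z
    · rw [hzt] at hVt; exact lt_irrefl _ hVt
    · exact absurd hVt (hslice _ hB hft hzt).not_gt
  -- A limit of the exit points. The orbit through it is the required branch.
  obtain ⟨q, hq, φ, hφ, hφq⟩ := (isCompact_sphere c δ).tendsto_subseq
    (x := fun n ↦ Φ (T (n + n₀)) (p (n + n₀))) (fun n ↦ hTs _ (hnB n))
  have hφt : Tendsto (fun n ↦ φ n + n₀) atTop atTop :=
    tendsto_atTop_mono (fun n ↦ Nat.le_add_right _ _) hφ.tendsto_atTop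
  have hVq : V q ≤ V z := by
    refine le_of_tendsto ((hVc.tendsto q).comp hφq) (Eventually.of_forall fun n ↦ ?_)
    have := hanti (p (φ n + n₀)) (hT0 _ (hnB (φ n)))
    simp only [hΦ.zero] at this
    exact this.trans (hpV _).le
  have hqz : q ≠ z := by
    rintro rfl
    exact absurd (mem_sphere.1 hq) (ne_of_lt hzB)
  have hfq : f z < f q := by
    have h1 : f z ≤ f q := ge_of_tendsto ((hf.tendsto q).comp hφq)
      (Eventually.of_forall fun n ↦ (hside (φ n)).le)
    refine lt_of_le_of_ne h1 fun h ↦ ?_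
    exact absurd hVq (not_le.2 (hslice q (sphere_subset_closedBall hq) h.symm hqz))
  -- the backward orbit of `q` stays in the ball
  have hback : ∀ s ≥ 0, Φ (-s) q ∈ closedBall c δ := by
    intro s hs
    have hlim : Tendsto (fun n ↦ Φ (-s) (Φ (T (φ n + n₀)) (p (φ n + n₀)))) atTop
        (𝓝 (Φ (-s) q)) := ((hcont' (-s)).tendsto q).comp hφq
    refine isClosed_closedBall.mem_of_tendsto hlim ?_
    -- Exit times tend to infinity: up to time `s` an orbit separates from the fixed point `z` by at
    -- most the factor `exp (K * s)`, hence is still inside the ball. Going back by `s` from the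
    -- exit point therefore stays in the ball, and so does the limit.
    have hsmall : ∀ᶠ n in atTop,
        dist (p (φ n + n₀)) z * Real.exp (K * s) < δ - dist z c := by
      have h1 : Tendsto (fun n ↦ dist (p (φ n + n₀)) z * Real.exp (K * s)) atTop
          (𝓝 (0 * Real.exp (K * s))) :=
        ((tendsto_iff_dist_tendsto_zero.1 hpt).comp hφt).mul_const _
      rw [zero_mul] at h1
      exact h1.eventually_lt_const (by simpa using hzB)
    filter_upwards [hsmall] with n hn
    have hTs' : s < T (φ n + n₀) := by
      by_contra hcon
      push Not at hcon
      have h1 := hΦ.dist_le hF (T (φ n + n₀)) (p (φ n + n₀)) z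
      rw [hΦz, abs_of_nonneg (hT0 _ (hnB (φ n)))] at h1
      have h2 : Real.exp (K * T (φ n + n₀)) ≤ Real.exp (K * s) :=
        Real.exp_le_exp.2 (mul_le_mul_of_nonneg_left hcon K.2)
      have h3 := mul_le_mul_of_nonneg_left h2 (dist_nonneg (x := p (φ n + n₀)) (y := z))
      have h4 := hTs _ (hnB (φ n))
      linarith [dist_triangle (Φ (T (φ n + n₀)) (p (φ n + n₀))) z c]
    rw [← hΦ.add hF]
    rcases hs.lt_or_eq with h | h
    · exact (hTlt _ (hnB (φ n)) _ (by linarith) (by linarith)).le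
    · rw [← h, neg_zero, zero_add]; exact (hTs _ (hnB (φ n))).le
  have horb : ∀ t, HasDerivAt (fun t ↦ Φ t q) (-G (Φ t q)) t := by
    intro t
    rw [← hFG _ ?_]
    · exact hΦ.deriv q t
    · rcases le_total t 0 with ht | ht
      · right
        have := hback (-t) (by linarith)
        rwa [neg_neg] at this
      · left
        have := hanti q ht
        simp only [hΦ.zero] at this
        exact this.trans hVq
  refine ⟨fun t ↦ Φ t q, horb, ?_, by simpa [hΦ.zero] using hq, by simpa [hΦ.zero] using hfq,
    by simpa [hΦ.zero] using hVq⟩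
  -- Reversed in time, the orbit is a gradient orbit of `-V` confined to a compact ball whose only
  -- stationary point is `z`, so LaSalle's principle gives the limit at `-∞`.
  have hV' : ∀ x, HasGradientAt (fun y ↦ -V y) (-G x) x := fun x ↦ by
    rw [hasGradientAt_iff_hasFDerivAt, map_neg]; exact (hV x).hasFDerivAt.neg
  have hrev : FwdOrbit (fun x ↦ -G x) (fun t ↦ Φ (-t) q) := by
    intro t _
    have := (horb (-t)).scomp t (hasDerivAt_neg t)
    refine HasDerivAt.hasDerivWithinAt ?_
    simpa [Function.comp_def] using this
  have := hrev.tendsto hV' hG.continuous.neg (isCompact_closedBall c δ) hback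
    (fun x hx hx0 ↦ huniq x hx (neg_eq_zero.1 hx0))
  have h2 := this.comp tendsto_neg_atBot_atTop
  simpa [Function.comp_def] using h2

/-- Each side of the unstable manifold of a stationary point with one unstable direction consists
of a single orbit, hence has a single limit. -/
theorem limit_unique_of_same_side (hV : ∀ x, HasGradientAt V (G x) x) (hG : ContDiff ℝ 1 G)
    {H : E →L[ℝ] E} (hH : ∀ x y, inner ℝ (H x) y = inner ℝ x (H y)) {B : Set E} {κ : ℝ}
    (hκ : 0 < κ)
    (hmono : ∀ x ∈ B, ∀ y ∈ B, κ * ‖x - y‖ ^ 2 ≤ inner ℝ (H (x - y)) (G x - G y))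
    {f : E → ℝ} (hf : Continuous f)
    (hslice : ∀ x ∈ B, ∀ y ∈ B, f x = f y → 0 ≤ inner ℝ (H (x - y)) (x - y)) {u v : ℝ → E}
    {z x y : E} (hu : ∀ t, HasDerivAt u (-G (u t)) t) (hv : ∀ t, HasDerivAt v (-G (v t)) t)
    (huB : ∀ t ≤ 0, u t ∈ B) (hvB : ∀ t ≤ 0, v t ∈ B) (huz : Tendsto u atBot (𝓝 z))
    (hvz : Tendsto v atBot (𝓝 z)) (hux : Tendsto u atTop (𝓝 x)) (hvy : Tendsto v atTop (𝓝 y))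
    (hfu : f z < f (u 0)) (hfv : f z < f (v 0)) : x = y := by
  wlog hle : f (u 0) ≤ f (v 0) generalizing u v x y
  · exact (this hv hu hvB huB hvz huz hvy hux hfv hfu (not_le.1 hle).le).symm
  have hvc : Continuous v := continuous_iff_continuousAt.2 fun t ↦ (hv t).continuousAt
  -- The orbit that ends further out passes through the level `f (u 0)` at some earlier time. There
  -- both points lie in one slice, where the quadratic form is nonnegative, so the comparison of
  -- backward asymptotic orbits identifies them up to a time shift.
  obtain ⟨r, hr0, hr⟩ : ∃ r ≤ 0, f (v r) = f (u 0) := by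
    have h1 : Tendsto (fun t ↦ f (v t)) atBot (𝓝 (f z)) := (hf.tendsto z).comp hvz
    obtain ⟨r, hr, hr', -⟩ := exists_first_exit (hf.comp hvc) (h1.eventually_lt_const hfu) hle
    exact ⟨r, hr, hr'⟩
  have heq : u 0 = (fun t ↦ v (t + r)) 0 := by
    refine eq_of_backward_asymptotic hH hκ hmono hu (hasDerivAt_shift hv r) huB
      (fun t ht ↦ hvB _ (by linarith)) huz (hvz.comp (tendsto_atBot_add_const_right _ r tendsto_id))
      (hslice _ (huB 0 le_rfl) _ (hvB _ (by linarith)) (by rw [zero_add, hr]))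
  have hall := FwdOrbit.eqOn hV hG (fwdOrbit_of_hasDerivAt hu)
    (fwdOrbit_of_hasDerivAt (hasDerivAt_shift hv r)) heq
  have hvy' : Tendsto (fun t ↦ v (t + r)) atTop (𝓝 y) :=
    hvy.comp (tendsto_atTop_add_const_right _ r tendsto_id)
  refine tendsto_nhds_unique (hux.congr' ?_) hvy'
  exact (eventually_ge_atTop 0).mono fun t ht ↦ hall t ht

end GradFlow

/-! ### Perturbed families of potentials and branches of stationary points -/

namespace GradFlow

open Metric NNReal

variable {E : Type*} [NormedAddCommGroup E] [InnerProductSpace ℝ E]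

/-- The tube lemma. It reduces statements uniform over a compact set of points, for small `γ`, to
local ones near each point of the set. -/
theorem _root_.IsCompact.eventually_forall {X Y : Type*} [TopologicalSpace Y] {l : Filter X}
    {K : Set Y} (hK : IsCompact K) {p : X → Y → Prop}
    (hp : ∀ y ∈ K, ∀ᶠ z in l ×ˢ 𝓝 y, p z.1 z.2) : ∀ᶠ x in l, ∀ y ∈ K, p x y := by
  have h : {z : X × Y | p z.1 z.2} ∈ l ×ˢ 𝓝ˢ K := hK.mem_prod_nhdsSet_of_forall hp
  have h' : ∀ᶠ z in l ×ˢ 𝓝ˢ K, p z.1 z.2 := h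
  exact h'.curry.mono fun x hx ↦ hx.self_of_nhdsSet

theorem exists_coercive [FiniteDimensional ℝ E] (H : E →L[ℝ] E) (U : Submodule ℝ E)
    (h : ∀ w ∈ U, w ≠ 0 → 0 < inner ℝ (H w) w) :
    ∃ κ > 0, ∀ w ∈ U, κ * ‖w‖ ^ 2 ≤ inner ℝ (H w) w := by
  have hc : Continuous fun w : E ↦ inner ℝ (H w) w := H.continuous.inner continuous_id
  have hK : IsCompact (sphere (0 : E) 1 ∩ U) :=
    (isCompact_sphere 0 1).inter_right U.closed_of_finiteDimensional
  rcases (sphere (0 : E) 1 ∩ U).eq_empty_or_nonempty with he | hne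
  · refine ⟨1, one_pos, fun w hw ↦ ?_⟩
    by_cases hw0 : w = 0
    · simp [hw0]
    · exfalso
      have : ‖w‖⁻¹ • w ∈ sphere (0 : E) 1 ∩ U := by
        refine ⟨?_, U.smul_mem _ hw⟩
        rw [mem_sphere_zero_iff_norm, norm_smul, norm_inv, norm_norm,
          inv_mul_cancel₀ (norm_ne_zero_iff.2 hw0)]
      rw [he] at this
      exact this
  · obtain ⟨w₀, hw₀, hmin⟩ := hK.exists_isMinOn hne hc.continuousOn
    have hw₀0 : w₀ ≠ 0 := by
      rintro rfl; simp at hw₀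
    refine ⟨_, h w₀ hw₀.2 hw₀0, fun w hw ↦ ?_⟩
    by_cases hw0 : w = 0
    · simp [hw0]
    · have hn : 0 < ‖w‖ := norm_pos_iff.2 hw0
      have hmem : ‖w‖⁻¹ • w ∈ sphere (0 : E) 1 ∩ U := by
        refine ⟨?_, U.smul_mem _ hw⟩
        rw [mem_sphere_zero_iff_norm, norm_smul, norm_inv, norm_norm, inv_mul_cancel₀ hn.ne']
      have := isMinOn_iff.1 hmin _ hmem
      simp only [map_smul, inner_smul_left, inner_smul_right, map_inv₀, conj_trivial] at this
      have h2 : ‖w‖⁻¹ * (‖w‖⁻¹ * inner ℝ (H w) w) * ‖w‖ ^ 2 = inner ℝ (H w) w := by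
        field_simp
      nlinarith [sq_nonneg ‖w‖, mul_le_mul_of_nonneg_right this (sq_nonneg ‖w‖)]

theorem exists_antilipschitz [FiniteDimensional ℝ E] (H : E →L[ℝ] E) (h : Function.Injective H) :
    ∃ κ > 0, ∀ w, κ * ‖w‖ ≤ ‖H w‖ := by
  obtain ⟨K, hK, hK'⟩ := (H : E →ₗ[ℝ] E).exists_antilipschitzWith (LinearMap.ker_eq_bot.2 h)
  have hK0 : (0 : ℝ) < K := hK
  refine ⟨(K : ℝ)⁻¹, inv_pos.2 hK0, fun w ↦ ?_⟩
  have := hK'.le_mul_norm_sub w 0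
  rw [inv_mul_le_iff₀ hK0]
  simpa using this

/-- A perturbation `V₀ + γ W` of a potential `V₀` by a nonnegative quadratic form `W`. -/
structure Family (E : Type*) [NormedAddCommGroup E] [InnerProductSpace ℝ E] [CompleteSpace E] where
  V₀ : E → ℝ
  W : E → ℝ
  G₀ : E → E
  L : E →L[ℝ] E
  hV₀ : ∀ x, HasGradientAt V₀ (G₀ x) x
  hW : ∀ x, HasGradientAt W (L x) x
  contDiff : ContDiff ℝ 1 G₀
  W_nonneg : ∀ x, 0 ≤ W x
  bdd : ∀ ℓ, Bornology.IsBounded {x | V₀ x ≤ ℓ}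

namespace Family

variable [CompleteSpace E] (P : Family E)

/-- The perturbed potential. -/
def V (γ : ℝ) (x : E) : ℝ := P.V₀ x + γ * P.W x

/-- The gradient of the perturbed potential. -/
def G (γ : ℝ) (x : E) : E := P.G₀ x + γ • P.L x

theorem hasGradientAt (γ : ℝ) (x : E) : HasGradientAt (P.V γ) (P.G γ x) x := by
  rw [hasGradientAt_iff_hasFDerivAt, G, map_add, map_smulₛₗ]
  exact (P.hV₀ x).hasFDerivAt.add ((P.hW x).hasFDerivAt.const_mul γ)

theorem contDiff_G (γ : ℝ) : ContDiff ℝ 1 (P.G γ) :=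
  P.contDiff.add (P.L.contDiff.const_smul γ)

theorem continuous_V₀ : Continuous P.V₀ :=
  continuous_iff_continuousAt.2 fun x ↦ (P.hV₀ x).differentiableAt.continuousAt

theorem continuous_W : Continuous P.W :=
  continuous_iff_continuousAt.2 fun x ↦ (P.hW x).differentiableAt.continuousAt

theorem continuous_V (γ : ℝ) : Continuous (P.V γ) :=
  P.continuous_V₀.add (continuous_const.mul P.continuous_W)

theorem continuous_V_uncurry : Continuous fun z : ℝ × E ↦ P.V z.1 z.2 :=
  (P.continuous_V₀.comp continuous_snd).add
    (continuous_fst.mul (P.continuous_W.comp continuous_snd))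

theorem continuous_G_uncurry : Continuous fun z : ℝ × E ↦ P.G z.1 z.2 :=
  (P.contDiff.continuous.comp continuous_snd).add
    (continuous_fst.smul (P.L.continuous.comp continuous_snd))

theorem V₀_le_V {γ : ℝ} (hγ : 0 ≤ γ) (x : E) : P.V₀ x ≤ P.V γ x :=
  le_add_of_nonneg_right (mul_nonneg hγ (P.W_nonneg x))

theorem bdd_V {γ : ℝ} (hγ : 0 ≤ γ) (ℓ : ℝ) : Bornology.IsBounded {x | P.V γ x ≤ ℓ} :=
  (P.bdd ℓ).subset fun x hx ↦ (P.V₀_le_V hγ x).trans hx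

theorem fderiv_G (γ : ℝ) (x : E) : fderiv ℝ (P.G γ) x = fderiv ℝ P.G₀ x + γ • P.L := by
  have h := ((P.contDiff.differentiable one_ne_zero x).hasFDerivAt).add
    (P.L.hasFDerivAt.const_smul γ)
  exact h.fderiv

/-- The gradients of the perturbed potentials are well approximated by `H` on a neighbourhood. -/
theorem eventually_fderiv_close (c : E) {ε : ℝ} (hε : 0 < ε) :
    ∃ r > 0, ∀ᶠ γ in 𝓝[≥] (0 : ℝ), ∀ x ∈ closedBall c r,
      ‖fderiv ℝ (P.G γ) x - fderiv ℝ P.G₀ c‖ ≤ ε := by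
  have h1 : ∀ᶠ x in 𝓝 c, ‖fderiv ℝ P.G₀ x - fderiv ℝ P.G₀ c‖ < ε / 2 := by
    have := (P.contDiff.continuous_fderiv one_ne_zero).tendsto c
    have h2 := (this.sub_const (fderiv ℝ P.G₀ c)).norm
    rw [sub_self, norm_zero] at h2
    exact h2.eventually_lt_const (by positivity)
  obtain ⟨r, hr, hr'⟩ := nhds_basis_closedBall.eventually_iff.1 h1
  refine ⟨r, hr, ?_⟩
  have h3 : ∀ᶠ γ in 𝓝[≥] (0 : ℝ), ‖γ • P.L‖ < ε / 2 := by
    have : Tendsto (fun γ : ℝ ↦ ‖γ • P.L‖) (𝓝 0) (𝓝 ‖(0 : ℝ) • P.L‖) :=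
      (continuous_id.smul continuous_const).norm.tendsto 0
    rw [zero_smul, norm_zero] at this
    exact (this.mono_left nhdsWithin_le_nhds).eventually_lt_const (by positivity)
  filter_upwards [h3] with γ hγ x hx
  rw [fderiv_G, add_sub_right_comm]
  linarith [norm_add_le (fderiv ℝ P.G₀ x - fderiv ℝ P.G₀ c) (γ • P.L), hr' hx]

theorem approx {γ r ε : ℝ} {c : E} {H : E →L[ℝ] E}
    (h : ∀ x ∈ closedBall c r, ‖fderiv ℝ (P.G γ) x - H‖ ≤ ε) {x y : E} (hx : x ∈ closedBall c r)
    (hy : y ∈ closedBall c r) : ‖P.G γ x - P.G γ y - H (x - y)‖ ≤ ε * ‖x - y‖ :=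
  Convex.norm_image_sub_le_of_norm_hasFDerivWithin_le'
    (fun x _ ↦ ((P.contDiff_G γ).differentiable one_ne_zero x).hasFDerivAt.hasFDerivWithinAt) h
    (convex_closedBall c r) hy hx

/-- `ξ` is the branch of stationary points of `V_γ` through the stationary point `c` of `V_0`. -/
structure IsBranch (c : E) (ξ : ℝ → E) (r γ₁ C : ℝ) : Prop where
  r_pos : 0 < r
  γ₁_pos : 0 < γ₁
  zero : ∀ γ ∈ Icc 0 γ₁, P.G γ (ξ γ) = 0
  dist_le : ∀ γ ∈ Icc 0 γ₁, ‖ξ γ - c‖ ≤ C * γ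
  lt : C * γ₁ < r
  continuousOn : ContinuousOn ξ (Icc 0 γ₁)
  unique : ∀ γ ∈ Icc 0 γ₁, ∀ x ∈ closedBall c r, P.G γ x = 0 → x = ξ γ
  energy : ∀ γ ∈ Icc 0 γ₁, |P.V γ (ξ γ) - (P.V₀ c + γ * P.W c)| ≤ C * γ ^ 2

variable {P}

theorem IsBranch.C_nonneg {c : E} {ξ : ℝ → E} {r γ₁ C : ℝ} (h : P.IsBranch c ξ r γ₁ C) : 0 ≤ C := by
  have := (norm_nonneg _).trans (h.dist_le γ₁ ⟨h.γ₁_pos.le, le_rfl⟩)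
  exact nonneg_of_mul_nonneg_left this h.γ₁_pos

theorem IsBranch.mem_closedBall {c : E} {ξ : ℝ → E} {r γ₁ C : ℝ} (h : P.IsBranch c ξ r γ₁ C) {γ : ℝ}
    (hγ : γ ∈ Icc 0 γ₁) : ξ γ ∈ ball c r := by
  rw [mem_ball_iff_norm]
  have := mul_le_mul_of_nonneg_left hγ.2 h.C_nonneg
  linarith [h.dist_le γ hγ, h.lt]

theorem IsBranch.tendsto {c : E} {ξ : ℝ → E} {r γ₁ C : ℝ} (h : P.IsBranch c ξ r γ₁ C) :
    Tendsto ξ (𝓝[≥] 0) (𝓝 c) := by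
  rw [tendsto_iff_norm_sub_tendsto_zero]
  have h1 : Tendsto (fun γ : ℝ ↦ C * γ) (𝓝[≥] 0) (𝓝 0) := by
    have : Tendsto (fun γ : ℝ ↦ C * γ) (𝓝 0) (𝓝 (C * 0)) :=
      (continuous_const.mul continuous_id).tendsto 0
    rw [mul_zero] at this
    exact this.mono_left nhdsWithin_le_nhds
  refine squeeze_zero' (Eventually.of_forall fun _ ↦ norm_nonneg _) ?_ h1
  filter_upwards [Icc_mem_nhdsGE h.γ₁_pos] with γ hγ using h.dist_le γ hγ

/-- A continuous family of stationary points that starts at `c` follows the branch. -/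
theorem IsBranch.eq_of_continuousOn {c : E} {ξ : ℝ → E} {r γ₁ C : ℝ}
    (h : P.IsBranch c ξ r γ₁ C) {γ : ℝ} (hγ : γ ∈ Icc 0 γ₁) {η : ℝ → E}
    (hη : ContinuousOn η (Icc 0 γ)) (h0 : η 0 = c) (hz : ∀ g ∈ Icc 0 γ, P.G g (η g) = 0) :
    η γ = ξ γ := by
  -- Open-closed argument: as long as the family is in the closed ball it equals `ξ`, which lies in
  -- the open ball, so it cannot reach the boundary.
  have hcl : IsClosed ({g | η g ∈ closedBall c r} ∩ Icc 0 γ) := by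
    rw [inter_comm]
    exact hη.preimage_isClosed_of_isClosed isClosed_Icc isClosed_closedBall
  have := hcl.Icc_subset_of_forall_mem_nhdsWithin
    (show η 0 ∈ closedBall c r by rw [h0]; exact mem_closedBall_self h.r_pos.le) (fun g hg ↦ by
      have hgI : g ∈ Icc 0 γ₁ := ⟨hg.2.1, hg.2.2.le.trans hγ.2⟩
      have heq := h.unique g hgI _ hg.1 (hz g ⟨hg.2.1, hg.2.2.le⟩)
      have hb : η g ∈ ball c r := heq ▸ h.mem_closedBall hgI
      have hc : ContinuousWithinAt η (Ioi g) g := by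
        refine ContinuousWithinAt.mono_of_mem_nhdsWithin (hη g ⟨hg.2.1, hg.2.2.le⟩) ?_
        filter_upwards [Ioc_mem_nhdsGT hg.2.2] with s hs using ⟨hg.2.1.trans hs.1.le, hs.2⟩
      exact (hc.eventually (isOpen_ball.mem_nhds hb)).mono fun s hs ↦ ball_subset_closedBall hs)
  exact h.unique γ hγ _ (this ⟨hγ.1, le_rfl⟩) (hz γ ⟨hγ.1, le_rfl⟩)

variable [FiniteDimensional ℝ E]

variable (P) in
-- A quantitative implicit function theorem. Near `c` all the gradients `G γ` differ from the
-- invertible linearization by at most half its lower bound, which gives existence, uniqueness and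
-- Lipschitz dependence on `γ`. The displacement enters the energy only at second order because the
-- gradient is itself `O(γ)` between `c` and the new stationary point.
theorem exists_isBranch {c : E} (hc : P.G₀ c = 0) (hinj : Function.Injective (fderiv ℝ P.G₀ c)) :
    ∃ ξ r γ₁ C, P.IsBranch c ξ r γ₁ C := by
  set H := fderiv ℝ P.G₀ c with hH
  obtain ⟨κ, hκ, hHκ⟩ := exists_antilipschitz H hinj
  obtain ⟨r, hr, hclose⟩ := P.eventually_fderiv_close c (half_pos hκ)
  -- This constant comes from `κ / 2 * ‖ξ γ - c‖ ≤ ‖P.G γ c‖ = γ * ‖P.L c‖`.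
  set C₀ := ‖P.L c‖ * (2 / κ) with hC₀
  have hC₀0 : 0 ≤ C₀ := by positivity
  have hsmall : ∀ᶠ γ in 𝓝[≥] (0 : ℝ), C₀ * γ < r ∧ γ < 1 := by
    have h1 : Tendsto (fun γ : ℝ ↦ C₀ * γ) (𝓝 0) (𝓝 (C₀ * 0)) :=
      (continuous_const.mul continuous_id).tendsto 0
    rw [mul_zero] at h1
    exact ((h1.mono_left nhdsWithin_le_nhds).eventually_lt_const hr).and
      ((tendsto_id.mono_left nhdsWithin_le_nhds).eventually_lt_const one_pos)
  obtain ⟨γ₁, hγ₁, hsub⟩ := mem_nhdsGE_iff_exists_Icc_subset.1 (hclose.and hsmall)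
  have happrox : ∀ γ ∈ Icc 0 γ₁, ∀ x ∈ closedBall c r, ∀ y ∈ closedBall c r,
      ‖P.G γ x - P.G γ y - H (x - y)‖ ≤ κ / 2 * ‖x - y‖ :=
    fun γ hγ x hx y hy ↦ P.approx (hsub hγ).1 hx hy
  have hlow : ∀ γ ∈ Icc 0 γ₁, ∀ x ∈ closedBall c r, ∀ y ∈ closedBall c r,
      κ / 2 * ‖x - y‖ ≤ ‖P.G γ x - P.G γ y‖ := by
    intro γ hγ x hx y hy
    have h1 := happrox γ hγ x hx y hy
    have h2 := norm_sub_norm_le (H (x - y)) (H (x - y) - (P.G γ x - P.G γ y))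
    rw [sub_sub_cancel, norm_sub_rev (H (x - y))] at h2
    linarith [hHκ (x - y)]
  have hcr : c ∈ closedBall c r := mem_closedBall_self hr.le
  have hGc : ∀ γ, P.G γ c = γ • P.L c := fun γ ↦ by rw [G, hc, zero_add]
  -- existence
  have hsurj : Function.Surjective H :=
    (LinearMap.injective_iff_surjective (f := (H : E →ₗ[ℝ] E))).1 hinj
  choose S hS using hsurj
  let Hs : H.NonlinearRightInverse :=
    { toFun := S
      nnnorm := ⟨κ⁻¹, (inv_pos.2 hκ).le⟩
      bound' := fun y ↦ by
        have := hHκ (S y)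
        rw [hS] at this
        change ‖S y‖ ≤ κ⁻¹ * ‖y‖
        rwa [← div_eq_inv_mul, le_div_iff₀ hκ, mul_comm]
      right_inv' := hS }
  have hex : ∀ γ ∈ Icc 0 γ₁, ∃ x ∈ closedBall c r, P.G γ x = 0 := by
    intro γ hγ
    have hA : ApproximatesLinearOn (P.G γ) H (closedBall c r) ⟨κ / 2, (half_pos hκ).le⟩ :=
      fun x hx y hy ↦ happrox γ hγ x hx y hy
    refine hA.surjOn_closedBall_of_nonlinearRightInverse Hs hr.le subset_rfl ?_
    rw [mem_closedBall, dist_comm, dist_zero_right, hGc, norm_smul, Real.norm_of_nonneg hγ.1]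
    change γ * ‖P.L c‖ ≤ (κ⁻¹⁻¹ - κ / 2) * r
    rw [inv_inv]
    have := (hsub hγ).2.1
    have h2 : C₀ * γ * (κ / 2) = γ * ‖P.L c‖ := by rw [hC₀]; field_simp
    nlinarith
  choose! ξ hξr hξ0 using hex
  have hdist : ∀ γ ∈ Icc 0 γ₁, ‖ξ γ - c‖ ≤ C₀ * γ := by
    intro γ hγ
    have h1 := hlow γ hγ _ (hξr γ hγ) c hcr
    rw [hξ0 γ hγ, hGc, zero_sub, norm_neg, norm_smul, Real.norm_of_nonneg hγ.1] at h1
    have h2 : C₀ * γ * (κ / 2) = γ * ‖P.L c‖ := by rw [hC₀]; field_simp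
    by_contra hcon
    push Not at hcon
    nlinarith
  set B := ‖H‖ + κ / 2 with hB
  have hB0 : 0 ≤ B := by positivity
  -- The second term is the energy error: a gradient of size `B * (2 * C₀ * γ)` acting over a
  -- distance `C₀ * γ`.
  set C := C₀ + 2 * B * C₀ ^ 2 with hC
  have hCC : C₀ ≤ C := by rw [hC]; linarith [mul_nonneg (mul_nonneg zero_le_two hB0) (sq_nonneg C₀)]
  obtain ⟨γ₂, hγ₂, hγ₂C⟩ : ∃ γ₂ > 0, C * γ₂ < r := by
    refine ⟨r / (2 * (C + 1)), by positivity, ?_⟩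
    have hC0 : 0 ≤ C := hC₀0.trans hCC
    rw [mul_div_assoc', div_lt_iff₀ (by positivity)]
    nlinarith
  have hmin : min γ₁ γ₂ ≤ γ₁ := min_le_left _ _
  refine ⟨ξ, r, min γ₁ γ₂, C, ⟨hr, lt_min hγ₁ hγ₂, ?_, ?_, ?_, ?_, ?_, ?_⟩⟩
  · exact fun γ hγ ↦ hξ0 γ ⟨hγ.1, hγ.2.trans hmin⟩
  · exact fun γ hγ ↦ (hdist γ ⟨hγ.1, hγ.2.trans hmin⟩).trans
      (mul_le_mul_of_nonneg_right hCC hγ.1)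
  · exact (mul_le_mul_of_nonneg_left (min_le_right _ _) (hC₀0.trans hCC)).trans_lt hγ₂C
  · refine ContinuousOn.mono ?_ (Icc_subset_Icc_right hmin)
    obtain ⟨b, hb⟩ := (isCompact_closedBall c r).exists_bound_of_continuousOn P.L.continuous.continuousOn
    -- At a zero of `G g'` the gradient `G g` is `(g - g') • L`, so the lower bound for differences
    -- of gradients gives a Lipschitz estimate in `γ`.
    have hlip : ∀ g ∈ Icc 0 γ₁, ∀ g' ∈ Icc 0 γ₁, ‖ξ g - ξ g'‖ ≤ (2 / κ * b) * |g - g'| := by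
      intro g hg g' hg'
      have h1 := hlow g hg _ (hξr g hg) _ (hξr g' hg')
      have h2 : P.G g (ξ g') = (g - g') • P.L (ξ g') := by
        have h3 := hξ0 g' hg'
        rw [G] at h3 ⊢
        rw [sub_smul, eq_neg_of_add_eq_zero_left h3]; abel
      rw [hξ0 g hg, h2, zero_sub, norm_neg, norm_smul, Real.norm_eq_abs] at h1
      have h4 := mul_le_mul_of_nonneg_left (hb _ (hξr g' hg')) (abs_nonneg (g - g'))
      have h5 : ‖ξ g - ξ g'‖ = 2 / κ * (κ / 2 * ‖ξ g - ξ g'‖) := by field_simp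
      rw [h5, mul_assoc]
      refine mul_le_mul_of_nonneg_left ?_ (by positivity)
      linarith
    have hb0 : 0 ≤ b := (norm_nonneg _).trans (hb c hcr)
    refine (LipschitzOnWith.of_dist_le_mul (K := ⟨2 / κ * b, by positivity⟩) ?_).continuousOn
    intro g hg g' hg'
    rw [dist_eq_norm, Real.dist_eq]
    exact hlip g hg g' hg'
  · intro γ hγ x hx hx0
    have hγ' : γ ∈ Icc 0 γ₁ := ⟨hγ.1, hγ.2.trans hmin⟩
    have h1 := hlow γ hγ' x hx _ (hξr γ hγ')
    rw [hx0, hξ0 γ hγ', sub_self, norm_zero] at h1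
    have h2 : ‖x - ξ γ‖ ≤ 0 := nonpos_of_mul_nonpos_right h1 (half_pos hκ)
    exact sub_eq_zero.1 (norm_le_zero_iff.1 h2)
  · intro γ hγ
    have hγ' : γ ∈ Icc 0 γ₁ := ⟨hγ.1, hγ.2.trans hmin⟩
    have hsub2 : closedBall c (C₀ * γ) ⊆ closedBall c r :=
      closedBall_subset_closedBall (hsub hγ').2.1.le
    have hb : ∀ x ∈ closedBall c (C₀ * γ), ‖P.G γ x‖ ≤ B * (2 * (C₀ * γ)) := by
      intro x hx
      have h1 := happrox γ hγ' x (hsub2 hx) _ (hξr γ hγ')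
      rw [hξ0 γ hγ', sub_zero] at h1
      have h2 : ‖P.G γ x‖ ≤ B * ‖x - ξ γ‖ := by
        have h3 := norm_le_norm_sub_add (P.G γ x) (H (x - ξ γ))
        have h4 := H.le_opNorm (x - ξ γ)
        rw [hB]; linarith
      refine h2.trans (mul_le_mul_of_nonneg_left ?_ hB0)
      have h5 := norm_sub_le_norm_sub_add_norm_sub x c (ξ γ)
      have h6 := hdist γ hγ'
      rw [norm_sub_rev] at h6
      linarith [mem_closedBall_iff_norm.1 hx]
    have hmv := (convex_closedBall c (C₀ * γ)).norm_image_sub_le_of_norm_hasFDerivWithin_le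
      (f := P.V γ) (C := B * (2 * (C₀ * γ)))
      (fun x _ ↦ (P.hasGradientAt γ x).hasFDerivAt.hasFDerivWithinAt)
      (fun x hx ↦ by rw [LinearIsometryEquiv.norm_map]; exact hb x hx)
      (mem_closedBall_self (mul_nonneg hC₀0 hγ.1))
      (mem_closedBall_iff_norm.2 (hdist γ hγ'))
    rw [Real.norm_eq_abs] at hmv
    refine hmv.trans ?_
    have h7 := mul_le_mul_of_nonneg_left (hdist γ hγ')
      (show 0 ≤ B * (2 * (C₀ * γ)) from mul_nonneg hB0 (mul_nonneg zero_le_two (mul_nonneg hC₀0 hγ.1)))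
    refine h7.trans ?_
    rw [hC]
    nlinarith [mul_nonneg hC₀0 (sq_nonneg γ)]

end Family

end GradFlow

/-! ### Local dynamics at a saddle, uniformly in the perturbation -/

namespace GradFlow

open Metric NNReal

variable {E : Type*} [NormedAddCommGroup E] [InnerProductSpace ℝ E]

theorem segment_mem {c : E} {r : ℝ} {x y : E} (hx : x ∈ closedBall c r) (hy : y ∈ closedBall c r)
    {s : ℝ} (hs : s ∈ Icc (0 : ℝ) 1) : y + s • (x - y) ∈ closedBall c r :=
  (convex_closedBall c r).add_smul_sub_mem hy hx hs

namespace Family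

variable [CompleteSpace E] {P : Family E}

theorem IsBranch.mono {c : E} {ξ : ℝ → E} {r γ₁ C r' γ₁' : ℝ} (h : P.IsBranch c ξ r γ₁ C)
    (hr' : 0 < r') (hr : r' ≤ r) (hγ' : 0 < γ₁') (hγ : γ₁' ≤ γ₁) (hlt : C * γ₁' < r') :
    P.IsBranch c ξ r' γ₁' C where
  r_pos := hr'
  γ₁_pos := hγ'
  zero γ hγ1 := h.zero γ ⟨hγ1.1, hγ1.2.trans hγ⟩
  dist_le γ hγ1 := h.dist_le γ ⟨hγ1.1, hγ1.2.trans hγ⟩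
  lt := hlt
  continuousOn := h.continuousOn.mono (Icc_subset_Icc_right hγ)
  unique γ hγ1 x hx := h.unique γ ⟨hγ1.1, hγ1.2.trans hγ⟩ x (closedBall_subset_closedBall hr hx)
  energy γ hγ1 := h.energy γ ⟨hγ1.1, hγ1.2.trans hγ⟩

variable (P) in
/-- The Hessian of `V₀` at the stationary point `c` is positive definite on the kernel of `f` and
has a negative direction. -/
structure IsSaddleAt (c : E) (f : E →L[ℝ] ℝ) : Prop where
  zero : P.G₀ c = 0
  symm : ∀ x y, inner ℝ (fderiv ℝ P.G₀ c x) y = inner ℝ x (fderiv ℝ P.G₀ c y)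
  pos : ∀ w, f w = 0 → w ≠ 0 → 0 < inner ℝ (fderiv ℝ P.G₀ c w) w
  neg : ∃ v, inner ℝ (fderiv ℝ P.G₀ c v) v < 0

theorem IsSaddleAt.exists_neg {c : E} {f : E →L[ℝ] ℝ} (h : P.IsSaddleAt c f) :
    ∃ v, 0 < f v ∧ inner ℝ (fderiv ℝ P.G₀ c v) v < 0 := by
  obtain ⟨v, hv⟩ := h.neg
  have hfv : f v ≠ 0 := by
    intro h0
    have hv0 : v ≠ 0 := by rintro rfl; simp at hv
    exact absurd (h.pos v h0 hv0) (not_lt.2 hv.le)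
  rcases hfv.lt_or_gt with h1 | h1
  · exact ⟨-v, by simpa using h1, by simpa using hv⟩
  · exact ⟨v, h1, hv⟩

/-- A null vector transverse to the kernel of `f` could be used to shift a negative direction into
this kernel without changing its quadratic form, against positivity there. -/
theorem IsSaddleAt.injective {c : E} {f : E →L[ℝ] ℝ} (h : P.IsSaddleAt c f) :
    Function.Injective (fderiv ℝ P.G₀ c) := by
  set H := fderiv ℝ P.G₀ c with hH
  refine (injective_iff_map_eq_zero H).2 fun x hx ↦ ?_
  by_contra hx0
  by_cases hfx : f x = 0
  · have := h.pos x hfx hx0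
    rw [← hH, hx, inner_zero_left] at this
    exact lt_irrefl _ this
  · obtain ⟨v, -, hv⟩ := h.exists_neg
    have h1 : f (v - (f v / f x) • x) = 0 := by
      rw [map_sub, map_smul, smul_eq_mul, div_mul_cancel₀ _ hfx, sub_self]
    have h2 : inner ℝ (H (v - (f v / f x) • x)) (v - (f v / f x) • x) = inner ℝ (H v) v := by
      rw [map_sub, map_smul, hx, smul_zero, sub_zero, inner_sub_right, inner_smul_right,
        h.symm v x, ← hH, hx, inner_zero_right, mul_zero, sub_zero]
    have h3 : v - (f v / f x) • x ≠ 0 := by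
      intro h0
      rw [h0, inner_zero_right] at h2
      rw [← h2] at hv
      exact lt_irrefl _ hv
    have := h.pos _ h1 h3
    rw [← hH, h2] at this
    exact lt_asymm hv this

variable (P) in
/-- A neighbourhood of a saddle of `V₀` in which the perturbed gradients are uniformly close to
the linearization. -/
structure SaddleNbhd (c : E) (f : E →L[ℝ] ℝ) (ξ : ℝ → E) (r γ₁ C κ : ℝ) (v : E) : Prop where
  saddle : P.IsSaddleAt c f
  branch : P.IsBranch c ξ r γ₁ C
  κ_pos : 0 < κ
  close : ∀ γ ∈ Icc 0 γ₁, ∀ x ∈ closedBall c r, ‖fderiv ℝ (P.G γ) x - fderiv ℝ P.G₀ c‖ ≤ κ / 2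
  slice : ∀ w, f w = 0 → κ * ‖w‖ ^ 2 ≤ inner ℝ (fderiv ℝ P.G₀ c w) w
  low : ∀ w, κ * ‖w‖ ≤ ‖fderiv ℝ P.G₀ c w‖
  v_pos : 0 < f v
  v_neg : inner ℝ (fderiv ℝ P.G₀ c v) v ≤ -(κ * ‖v‖ ^ 2)

/-- A single `κ` serves as coercivity constant on the slice, as lower bound for the linearization
and for the negative direction. The ball and the range of `γ` are then shrunk until gradients are
linear up to `κ / 2`. -/
theorem IsSaddleAt.exists_nbhd [FiniteDimensional ℝ E] {c : E} {f : E →L[ℝ] ℝ}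
    (h : P.IsSaddleAt c f) : ∃ ξ r γ₁ C κ v, P.SaddleNbhd c f ξ r γ₁ C κ v := by
  set H := fderiv ℝ P.G₀ c with hH
  obtain ⟨κ₁, hκ₁, h1⟩ := exists_coercive H f.ker (fun w hw ↦ h.pos w hw)
  obtain ⟨κ₂, hκ₂, h2⟩ := exists_antilipschitz H h.injective
  obtain ⟨v, hv0, hv⟩ := h.exists_neg
  have hvn : 0 < ‖v‖ := norm_pos_iff.2 (by rintro rfl; simp at hv0)
  set κ₃ := -inner ℝ (H v) v / ‖v‖ ^ 2 with hκ₃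
  have hκ₃0 : 0 < κ₃ := div_pos (neg_pos.2 hv) (by positivity)
  set κ := min κ₁ (min κ₂ κ₃) with hκ
  have hκ0 : 0 < κ := lt_min hκ₁ (lt_min hκ₂ hκ₃0)
  obtain ⟨ξ, r₁, γ₁, C, hb⟩ := P.exists_isBranch h.zero h.injective
  obtain ⟨r₂, hr₂, hcl⟩ := P.eventually_fderiv_close c (half_pos hκ0)
  obtain ⟨γ₂, hγ₂, hsub⟩ := mem_nhdsGE_iff_exists_Icc_subset.1 hcl
  set r := min r₁ r₂ with hr
  have hr0 : 0 < r := lt_min hb.r_pos hr₂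
  have hC1 : 0 < C + 1 := by linarith [hb.C_nonneg]
  set γ₃ := min (min γ₁ γ₂) (r / (2 * (C + 1))) with hγ₃
  have hγ₃0 : 0 < γ₃ := lt_min (lt_min hb.γ₁_pos hγ₂) (by positivity)
  have hlt : C * γ₃ < r := by
    have h3 : γ₃ ≤ r / (2 * (C + 1)) := min_le_right _ _
    rw [le_div_iff₀ (by positivity)] at h3
    nlinarith [hb.C_nonneg]
  refine ⟨ξ, r, γ₃, C, κ, v, h, hb.mono hr0 (min_le_left _ _) hγ₃0
    ((min_le_left _ _).trans (min_le_left _ _)) hlt, hκ0, ?_, ?_, ?_, hv0, ?_⟩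
  · intro γ hγ x hx
    exact hsub ⟨hγ.1, hγ.2.trans ((min_le_left _ _).trans (min_le_right _ _))⟩ x
      (closedBall_subset_closedBall (min_le_right _ _) hx)
  · intro w hw
    exact (mul_le_mul_of_nonneg_right (min_le_left _ _) (sq_nonneg _)).trans (h1 w hw)
  · intro w
    exact (mul_le_mul_of_nonneg_right ((min_le_right _ _).trans (min_le_left _ _))
      (norm_nonneg _)).trans (h2 w)
  · have h3 : κ * ‖v‖ ^ 2 ≤ κ₃ * ‖v‖ ^ 2 :=
      mul_le_mul_of_nonneg_right ((min_le_right _ _).trans (min_le_right _ _)) (sq_nonneg _)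
    have h4 : κ₃ * ‖v‖ ^ 2 = -inner ℝ (H v) v := by rw [hκ₃]; field_simp
    linarith

theorem energy_le_of_tendsto_atBot {V : E → ℝ} {G : E → E} (hV : ∀ x, HasGradientAt V (G x) x)
    {u : ℝ → E} (hu : ∀ t, HasDerivAt u (-G (u t)) t) {z : E} (hz : Tendsto u atBot (𝓝 z)) (t : ℝ) :
    V (u t) ≤ V z := by
  have hc : Continuous V :=
    continuous_iff_continuousAt.2 fun x ↦ (hV x).differentiableAt.continuousAt
  refine ge_of_tendsto ((hc.tendsto z).comp hz) ((eventually_le_atBot t).mono fun s hs ↦ ?_)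
  have := (fwdOrbit_of_hasDerivAt (hasDerivAt_shift hu s)).energy_le hV (t := t - s) (by linarith)
  simpa using this

theorem energy_le_of_tendsto_atTop {V : E → ℝ} {G : E → E} (hV : ∀ x, HasGradientAt V (G x) x)
    {u : ℝ → E} (hu : ∀ t, HasDerivAt u (-G (u t)) t) {x : E} (hx : Tendsto u atTop (𝓝 x)) (t : ℝ) :
    V x ≤ V (u t) := by
  have hc : Continuous V :=
    continuous_iff_continuousAt.2 fun x ↦ (hV x).differentiableAt.continuousAt
  refine le_of_tendsto ((hc.tendsto x).comp hx) ((eventually_ge_atTop t).mono fun s hs ↦ ?_)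
  have := (fwdOrbit_of_hasDerivAt (hasDerivAt_shift hu t)).energy_le hV (t := s - t) (by linarith)
  simpa using this

section SaddleNbhd

variable {c : E} {f : E →L[ℝ] ℝ} {ξ : ℝ → E} {r γ₁ C κ : ℝ} {v : E} {γ : ℝ}

theorem SaddleNbhd.approx (h : P.SaddleNbhd c f ξ r γ₁ C κ v) (hγ : γ ∈ Icc 0 γ₁) {x y : E}
    (hx : x ∈ closedBall c r) (hy : y ∈ closedBall c r) :
    ‖P.G γ x - P.G γ y - fderiv ℝ P.G₀ c (x - y)‖ ≤ κ / 2 * ‖x - y‖ :=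
  P.approx (h.close γ hγ) hx hy

theorem SaddleNbhd.norm_le (h : P.SaddleNbhd c f ξ r γ₁ C κ v) (hγ : γ ∈ Icc 0 γ₁) {x : E}
    (hx : x ∈ closedBall c r) : κ / 2 * ‖x - ξ γ‖ ≤ ‖P.G γ x‖ := by
  have h1 := h.approx hγ hx (ball_subset_closedBall (h.branch.mem_closedBall hγ))
  rw [h.branch.zero γ hγ, sub_zero] at h1
  have h2 := norm_sub_norm_le (fderiv ℝ P.G₀ c (x - ξ γ)) (P.G γ x)
  rw [norm_sub_rev] at h2
  linarith [h.low (x - ξ γ)]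

theorem SaddleNbhd.inner_sub (h : P.SaddleNbhd c f ξ r γ₁ C κ v) (hγ : γ ∈ Icc 0 γ₁) {x y : E}
    (hx : x ∈ closedBall c r) (hy : y ∈ closedBall c r) (w : E) :
    |inner ℝ (P.G γ x - P.G γ y) w - inner ℝ (fderiv ℝ P.G₀ c (x - y)) w| ≤
      κ / 2 * ‖x - y‖ * ‖w‖ := by
  rw [← inner_sub_left]
  exact (abs_real_inner_le_norm _ _).trans
    (mul_le_mul_of_nonneg_right (h.approx hγ hx hy) (norm_nonneg _))

theorem hasDerivAt_line (P : Family E) (γ : ℝ) (y w : E) (s : ℝ) :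
    HasDerivAt (fun s : ℝ ↦ P.V γ (y + s • w)) (inner ℝ (P.G γ (y + s • w)) w) s := by
  have h1 : HasDerivAt (fun s : ℝ ↦ y + s • w) w s := by
    simpa using ((hasDerivAt_id s).smul_const w).const_add y
  have := (P.hasGradientAt γ (y + s • w)).hasFDerivAt.comp_hasDerivAt s h1
  simpa [Function.comp_def] using this

theorem hasDerivAt_half_sq (a s : ℝ) : HasDerivAt (fun s : ℝ ↦ a / 2 * s ^ 2) (a * s) s := by
  have := ((hasDerivAt_id s).pow 2).const_mul (a / 2)
  refine this.congr_deriv ?_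
  simp; ring

/-- In the slices `f = const` the perturbed potential is uniformly convex. -/
theorem SaddleNbhd.slice_energy (h : P.SaddleNbhd c f ξ r γ₁ C κ v) (hγ : γ ∈ Icc 0 γ₁) {x y : E}
    (hx : x ∈ closedBall c r) (hy : y ∈ closedBall c r) (hfxy : f x = f y) (hGy : P.G γ y = 0) :
    P.V γ y + κ / 4 * ‖x - y‖ ^ 2 ≤ P.V γ x := by
  set w := x - y with hw
  have hfw : f w = 0 := by rw [hw, map_sub, hfxy, sub_self]
  -- Along the segment from `y` to `x` the slope of the potential is at least `(κ - κ / 2) * s *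
  -- ‖w‖²`. Integration gives the constant `κ / 4`.
  have key := le_of_hasDerivWithinAt_nonpos (T := 1)
    (f := fun s ↦ -P.V γ (y + s • w) + (κ / 2 * ‖w‖ ^ 2) / 2 * s ^ 2)
    (f' := fun s ↦ -inner ℝ (P.G γ (y + s • w)) w + (κ / 2 * ‖w‖ ^ 2) * s) zero_le_one
    (fun s _ ↦ ((hasDerivAt_line P γ y w s).neg.add (hasDerivAt_half_sq _ s)).hasDerivWithinAt)
    (fun s hs ↦ by
      have h1 := h.inner_sub hγ (segment_mem hx hy hs) hy w
      rw [hGy, sub_zero, add_sub_cancel_left, map_smul, inner_smul_left, norm_smul,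
        Real.norm_of_nonneg hs.1] at h1
      simp only [conj_trivial] at h1
      have h2 := h.slice w hfw
      have h3 := (abs_le.1 h1).1
      have h4 := mul_le_mul_of_nonneg_left h2 hs.1
      nlinarith)
  have h5 : y + (1 : ℝ) • w = x := by rw [one_smul, hw]; abel
  rw [h5, zero_smul, add_zero] at key
  linarith

/-- The energy decreases in the unstable direction. -/
theorem SaddleNbhd.descend (h : P.SaddleNbhd c f ξ r γ₁ C κ v) (hγ : γ ∈ Icc 0 γ₁) {y v' : E}
    (hy : y ∈ closedBall c r) (hGy : P.G γ y = 0) (hv' : v' = v ∨ v' = -v) {s : ℝ} (hs : 0 < s)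
    (hmem : y + s • v' ∈ closedBall c r) : P.V γ (y + s • v') < P.V γ y := by
  have hvn : 0 < ‖v'‖ := by
    have : 0 < ‖v‖ := norm_pos_iff.2 (by rintro rfl; simpa using h.v_pos)
    rcases hv' with rfl | rfl
    · exact this
    · rwa [norm_neg]
  have hvneg : inner ℝ (fderiv ℝ P.G₀ c v') v' ≤ -(κ * ‖v'‖ ^ 2) := by
    rcases hv' with rfl | rfl
    · exact h.v_neg
    · simpa using h.v_neg
  have key := le_of_hasDerivWithinAt_nonpos (T := s)
    (f := fun s ↦ P.V γ (y + s • v') + (κ / 2 * ‖v'‖ ^ 2) / 2 * s ^ 2)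
    (f' := fun s ↦ inner ℝ (P.G γ (y + s • v')) v' + (κ / 2 * ‖v'‖ ^ 2) * s) hs.le
    (fun t _ ↦ ((hasDerivAt_line P γ y v' t).add (hasDerivAt_half_sq _ t)).hasDerivWithinAt)
    (fun t ht ↦ by
      have hmem' : y + t • v' ∈ closedBall c r := by
        have := segment_mem hmem hy (s := t / s)
          ⟨div_nonneg ht.1 hs.le, (div_le_one hs).2 ht.2⟩
        rwa [add_sub_cancel_left, smul_smul, div_mul_cancel₀ _ hs.ne'] at this
      have h1 := h.inner_sub hγ hmem' hy v'
      rw [hGy, sub_zero, add_sub_cancel_left, map_smul, inner_smul_left, norm_smul,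
        Real.norm_of_nonneg ht.1] at h1
      simp only [conj_trivial] at h1
      have h3 := (abs_le.1 h1).2
      have h4 := mul_le_mul_of_nonneg_left hvneg ht.1
      nlinarith)
  rw [zero_smul, add_zero] at key
  have : 0 < (κ / 2 * ‖v'‖ ^ 2) / 2 * s ^ 2 := by have := h.κ_pos; positivity
  linarith

/-- Orbits started on a sphere around the saddle lose a definite amount of energy before they can
change sides. -/
theorem SaddleNbhd.eventually_drop (h : P.SaddleNbhd c f ξ r γ₁ C κ v) {δ : ℝ} (hδ0 : 0 < δ)
    (hδr : 2 * δ ≤ r) (C' : ℝ) : ∀ᶠ γ in 𝓝[≥] (0 : ℝ), ∀ q ∈ sphere c δ,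
      P.V γ q ≤ P.V₀ c + C' * γ → f q ≠ f c ∧ ∀ u, FwdOrbit (P.G γ) u → u 0 = q →
        ∃ T ≥ 0, P.V γ (u T) ≤ P.V₀ c - κ * δ ^ 2 / 32 ∧ u T ∈ closedBall c (2 * δ) ∧
          0 < (f (u T) - f c) * (f q - f c) := by
  have hκ := h.κ_pos
  have hsmall : ∀ᶠ γ in 𝓝[≥] (0 : ℝ), C * γ < δ / 4 ∧ C' * γ < κ * δ ^ 2 / 32 := by
    have h1 : ∀ a : ℝ, Tendsto (fun γ : ℝ ↦ a * γ) (𝓝[≥] 0) (𝓝 0) := by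
      intro a
      have h1 : Tendsto (fun γ : ℝ ↦ a * γ) (𝓝 0) (𝓝 (a * 0)) :=
        (continuous_const.mul continuous_id).tendsto 0
      rw [mul_zero] at h1
      exact h1.mono_left nhdsWithin_le_nhds
    exact ((h1 C).eventually_lt_const (by positivity)).and
      ((h1 C').eventually_lt_const (by positivity))
  filter_upwards [hsmall, Icc_mem_nhdsGE h.branch.γ₁_pos] with γ hγs hγ q hq hVq
  -- energy on the slice through `c`
  have hslice : ∀ x ∈ closedBall c (2 * δ), δ / 2 ≤ dist x c → f x = f c →
      P.V₀ c + κ * δ ^ 2 / 16 ≤ P.V γ x := by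
    intro x hx hxδ hfx
    have h1 := h.slice_energy (γ := 0) ⟨le_rfl, h.branch.γ₁_pos.le⟩
      (closedBall_subset_closedBall hδr hx)
      (mem_closedBall_self h.branch.r_pos.le) hfx (by simp [G, h.saddle.zero])
    simp only [V, zero_mul, add_zero] at h1
    rw [← dist_eq_norm] at h1
    have h2 := P.V₀_le_V hγ.1 x
    have h3 : (δ / 2) ^ 2 ≤ dist x c ^ 2 := pow_le_pow_left₀ (by positivity) hxδ 2
    nlinarith
  have hqB : q ∈ closedBall c (2 * δ) := by
    rw [mem_closedBall, mem_sphere.1 hq]; linarith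
  have hpos : 0 < κ * δ ^ 2 := by positivity
  have hfq : f q ≠ f c := by
    intro hfq
    have := hslice q hqB (by rw [mem_sphere.1 hq]; linarith) hfq
    linarith [hγs.2]
  refine ⟨hfq, fun u hu hu0 ↦ ?_⟩
  -- Within `δ / 2` of `q` the distance to `c` is at least `δ / 2`, hence at least `δ / 4` to the
  -- perturbed saddle, so the gradient is at least `κ * δ / 8`. The resulting drop `κ * δ ^ 2 / 16`
  -- is twice what is claimed; the other half absorbs `C' * γ`.
  have hannulus : ∀ x ∈ closedBall (u 0) (δ / 2), x ∈ closedBall c (2 * δ) ∧ δ / 2 ≤ dist x c := by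
    intro x hx
    rw [hu0, mem_closedBall] at hx
    rw [mem_closedBall]
    have h1 := dist_triangle x q c
    have h2 := dist_triangle q x c
    rw [dist_comm q x] at h2
    rw [mem_sphere.1 hq] at h1 h2
    constructor <;> linarith
  obtain ⟨T, hT, hball, hdrop⟩ := hu.exists_drop (P.hasGradientAt γ) (half_pos hδ0)
    (show 0 < κ * δ / 8 by positivity) (fun x hx ↦ by
      obtain ⟨h1, h2⟩ := hannulus x hx
      have h3 := h.norm_le hγ (closedBall_subset_closedBall hδr h1)
      have h4 := h.branch.dist_le γ hγ
      have h5 := norm_sub_le_norm_sub_add_norm_sub x (ξ γ) c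
      rw [dist_eq_norm] at h2
      have h6 : δ / 4 ≤ ‖x - ξ γ‖ := by linarith [hγs.1]
      nlinarith)
  refine ⟨T, hT, ?_, (hannulus _ (hball T ⟨hT, le_rfl⟩)).1, ?_⟩
  · rw [hu0] at hdrop
    have h1 : κ * δ / 8 * (δ / 2) = κ * δ ^ 2 / 16 := by ring
    linarith [hγs.2]
  -- In the annulus the slice through `c` lies higher than the starting energy, so the orbit cannot
  -- cross it.
  · have hne : ∀ s ∈ Icc 0 T, f (u s) ≠ f c := by
      intro s hs hfs
      obtain ⟨h1, h2⟩ := hannulus _ (hball s hs)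
      have h3 := hslice _ h1 h2 hfs
      have h4 := hu.energy_le (P.hasGradientAt γ) hs.1
      rw [hu0] at h4
      linarith [hγs.2]
    by_contra hcon
    push Not at hcon
    have hc : ContinuousOn (fun s ↦ f (u s)) (Icc 0 T) :=
      f.continuous.comp_continuousOn (hu.continuousOn.mono Icc_subset_Ici_self)
    rw [← hu0] at hcon hfq
    rcases lt_or_gt_of_ne hfq with h1 | h1
    · have h2 : f c ≤ f (u T) := by nlinarith
      obtain ⟨s, hs, hs'⟩ := intermediate_value_Icc hT hc (show f c ∈ Icc _ _ from ⟨h1.le, h2⟩)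
      exact hne s hs hs'
    · have h2 : f (u T) ≤ f c := by nlinarith
      obtain ⟨s, hs, hs'⟩ := intermediate_value_Icc' hT hc (show f c ∈ Icc _ _ from ⟨h2, h1.le⟩)
      exact hne s hs hs'

variable [FiniteDimensional ℝ E]

/-- Both branches of the unstable manifold exist. -/
theorem SaddleNbhd.exists_orbit (h : P.SaddleNbhd c f ξ r γ₁ C κ v) (hγ : γ ∈ Icc 0 γ₁) {δ : ℝ}
    (hδr : δ ≤ r) (hδ : ξ γ ∈ ball c δ) {σ : ℝ} (hσ : σ = 1 ∨ σ = -1) :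
    ∃ u : ℝ → E, (∀ t, HasDerivAt u (-P.G γ (u t)) t) ∧ Tendsto u atBot (𝓝 (ξ γ)) ∧
      u 0 ∈ sphere c δ ∧ 0 < σ * (f (u 0) - f (ξ γ)) ∧ P.V γ (u 0) ≤ P.V γ (ξ γ) := by
  have hsub := closedBall_subset_closedBall (x := c) hδr
  have hξ := ball_subset_closedBall hδ
  have hz := h.branch.zero γ hγ
  have hσ0 : σ ≠ 0 := by rcases hσ with rfl | rfl <;> norm_num
  obtain ⟨u, hu, hlim, hsph, hf, hV⟩ := exists_unstable_orbit (P.hasGradientAt γ) (P.contDiff_G γ)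
    (P.bdd_V hγ.1) (z := ξ γ) (c := c) (δ := δ) (fun x ↦ σ * f x)
    (continuous_const.mul f.continuous) hz hδ
    (fun x hx hx0 ↦ h.branch.unique γ hγ x (hsub hx) hx0)
    (fun x hx hfx hne ↦ by
      have h1 := h.slice_energy hγ (hsub hx) (hsub hξ) (mul_left_cancel₀ hσ0 hfx) hz
      have h2 : 0 < ‖x - ξ γ‖ := norm_pos_iff.2 (sub_ne_zero.2 hne)
      have := h.κ_pos
      have h3 : 0 < κ / 4 * ‖x - ξ γ‖ ^ 2 := by positivity
      linarith)
    (fun ε hε ↦ by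
      have hvσ : σ • v = v ∨ σ • v = -v := by rcases hσ with rfl | rfl <;> simp
      have hcont : Continuous fun s : ℝ ↦ ξ γ + s • (σ • v) :=
        continuous_const.add (continuous_id.smul continuous_const)
      have h0 : ∀ {U : Set E}, IsOpen U → ξ γ ∈ U → ∀ᶠ s in 𝓝 (0 : ℝ), ξ γ + s • (σ • v) ∈ U := by
        intro U hU hm
        exact (hcont.tendsto 0).eventually_mem (hU.mem_nhds (by simpa using hm))
      have hev := (h0 isOpen_ball (mem_ball_self hε)).and (h0 isOpen_ball hδ)
      obtain ⟨s, hs, hs0⟩ := ((hev.filter_mono nhdsWithin_le_nhds).and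
        (eventually_mem_nhdsWithin (a := (0 : ℝ)) (s := Ioi 0))).exists
      refine ⟨_, hs.1, ?_, h.descend hγ (hsub hξ) hz hvσ hs0 (hsub (ball_subset_closedBall hs.2))⟩
      rw [map_add, map_smul, map_smul, smul_eq_mul, smul_eq_mul, mul_add]
      have hσσ : σ * (s * (σ * f v)) = s * f v := by rcases hσ with rfl | rfl <;> ring
      rw [hσσ]
      have := mul_pos hs0 h.v_pos
      linarith)
  exact ⟨u, hu, hlim, hsph, by rw [mul_sub]; linarith, hV⟩

/-- Two orbits from the saddle with different limits leave its neighbourhood on different sides. -/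
theorem SaddleNbhd.opposite_sides (h : P.SaddleNbhd c f ξ r γ₁ C κ v) (hγ : γ ∈ Icc 0 γ₁) {δ : ℝ}
    (hδr : δ ≤ r) (hδ : ξ γ ∈ ball c δ) {u₁ u₂ : ℝ → E} {x₁ x₂ : E} (hne : x₁ ≠ x₂)
    (hu₁ : ∀ t, HasDerivAt u₁ (-P.G γ (u₁ t)) t) (hu₂ : ∀ t, HasDerivAt u₂ (-P.G γ (u₂ t)) t)
    (hz₁ : Tendsto u₁ atBot (𝓝 (ξ γ))) (hz₂ : Tendsto u₂ atBot (𝓝 (ξ γ)))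
    (hx₁ : Tendsto u₁ atTop (𝓝 x₁)) (hx₂ : Tendsto u₂ atTop (𝓝 x₂)) (hx₁' : x₁ ∉ closedBall c δ)
    (hx₂' : x₂ ∉ closedBall c δ) :
    ∃ s₁ s₂, u₁ s₁ ∈ sphere c δ ∧ u₂ s₂ ∈ sphere c δ ∧
      (f (u₁ s₁) - f (ξ γ)) * (f (u₂ s₂) - f (ξ γ)) < 0 := by
  have hsub := closedBall_subset_closedBall (x := c) hδr
  have hξ := ball_subset_closedBall hδ
  have hz := h.branch.zero γ hγ
  -- each orbit has a first exit point, which is not in the slice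
  have hexit : ∀ {u : ℝ → E} {x : E}, (∀ t, HasDerivAt u (-P.G γ (u t)) t) →
      Tendsto u atBot (𝓝 (ξ γ)) → Tendsto u atTop (𝓝 x) → x ∉ closedBall c δ →
      ∃ s, u s ∈ sphere c δ ∧ (∀ t ≤ s, u t ∈ closedBall c δ) ∧ f (u s) ≠ f (ξ γ) := by
    intro u x hu hbot htop hx
    have hcont : Continuous u := continuous_iff_continuousAt.2 fun t ↦ (hu t).continuousAt
    obtain ⟨a, ha⟩ := (htop.eventually (isClosed_closedBall.isOpen_compl.mem_nhds hx)).exists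
    obtain ⟨s, -, hs, hlt⟩ := exists_first_exit (φ := fun t ↦ dist (u t) c)
      (hcont.dist continuous_const) (δ := δ) (a := a)
      ((hbot.eventually (isOpen_ball.mem_nhds hδ)).mono fun t ht ↦ ht)
      (by simpa using (not_le.1 ha).le)
    refine ⟨s, hs, fun t ht ↦ ?_, fun hfs ↦ ?_⟩
    · rcases ht.lt_or_eq with h1 | h1
      · exact (hlt t h1).le
      · rw [h1]; exact hs.le
    · have hsB : u s ∈ closedBall c δ := le_of_eq hs
      have h1 := h.slice_energy hγ (hsub hsB) (hsub hξ) hfs hz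
      have h2 := energy_le_of_tendsto_atBot (P.hasGradientAt γ) hu hbot s
      have h3 : u s ≠ ξ γ := by
        intro heq
        rw [heq] at hs
        exact absurd hs (ne_of_lt hδ)
      have h4 : 0 < ‖u s - ξ γ‖ := norm_pos_iff.2 (sub_ne_zero.2 h3)
      have := h.κ_pos
      have h5 : 0 < κ / 4 * ‖u s - ξ γ‖ ^ 2 := by positivity
      linarith
  obtain ⟨s₁, hs₁, hB₁, hf₁⟩ := hexit hu₁ hz₁ hx₁ hx₁'
  obtain ⟨s₂, hs₂, hB₂, hf₂⟩ := hexit hu₂ hz₂ hx₂ hx₂'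
  refine ⟨s₁, s₂, hs₁, hs₂, ?_⟩
  by_contra hcon
  push Not at hcon
  have hκ := h.κ_pos
  -- If both exits were on one side, the orbits would belong to the same half of the unstable
  -- manifold and have the same limit. Taking `g = -f` covers the other side.
  have hsame : ∀ g : E →L[ℝ] ℝ, (g = f ∨ g = -f) → g (ξ γ) < g (u₁ s₁) → g (ξ γ) < g (u₂ s₂) →
      x₁ = x₂ := by
    intro g hg hg₁ hg₂
    refine limit_unique_of_same_side (P.hasGradientAt γ) (P.contDiff_G γ) h.saddle.symm
      (B := closedBall c δ) (κ := κ ^ 2 / 2) (by positivity) (fun x hx y hy ↦ ?_) g.continuous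
      (fun x _ y _ hgxy ↦ ?_) (hasDerivAt_shift hu₁ s₁) (hasDerivAt_shift hu₂ s₂)
      (fun t ht ↦ hB₁ _ (by linarith)) (fun t ht ↦ hB₂ _ (by linarith))
      (hz₁.comp (tendsto_atBot_add_const_right _ s₁ tendsto_id))
      (hz₂.comp (tendsto_atBot_add_const_right _ s₂ tendsto_id))
      (hx₁.comp (tendsto_atTop_add_const_right _ s₁ tendsto_id))
      (hx₂.comp (tendsto_atTop_add_const_right _ s₂ tendsto_id))
      (by simpa using hg₁) (by simpa using hg₂)
    -- With `w` the image of `x - y` under the linearization, the pairing is at least `‖w‖² - κ / 2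
    -- * ‖x - y‖ * ‖w‖`. This is at least `κ² / 2 * ‖x - y‖²`, since `‖w‖ ≥ κ * ‖x - y‖`.
    · set w := fderiv ℝ P.G₀ c (x - y) with hw
      have h1 := h.inner_sub hγ (hsub hx) (hsub hy) w
      rw [real_inner_comm, ← hw, real_inner_self_eq_norm_sq] at h1
      have h2 := (abs_le.1 h1).1
      have h3 := h.low (x - y)
      rw [← hw] at h3
      have h4 := norm_nonneg (x - y)
      have h5 : 0 ≤ (‖w‖ - κ * ‖x - y‖) * (‖w‖ + κ / 2 * ‖x - y‖) :=
        mul_nonneg (by linarith) (by positivity)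
      nlinarith
    · have hfxy : f x = f y := by
        rcases hg with rfl | rfl
        · exact hgxy
        · simpa using hgxy
      have := h.slice (x - y) (by rw [map_sub, hfxy, sub_self])
      exact le_trans (by positivity) this
  rcases lt_or_gt_of_ne hf₁ with h1 | h1
  · have h2 : f (u₂ s₂) < f (ξ γ) := by
      rcases lt_or_gt_of_ne hf₂ with h2 | h2
      · exact h2
      · exfalso; nlinarith [mul_pos (sub_pos.2 h1) (sub_pos.2 h2)]
    exact hne (hsame (-f) (Or.inr rfl) (by simpa using h1) (by simpa using h2))
  · have h2 : f (ξ γ) < f (u₂ s₂) := by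
      rcases lt_or_gt_of_ne hf₂ with h2 | h2
      · exfalso; nlinarith [mul_pos (sub_pos.2 h1) (sub_pos.2 h2)]
      · exact h2
    exact hne (hsame f (Or.inl rfl) h1 h2)

/-- The exit points are on the corresponding side of the slice through the unperturbed saddle. -/
theorem SaddleNbhd.eventually_side (h : P.SaddleNbhd c f ξ r γ₁ C κ v) {δ : ℝ} (hδ0 : 0 < δ)
    (hδr : δ ≤ r) : ∀ᶠ γ in 𝓝[≥] (0 : ℝ), ∀ q ∈ sphere c δ, P.V γ q ≤ P.V γ (ξ γ) →
      f q ≠ f (ξ γ) → 0 < (f q - f c) * (f q - f (ξ γ)) := by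
  -- Pointwise in `q`: if `q` lies in the slice through `c`, its energy strictly exceeds that of the
  -- saddle and the hypothesis fails nearby. Otherwise both differences are close to the nonzero
  -- number `f q - f c`.
  refine (isCompact_sphere c δ).eventually_forall fun q hq ↦ ?_
  have hξ : Tendsto (fun z : ℝ × E ↦ ξ z.1) (𝓝[≥] 0 ×ˢ 𝓝 q) (𝓝 c) :=
    h.branch.tendsto.comp tendsto_fst
  have hfst : Tendsto (fun z : ℝ × E ↦ z.1) (𝓝[≥] 0 ×ˢ 𝓝 q) (𝓝 0) :=
    (tendsto_id.mono_left nhdsWithin_le_nhds).comp tendsto_fst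
  have hsnd : Tendsto (fun z : ℝ × E ↦ z.2) (𝓝[≥] (0 : ℝ) ×ˢ 𝓝 q) (𝓝 q) := tendsto_snd
  by_cases hfq : f q = f c
  · have hV : P.V₀ c < P.V₀ q := by
      have h1 := h.slice_energy (γ := 0) ⟨le_rfl, h.branch.γ₁_pos.le⟩
        (closedBall_subset_closedBall hδr (sphere_subset_closedBall hq))
        (mem_closedBall_self h.branch.r_pos.le) hfq (by simp [G, h.saddle.zero])
      simp only [V, zero_mul, add_zero] at h1
      rw [← dist_eq_norm, mem_sphere.1 hq] at h1
      have := h.κ_pos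
      have h2 : 0 < κ / 4 * δ ^ 2 := by positivity
      linarith
    have h1 : Tendsto (fun z : ℝ × E ↦ P.V z.1 z.2) (𝓝[≥] 0 ×ˢ 𝓝 q) (𝓝 (P.V 0 q)) :=
      (P.continuous_V_uncurry.tendsto (0, q)).comp (hfst.prodMk_nhds hsnd)
    have h2 : Tendsto (fun z : ℝ × E ↦ P.V z.1 (ξ z.1)) (𝓝[≥] 0 ×ˢ 𝓝 q) (𝓝 (P.V 0 c)) :=
      (P.continuous_V_uncurry.tendsto (0, c)).comp (hfst.prodMk_nhds hξ)
    have h3 : P.V 0 c < P.V 0 q := by simpa [V] using hV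
    filter_upwards [h2.eventually_lt h1 h3] with z hz hle
    exact absurd hle (not_le.2 hz)
  · have h1 : Tendsto (fun z : ℝ × E ↦ (f z.2 - f c) * (f z.2 - f (ξ z.1)))
        (𝓝[≥] 0 ×ˢ 𝓝 q) (𝓝 ((f q - f c) * (f q - f c))) :=
      (((f.continuous.tendsto q).comp hsnd).sub_const _).mul
        (((f.continuous.tendsto q).comp hsnd).sub ((f.continuous.tendsto c).comp hξ))
    have h2 : 0 < (f q - f c) * (f q - f c) := mul_self_pos.2 (sub_ne_zero.2 hfq)
    filter_upwards [h1.eventually_const_lt h2] with z hz _ _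
    exact hz

end SaddleNbhd

end Family

end GradFlow

/-! ### Trapping regions, limits of low orbits, and communication heights -/

namespace GradFlow

open Metric NNReal Landscape

variable {E : Type*} [NormedAddCommGroup E] [InnerProductSpace ℝ E] [CompleteSpace E]

namespace Family

variable {P : Family E} {R Rc : Set E} {v₀ : ℝ}

/-- An orbit whose energy is below the boundary level of a region cannot leave this region. -/
theorem stays_of_energy_lt (hR : IsOpen R) (hRc : IsClosed Rc) (hsub : R ⊆ Rc)
    (hfront : ∀ x ∈ Rc, x ∉ R → v₀ ≤ P.V₀ x) {γ : ℝ} (hγ : 0 ≤ γ) {u : ℝ → E}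
    (hu : FwdOrbit (P.G γ) u) (h0 : u 0 ∈ R) (hlt : P.V γ (u 0) < v₀) : ∀ t ≥ 0, u t ∈ R := by
  refine hu.mem_of_no_exit hR hRc hsub h0 fun t ht htRc ↦ ?_
  by_contra hcon
  have h1 := hu.energy_le (P.hasGradientAt γ) ht
  have h2 := P.V₀_le_V hγ (u t)
  linarith [hfront _ htRc hcon]

variable [FiniteDimensional ℝ E]

/-- Orbits at low energy in a region that contains one low-lying stationary point converge to the
perturbation of this point. -/
theorem eventually_tendsto (hR : IsOpen R) (hRc : IsClosed Rc) (hsub : R ⊆ Rc)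
    (hfront : ∀ x ∈ Rc, x ∉ R → v₀ ≤ P.V₀ x) {m : E} {ξ : ℝ → E} {r γ₁ C : ℝ}
    (hm : P.IsBranch m ξ r γ₁ C) (hclass : ∀ x ∈ Rc, P.G₀ x = 0 → P.V₀ x < v₀ → x = m) {e : ℝ}
    (he : 0 < e) : ∀ᶠ γ in 𝓝[≥] (0 : ℝ), ∀ u, FwdOrbit (P.G γ) u → ∀ T ≥ 0, u T ∈ R →
      P.V γ (u T) ≤ v₀ - e → Tendsto u atTop (𝓝 (ξ γ)) := by
  set K : Set E := Rc ∩ {x | P.V₀ x ≤ v₀ - e} with hK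
  have hKc : IsCompact K :=
    Metric.isCompact_of_isClosed_isBounded
      (hRc.inter (isClosed_le P.continuous_V₀ continuous_const))
      ((P.bdd (v₀ - e)).subset inter_subset_right)
  -- Near a nonstationary point of the compact set `K` the perturbed gradients do not vanish. The
  -- only stationary point in `K` is `m`, near which the branch is unique.
  have huniq : ∀ᶠ γ in 𝓝[≥] (0 : ℝ), ∀ x ∈ K, P.G γ x = 0 → x = ξ γ := by
    refine hKc.eventually_forall fun y hy ↦ ?_
    have hfst : Tendsto (fun z : ℝ × E ↦ z.1) (𝓝[≥] 0 ×ˢ 𝓝 y) (𝓝 0) :=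
      (tendsto_id.mono_left nhdsWithin_le_nhds).comp tendsto_fst
    have hsnd : Tendsto (fun z : ℝ × E ↦ z.2) (𝓝[≥] (0 : ℝ) ×ˢ 𝓝 y) (𝓝 y) := tendsto_snd
    by_cases hG : P.G₀ y = 0
    · have hym : y = m := hclass y hy.1 hG (by linarith [hy.2.out])
      have h1 : ∀ᶠ z : ℝ × E in 𝓝[≥] 0 ×ˢ 𝓝 y, z.1 ∈ Icc 0 γ₁ :=
        tendsto_fst.eventually (Icc_mem_nhdsGE hm.γ₁_pos)
      have h2 : ∀ᶠ z : ℝ × E in 𝓝[≥] (0 : ℝ) ×ˢ 𝓝 y, z.2 ∈ closedBall m r :=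
        hsnd.eventually (hym ▸ closedBall_mem_nhds _ hm.r_pos)
      filter_upwards [h1, h2] with z hz1 hz2 hz using hm.unique z.1 hz1 z.2 hz2 hz
    · have h1 : Tendsto (fun z : ℝ × E ↦ P.G z.1 z.2) (𝓝[≥] 0 ×ˢ 𝓝 y) (𝓝 (P.G 0 y)) :=
        (P.continuous_G_uncurry.tendsto (0, y)).comp (hfst.prodMk_nhds hsnd)
      have h2 : P.G 0 y ≠ 0 := by simpa [G] using hG
      filter_upwards [h1.eventually_ne h2] with z hz hz0
      exact absurd hz0 hz
  filter_upwards [huniq, self_mem_nhdsWithin] with γ hγu hγ0 u hu T hT huT hV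
  have hγ : 0 ≤ γ := hγ0
  have hs := hu.shift hT
  have hstay := stays_of_energy_lt hR hRc hsub hfront hγ hs (by simpa using huT)
    (by simp only [add_zero]; linarith)
  have hlim := hs.tendsto (P.hasGradientAt γ) (P.contDiff_G γ).continuous hKc (fun t ht ↦
    ⟨hsub (hstay t ht), by
      have h1 := hs.energy_le (P.hasGradientAt γ) ht
      simp only [add_zero] at h1
      exact ((P.V₀_le_V hγ _).trans h1).trans hV⟩) hγu
  have := hlim.comp (tendsto_atTop_add_const_right atTop (-T) tendsto_id)
  refine this.congr fun t ↦ ?_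
  simp

end Family

section Heights

variable {V : E → ℝ} {D : Set E} {x y : E}

/-- The closure of a half-orbit is a path. -/
theorem joinedIn_of_tendsto {E : Type*} [TopologicalSpace E] {F : Set E} {u : ℝ → E} {x : E}
    (hu : Continuous u)
    (hx : Tendsto u atTop (𝓝 x)) (hF : ∀ t ≥ 0, u t ∈ F) (hxF : x ∈ F) : JoinedIn F (u 0) x := by
  -- The half-line is compactified by `s = 1 / (1 + t)`, with the limit at `s = 0`; the maximum with
  -- `0` keeps the time nonnegative.
  let g : ℝ → E := fun s ↦ if 0 < s then u (max (s⁻¹ - 1) 0) else x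
  have hg : ContinuousOn g (Icc 0 1) := by
    intro s hs
    rcases hs.1.lt_or_eq with h | h
    · have h1 : ContinuousAt (fun s : ℝ ↦ u (max (s⁻¹ - 1) 0)) s :=
        hu.continuousAt.comp ((((continuousAt_inv₀ h.ne').sub continuousAt_const).max
          continuousAt_const))
      refine (h1.congr ?_).continuousWithinAt
      filter_upwards [lt_mem_nhds h] with t ht
      simp [g, ht]
    · subst h
      have hg0 : g 0 = x := by simp [g]
      rw [ContinuousWithinAt, hg0]
      have h1 : Tendsto (fun s : ℝ ↦ u (max (s⁻¹ - 1) 0)) (𝓝[>] 0) (𝓝 x) := by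
        refine hx.comp (tendsto_atTop_mono (fun s ↦ le_max_left _ _) ?_)
        exact tendsto_atTop_add_const_right _ (-1) tendsto_inv_nhdsGT_zero
      have h2 : Tendsto g (𝓝[>] 0) (𝓝 x) := by
        refine h1.congr' ?_
        filter_upwards [self_mem_nhdsWithin] with s hs
        have : (0 : ℝ) < s := hs
        simp [g, this]
      have h3 : Tendsto g (𝓝[≥] 0) (𝓝 x) := by
        rw [← Ioi_insert, nhdsWithin_insert, tendsto_sup]
        refine ⟨?_, h2⟩
        rw [tendsto_pure_left]
        intro s hs
        rw [hg0]
        exact mem_of_mem_nhds hs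
      exact h3.mono_left (nhdsWithin_mono _ Icc_subset_Ici_self)
  have : JoinedIn F (g 1) (g 0) := by
    refine JoinedIn.symm (JoinedIn.ofLine hg rfl rfl ?_)
    rintro _ ⟨s, hs, rfl⟩
    by_cases h : 0 < s
    · simp only [g, h, if_true]
      exact hF _ (le_max_right _ _)
    · simpa [g, h] using hxF
  simpa [g] using this

theorem joinedIn_of_hasOrbit {F : Set E} {z : E}
    (h : ∀ u : ℝ → E, (∀ t, HasDerivAt u (-gradient V (u t)) t) → Tendsto u atBot (𝓝 z) →
      Tendsto u atTop (𝓝 x) → ∀ t, u t ∈ F) (hz : z ∈ F) (hx : x ∈ F) (horb : HasOrbit V z x) :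
    JoinedIn F z x := by
  obtain ⟨u, hu, hbot, htop⟩ := horb
  have hF := h u hu hbot htop
  have hc : Continuous u := continuous_iff_continuousAt.2 fun t ↦ (hu t).continuousAt
  refine JoinedIn.trans (y := u 0) ?_ (joinedIn_of_tendsto hc htop (fun t _ ↦ hF t) hx)
  have := joinedIn_of_tendsto (u := fun t ↦ u (-t)) (hc.comp continuous_neg)
    (hbot.comp tendsto_neg_atTop_atBot) (fun t _ ↦ hF _) hz
  simpa using this.symm

theorem le_ciSup_path {E : Type*} [TopologicalSpace E] {V : E → ℝ} {x : E} (hV : Continuous V)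
    {y : E} (p : Path x y) (t : unitInterval) :
    V (p t) ≤ ⨆ s, V (p s) :=
  le_ciSup (isCompact_range (hV.comp p.continuous)).bddAbove t

theorem commHeightIn_le {E : Type*} [NormedAddCommGroup E] {V : E → ℝ} {D : Set E} {x : E}
    (hV : Continuous V) {y : E} {h : ℝ}
    (hj : JoinedIn (D ∩ {v | V v ≤ h}) x y) : commHeightIn V D x {y} ≤ h - V x := by
  refine sub_le_sub_right ?_ _
  obtain ⟨p, hp⟩ := hj
  have h1 : (⨆ t, V (p t)) ≤ h := ciSup_le fun t ↦ (hp t).2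
  have hmem : (⨆ t, V (p t)) ∈
      {h | ∃ y' ∈ ({y} : Set E), ∃ q : Path x y', (∀ t, q t ∈ D) ∧ h = ⨆ t, V (q t)} :=
    ⟨y, rfl, p, fun t ↦ (hp t).1, rfl⟩
  refine (csInf_le ?_ hmem).trans h1
  refine ⟨V x, ?_⟩
  rintro _ ⟨y', -, q, -, rfl⟩
  have := le_ciSup_path hV q 0
  rwa [q.source] at this

/-- Joinability is required because the infimum of the empty set of heights is `0` by convention,
for which no lower bound would hold. -/
theorem le_commHeightIn {E : Type*} [NormedAddCommGroup E] {V : E → ℝ} {D : Set E} {x y : E}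
    {h : ℝ} (hj : JoinedIn D x y)
    (hlow : ∀ p : Path x y, (∀ t, p t ∈ D) → h ≤ ⨆ t, V (p t)) :
    h - V x ≤ commHeightIn V D x {y} := by
  refine sub_le_sub_right (le_csInf ?_ ?_) _
  · obtain ⟨p, hp⟩ := hj
    exact ⟨_, y, rfl, p, hp, rfl⟩
  · rintro _ ⟨_, rfl, p, hp, rfl⟩
    exact hlow p hp

end Heights

end GradFlow

/-! ## Morse index and definiteness -/

namespace Landscape

variable {E : Type*} [NormedAddCommGroup E] [InnerProductSpace ℝ E]
  {V : E → ℝ} {x : E}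

theorem nondegenerate_of_symm {B : LinearMap.BilinForm ℝ E} (hB : ∀ v w, B v w = B w v)
    (h : ∀ v, (∀ w, B v w = 0) → v = 0) : B.Nondegenerate :=
  ⟨h, fun w hw ↦ h w fun v ↦ by rw [hB]; exact hw v⟩

variable [FiniteDimensional ℝ E]

theorem le_morseIndex (U : Submodule ℝ E) (hU : ∀ w ∈ U, w ≠ 0 → hessian V x w w < 0) :
    Module.finrank ℝ U ≤ morseIndex V x := by
  refine le_sigNeg_of_negDef _ fun w hw ↦ ?_
  have := hU w w.2 (by simpa using hw)
  simpa using this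

/-- A subspace on which the Hessian is negative definite meets one on which it is nonnegative only
in `0`, so their dimensions add up to at most that of the space. -/
theorem morseIndex_le_of_disjoint {U : Submodule ℝ E} (hU : ∀ w ∈ U, 0 ≤ hessian V x w w) :
    morseIndex V x + Module.finrank ℝ U ≤ Module.finrank ℝ E := by
  obtain ⟨Z, hZ, hneg⟩ := exists_finrank_eq_sigNeg_and_negDef
    (Q := LinearMap.BilinMap.toQuadraticMap (hessian V x))
  have hdisj : Z ⊓ U = ⊥ := by
    rw [eq_bot_iff]
    intro w hw
    by_contra hw0
    have h1 := hneg ⟨w, hw.1⟩ (by simpa [Subtype.ext_iff] using hw0)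
    have h2 : hessian V x w w < 0 := by simpa using h1
    exact absurd (hU w hw.2) (not_le.2 h2)
  have := Submodule.finrank_sup_add_finrank_inf_eq Z U
  rw [hdisj, finrank_bot, add_zero, hZ] at this
  rw [morseIndex, ← this]
  exact Submodule.finrank_le _

theorem morseIndex_eq_zero (h : ∀ w, 0 ≤ hessian V x w w) : morseIndex V x = 0 := by
  have := morseIndex_le_of_disjoint (V := V) (x := x) (U := ⊤) (fun w _ ↦ h w)
  rw [finrank_top] at this
  omega

theorem morseIndex_eq_one (f : E →ₗ[ℝ] ℝ) (hpos : ∀ w, f w = 0 → 0 ≤ hessian V x w w) {v : E}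
    (hv : hessian V x v v < 0) : morseIndex V x = 1 := by
  have h1 : Module.finrank ℝ (Submodule.span ℝ {v}) ≤ morseIndex V x := by
    refine le_morseIndex _ fun w hw hw0 ↦ ?_
    obtain ⟨a, rfl⟩ := Submodule.mem_span_singleton.1 hw
    have ha : a ≠ 0 := by rintro rfl; simp at hw0
    simp only [map_smul, LinearMap.smul_apply, smul_eq_mul]
    have := mul_pos_of_neg_of_neg (neg_neg_of_pos (mul_self_pos.2 ha)) hv
    nlinarith
  have hv0 : v ≠ 0 := by rintro rfl; simp at hv
  rw [finrank_span_singleton hv0] at h1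
  have h2 := morseIndex_le_of_disjoint (V := V) (x := x) (U := f.ker) hpos
  have h3 := f.finrank_range_add_finrank_ker
  have h4 : Module.finrank ℝ f.range ≤ 1 := by
    simpa using Submodule.finrank_le f.range
  omega

end Landscape

/-! ## The coupled system as a perturbed landscape -/

namespace MassConserving

open Landscape GradFlow

variable {N : ℕ}

/-- The coordinate at a site as a continuous linear functional. -/
def coordL (N : ℕ) (i : Fin N) : S N →L[ℝ] ℝ :=
  (EuclideanSpace.proj i).comp (incl N).toContinuousLinearMap

theorem coordL_apply (i : Fin N) (x : S N) : coordL N i x = coord x i := rfl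

@[simp] theorem coord_add (x y : S N) (i : Fin N) : coord (x + y) i = coord x i + coord y i :=
  (coordL N i).map_add x y

@[simp] theorem coord_sub (x y : S N) (i : Fin N) : coord (x - y) i = coord x i - coord y i :=
  (coordL N i).map_sub x y

@[simp] theorem coord_neg (x : S N) (i : Fin N) : coord (-x) i = -coord x i :=
  (coordL N i).map_neg x

@[simp] theorem coord_smul (a : ℝ) (x : S N) (i : Fin N) : coord (a • x) i = a * coord x i :=
  (coordL N i).map_smul a x

@[simp] theorem coord_zero (i : Fin N) : coord (0 : S N) i = 0 := (coordL N i).map_zero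

theorem continuous_coord (i : Fin N) : Continuous fun x : S N ↦ coord x i := (coordL N i).continuous

theorem sum_coord (x : S N) : ∑ i, coord x i = 0 := x.2

theorem coord_ext {x y : S N} (h : ∀ i, coord x i = coord y i) : x = y := by
  apply (incl N).injective
  ext i
  exact h i

/-- The point of the hyperplane with given coordinates. -/
def ofCoords (v : Fin N → ℝ) (h : ∑ i, v i = 0) : S N := ⟨WithLp.toLp 2 v, h⟩

@[simp] theorem coord_ofCoords (v : Fin N → ℝ) (h : ∑ i, v i = 0) (i : Fin N) :
    coord (ofCoords v h) i = v i := rfl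

theorem inner_eq_sum (x y : S N) : inner ℝ x y = ∑ i, coord x i * coord y i := by
  have : inner ℝ x y = inner ℝ (incl N x) (incl N y) := ((incl N).inner_map_map x y).symm
  rw [this, PiLp.inner_apply]
  refine Finset.sum_congr rfl fun i _ ↦ ?_
  simp [coord, mul_comm]

theorem norm_sq_eq_sum (x : S N) : ‖x‖ ^ 2 = ∑ i, coord x i ^ 2 := by
  rw [← real_inner_self_eq_norm_sq, inner_eq_sum]
  simp [sq]

/-- The interaction energy. -/
def couplingEnergy (N : ℕ) (x : S N) : ℝ :=
  1 / 4 * ∑ i, (coord x (finRotate N i) - coord x i) ^ 2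

theorem V_zero_apply (x : S N) : V N 0 x = ∑ i, (coord x i ^ 4 / 4 - coord x i ^ 2 / 2) := by
  simp [V, potential, coord]

theorem V_eq (γ : ℝ) (x : S N) : V N γ x = V N 0 x + γ * couplingEnergy N x := by
  rw [V_zero_apply]
  simp only [V, potential, couplingEnergy, coord]
  ring

theorem contDiff_V₀ : ContDiff ℝ 2 (V N 0) := by
  have : V N 0 = fun x ↦ ∑ i, (coordL N i x ^ 4 / 4 - coordL N i x ^ 2 / 2) :=
    funext fun x ↦ V_zero_apply x
  rw [this]
  exact ContDiff.sum fun i _ ↦ (((coordL N i).contDiff.pow 4).div_const 4).sub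
    (((coordL N i).contDiff.pow 2).div_const 2)

theorem hasFDerivAt_V₀ (x : S N) :
    HasFDerivAt (V N 0) (∑ i, (coord x i ^ 3 - coord x i) • coordL N i) x := by
  have : V N 0 = fun x ↦ ∑ i, (coordL N i x ^ 4 / 4 - coordL N i x ^ 2 / 2) :=
    funext fun x ↦ V_zero_apply x
  rw [this]
  refine HasFDerivAt.fun_sum fun i _ ↦ ?_
  have h : HasDerivAt (fun s : ℝ ↦ s ^ 4 / 4 - s ^ 2 / 2) (coord x i ^ 3 - coord x i)
      (coordL N i x) := by
    have := ((hasDerivAt_pow 4 (coordL N i x)).div_const 4).sub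
      ((hasDerivAt_pow 2 (coordL N i x)).div_const 2)
    refine this.congr_deriv ?_
    rw [coordL_apply]; norm_num
  exact h.comp_hasFDerivAt x (coordL N i).hasFDerivAt

/-- The difference of the coordinates at a site and its right neighbour. -/
def diffL (N : ℕ) (i : Fin N) : S N →L[ℝ] ℝ := coordL N (finRotate N i) - coordL N i

theorem diffL_apply (i : Fin N) (x : S N) :
    diffL N i x = coord x (finRotate N i) - coord x i := rfl

theorem hasFDerivAt_couplingEnergy (x : S N) :
    HasFDerivAt (couplingEnergy N) ((1 / 2 : ℝ) • ∑ i, diffL N i x • diffL N i) x := by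
  have : couplingEnergy N = fun x ↦ 1 / 4 * ∑ i, (diffL N i x) ^ 2 := rfl
  rw [this]
  have h1 : HasFDerivAt (fun x : S N ↦ ∑ i, (diffL N i x) ^ 2)
      (∑ i, (2 * diffL N i x) • diffL N i) x := by
    refine HasFDerivAt.fun_sum fun i _ ↦ ?_
    have h := hasDerivAt_pow 2 (diffL N i x)
    have := h.comp_hasFDerivAt x (diffL N i).hasFDerivAt
    simpa [Function.comp_def] using this
  have h2 := h1.const_mul (1 / 4)
  refine h2.congr_fderiv ?_
  rw [Finset.smul_sum, Finset.smul_sum]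
  refine Finset.sum_congr rfl fun i _ ↦ ?_
  rw [smul_smul, smul_smul]
  congr 1
  ring

/-- The linear gradient of the interaction energy. -/
def couplingL (N : ℕ) : S N →L[ℝ] S N :=
  ∑ i, (1 / 2 : ℝ) • (diffL N i).smulRight ((InnerProductSpace.toDual ℝ (S N)).symm (diffL N i))

theorem toDual_couplingL (x : S N) : InnerProductSpace.toDual ℝ (S N) (couplingL N x) =
    (1 / 2 : ℝ) • ∑ i, diffL N i x • diffL N i := by
  rw [couplingL, sum_apply, map_sum, Finset.smul_sum]
  refine Finset.sum_congr rfl fun i _ ↦ ?_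
  simp

theorem isBounded_sublevel (ℓ : ℝ) : Bornology.IsBounded {x : S N | V N 0 x ≤ ℓ} := by
  refine (Metric.isBounded_closedBall (x := (0 : S N)) (r := √(2 * (ℓ + N)))).subset fun x hx ↦ ?_
  rw [mem_closedBall_zero_iff]
  apply Real.le_sqrt_of_sq_le
  have h1 : ∑ i, (coord x i ^ 2 / 2 - 1) ≤ V N 0 x := by
    rw [V_zero_apply]
    -- The inequality `s⁴ / 4 - s² / 2 ≥ s² / 2 - 1` is `(s² - 2)² ≥ 0`.
    exact Finset.sum_le_sum fun i _ ↦ by nlinarith [sq_nonneg (coord x i ^ 2 - 2)]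
  rw [Finset.sum_sub_distrib, ← Finset.sum_div, ← norm_sq_eq_sum] at h1
  simp only [Finset.sum_const, Finset.card_univ, Fintype.card_fin, nsmul_eq_mul, mul_one] at h1
  have h2 : V N 0 x ≤ ℓ := hx
  linarith

/-- The potentials `V_γ` as a perturbed landscape. -/
def fam (N : ℕ) : Family (S N) where
  V₀ := V N 0
  W := couplingEnergy N
  G₀ := gradient (V N 0)
  L := couplingL N
  hV₀ x := (hasFDerivAt_V₀ x).differentiableAt.hasGradientAt
  hW x := by
    rw [hasGradientAt_iff_hasFDerivAt, toDual_couplingL]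
    exact hasFDerivAt_couplingEnergy x
  contDiff := by
    have h1 : ContDiff ℝ 1 (fderiv ℝ (V N 0)) := contDiff_V₀.fderiv_right (by norm_num)
    exact (InnerProductSpace.toDual ℝ (S N)).symm.contDiff.comp h1
  W_nonneg x := by
    refine mul_nonneg (by norm_num) (Finset.sum_nonneg fun i _ ↦ sq_nonneg _)
  bdd := isBounded_sublevel

theorem fam_V (γ : ℝ) : (fam N).V γ = V N γ := funext fun x ↦ (V_eq γ x).symm

theorem fam_G (γ : ℝ) (x : S N) : (fam N).G γ x = gradient (V N γ) x := by
  rw [← fam_V]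
  exact ((fam N).hasGradientAt γ x).gradient.symm

/-- The gradient in the hyperplane is used only through its pairing with zero-sum vectors, so no
projection or Lagrange multiplier appears explicitly. -/
theorem inner_G₀ (x w : S N) :
    inner ℝ ((fam N).G₀ x) w = ∑ i, (coord x i ^ 3 - coord x i) * coord w i := by
  have h1 := ((fam N).hV₀ x).hasFDerivAt.unique (hasFDerivAt_V₀ x)
  have h2 := congrArg (fun φ : S N →L[ℝ] ℝ ↦ φ w) h1
  simpa [coordL_apply] using h2

theorem inner_couplingL (x w : S N) : inner ℝ (couplingL N x) w =
    1 / 2 * ∑ i, (coord x (finRotate N i) - coord x i) * (coord w (finRotate N i) - coord w i) := by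
  have h2 := congrArg (fun φ : S N →L[ℝ] ℝ ↦ φ w) (toDual_couplingL x)
  simpa [diffL_apply] using h2

theorem inner_G (γ : ℝ) (x w : S N) :
    inner ℝ ((fam N).G γ x) w = ∑ i, (coord x i ^ 3 - coord x i) * coord w i +
      γ * (1 / 2 * ∑ i, (coord x (finRotate N i) - coord x i) *
        (coord w (finRotate N i) - coord w i)) := by
  rw [Family.G, inner_add_left, inner_G₀, inner_smul_left]
  congr 2
  exact inner_couplingL x w

theorem inner_fderiv_G₀ (x v w : S N) : inner ℝ (fderiv ℝ (fam N).G₀ x v) w =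
    ∑ i, (3 * coord x i ^ 2 - 1) * coord v i * coord w i := by
  have h1 : HasFDerivAt (fun y ↦ inner ℝ ((fam N).G₀ y) w)
      ((innerSL ℝ w).comp (fderiv ℝ (fam N).G₀ x)) x := by
    have h := ((fam N).contDiff.differentiable one_ne_zero x).hasFDerivAt
    have := (innerSL ℝ w).hasFDerivAt.comp x h
    refine this.congr_of_eventuallyEq (Eventually.of_forall fun y ↦ ?_)
    simp [real_inner_comm]
  have h2 : HasFDerivAt (fun y ↦ inner ℝ ((fam N).G₀ y) w)
      (∑ i, ((3 * coord x i ^ 2 - 1) * coord w i) • coordL N i) x := by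
    have : (fun y ↦ inner ℝ ((fam N).G₀ y) w) =
        fun y ↦ ∑ i, (coordL N i y ^ 3 - coordL N i y) * coord w i :=
      funext fun y ↦ inner_G₀ y w
    rw [this]
    refine HasFDerivAt.fun_sum fun i _ ↦ ?_
    have h : HasDerivAt (fun s : ℝ ↦ (s ^ 3 - s) * coord w i) ((3 * coord x i ^ 2 - 1) * coord w i)
        (coordL N i x) := by
      have := ((hasDerivAt_pow 3 (coordL N i x)).sub (hasDerivAt_id _)).mul_const (coord w i)
      refine this.congr_deriv ?_
      rw [coordL_apply]; norm_num
    exact h.comp_hasFDerivAt x (coordL N i).hasFDerivAt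
  have h3 := congrArg (fun φ : S N →L[ℝ] ℝ ↦ φ v) (h1.unique h2)
  simp only [ContinuousLinearMap.comp_apply, innerSL_apply_apply, sum_apply,
    smul_apply, coordL_apply, smul_eq_mul] at h3
  rw [real_inner_comm, h3]
  exact Finset.sum_congr rfl fun i _ ↦ by ring

theorem fderiv_G₀_symm (x v w : S N) : inner ℝ (fderiv ℝ (fam N).G₀ x v) w =
    inner ℝ v (fderiv ℝ (fam N).G₀ x w) := by
  rw [real_inner_comm (fderiv ℝ (fam N).G₀ x w), inner_fderiv_G₀, inner_fderiv_G₀]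
  exact Finset.sum_congr rfl fun i _ ↦ by ring

theorem hessian_eq (γ : ℝ) (x v w : S N) :
    hessian (V N γ) x v w = inner ℝ (fderiv ℝ ((fam N).G γ) x v) w := by
  have h1 : fderiv ℝ (V N γ) = fun y ↦ InnerProductSpace.toDual ℝ (S N) ((fam N).G γ y) := by
    funext y
    rw [← fam_V]
    exact ((fam N).hasGradientAt γ y).hasFDerivAt.fderiv
  have h2 := (((fam N).contDiff_G γ).differentiable one_ne_zero x).hasFDerivAt
  have h3 : HasFDerivAt (fderiv ℝ (V N γ)) ((innerSL ℝ).comp (fderiv ℝ ((fam N).G γ) x)) x := by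
    rw [h1]
    exact (innerSL ℝ : S N →L[ℝ] S N →L[ℝ] ℝ).hasFDerivAt.comp x h2
  rw [hessian, ContinuousLinearMap.toBilinForm_apply, h3.fderiv]
  rfl

theorem hessian_symm (γ : ℝ) (x v w : S N) : hessian (V N γ) x v w = hessian (V N γ) x w v := by
  have h : ∀ v w, inner ℝ (couplingL N v) w = inner ℝ (couplingL N w) v := by
    intro v w
    rw [inner_couplingL, inner_couplingL]
    congr 1
    exact Finset.sum_congr rfl fun i _ ↦ by ring
  simp only [hessian_eq, Family.fderiv_G, add_apply, inner_add_left,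
    smul_apply, inner_smul_left, conj_trivial]
  rw [fderiv_G₀_symm, real_inner_comm]
  congr 2
  exact h v w

end MassConserving

/-! ## Stationary points of the uncoupled potential -/

namespace MassConserving

open Landscape GradFlow

/-- The tilted double well lies above its tangent parabola at the root `b` of `ξ³ - ξ = a³ - a`, on
the side of `a` that contains `b`. -/
theorem tilted_well_le {a b x ρ : ℝ} (h : b ^ 2 + b * a + a ^ 2 = 1)
    (hx : 0 ≤ (b - a) * (x - a)) (hρ : 0 < ρ) (hab : a ^ 2 + ρ ≤ b ^ 2) :
    b ^ 4 / 4 - b ^ 2 / 2 - (a ^ 3 - a) * b + ρ / 4 * (x - b) ^ 2 ≤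
      x ^ 4 / 4 - x ^ 2 / 2 - (a ^ 3 - a) * x := by
  have h1 : 0 ≤ (a + b) * (x - a) := by
    have h2 : 0 < (b - a) * (a + b) := by nlinarith
    by_contra hcon
    push Not at hcon
    have hne : b - a ≠ 0 := by
      rintro h0
      simp [h0] at h2
    have h3 : (b - a) ^ 2 * ((a + b) * (x - a)) < 0 :=
      mul_neg_of_pos_of_neg (by positivity) hcon
    nlinarith [mul_nonneg h2.le hx]
  -- Both `a` and `b` solve the tilted equation, so `b` is a critical point of the tilted well and
  -- the difference of values is divisible by `(x - b)²`.
  have key : x ^ 4 / 4 - x ^ 2 / 2 - (a ^ 3 - a) * x -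
      (b ^ 4 / 4 - b ^ 2 / 2 - (a ^ 3 - a) * b) =
      1 / 4 * (x - b) ^ 2 * ((x - a) ^ 2 + 2 * ((a + b) * (x - a)) + (b ^ 2 - a ^ 2)) := by
    linear_combination (x - b) * ((x + b) / 2 - a) * h
  have h2 : ρ ≤ (x - a) ^ 2 + 2 * ((a + b) * (x - a)) + (b ^ 2 - a ^ 2) := by nlinarith
  nlinarith [mul_le_mul_of_nonneg_left h2 (sq_nonneg (x - b))]

variable {N : ℕ}

/-- The tilt is free on the hyperplane. A suitable `l`, the Lagrange multiplier of a nearby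
stationary point, decouples the coordinates and turns global energy bounds into one-dimensional
ones. -/
theorem V_zero_eq_sum_tilted (l : ℝ) (x : S N) :
    V N 0 x = ∑ i, (coord x i ^ 4 / 4 - coord x i ^ 2 / 2 - l * coord x i) := by
  rw [Finset.sum_sub_distrib, ← Finset.mul_sum, sum_coord, mul_zero, sub_zero, V_zero_apply]

/-- A lower bound on the energy at points that have a coordinate in common with a stationary
point. -/
theorem add_dist_le_V_zero {c x : S N} {k : Fin N} {ρ : ℝ} (hρ : 0 < ρ)
    (hk : coord x k = coord c k)
    (hroot : ∀ j ≠ k, coord c j ^ 2 + coord c j * coord c k + coord c k ^ 2 = 1)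
    (hside : ∀ j ≠ k, 0 ≤ (coord c j - coord c k) * (coord x j - coord c k))
    (hgap : ∀ j ≠ k, coord c k ^ 2 + ρ ≤ coord c j ^ 2) :
    V N 0 c + ρ / 4 * ‖x - c‖ ^ 2 ≤ V N 0 x := by
  rw [V_zero_eq_sum_tilted (coord c k ^ 3 - coord c k) c,
    V_zero_eq_sum_tilted (coord c k ^ 3 - coord c k) x, norm_sq_eq_sum, Finset.mul_sum,
    ← Finset.sum_add_distrib]
  refine Finset.sum_le_sum fun j _ ↦ ?_
  rw [coord_sub]
  by_cases hj : j = k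
  · simp [hj, hk]
  · exact tilted_well_le (hroot j hj) (hside j hj) hρ (hgap j hj)

/-- The vector `e_i - e_j`. -/
def diffVec (i j : Fin N) : S N :=
  ofCoords (Pi.single i 1 - Pi.single j 1) (by simp)

theorem coord_diffVec (i j k : Fin N) :
    coord (diffVec i j) k = (if k = i then 1 else 0) - if k = j then 1 else 0 := by
  simp [diffVec, Pi.single_apply]

/-- The vectors `e_i - e_j` are test directions that show all the values `ξ³ - ξ` to be equal;
conversely a constant is orthogonal to the hyperplane. -/
theorem G₀_eq_zero_iff (x : S N) :
    (fam N).G₀ x = 0 ↔ ∃ l, ∀ i, coord x i ^ 3 - coord x i = l := by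
  constructor
  · intro h
    have h1 : ∀ i j, coord x i ^ 3 - coord x i = coord x j ^ 3 - coord x j := by
      intro i j
      have := inner_G₀ x (diffVec i j)
      simp only [h, inner_zero_left, coord_diffVec, mul_sub, Finset.sum_sub_distrib, mul_ite,
        mul_one, mul_zero, Finset.sum_ite_eq', Finset.mem_univ, if_true] at this
      linarith
    rcases isEmpty_or_nonempty (Fin N) with he | ⟨⟨j⟩⟩
    · exact ⟨0, fun i ↦ he.elim i⟩
    · exact ⟨_, fun i ↦ h1 i j⟩
  · rintro ⟨l, hl⟩
    refine ext_inner_right ℝ fun w ↦ ?_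
    rw [inner_G₀, inner_zero_left]
    simp [hl, ← Finset.mul_sum, sum_coord]

/-- The equation `ξ³ - ξ = l` turns the quartic into `l * ξ / 4 - ξ² / 4`, and the linear part sums
to zero. -/
theorem V_zero_of_stationary {x : S N} (h : (fam N).G₀ x = 0) : V N 0 x = -(‖x‖ ^ 2) / 4 := by
  obtain ⟨l, hl⟩ := (G₀_eq_zero_iff x).1 h
  have : V N 0 x = ∑ i, (l / 4 * coord x i - coord x i ^ 2 / 4) := by
    rw [V_zero_apply]
    refine Finset.sum_congr rfl fun i _ ↦ ?_
    rw [← hl i]; ring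
  rw [this, Finset.sum_sub_distrib, ← Finset.mul_sum, sum_coord, ← Finset.sum_div, norm_sq_eq_sum]
  ring

/-- The coordinates of a stationary point that is not constant are among three ordered roots. -/
theorem exists_roots {x : S N} {l : ℝ} (hl : ∀ i, coord x i ^ 3 - coord x i = l) (hx : x ≠ 0) :
    ∃ t m b : ℝ, b ≤ m ∧ m ≤ t ∧ t + m + b = 0 ∧ t ^ 2 + t * m + m ^ 2 = 1 ∧
      t ^ 3 - t = l ∧ ∀ i, coord x i = t ∨ coord x i = m ∨ coord x i = b := by
  have hne : ∃ i j, coord x i < coord x j := by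
    by_contra! hcon
    apply hx
    refine coord_ext fun i ↦ ?_
    have h1 : ∀ j, coord x j = coord x i := fun j ↦ le_antisymm (hcon i j) (hcon j i)
    have h2 := sum_coord x
    simp only [h1, Finset.sum_const, Finset.card_univ, Fintype.card_fin, nsmul_eq_mul,
      mul_eq_zero, Nat.cast_eq_zero] at h2
    rcases h2 with h2 | h2
    · subst h2; exact i.elim0
    · simpa using h2
  obtain ⟨i, j, hij⟩ := hne
  set u := coord x i
  set v := coord x j
  have h1 : u ^ 2 + u * v + v ^ 2 = 1 := by
    have : (u - v) * (u ^ 2 + u * v + v ^ 2 - 1) = 0 := by linear_combination hl i - hl j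
    rcases mul_eq_zero.1 this with h | h <;> linarith
  -- By Vieta the third root is `-u - v`; it may coincide with `u` or `v`, which is why the roots
  -- are ordered only weakly.
  have h2 : ∀ k, coord x k = u ∨ coord x k = v ∨ coord x k = -u - v := by
    intro k
    have : (coord x k - u) * ((coord x k - v) * (coord x k - (-u - v))) = 0 := by
      linear_combination hl k - hl i - (coord x k - u) * h1
    rcases mul_eq_zero.1 this with h | h
    · exact Or.inl (sub_eq_zero.1 h)
    · rcases mul_eq_zero.1 h with h | h
      · exact Or.inr (Or.inl (sub_eq_zero.1 h))
      · exact Or.inr (Or.inr (sub_eq_zero.1 h))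
  have hlu : u ^ 3 - u = l := hl i
  have hlv : v ^ 3 - v = l := hl j
  rcases le_total (-u - v) u with h | h
  · exact ⟨v, u, -u - v, h, hij.le, by ring, by linarith, hlv, fun k ↦ by
      rcases h2 k with h | h | h <;> simp [h]⟩
  rcases le_total (-u - v) v with h' | h'
  · exact ⟨v, -u - v, u, h, h', by ring, by linear_combination h1, hlv, fun k ↦ by
      rcases h2 k with h | h | h <;> simp [h]⟩
  · exact ⟨-u - v, v, u, hij.le, h', by ring, by linear_combination h1,
      by linear_combination hlu - (2 * u + v) * h1, fun k ↦ by
      rcases h2 k with h | h | h <;> simp [h]⟩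

/-- Permutation of the sites. -/
def permute (σ : Equiv.Perm (Fin N)) (x : S N) : S N :=
  ofCoords (fun i ↦ coord x (σ i)) (by rw [Equiv.sum_comp σ (coord x), sum_coord])

@[simp] theorem coord_permute (σ : Equiv.Perm (Fin N)) (x : S N) (i : Fin N) :
    coord (permute σ x) i = coord x (σ i) := rfl

theorem V_zero_permute (σ : Equiv.Perm (Fin N)) (x : S N) : V N 0 (permute σ x) = V N 0 x := by
  simp only [V_zero_apply, coord_permute]
  exact Equiv.sum_comp σ fun i ↦ coord x i ^ 4 / 4 - coord x i ^ 2 / 2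

/-- A stationary point of the uncoupled system with triple `(1, n₁, n₂)`, with roots `α` (minority)
and `β` (majority), whose special site `i` carries the middle root. -/
structure IsGenericSaddle (c : S N) (i : Fin N) (α β : ℝ) : Prop where
  coord_site : coord c i = -(α + β)
  root : α ^ 2 + α * β + β ^ 2 = 1
  coord_ne : ∀ k ≠ i, coord c k = α ∨ coord c k = β
  gap : (α + β) ^ 2 < β ^ 2
  opposite : (α + β) * β < 0
  card_lt : 2 * (Finset.univ.filter fun k ↦ k ≠ i ∧ coord c k = α).card < N

namespace IsGenericSaddle

variable {c : S N} {i : Fin N} {α β : ℝ} (h : IsGenericSaddle c i α β)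

/-- The sites whose coordinate has the minority sign. -/
def minority (c : S N) (i : Fin N) (α : ℝ) (k : Fin N) : Prop := k ≠ i ∧ coord c k = α

open Classical in
/-- The reference value at a site after the decay of the special site to the majority. -/
def pattern (c : S N) (i : Fin N) (α β : ℝ) (k : Fin N) : ℝ :=
  if minority c i α k then α else β

/-- The points whose coordinates are on the same side of the middle root as the pattern. -/
def region (c : S N) (i : Fin N) (α β : ℝ) : Set (S N) :=
  {x | ∀ k, 0 < (pattern c i α β k - coord c i) * (coord x k - coord c i)}

/-- The closed version of `region`. -/
def closedRegion (c : S N) (i : Fin N) (α β : ℝ) : Set (S N) :=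
  {x | ∀ k, 0 ≤ (pattern c i α β k - coord c i) * (coord x k - coord c i)}

theorem isOpen_region : IsOpen (region c i α β) := by
  simp only [region, ofPred_forall]
  exact isOpen_iInter_of_finite fun k ↦ isOpen_lt continuous_const
    (continuous_const.mul ((continuous_coord k).sub continuous_const))

theorem isClosed_closedRegion : IsClosed (closedRegion c i α β) := by
  simp only [closedRegion, ofPred_forall]
  exact isClosed_iInter fun k ↦ isClosed_le continuous_const
    (continuous_const.mul ((continuous_coord k).sub continuous_const))

theorem region_subset : region c i α β ⊆ closedRegion c i α β := fun _ hx k ↦ (hx k).le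

theorem gap' (h : IsGenericSaddle c i α β) : (α + β) ^ 2 < α ^ 2 := by
  nlinarith [h.opposite, sq_nonneg β]

theorem mul_neg (h : IsGenericSaddle c i α β) : α * β < 0 := by
  nlinarith [h.opposite, sq_nonneg β]

theorem alpha_ne (h : IsGenericSaddle c i α β) : α ≠ β := by
  rintro rfl
  nlinarith [h.mul_neg, mul_self_nonneg α]

theorem pattern_eq_alpha {k : Fin N} (hk : k ≠ i) (hα : coord c k = α) :
    pattern c i α β k = α := if_pos ⟨hk, hα⟩

theorem pattern_site : pattern c i α β i = β := if_neg fun h ↦ h.1 rfl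

theorem pattern_eq_beta (h : IsGenericSaddle c i α β) {k : Fin N} (hβ : coord c k = β) :
    pattern c i α β k = β := if_neg fun hk ↦ h.alpha_ne (hk.2.symm.trans hβ)

theorem root_beta (h : IsGenericSaddle c i α β) :
    β ^ 2 + β * coord c i + coord c i ^ 2 = 1 := by
  rw [h.coord_site]; linear_combination h.root

theorem root_alpha (h : IsGenericSaddle c i α β) :
    α ^ 2 + α * coord c i + coord c i ^ 2 = 1 := by
  rw [h.coord_site]; linear_combination h.root

theorem sq_lt_beta (h : IsGenericSaddle c i α β) : coord c i ^ 2 < β ^ 2 := by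
  rw [h.coord_site, neg_sq]; exact h.gap

theorem sq_lt_alpha (h : IsGenericSaddle c i α β) : coord c i ^ 2 < α ^ 2 := by
  rw [h.coord_site, neg_sq]; exact h.gap'

theorem stationary (h : IsGenericSaddle c i α β) : (fam N).G₀ c = 0 := by
  refine (G₀_eq_zero_iff c).2 ⟨α ^ 3 - α, fun k ↦ ?_⟩
  by_cases hk : k = i
  · rw [hk, h.coord_site]
    linear_combination (-(2 * α + β)) * h.root
  · rcases h.coord_ne k hk with hk | hk
    · rw [hk]
    · rw [hk]
      linear_combination (β - α) * h.root

/-- Moving the special site to another majority site leads to the same pattern of signs: all these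
saddles border one and the same region. -/
theorem pattern_swap (h : IsGenericSaddle c i α β) {j : Fin N} (hj : coord c j = β) (k : Fin N) :
    pattern (permute (Equiv.swap i j) c) j α β k = pattern c i α β k := by
  unfold pattern
  congr 1
  simp only [minority, coord_permute, eq_iff_iff]
  by_cases hki : k = i
  · subst hki; simp [hj, h.alpha_ne.symm]
  · by_cases hkj : k = j
    · subst hkj; simp [hj, h.alpha_ne.symm]
    · simp [hki, hkj, Equiv.swap_apply_of_ne_of_ne hki hkj]

/-- Energy on the part of the boundary of the region where a majority site is critical. -/
theorem exists_front_bound (h : IsGenericSaddle c i α β) : ∃ ρ > 0, ∀ x ∈ closedRegion c i α β,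
    x ∉ region c i α β →
      (∃ j, (j = i ∨ coord c j = β) ∧
        V N 0 c + ρ * ‖x - permute (Equiv.swap i j) c‖ ^ 2 ≤ V N 0 x) ∨ V N 0 c + ρ ≤ V N 0 x := by
  set a := coord c i with ha
  obtain ⟨ρ, hρ, hρα, hρβ⟩ : ∃ ρ > 0, a ^ 2 + ρ ≤ α ^ 2 ∧ a ^ 2 + ρ ≤ β ^ 2 :=
    ⟨min (α ^ 2 - a ^ 2) (β ^ 2 - a ^ 2), lt_min (sub_pos.2 h.sq_lt_alpha) (sub_pos.2 h.sq_lt_beta),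
      by linarith [min_le_left (α ^ 2 - a ^ 2) (β ^ 2 - a ^ 2)],
      by linarith [min_le_right (α ^ 2 - a ^ 2) (β ^ 2 - a ^ 2)]⟩
  -- The well tilted by the multiplier of `c`. In it the minority root is strictly deeper than the
  -- majority root, which makes criticality of a minority site expensive.
  let g : ℝ → ℝ := fun s ↦ s ^ 4 / 4 - s ^ 2 / 2 - (a ^ 3 - a) * s
  have hgap : 0 < g β - g α := by
    have h1 : g β - g α = (α - β) * a * (3 * a ^ 2 - 4) / 4 := by
      simp only [g, ha, h.coord_site]
      linear_combination (-(α - β) * (α + β) / 2) * h.root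
    have h2 : (α - β) * a < 0 := by
      rw [ha, h.coord_site]; nlinarith [h.gap', h.opposite, h.gap]
    have h3 : 3 * a ^ 2 - 4 < 0 := by
      have := h.root_beta
      nlinarith [h.sq_lt_beta, sq_nonneg (a + β), sq_nonneg (a - 2 * β), sq_nonneg (2 * a + β)]
    rw [h1]
    have := mul_pos_of_neg_of_neg h2 h3
    linarith
  refine ⟨min (ρ / 4) (g β - g α), lt_min (by positivity) hgap, fun x hx hxR ↦ ?_⟩
  obtain ⟨k, hk⟩ : ∃ k, coord x k = a := by
    by_contra! hcon
    refine hxR fun k ↦ lt_of_le_of_ne (hx k) (Ne.symm (mul_ne_zero ?_ (sub_ne_zero.2 (hcon k))))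
    unfold pattern
    rw [sub_ne_zero]
    split_ifs
    · rintro h0
      exact absurd h.sq_lt_alpha (by rw [h0]; exact lt_irrefl _)
    · rintro h0
      exact absurd h.sq_lt_beta (by rw [h0]; exact lt_irrefl _)
  -- A critical minority site is compared with `c` after exchange of `i` and `k`: this has the
  -- minority value at `i`, while `x` must stay on the majority side there and so costs at least `g
  -- β - g α` more.
  by_cases hkm : k ≠ i ∧ coord c k = α
  · right
    refine (add_le_add_right (min_le_right _ _) _).trans ?_
    rw [← V_zero_permute (Equiv.swap i k) c,
      V_zero_eq_sum_tilted (a ^ 3 - a) (permute (Equiv.swap i k) c),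
      V_zero_eq_sum_tilted (a ^ 3 - a) x]
    have h1 : g β - g α = ∑ j, if j = i then g β - g α else 0 := by simp
    rw [h1, ← Finset.sum_add_distrib]
    refine Finset.sum_le_sum fun j _ ↦ ?_
    have hα : ∀ j, j ≠ i → coord c j = α → g α ≤ g (coord x j) := fun j hj hjα ↦ by
      have : g α + ρ / 4 * (coord x j - α) ^ 2 ≤ g (coord x j) :=
        tilted_well_le h.root_alpha (by simpa [pattern_eq_alpha hj hjα] using hx j) hρ hρα
      have h3 : 0 ≤ ρ / 4 * (coord x j - α) ^ 2 := by positivity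
      linarith
    have hβ : ∀ j, pattern c i α β j = β → g β ≤ g (coord x j) := fun j hjβ ↦ by
      have : g β + ρ / 4 * (coord x j - β) ^ 2 ≤ g (coord x j) :=
        tilted_well_le h.root_beta (by simpa [hjβ] using hx j) hρ hρβ
      have h3 : 0 ≤ ρ / 4 * (coord x j - β) ^ 2 := by positivity
      linarith
    by_cases hji : j = i
    · subst hji
      have := hβ j pattern_site
      simp only [coord_permute, Equiv.swap_apply_left, hkm.2, if_true]
      simp only [g] at this ⊢
      linarith
    · by_cases hjk : j = k
      · subst hjk
        simp [hji, hk, ha]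
      · simp only [coord_permute, Equiv.swap_apply_of_ne_of_ne hji hjk, if_neg hji, add_zero]
        rcases h.coord_ne j hji with hj | hj
        · rw [hj]; exact hα j hji hj
        · rw [hj]; exact hβ j (h.pattern_eq_beta hj)
  -- If `k` is `i` or a majority site, the exchanged saddle has the same pattern elsewhere, and `x`
  -- shares its critical coordinate, so the quadratic bound applies.
  · left
    have hkβ : k = i ∨ coord c k = β := by
      by_contra! hcon
      exact hkm ⟨hcon.1, (h.coord_ne k hcon.1).resolve_right hcon.2⟩
    refine ⟨k, hkβ, ?_⟩
    have hc' : coord (permute (Equiv.swap i k) c) k = a := by simp [ha]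
    have hval : ∀ j ≠ k, coord (permute (Equiv.swap i k) c) j = pattern c i α β j ∧
        (coord (permute (Equiv.swap i k) c) j = α ∨ coord (permute (Equiv.swap i k) c) j = β) := by
      intro j hj
      by_cases hji : j = i
      · subst hji
        have : coord c k = β := hkβ.resolve_left (Ne.symm hj)
        simp [this, pattern_site]
      · simp only [coord_permute, Equiv.swap_apply_of_ne_of_ne hji hj]
        rcases h.coord_ne j hji with h1 | h1
        · simp [h1, pattern_eq_alpha hji h1]
        · simp [h1, h.pattern_eq_beta h1]
    rw [← V_zero_permute (Equiv.swap i k) c]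
    refine le_trans ?_ (add_dist_le_V_zero (c := permute (Equiv.swap i k) c) (k := k) hρ
        (by rw [hk, hc']) (fun j hj ↦ ?_)
      (fun j hj ↦ ?_) (fun j hj ↦ ?_))
    · gcongr
      exact min_le_left _ _
    · rw [hc']
      rcases (hval j hj).2 with h1 | h1 <;> rw [h1]
      · exact h.root_alpha
      · exact h.root_beta
    · rw [hc', (hval j hj).1]; exact hx j
    · rw [hc']
      rcases (hval j hj).2 with h1 | h1 <;> rw [h1]
      · exact hρα
      · exact hρβ

theorem le_V_zero_of_front (h : IsGenericSaddle c i α β) {x : S N} (hx : x ∈ closedRegion c i α β)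
    (hxR : x ∉ region c i α β) : V N 0 c ≤ V N 0 x := by
  obtain ⟨ρ, hρ, hb⟩ := h.exists_front_bound
  rcases hb x hx hxR with ⟨j, -, hj⟩ | hj
  · have : 0 ≤ ρ * ‖x - permute (Equiv.swap i j) c‖ ^ 2 := by positivity
    linarith
  · linarith

end IsGenericSaddle

end MassConserving

/-! ## Configurations of particles and holes -/

namespace MassConserving

open Landscape GradFlow

variable {M : ℕ}

/-- The size of the special coordinate of the saddles of the family `C_1`. -/
def tau (M : ℕ) : ℝ := (√((M : ℝ) ^ 2 - 3 * M + 3))⁻¹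

/-- The scale of the coordinates of the local minima of the family `B_1`. -/
def sigma (M : ℕ) : ℝ := (√((M : ℝ) ^ 2 + 3))⁻¹

/-- The energy of the saddles of the family `C_1` for `γ = 0`. -/
def saddleLevel (M : ℕ) : ℝ := -(M : ℝ) / 2 + M * (M - 1) / 4 * tau M ^ 2

theorem tau_pos : 0 < tau M := by
  refine inv_pos.2 (Real.sqrt_pos.2 ?_)
  nlinarith [sq_nonneg ((M : ℝ) - 3 / 2)]

theorem tau_sq : tau M ^ 2 * ((M : ℝ) ^ 2 - 3 * M + 3) = 1 := by
  have h : 0 < (M : ℝ) ^ 2 - 3 * M + 3 := by nlinarith [sq_nonneg ((M : ℝ) - 3 / 2)]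
  rw [tau, inv_pow, Real.sq_sqrt h.le, inv_mul_cancel₀ h.ne']

theorem sigma_pos : 0 < sigma M := inv_pos.2 (Real.sqrt_pos.2 (by positivity))

theorem sigma_sq : sigma M ^ 2 * ((M : ℝ) ^ 2 + 3) = 1 := by
  have h : 0 < (M : ℝ) ^ 2 + 3 := by positivity
  rw [sigma, inv_pow, Real.sq_sqrt h.le, inv_mul_cancel₀ h.ne']

theorem tau_sq_le (hM : 4 ≤ M) : 7 * tau M ^ 2 ≤ 1 := by
  have hM' : (4 : ℝ) ≤ M := by exact_mod_cast hM
  have := tau_sq (M := M)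
  nlinarith [mul_nonneg (sq_nonneg (tau M))
    (mul_nonneg (sub_nonneg.2 hM') (by linarith : 0 ≤ (M : ℝ) + 1))]

/-- All coordinates are `±1` (particles and holes). -/
def IsSpin (a : S (2 * M)) : Prop := ∀ k, coord a k = 1 ∨ coord a k = -1

theorem IsSpin.neg {a : S (2 * M)} (ha : IsSpin a) : IsSpin (-a) := fun k ↦ by
  rcases ha k with h | h <;> simp [h]

theorem IsSpin.mul_self {a : S (2 * M)} (ha : IsSpin a) (k : Fin (2 * M)) :
    coord a k * coord a k = 1 := by rcases ha k with h | h <;> simp [h]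

theorem IsSpin.eq_or {a : S (2 * M)} (ha : IsSpin a) (k l : Fin (2 * M)) :
    coord a l = coord a k ∨ coord a l = -coord a k := by
  rcases ha k with h | h <;> rcases ha l with h' | h' <;> simp [h, h']

theorem IsSpin.ne_neg {a : S (2 * M)} (ha : IsSpin a) (k : Fin (2 * M)) :
    coord a k ≠ -coord a k := by
  rcases ha k with h | h <;> simp [h] <;> norm_num

theorem IsSpin.permute {a : S (2 * M)} (ha : IsSpin a) (σ : Equiv.Perm (Fin (2 * M))) :
    IsSpin (permute σ a) := fun k ↦ ha (σ k)

theorem IsSpin.card_eq {a : S (2 * M)} (ha : IsSpin a) :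
    (Finset.univ.filter fun l ↦ coord a l = 1).card = M := by
  have h1 : ∑ l, (if coord a l = 1 then (1 : ℝ) else 0) = M := by
    have h2 : ∀ l, (if coord a l = 1 then (1 : ℝ) else 0) = (1 + coord a l) / 2 := by
      intro l
      rcases ha l with h | h
      · simp [h]
      · simp [h]; norm_num
    simp only [h2]
    rw [← Finset.sum_div, Finset.sum_add_distrib, sum_coord]
    simp
  rw [Finset.sum_boole] at h1
  exact_mod_cast h1

theorem IsSpin.card_eq_site {a : S (2 * M)} (ha : IsSpin a) (k : Fin (2 * M)) :
    (Finset.univ.filter fun l ↦ coord a l = coord a k).card = M := by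
  rcases ha k with h | h
  · rw [h]; exact ha.card_eq
  · rw [h]
    have := ha.neg.card_eq
    simpa [neg_eq_iff_eq_neg] using this

theorem IsSpin.sum_ite {a : S (2 * M)} (ha : IsSpin a) (u v : ℝ) :
    ∑ l, (if coord a l = 1 then u else v) = M * u + M * v := by
  have h2 : ∀ l, (if coord a l = 1 then u else v) = (u + v) / 2 + (u - v) / 2 * coord a l := by
    intro l
    rcases ha l with h | h
    · simp [h]; ring
    · rw [h, if_neg (by norm_num)]; ring
  simp only [h2]
  rw [Finset.sum_add_distrib, ← Finset.mul_sum, sum_coord]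
  simp; ring

theorem IsSpin.V_zero {a : S (2 * M)} (ha : IsSpin a) : V (2 * M) 0 a = -(M : ℝ) / 2 := by
  have : ∀ i, coord a i ^ 4 / 4 - coord a i ^ 2 / 2 = (-1 / 4 : ℝ) := by
    intro i
    rcases ha i with h | h <;> rw [h] <;> norm_num
  rw [V_zero_apply]
  simp only [this, Finset.sum_const, Finset.card_univ, Fintype.card_fin, nsmul_eq_mul]
  push_cast; ring

theorem IsSpin.norm_sq {a : S (2 * M)} (ha : IsSpin a) : ‖a‖ ^ 2 = 2 * M := by
  rw [norm_sq_eq_sum]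
  simp [sq, ha.mul_self]

theorem IsSpin.stationary {a : S (2 * M)} (ha : IsSpin a) : (fam (2 * M)).G₀ a = 0 := by
  refine (G₀_eq_zero_iff a).2 ⟨0, fun k ↦ ?_⟩
  rcases ha k with h | h <;> rw [h] <;> norm_num

/-- The zero-sum vector with equal coordinates outside a given site. -/
def bump (k : Fin (2 * M)) : S (2 * M) :=
  ofCoords (fun l ↦ 1 / 2 - M * if l = k then 1 else 0) (by
    rw [Finset.sum_sub_distrib, ← Finset.mul_sum]
    simp; ring)

theorem coord_bump (k l : Fin (2 * M)) : coord (bump k) l = 1 / 2 - M * if l = k then 1 else 0 :=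
  rfl

theorem norm_sq_bump (k : Fin (2 * M)) : ‖bump k‖ ^ 2 = (M : ℝ) ^ 2 - M / 2 := by
  rw [norm_sq_eq_sum]
  have : ∀ l, coord (bump k) l ^ 2 = 1 / 4 + ((M : ℝ) ^ 2 - M) * if l = k then 1 else 0 := by
    intro l
    rw [coord_bump]
    split_ifs <;> ring
  simp only [this, Finset.sum_add_distrib, ← Finset.mul_sum]
  simp; ring

theorem inner_bump (x : S (2 * M)) (k : Fin (2 * M)) : inner ℝ x (bump k) = -M * coord x k := by
  rw [inner_eq_sum]
  simp only [coord_bump, mul_sub, Finset.sum_sub_distrib, ← Finset.sum_mul, sum_coord]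
  simp; ring

/-- The saddle of the uncoupled system at which the particle or hole at site `k` disappears. -/
def saddle (a : S (2 * M)) (k : Fin (2 * M)) : S (2 * M) :=
  tau M • (((2 * M - 3) / 2 : ℝ) • a + coord a k • bump k)

/-- The local minimum of the family `B_1` reached from `a` by the decay of the particle or hole at
site `k`. -/
def product (a : S (2 * M)) (k : Fin (2 * M)) : S (2 * M) :=
  sigma M • ((M : ℝ) • a + (2 * coord a k) • bump k)

theorem product_neg (a : S (2 * M)) (k : Fin (2 * M)) : product (-a) k = -product a k := by
  refine coord_ext fun l ↦ ?_
  simp [product]; ring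

theorem coord_saddle_self (a : S (2 * M)) (k : Fin (2 * M)) :
    coord (saddle a k) k = -tau M * coord a k := by
  simp [saddle, coord_bump]; ring

theorem coord_saddle_same {a : S (2 * M)} {k l : Fin (2 * M)} (hl : l ≠ k)
    (h : coord a l = coord a k) : coord (saddle a k) l = (M - 1) * tau M * coord a k := by
  simp [saddle, coord_bump, hl, h]; ring

theorem coord_saddle_opp {a : S (2 * M)} (ha : IsSpin a) {k l : Fin (2 * M)}
    (h : coord a l = -coord a k) : coord (saddle a k) l = -((M - 2) * tau M * coord a k) := by
  have hl : l ≠ k := by rintro rfl; exact ha.ne_neg l h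
  simp [saddle, coord_bump, hl, h]; ring

theorem coord_product_self (a : S (2 * M)) (k : Fin (2 * M)) :
    coord (product a k) k = -((M - 1) * sigma M * coord a k) := by
  simp [product, coord_bump]; ring

theorem coord_product_same {a : S (2 * M)} {k l : Fin (2 * M)} (hl : l ≠ k)
    (h : coord a l = coord a k) : coord (product a k) l = (M + 1) * sigma M * coord a k := by
  simp [product, coord_bump, hl, h]; ring

theorem coord_product_opp {a : S (2 * M)} (ha : IsSpin a) {k l : Fin (2 * M)}
    (h : coord a l = -coord a k) : coord (product a k) l = -((M - 1) * sigma M * coord a k) := by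
  have hl : l ≠ k := by rintro rfl; exact ha.ne_neg l h
  simp [product, coord_bump, hl, h]; ring

/-- The special site leaves `M - 1` sites of its own sign, the minority, against `M` of the opposite
sign. With coordinates proportional to `-1`, `M - 1` and `-(M - 2)` the root equation reads `τ² (M²
- 3M + 3) = 1`. -/
theorem isGenericSaddle_saddle (hM : 4 ≤ M) {a : S (2 * M)} (ha : IsSpin a) (k : Fin (2 * M)) :
    IsGenericSaddle (saddle a k) k ((M - 1) * tau M * coord a k)
      (-((M - 2) * tau M * coord a k)) := by
  have hM' : (4 : ℝ) ≤ M := by exact_mod_cast hM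
  have hs := ha.mul_self k
  have ht := tau_sq (M := M)
  have ht0 := tau_pos (M := M)
  have hroot : ((M - 1) * tau M * coord a k) ≠ (-((M - 2) * tau M * coord a k)) := by
    intro h
    have h1 : (2 * M - 3) * tau M * (coord a k * coord a k) = 0 := by
      linear_combination coord a k * h
    rw [hs, mul_one] at h1
    have : 0 < (2 * M - 3) * tau M := by have : (0:ℝ) < 2 * M - 3 := by linarith
                                         positivity
    linarith
  refine ⟨?_, ?_, fun l hl ↦ ?_, ?_, ?_, ?_⟩
  · rw [coord_saddle_self]; ring
  · linear_combination (tau M ^ 2 * ((M : ℝ) ^ 2 - 3 * M + 3)) * hs + ht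
  · rcases ha.eq_or k l with h | h
    · exact Or.inl (coord_saddle_same hl h)
    · exact Or.inr (coord_saddle_opp ha h)
  · have h1 : ((M - 1) * tau M * coord a k + -((M - 2) * tau M * coord a k)) ^ 2 = tau M ^ 2 := by
      linear_combination tau M ^ 2 * hs
    have h2 : (-((M - 2) * tau M * coord a k)) ^ 2 = (M - 2) ^ 2 * tau M ^ 2 := by
      linear_combination (M - 2) ^ 2 * tau M ^ 2 * hs
    rw [h1, h2]
    have : 1 < ((M : ℝ) - 2) ^ 2 := by nlinarith
    have h3 : 0 < tau M ^ 2 := by positivity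
    nlinarith
  · have h1 : ((M - 1) * tau M * coord a k + -((M - 2) * tau M * coord a k)) *
        (-((M - 2) * tau M * coord a k)) = -((M - 2) * tau M ^ 2) := by
      linear_combination -(M - 2) * tau M ^ 2 * hs
    rw [h1, neg_lt_zero]
    have : (0 : ℝ) < M - 2 := by linarith
    positivity
  · have h1 : (Finset.univ.filter fun l ↦ l ≠ k ∧
        coord (saddle a k) l = (M - 1) * tau M * coord a k) ⊆
        (Finset.univ.filter fun l ↦ coord a l = coord a k).erase k := by
      intro l hl
      simp only [Finset.mem_filter, Finset.mem_univ, true_and] at hl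
      rw [Finset.mem_erase, Finset.mem_filter]
      refine ⟨hl.1, Finset.mem_univ _, ?_⟩
      rcases ha.eq_or k l with h | h
      · exact h
      · rw [coord_saddle_opp ha h] at hl
        exact absurd hl.2.symm hroot
    have h2 := Finset.card_le_card h1
    rw [Finset.card_erase_of_mem (by simp), ha.card_eq_site] at h2
    omega

theorem norm_sq_saddle {a : S (2 * M)} (ha : IsSpin a) (k : Fin (2 * M)) :
    ‖saddle a k‖ ^ 2 = 2 * M - M * (M - 1) * tau M ^ 2 := by
  have hs := ha.mul_self k
  rw [saddle, norm_smul, mul_pow, Real.norm_eq_abs, sq_abs, norm_add_sq_real, norm_smul, norm_smul,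
    inner_smul_left, inner_smul_right, inner_bump, mul_pow, mul_pow, ha.norm_sq, norm_sq_bump,
    Real.norm_eq_abs, Real.norm_eq_abs, sq_abs, sq_abs]
  simp only [conj_trivial]
  linear_combination (2 * M : ℝ) * tau_sq (M := M) +
    (-(tau M ^ 2 * (2 * M - 3) * M) + tau M ^ 2 * ((M : ℝ) ^ 2 - M / 2)) * hs

theorem V_zero_saddle (hM : 4 ≤ M) {a : S (2 * M)} (ha : IsSpin a) (k : Fin (2 * M)) :
    V (2 * M) 0 (saddle a k) = saddleLevel M := by
  rw [V_zero_of_stationary (isGenericSaddle_saddle hM ha k).stationary, norm_sq_saddle ha,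
    saddleLevel]
  ring

/-! ### The regions around the configurations -/

/-- A neighbourhood of the configuration `a`, bounded by the saddles adjacent to `a`. -/
def spinRegion (a : S (2 * M)) : Set (S (2 * M)) :=
  {x | (∀ k, -tau M < coord a k * coord x k) ∧
    ∀ i j, coord a i = 1 → coord a j = -1 → coord x j < coord x i}

/-- The closed version of `spinRegion`. -/
def closedSpinRegion (a : S (2 * M)) : Set (S (2 * M)) :=
  {x | (∀ k, -tau M ≤ coord a k * coord x k) ∧
    ∀ i j, coord a i = 1 → coord a j = -1 → coord x j ≤ coord x i}

theorem isOpen_spinRegion (a : S (2 * M)) : IsOpen (spinRegion a) := by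
  have h1 : IsOpen {x : S (2 * M) | ∀ k, -tau M < coord a k * coord x k} := by
    simp only [ofPred_forall]
    exact isOpen_iInter_of_finite fun k ↦ isOpen_lt continuous_const
      (continuous_const.mul (continuous_coord k))
  have h2 : IsOpen {x : S (2 * M) |
      ∀ i j, coord a i = 1 → coord a j = -1 → coord x j < coord x i} := by
    simp only [ofPred_forall]
    exact isOpen_iInter_of_finite fun i ↦ isOpen_iInter_of_finite fun j ↦
      isOpen_iInter_of_finite fun _ ↦ isOpen_iInter_of_finite fun _ ↦
      isOpen_lt (continuous_coord j) (continuous_coord i)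
  exact h1.inter h2

theorem isClosed_closedSpinRegion (a : S (2 * M)) : IsClosed (closedSpinRegion a) := by
  have h1 : IsClosed {x : S (2 * M) | ∀ k, -tau M ≤ coord a k * coord x k} := by
    simp only [ofPred_forall]
    exact isClosed_iInter fun k ↦ isClosed_le continuous_const
      (continuous_const.mul (continuous_coord k))
  have h2 : IsClosed {x : S (2 * M) |
      ∀ i j, coord a i = 1 → coord a j = -1 → coord x j ≤ coord x i} := by
    simp only [ofPred_forall]
    exact isClosed_iInter fun i ↦ isClosed_iInter fun j ↦ isClosed_iInter fun _ ↦
      isClosed_iInter fun _ ↦ isClosed_le (continuous_coord j) (continuous_coord i)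
  exact h1.inter h2

theorem spinRegion_subset (a : S (2 * M)) : spinRegion a ⊆ closedSpinRegion a :=
  fun _ hx ↦ ⟨fun k ↦ (hx.1 k).le, fun i j hi hj ↦ (hx.2 i j hi hj).le⟩

theorem IsSpin.mem_spinRegion {a : S (2 * M)} (ha : IsSpin a) : a ∈ spinRegion a := by
  refine ⟨fun k ↦ ?_, fun i j hi hj ↦ ?_⟩
  · rw [ha.mul_self]; linarith [tau_pos (M := M)]
  · rw [hi, hj]; norm_num

/-- Energy of a point at which a particle and a hole have the same coordinate. -/
theorem saddleLevel_add_le (hM : 4 ≤ M) : ∃ ρ > 0, ∀ a : S (2 * M), IsSpin a →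
    ∀ x ∈ closedSpinRegion a, ∀ i j, coord a i = 1 → coord a j = -1 → coord x i = coord x j →
      saddleLevel M + ρ ≤ V (2 * M) 0 x := by
  have hM' : (4 : ℝ) ≤ M := by exact_mod_cast hM
  have ht := tau_sq (M := M)
  have ht7 := tau_sq_le hM
  have ht0 := tau_pos (M := M)
  -- The excess is the quartic term that remains in the lower bound at the extreme value `μ² = τ²`.
  refine ⟨3 / 4 * (M - 3) * (tau M ^ 2) ^ 2, by
    have : (0 : ℝ) < M - 3 := by linarith
    positivity, fun a ha x hx i j hi hj hij ↦ ?_⟩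
  set μ := coord x i with hμ
  have hμ1 : -tau M ≤ μ := by simpa [hi] using hx.1 i
  have hμ2 : μ ≤ tau M := by
    have := hx.1 j
    rw [hj, ← hij] at this; linarith
  have hμsq : μ ^ 2 ≤ tau M ^ 2 := by nlinarith
  -- The numbers `p` and `q` below are the outer roots of `ξ³ - ξ = μ³ - μ`. Smallness of `τ`
  -- ensures that `μ` is the middle root.
  set d := √(4 - 3 * μ ^ 2) with hd
  have hd2 : d ^ 2 = 4 - 3 * μ ^ 2 := Real.sq_sqrt (by nlinarith)
  have hd0 : 0 ≤ d := Real.sqrt_nonneg _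
  have hd1 : 1 < d := by nlinarith
  have hμd : |μ| * 3 < d := by
    refine abs_lt_of_sq_lt_sq' ?_ hd0 |>.2
    rw [mul_pow, sq_abs]; nlinarith
  have hμd1 := (abs_lt.1 (by linarith [abs_nonneg μ] : |μ| < d / 3)).1
  have hμd2 := (abs_lt.1 (by linarith [abs_nonneg μ] : |μ| < d / 3)).2
  set p := (-μ + d) / 2 with hp
  set q := (-μ - d) / 2 with hq
  have hproot : p ^ 2 + p * μ + μ ^ 2 = 1 := by rw [hp]; linear_combination hd2 / 4
  have hqroot : q ^ 2 + q * μ + μ ^ 2 = 1 := by rw [hq]; linear_combination hd2 / 4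
  obtain ⟨ρ, hρ, hρp, hρq⟩ : ∃ ρ > 0, μ ^ 2 + ρ ≤ p ^ 2 ∧ μ ^ 2 + ρ ≤ q ^ 2 := by
    have h1 : μ ^ 2 < p ^ 2 := by
      have : 0 < (p - μ) * (p + μ) := mul_pos (by rw [hp]; linarith) (by rw [hp]; linarith)
      nlinarith
    have h2 : μ ^ 2 < q ^ 2 := by
      have : 0 < (μ - q) * (-q - μ) := mul_pos (by rw [hq]; linarith) (by rw [hq]; linarith)
      nlinarith
    exact ⟨min (p ^ 2 - μ ^ 2) (q ^ 2 - μ ^ 2), lt_min (sub_pos.2 h1) (sub_pos.2 h2),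
      by linarith [min_le_left (p ^ 2 - μ ^ 2) (q ^ 2 - μ ^ 2)],
      by linarith [min_le_right (p ^ 2 - μ ^ 2) (q ^ 2 - μ ^ 2)]⟩
  let g : ℝ → ℝ := fun s ↦ s ^ 4 / 4 - s ^ 2 / 2 - (μ ^ 3 - μ) * s
  have hne : i ≠ j := by rintro rfl; rw [hi] at hj; norm_num at hj
  -- All particles lie above the common value `μ` and all holes below it, so in the well tilted by
  -- `μ³ - μ` they cost at least `g p` and `g q` respectively, while the two sites `i` and `j` cost
  -- exactly `g μ`.
  have h1 : ∑ l, ((if coord a l = 1 then g p else g q) + (if l = i then g μ - g p else 0) +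
      if l = j then g μ - g q else 0) ≤ V (2 * M) 0 x := by
    rw [V_zero_eq_sum_tilted (μ ^ 3 - μ) x]
    refine Finset.sum_le_sum fun l _ ↦ ?_
    by_cases hli : l = i
    · subst hli
      rw [if_pos hi, if_pos rfl, if_neg hne]
      simp [g, hμ]
    by_cases hlj : l = j
    · subst hlj
      rw [hj, if_neg (by norm_num), if_pos rfl, if_neg hli]
      simp only [g, ← hij]
      linarith
    rw [if_neg hli, if_neg hlj, add_zero, add_zero]
    rcases ha l with hl | hl
    · rw [if_pos hl]
      have h2 := hx.2 l j hl hj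
      rw [← hij] at h2
      have h4 : g p + ρ / 4 * (coord x l - p) ^ 2 ≤ g (coord x l) :=
        tilted_well_le hproot (mul_nonneg (by rw [hp]; linarith) (by linarith)) hρ hρp
      have h3 : 0 ≤ ρ / 4 * (coord x l - p) ^ 2 := by positivity
      exact le_trans (by linarith) h4
    · rw [hl, if_neg (by norm_num)]
      have h2 := hx.2 i l hi hl
      have h4 : g q + ρ / 4 * (coord x l - q) ^ 2 ≤ g (coord x l) :=
        tilted_well_le hqroot (mul_nonneg_of_nonpos_of_nonpos (by rw [hq]; linarith)
          (by linarith)) hρ hρq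
      have h3 : 0 ≤ ρ / 4 * (coord x l - q) ^ 2 := by positivity
      exact le_trans (by linarith) h4
  rw [Finset.sum_add_distrib, Finset.sum_add_distrib, ha.sum_ite] at h1
  simp only [Finset.sum_ite_eq', Finset.mem_univ, if_true] at h1
  refine le_trans ?_ h1
  have hpq : g p + g q = -(2 - μ ^ 2) / 4 + 3 / 4 * (μ ^ 3 - μ) * μ := by
    have e1 : g p = -p ^ 2 / 4 - 3 / 4 * (μ ^ 3 - μ) * p := by
      simp only [g]
      linear_combination (p ^ 2 / 4 - p * μ / 4) * hproot
    have e2 : g q = -q ^ 2 / 4 - 3 / 4 * (μ ^ 3 - μ) * q := by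
      simp only [g]
      linear_combination (q ^ 2 / 4 - q * μ / 4) * hqroot
    rw [e1, e2, hp, hq]
    linear_combination (-1 / 8) * hd2
  have hval : (M : ℝ) * g p + M * g q + (g μ - g p) + (g μ - g q) =
      -(M - 1) / 2 - (M - 3) / 2 * μ ^ 2 + 3 / 4 * (M - 3) * (μ ^ 2) ^ 2 := by
    have e3 : g μ = -3 / 4 * μ ^ 4 + μ ^ 2 / 2 := by simp only [g]; ring
    rw [e3]
    linear_combination ((M : ℝ) - 1) * hpq
  rw [hval, saddleLevel]
  -- The lower bound decreases with `μ²` as long as `μ²` is at most `1 / 3`, so the worst case is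
  -- `μ² = τ²`.
  have hq1 : (M - 3) / 2 * μ ^ 2 - 3 / 4 * (M - 3) * (μ ^ 2) ^ 2 ≤
      (M - 3) / 2 * tau M ^ 2 - 3 / 4 * (M - 3) * (tau M ^ 2) ^ 2 := by
    have : 0 ≤ (M - 3) * ((tau M ^ 2 - μ ^ 2) * (1 / 2 - 3 / 4 * (tau M ^ 2 + μ ^ 2))) := by
      refine mul_nonneg (by linarith) (mul_nonneg (by linarith) (by linarith))
    linarith
  have hq2 : 0 ≤ ((M : ℝ) - 3) * (M - 4) * tau M ^ 2 := by
    refine mul_nonneg (mul_nonneg (by linarith) (by linarith)) (by positivity)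
  have hq3 : (M : ℝ) * (M - 1) / 4 * tau M ^ 2 =
      1 / 2 - (M - 3) / 2 * tau M ^ 2 - ((M : ℝ) - 3) * (M - 4) * tau M ^ 2 / 4 := by
    linear_combination ht / 2
  linarith

/-- Two things can happen on the boundary. Either a coordinate has reached its value at the saddle
for that site, and the energy grows quadratically away from this saddle; or a particle and a hole
are level, which is uniformly more expensive. -/
theorem exists_spin_front_bound (hM : 4 ≤ M) : ∃ ρ > 0, ∀ a : S (2 * M), IsSpin a →
    ∀ x ∈ closedSpinRegion a, x ∉ spinRegion a →
      (∃ k, saddleLevel M + ρ * ‖x - saddle a k‖ ^ 2 ≤ V (2 * M) 0 x) ∨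
        saddleLevel M + ρ ≤ V (2 * M) 0 x := by
  obtain ⟨ρ, hρ, hb⟩ := saddleLevel_add_le hM
  have hM' : (4 : ℝ) ≤ M := by exact_mod_cast hM
  have ht := tau_sq (M := M)
  have ht0 := tau_pos (M := M)
  refine ⟨min ρ (tau M ^ 2 / 4), lt_min hρ (by positivity), fun a ha x hx hxR ↦ ?_⟩
  by_cases hk : ∃ k, coord a k * coord x k = -tau M
  · left
    obtain ⟨k, hk⟩ := hk
    have hs := ha.mul_self k
    refine ⟨k, le_trans ?_ (add_dist_le_V_zero (c := saddle a k) (k := k) (ρ := tau M ^ 2)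
      (by positivity) ?_ (fun l hl ↦ ?_) (fun l hl ↦ ?_) (fun l hl ↦ ?_))⟩
    · rw [V_zero_saddle hM ha]
      gcongr
      exact min_le_right _ _
    · rw [coord_saddle_self, ← hk]; linear_combination -coord x k * hs
    · rw [coord_saddle_self]
      rcases ha.eq_or k l with h | h
      · rw [coord_saddle_same hl h]
        linear_combination (tau M ^ 2 * ((M : ℝ) ^ 2 - 3 * M + 3)) * hs + ht
      · rw [coord_saddle_opp ha h]
        linear_combination (tau M ^ 2 * ((M : ℝ) ^ 2 - 3 * M + 3)) * hs + ht
    · rw [coord_saddle_self]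
      rcases ha.eq_or k l with h | h
      · rw [coord_saddle_same hl h]
        have h1 := hx.1 l
        rw [h] at h1
        have h2 : ((M - 1) * tau M * coord a k - -tau M * coord a k) *
            (coord x l - -tau M * coord a k) = M * tau M * (coord a k * coord x l + tau M) := by
          linear_combination (M * tau M ^ 2) * hs
        rw [h2]
        exact mul_nonneg (by positivity) (by linarith)
      · rw [coord_saddle_opp ha h]
        -- Here the ordering of particles above holes is used: once site `k` is at the critical
        -- value, all sites of opposite sign are beyond it.
        have h1 : coord a k * coord x l ≤ -tau M := by
          rw [← hk]
          rcases ha k with hk1 | hk1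
          · rw [hk1, one_mul, one_mul]
            exact hx.2 k l hk1 (by rw [h, hk1])
          · have := hx.2 l k (by rw [h, hk1]; norm_num) hk1
            rw [hk1]; linarith
        have h2 : (-((M - 2) * tau M * coord a k) - -tau M * coord a k) *
            (coord x l - -tau M * coord a k) = (M - 3) * tau M * (-tau M - coord a k * coord x l) := by
          linear_combination (-(M - 3) * tau M ^ 2) * hs
        rw [h2]
        exact mul_nonneg (mul_nonneg (by linarith) ht0.le) (by linarith)
    · rw [coord_saddle_self]
      have h0 : (-tau M * coord a k) ^ 2 = tau M ^ 2 := by linear_combination tau M ^ 2 * hs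
      rw [h0]
      have h3 : 0 < tau M ^ 2 := by positivity
      rcases ha.eq_or k l with h | h
      · rw [coord_saddle_same hl h]
        have : ((M - 1) * tau M * coord a k) ^ 2 = (M - 1) ^ 2 * tau M ^ 2 := by
          linear_combination (M - 1) ^ 2 * tau M ^ 2 * hs
        rw [this]
        have h4 : (2 : ℝ) ≤ (M - 1) ^ 2 := by nlinarith
        nlinarith
      · rw [coord_saddle_opp ha h]
        have : (-((M - 2) * tau M * coord a k)) ^ 2 = (M - 2) ^ 2 * tau M ^ 2 := by
          linear_combination (M - 2) ^ 2 * tau M ^ 2 * hs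
        rw [this]
        have h4 : (2 : ℝ) ≤ (M - 2) ^ 2 := by nlinarith
        nlinarith
  · right
    push Not at hk
    obtain ⟨i, j, hi, hj, hij⟩ : ∃ i j, coord a i = 1 ∧ coord a j = -1 ∧ coord x i = coord x j := by
      by_contra! hcon
      exact hxR ⟨fun k ↦ lt_of_le_of_ne (hx.1 k) (hk k).symm,
        fun i j hi hj ↦ lt_of_le_of_ne (hx.2 i j hi hj) (hcon i j hi hj).symm⟩
    refine le_trans ?_ (hb a ha x hx i j hi hj hij)
    gcongr
    exact min_le_left _ _

theorem saddleLevel_le_of_front (hM : 4 ≤ M) {a x : S (2 * M)} (ha : IsSpin a)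
    (hx : x ∈ closedSpinRegion a) (hxR : x ∉ spinRegion a) : saddleLevel M ≤ V (2 * M) 0 x := by
  obtain ⟨ρ, hρ, hb⟩ := exists_spin_front_bound hM
  rcases hb a ha x hx hxR with ⟨k, hk⟩ | hk
  · have : 0 ≤ ρ * ‖x - saddle a k‖ ^ 2 := by positivity
    linarith
  · linarith

end MassConserving

/-! ## Stationary points in the regions -/

namespace MassConserving

open Landscape GradFlow

variable {M : ℕ}

/-- The lowest root satisfies `3b² - 1 = (m - b)(t - b) ≥ 0`, whereas `τ² ≤ 1 / 7`. -/
theorem lowest_root_lt (hM : 4 ≤ M) {t m b : ℝ} (hbm : b ≤ m) (hmt : m ≤ t) (hsum : t + m + b = 0)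
    (hroot : t ^ 2 + t * m + m ^ 2 = 1) : b < -tau M := by
  have h7 := tau_sq_le hM
  have ht0 := tau_pos (M := M)
  have hb : b = -t - m := by linarith
  have hb0 : b ≤ 0 := by linarith
  have h3 : 1 ≤ 3 * b ^ 2 := by
    subst hb
    nlinarith [mul_nonneg (sub_nonneg.2 hbm) (sub_nonneg.2 hmt),
      mul_nonneg (sub_nonneg.2 hbm) (sub_nonneg.2 (hbm.trans hmt)), sq_nonneg (t - m)]
  by_contra hcon
  push Not at hcon
  nlinarith

/-- If `n` particles are at the middle root, the zero sum gives `(M - n) m = -n t`. For `n = 0` the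
roots are `1, 0, -1`. For `n ≥ 1` the root equation gives `m² ≥ τ²`, with equality at `n = 1`, so
these particles would have reached the saddle value. -/
theorem eq_spin_of_holes_lowest (hM : 4 ≤ M) {a x : S (2 * M)} (ha : IsSpin a)
    {t m b : ℝ} (hbm : b ≤ m) (hmt : m ≤ t) (hsum : t + m + b = 0)
    (hroot : t ^ 2 + t * m + m ^ 2 = 1) (hpart : ∀ k, coord a k = 1 → coord x k = t ∨ coord x k = m)
    (hhole : ∀ k, coord a k = -1 → coord x k = b)
    (hlow : ∀ k, -tau M < coord a k * coord x k) : x = a := by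
  have hM' : (4 : ℝ) ≤ M := by exact_mod_cast hM
  have ht := tau_sq (M := M)
  have ht0 := tau_pos (M := M)
  have hbneg := lowest_root_lt hM hbm hmt hsum hroot
  set F := Finset.univ.filter fun k ↦ coord a k = 1 ∧ coord x k ≠ t with hF
  have hsplit : ∀ k, coord x k = (if coord a k = 1 then t else b) +
      if coord a k = 1 ∧ coord x k ≠ t then m - t else 0 := by
    intro k
    rcases ha k with hk | hk
    · by_cases hkt : coord x k = t
      · simp [hk, hkt]
      · rw [if_pos hk, if_pos ⟨hk, hkt⟩, (hpart k hk).resolve_left hkt]; ring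
    · rw [hk, hhole k hk]
      norm_num
  have h0 := sum_coord x
  rw [Finset.sum_congr rfl fun k _ ↦ hsplit k, Finset.sum_add_distrib, ha.sum_ite,
    ← Finset.sum_filter, Finset.sum_const, nsmul_eq_mul, ← hF] at h0
  have hn : F.card ≤ M := by
    refine (Finset.card_le_card fun k hk ↦ ?_).trans ha.card_eq.le
    simp only [hF, Finset.mem_filter, Finset.mem_univ, true_and] at hk ⊢
    exact hk.1
  have hn' : (F.card : ℝ) ≤ M := by exact_mod_cast hn
  have hb : b = -t - m := by linarith
  have hrel : ((M : ℝ) - F.card) * m = -(F.card * t) := by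
    rw [hb] at h0; linear_combination -h0
  rcases F.eq_empty_or_nonempty with he | ⟨k, hk⟩
  · rw [he, Finset.card_empty, Nat.cast_zero] at hrel
    have hm : m = 0 := by
      have : (M : ℝ) * m = 0 := by linarith
      rcases mul_eq_zero.1 this with h | h
      · linarith
      · exact h
    rw [hm] at hroot hmt hb
    have ht1 : t = 1 := by nlinarith
    refine coord_ext fun k ↦ ?_
    rcases ha k with hk | hk
    · have : k ∉ F := by rw [he]; exact Finset.notMem_empty k
      simp only [hF, Finset.mem_filter, Finset.mem_univ, true_and, hk, ne_eq, not_not] at this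
      rw [this, ht1, hk]
    · rw [hhole k hk, hb, ht1, hk]; norm_num
  · exfalso
    have hn1 : (1 : ℝ) ≤ F.card := by
      have : 0 < F.card := Finset.card_pos.2 ⟨k, hk⟩
      exact_mod_cast this
    simp only [hF, Finset.mem_filter, Finset.mem_univ, true_and] at hk
    have hkm := (hpart k hk.1).resolve_left hk.2
    have h1 := hlow k
    rw [hk.1, hkm, one_mul] at h1
    set n : ℝ := (F.card : ℝ) with hnn
    have htpos : 0 < t := by linarith
    have hm0 : m < 0 := by
      by_contra hcon
      push Not at hcon
      nlinarith [mul_nonneg (sub_nonneg.2 hn') hcon]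
    have hm2 : m ^ 2 < tau M ^ 2 := by nlinarith
    have hm3 : m ^ 2 * ((M : ℝ) ^ 2 - 3 * M + 3) < 1 := by
      rw [← ht]
      exact mul_lt_mul_of_pos_right hm2 (by nlinarith)
    -- The root equation after elimination of `t`; it determines `m²` from the number `n` of middle
    -- coordinates.
    have hkey : n ^ 2 = m ^ 2 * ((M : ℝ) ^ 2 - 3 * M * n + 3 * n ^ 2) := by
      linear_combination (-n ^ 2) * hroot - (m * (M - n) - n * t - n * m) * hrel
    have h5 : n ^ 2 * (m ^ 2 * ((M : ℝ) ^ 2 - 3 * M + 3)) < n ^ 2 * 1 :=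
      mul_lt_mul_of_pos_left hm3 (pow_pos (by linarith) 2)
    have h6 : 0 ≤ m ^ 2 * ((n - 1) * (M * ((n + 1) * M - 3 * n))) := by
      refine mul_nonneg (sq_nonneg _) (mul_nonneg (by linarith) (mul_nonneg (by linarith) ?_))
      nlinarith
    linarith

/-- Below the saddles there are no stationary points in the region of a configuration, except this
configuration. -/
theorem eq_of_mem_closedSpinRegion (hM : 4 ≤ M) {a x : S (2 * M)} (ha : IsSpin a)
    (hx : x ∈ closedSpinRegion a) (hG : (fam (2 * M)).G₀ x = 0)
    (hV : V (2 * M) 0 x < saddleLevel M) : x = a := by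
  have hxR : x ∈ spinRegion a := by
    by_contra hcon
    exact absurd (saddleLevel_le_of_front hM ha hx hcon) (not_le.2 hV)
  have ht0 := tau_pos (M := M)
  obtain ⟨l, hl⟩ := (G₀_eq_zero_iff x).1 hG
  have hi : ∃ i, coord a i = 1 := by
    have := ha.card_eq
    obtain ⟨i, hi⟩ := Finset.card_pos.1 (by rw [this]; omega)
    exact ⟨i, by simpa using hi⟩
  have hj : ∃ j, coord a j = -1 := by
    have := ha.neg.card_eq
    obtain ⟨i, hi⟩ := Finset.card_pos.1 (by rw [this]; omega)
    exact ⟨i, by simpa [neg_eq_iff_eq_neg] using hi⟩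
  have hx0 : x ≠ 0 := by
    rintro rfl
    obtain ⟨i, hi⟩ := hi
    obtain ⟨j, hj⟩ := hj
    simpa using hxR.2 i j hi hj
  obtain ⟨t, m, b, hbm, hmt, hsum, hroot, -, hval⟩ := exists_roots hl hx0
  have hb := lowest_root_lt hM hbm hmt hsum hroot
  have ht : -t < -tau M := lowest_root_lt hM (neg_le_neg hmt) (neg_le_neg hbm)
    (by linarith)
      (by rw [show b = -t - m by linarith]; linear_combination hroot : (-b) ^ 2 + (-b) * (-m) + (-m) ^ 2 = 1)
  have hpart : ∀ k, coord a k = 1 → coord x k = t ∨ coord x k = m := by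
    intro k hk
    have h1 := hxR.1 k
    rw [hk, one_mul] at h1
    rcases hval k with h | h | h
    · exact Or.inl h
    · exact Or.inr h
    · linarith
  have hhole : ∀ k, coord a k = -1 → coord x k = m ∨ coord x k = b := by
    intro k hk
    have h1 := hxR.1 k
    rw [hk] at h1
    rcases hval k with h | h | h
    · linarith
    · exact Or.inl h
    · exact Or.inr h
  -- The middle root cannot be shared by particles and holes because of the strict ordering. If
  -- holes use it, the reflection `x ↦ -x` exchanges the roles.
  by_cases hmid : ∃ j, coord a j = -1 ∧ coord x j ≠ b
  · obtain ⟨j, hj, hjb⟩ := hmid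
    have hjm := (hhole j hj).resolve_right hjb
    have hpart' : ∀ k, coord a k = 1 → coord x k = t := by
      intro k hk
      refine (hpart k hk).resolve_right fun hkm ↦ ?_
      have := hxR.2 k j hk hj
      rw [hkm, hjm] at this
      exact lt_irrefl _ this
    have := eq_spin_of_holes_lowest hM ha.neg (x := -x) (t := -b) (m := -m) (b := -t)
      (neg_le_neg hmt) (neg_le_neg hbm) (by linarith)
      (by rw [show b = -t - m by linarith]; linear_combination hroot)
      (fun k hk ↦ by
        rw [coord_neg, neg_eq_iff_eq_neg] at hk
        rw [coord_neg]
        rcases hhole k hk with h | h <;> simp [h])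
      (fun k hk ↦ by
        rw [coord_neg, neg_inj] at hk
        rw [coord_neg, hpart' k hk])
      (fun k ↦ by simpa using hxR.1 k)
    exact neg_injective this
  · push Not at hmid
    exact eq_spin_of_holes_lowest hM ha hbm hmt hsum hroot hpart hmid hxR.1

theorem middle_count_bound {M n : ℝ} (hM : 4 ≤ M) (hn1 : 1 ≤ n) (hn : n ≤ M - 1) :
    0 ≤ (n + 2) ^ 2 * (M ^ 2 - 3 * M + 2) - (M + 1 - n) ^ 2 + (n + 2) * (M + 1 - n) := by
  have e1 : (9 : ℝ) ≤ (n + 2) ^ 2 := by nlinarith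
  have e2 : (0 : ℝ) ≤ M ^ 2 - 3 * M + 2 := by nlinarith
  have e3 : (M + 1 - n) ^ 2 ≤ M ^ 2 := pow_le_pow_left₀ (by linarith) (by linarith) 2
  have e4 : 0 ≤ (n + 2) * (M + 1 - n) := mul_nonneg (by linarith) (by linarith)
  have e5 : (0 : ℝ) ≤ 8 * M ^ 2 - 27 * M + 18 := by nlinarith
  have e6 := mul_le_mul_of_nonneg_right e1 e2
  linarith

/-- Again the middle root is excluded by counting. Among the `M - 1` upper sites it would have to
lie between `-τ` and `0`, which the zero sum forbids. Among the `M + 1` lower sites it would have to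
be below `-τ`, which is excluded for each possible multiplicity. Only the outer roots remain, and
the zero sum fixes their values. -/
theorem eq_product_of_mem_aux (hM : 4 ≤ M) {a x : S (2 * M)} (ha : IsSpin a) {k : Fin (2 * M)}
    (hk : coord a k = 1) (hG : (fam (2 * M)).G₀ x = 0)
    (hup : ∀ l, l ≠ k → coord a l = 1 → -tau M < coord x l)
    (hdown : ∀ l, l = k ∨ coord a l = -1 → coord x l < -tau M) : x = product a k := by
  have hM' : (4 : ℝ) ≤ M := by exact_mod_cast hM
  have htau := tau_sq (M := M)
  have ht0 := tau_pos (M := M)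
  obtain ⟨l, hl⟩ := (G₀_eq_zero_iff x).1 hG
  have hx0 : x ≠ 0 := by
    rintro rfl
    have := hdown k (Or.inl rfl)
    rw [coord_zero] at this
    linarith
  obtain ⟨t, m, b, hbm, hmt, hsum, hroot, -, hval⟩ := exists_roots hl hx0
  have hb := lowest_root_lt hM hbm hmt hsum hroot
  have ht : -t < -tau M := lowest_root_lt hM (neg_le_neg hmt) (neg_le_neg hbm)
    (by linarith)
      (by rw [show b = -t - m by linarith]; linear_combination hroot : (-b) ^ 2 + (-b) * (-m) + (-m) ^ 2 = 1)
  have hbe : b = -t - m := by linarith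
  have hup' : ∀ l, l ≠ k → coord a l = 1 → coord x l = t ∨ coord x l = m := by
    intro l hlk hl1
    have h1 := hup l hlk hl1
    rcases hval l with h | h | h
    · exact Or.inl h
    · exact Or.inr h
    · linarith
  have hdown' : ∀ l, l = k ∨ coord a l = -1 → coord x l = m ∨ coord x l = b := by
    intro l hl
    have h1 := hdown l hl
    rcases hval l with h | h | h
    · linarith
    · exact Or.inl h
    · exact Or.inr h
  have hk0 : coord a k ≠ -1 := by rw [hk]; norm_num
  -- the sum of the reference values
  have href : ∑ l, ((if coord a l = 1 then t else b) + if l = k then b - t else 0) =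
      (M - 1) * t + (M + 1) * b := by
    rw [Finset.sum_add_distrib, ha.sum_ite]
    simp only [Finset.sum_ite_eq', Finset.mem_univ, if_true]
    ring
  by_cases hmid : ∃ l, (l ≠ k ∧ coord a l = 1) ∧ coord x l ≠ t
  · -- a majority of coordinates at the lowest root
    exfalso
    set F := Finset.univ.filter fun l ↦ (l ≠ k ∧ coord a l = 1) ∧ coord x l ≠ t with hF
    obtain ⟨l₀, hl₀⟩ := hmid
    have hl₀m := (hup' l₀ hl₀.1.1 hl₀.1.2).resolve_left hl₀.2
    have hmτ : -tau M < m := hl₀m ▸ hup l₀ hl₀.1.1 hl₀.1.2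
    have hsplit : ∀ l, coord x l = ((if coord a l = 1 then t else b) + if l = k then b - t else 0) +
        if (l ≠ k ∧ coord a l = 1) ∧ coord x l ≠ t then m - t else 0 := by
      intro l
      by_cases hlk : l = k
      · subst hlk
        have : coord x l = b := (hdown' l (Or.inl rfl)).resolve_left fun h ↦ by
          have := hdown l (Or.inl rfl); linarith
        simp [hk, this]
      rcases ha l with h1 | h1
      · by_cases hlt : coord x l = t
        · simp [h1, hlt, hlk]
        · rw [if_pos h1, if_neg hlk, if_pos ⟨⟨hlk, h1⟩, hlt⟩, (hup' l hlk h1).resolve_left hlt]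
          ring
      · have : coord x l = b := (hdown' l (Or.inr h1)).resolve_left fun h ↦ by
          have := hdown l (Or.inr h1); linarith
        rw [this, h1]
        norm_num [hlk]
    have h0 := sum_coord x
    rw [Finset.sum_congr rfl fun k _ ↦ hsplit k, Finset.sum_add_distrib, href,
      ← Finset.sum_filter, Finset.sum_const, nsmul_eq_mul, ← hF] at h0
    have hn : F.card ≤ M - 1 := by
      have h1 := Finset.card_erase_of_mem (s := Finset.univ.filter fun l ↦ coord a l = 1)
        (a := k) (by simp [hk])
      rw [ha.card_eq] at h1
      refine (Finset.card_le_card fun l hl ↦ ?_).trans h1.le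
      simp only [hF, Finset.mem_filter, Finset.mem_univ, true_and, Finset.mem_erase] at hl ⊢
      exact hl.1
    have hn' : (F.card : ℝ) ≤ M - 1 := by
      have : F.card + 1 ≤ M := by omega
      have : (F.card : ℝ) + 1 ≤ M := by exact_mod_cast this
      linarith
    have hn1 : (1 : ℝ) ≤ F.card := by
      have : 0 < F.card := Finset.card_pos.2 ⟨l₀, by simpa [hF] using hl₀⟩
      exact_mod_cast this
    set n : ℝ := (F.card : ℝ) with hnn
    have hrel : (M + 1 - n) * m = -((n + 2) * t) := by rw [hbe] at h0; linear_combination -h0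
    have hm0 : m < 0 := by
      by_contra hcon
      push Not at hcon
      nlinarith [mul_nonneg (by linarith : 0 ≤ M + 1 - n) hcon]
    have hm2 : m ^ 2 < tau M ^ 2 := by nlinarith
    have hm3 : m ^ 2 * ((M : ℝ) ^ 2 - 3 * M + 3) < 1 := by
      rw [← htau]
      exact mul_lt_mul_of_pos_right hm2 (by nlinarith)
    -- The root equation after elimination of `t`. Together with `m² < τ²` it contradicts the
    -- polynomial inequality `middle_count_bound`.
    have hkey : (n + 2) ^ 2 = m ^ 2 * ((M + 1 - n) ^ 2 - (n + 2) * (M + 1 - n) + (n + 2) ^ 2) := by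
      linear_combination (-(n + 2) ^ 2) * hroot - (m * (M + 1 - n) - (n + 2) * t - (n + 2) * m) * hrel
    have h5 : (n + 2) ^ 2 * (m ^ 2 * ((M : ℝ) ^ 2 - 3 * M + 3)) < (n + 2) ^ 2 * 1 :=
      mul_lt_mul_of_pos_left hm3 (pow_pos (by linarith) 2)
    have h6 := middle_count_bound hM' hn1 hn'
    have h7 := mul_nonneg (sq_nonneg m) h6
    linarith
  · push Not at hmid
    set F := Finset.univ.filter fun l ↦ (l = k ∨ coord a l = -1) ∧ coord x l ≠ b with hF
    have hsplit : ∀ l, coord x l = ((if coord a l = 1 then t else b) + if l = k then b - t else 0) +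
        if (l = k ∨ coord a l = -1) ∧ coord x l ≠ b then m - b else 0 := by
      intro l
      by_cases hlk : l = k
      · subst hlk
        by_cases hlb : coord x l = b
        · simp [hk, hlb]
        · rw [if_pos hk, if_pos rfl, if_pos ⟨Or.inl rfl, hlb⟩,
            (hdown' l (Or.inl rfl)).resolve_right hlb]
          ring
      rcases ha l with h1 | h1
      · rw [hmid l ⟨hlk, h1⟩, h1]
        norm_num [hlk]
      · by_cases hlb : coord x l = b
        · rw [hlb, h1]; norm_num [hlk]
        · rw [if_neg (by rw [h1]; norm_num), if_neg hlk, if_pos ⟨Or.inr h1, hlb⟩,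
            (hdown' l (Or.inr h1)).resolve_right hlb]
          ring
    have h0 := sum_coord x
    rw [Finset.sum_congr rfl fun k _ ↦ hsplit k, Finset.sum_add_distrib, href,
      ← Finset.sum_filter, Finset.sum_const, nsmul_eq_mul, ← hF] at h0
    rcases F.eq_empty_or_nonempty with he | ⟨l₀, hl₀⟩
    · rw [he, Finset.card_empty, Nat.cast_zero, zero_mul, add_zero] at h0
      have ht1 : t = (M + 1) * sigma M := by
        have h1 : (t - (M + 1) * sigma M) * (t + (M + 1) * sigma M) = 0 := by
          have e : t ^ 2 * ((M : ℝ) ^ 2 + 3) = (M + 1) ^ 2 := by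
            rw [hbe] at h0
            linear_combination (M + 1) ^ 2 * hroot + ((M + 1) * m + (M - 1) * t) * h0
          have e2 := sigma_sq (M := M)
          linear_combination (t ^ 2) * (-1 : ℝ) * e2 + sigma M ^ 2 * e
        have h2 : 0 < (M + 1) * sigma M := mul_pos (by linarith) sigma_pos
        rcases mul_eq_zero.1 h1 with h | h
        · linarith
        · linarith
      have hb1 : b = -((M - 1) * sigma M) := by
        have : (M + 1) * (b + (M - 1) * sigma M) = 0 := by rw [ht1] at h0; linear_combination h0
        rcases mul_eq_zero.1 this with h | h
        · linarith
        · linarith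
      have hb' : ∀ l, l = k ∨ coord a l = -1 → coord x l = b := by
        intro l hl
        have : l ∉ F := by rw [he]; exact Finset.notMem_empty l
        simp only [hF, Finset.mem_filter, Finset.mem_univ, true_and, hl, ne_eq, not_not] at this
        exact this
      refine coord_ext fun l ↦ ?_
      by_cases hlk : l = k
      · rw [hlk, coord_product_self, hb' k (Or.inl rfl), hb1, hk]; ring
      rcases ha l with h1 | h1
      · rw [coord_product_same hlk (h1.trans hk.symm), hmid l ⟨hlk, h1⟩, ht1, hk]; ring
      · rw [coord_product_opp ha (by rw [h1, hk]), hb' l (Or.inr h1), hb1, hk]; ring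
    · exfalso
      have hn1 : (1 : ℝ) ≤ F.card := by
        have : 0 < F.card := Finset.card_pos.2 ⟨l₀, hl₀⟩
        exact_mod_cast this
      -- Multiplicity one gives exactly `m² = τ²`, the saddle itself; multiplicity two gives `m =
      -- 0`; from three on, `b ≤ m < 0` makes the zero-sum relation impossible for `M ≥ 4`.
      have hnat : F.card = 1 ∨ F.card = 2 ∨ 3 ≤ F.card := by
        have : 0 < F.card := Finset.card_pos.2 ⟨l₀, hl₀⟩
        omega
      simp only [hF, Finset.mem_filter, Finset.mem_univ, true_and] at hl₀
      have hmτ : m < -tau M := (hdown' l₀ hl₀.1).resolve_right hl₀.2 ▸ hdown l₀ hl₀.1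
      have hrel : ((F.card : ℝ) - M + 1) * m = (F.card - 2) * b := by
        rw [show t = -b - m by linarith] at h0; linear_combination h0
      rcases hnat with h | h | h
      · rw [h, Nat.cast_one] at hrel
        have hbm' : b = (M - 2) * m := by linarith
        have ht' : t = -(M - 1) * m := by linarith
        have h3 : m ^ 2 * ((M : ℝ) ^ 2 - 3 * M + 3) = 1 := by
          rw [ht'] at hroot; linear_combination hroot
        have h4 : tau M ^ 2 < m ^ 2 := by nlinarith
        have h5 := mul_lt_mul_of_pos_right h4
          (show 0 < (M : ℝ) ^ 2 - 3 * M + 3 by nlinarith)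
        linarith
      · rw [h] at hrel
        push_cast at hrel
        nlinarith
      · have h3 : (3 : ℝ) ≤ F.card := by exact_mod_cast h
        nlinarith

theorem product_mem_aux {a x : S (2 * M)} {k : Fin (2 * M)} (hM : 4 ≤ M) (ha : IsSpin a)
    {α β : ℝ} (hα : α = (M - 1) * tau M * coord a k) (hβ : β = -((M - 2) * tau M * coord a k))
    (hx : x ∈ IsGenericSaddle.region (saddle a k) k α β) :
    (∀ l, l ≠ k → coord a l = coord a k → -tau M < coord a k * coord x l) ∧
      ∀ l, l = k ∨ coord a l = -coord a k → coord a k * coord x l < -tau M := by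
  have hM' : (4 : ℝ) ≤ M := by exact_mod_cast hM
  have ht0 := tau_pos (M := M)
  have hs := ha.mul_self k
  have hgen := isGenericSaddle_saddle hM ha k
  rw [← hα, ← hβ] at hgen
  constructor
  · intro l hlk hl
    have h1 := hx l
    rw [IsGenericSaddle.pattern_eq_alpha hlk (by rw [coord_saddle_same hlk hl, hα]),
      coord_saddle_self, hα] at h1
    have h2 : ((M - 1) * tau M * coord a k - -tau M * coord a k) *
        (coord x l - -tau M * coord a k) = M * tau M * (coord a k * coord x l + tau M) := by
      linear_combination (M * tau M ^ 2) * hs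
    rw [h2] at h1
    have h3 : (0 : ℝ) < M * tau M := by positivity
    have := (mul_pos_iff_of_pos_left h3).1 h1
    linarith
  · intro l hl
    have h1 := hx l
    have hpat : IsGenericSaddle.pattern (saddle a k) k α β l = β := by
      rcases hl with rfl | hl
      · exact IsGenericSaddle.pattern_site
      · exact hgen.pattern_eq_beta (by rw [coord_saddle_opp ha hl, hβ])
    rw [hpat, coord_saddle_self, hβ] at h1
    have h2 : (-((M - 2) * tau M * coord a k) - -tau M * coord a k) *
        (coord x l - -tau M * coord a k) = (M - 3) * tau M * (-tau M - coord a k * coord x l) := by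
      linear_combination (-(M - 3) * tau M ^ 2) * hs
    rw [h2] at h1
    have h3 : (0 : ℝ) < (M - 3) * tau M := mul_pos (by linarith) ht0
    have := (mul_pos_iff_of_pos_left h3).1 h1
    linarith

/-- Below the saddles there is only one stationary point in the region behind a saddle. -/
theorem eq_product_of_mem (hM : 4 ≤ M) {a x : S (2 * M)} (ha : IsSpin a) {k : Fin (2 * M)}
    (hx : x ∈ IsGenericSaddle.closedRegion (saddle a k) k ((M - 1) * tau M * coord a k)
      (-((M - 2) * tau M * coord a k)))
    (hG : (fam (2 * M)).G₀ x = 0) (hV : V (2 * M) 0 x < saddleLevel M) : x = product a k := by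
  have hgen := isGenericSaddle_saddle hM ha k
  have hxR : x ∈ IsGenericSaddle.region (saddle a k) k ((M - 1) * tau M * coord a k)
      (-((M - 2) * tau M * coord a k)) := by
    by_contra hcon
    have := hgen.le_V_zero_of_front hx hcon
    rw [V_zero_saddle hM ha] at this
    linarith
  obtain ⟨h1, h2⟩ := product_mem_aux hM ha rfl rfl hxR
  rcases ha k with hk | hk
  · simp only [hk, one_mul] at h1 h2
    exact eq_product_of_mem_aux hM ha hk hG h1 h2
  · have hG' : (fam (2 * M)).G₀ (-x) = 0 := by
      obtain ⟨l, hl⟩ := (G₀_eq_zero_iff x).1 hG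
      exact (G₀_eq_zero_iff _).2 ⟨-l, fun i ↦ by rw [coord_neg, ← hl i]; ring⟩
    simp only [hk, neg_one_mul, neg_neg] at h1 h2
    have := eq_product_of_mem_aux hM ha.neg (k := k) (x := -x) (by simp [hk]) hG'
      (fun l hlk hl ↦ by
        rw [coord_neg, neg_eq_iff_eq_neg] at hl
        simpa using h1 l hlk hl)
      (fun l hl ↦ by
        rw [coord_neg, neg_inj] at hl
        simpa using h2 l hl)
    rw [product_neg] at this
    exact neg_injective this

end MassConserving

/-! ## The index of the stationary points -/

namespace MassConserving

open Landscape GradFlow Metric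

variable {N : ℕ}

/-- Definiteness of the Hessian on a subspace is stable under perturbations. -/
theorem eventually_definite (c : S N) (U : Submodule ℝ (S N)) {s : ℝ} (hs : s = 1 ∨ s = -1)
    (h : ∀ w ∈ U, w ≠ 0 → 0 < s * inner ℝ (fderiv ℝ (fam N).G₀ c w) w) :
    ∃ r > 0, ∀ᶠ γ in 𝓝[≥] (0 : ℝ), ∀ x ∈ closedBall c r, ∀ w ∈ U, w ≠ 0 →
      0 < s * hessian (V N γ) x w w := by
  obtain ⟨κ, hκ, hU⟩ := exists_coercive (s • fderiv ℝ (fam N).G₀ c) U (fun w hw hw0 ↦ by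
    simpa [inner_smul_left] using h w hw hw0)
  obtain ⟨r, hr, hcl⟩ := (fam N).eventually_fderiv_close c (half_pos hκ)
  refine ⟨r, hr, hcl.mono fun γ hγ x hx w hw hw0 ↦ ?_⟩
  have h1 := hU w hw
  have h2 : |inner ℝ ((fderiv ℝ ((fam N).G γ) x - fderiv ℝ (fam N).G₀ c) w) w| ≤
      κ / 2 * ‖w‖ ^ 2 := by
    refine (abs_real_inner_le_norm _ _).trans ?_
    have h3 := ContinuousLinearMap.le_of_opNorm_le _ (hγ x hx) w
    calc _ ≤ κ / 2 * ‖w‖ * ‖w‖ := mul_le_mul_of_nonneg_right h3 (norm_nonneg _)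
      _ = _ := by ring
  have h4 : 0 < ‖w‖ := norm_pos_iff.2 hw0
  rw [hessian_eq]
  simp only [smul_apply, inner_smul_left, conj_trivial] at h1
  rw [sub_apply, inner_sub_left] at h2
  have h5 : 0 < κ * ‖w‖ ^ 2 := by positivity
  obtain ⟨h6, h7⟩ := abs_le.1 h2
  rcases hs with rfl | rfl <;> linarith

theorem nondegenerate_of_pos {γ : ℝ} {x : S N} (h : ∀ w ≠ 0, 0 < hessian (V N γ) x w w) :
    (hessian (V N γ) x).Nondegenerate := by
  refine nondegenerate_of_symm (hessian_symm γ x) fun v hv ↦ ?_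
  by_contra hv0
  exact absurd (hv v) (h v hv0).ne'

theorem mem_stationary_zero_of_pos {γ : ℝ} {x : S N} (h0 : (fam N).G γ x = 0)
    (h : ∀ w ≠ 0, 0 < hessian (V N γ) x w w) : x ∈ stationaryOfIndex (V N γ) 0 :=
  ⟨⟨by rw [← fam_G, h0], nondegenerate_of_pos h⟩,
    morseIndex_eq_zero fun w ↦ by
      by_cases hw : w = 0
      · simp [hw]
      · exact (h w hw).le⟩

theorem mem_stationary_one_of_slice {γ : ℝ} {x : S N} (h0 : (fam N).G γ x = 0) (f : S N →L[ℝ] ℝ)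
    (hf : ∀ w, f w = 0 → w ≠ 0 → 0 < hessian (V N γ) x w w) {v : S N}
    (hv : hessian (V N γ) x v v < 0) : x ∈ stationaryOfIndex (V N γ) 1 := by
  have hfv : f v ≠ 0 := fun h ↦ by
    have hv0 : v ≠ 0 := by rintro rfl; simp at hv
    exact absurd (hf v h hv0) (not_lt.2 hv.le)
  refine ⟨⟨by rw [← fam_G, h0], nondegenerate_of_symm (hessian_symm γ x) fun y hy ↦ ?_⟩,
    morseIndex_eq_one (f : S N →ₗ[ℝ] ℝ) (fun w hw ↦ ?_) hv⟩
  · by_contra hy0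
    by_cases hfy : f y = 0
    · exact absurd (hy y) (hf y hfy hy0).ne'
    · have h1 : f (v - (f v / f y) • y) = 0 := by
        rw [map_sub, map_smul, smul_eq_mul, div_mul_cancel₀ _ hfy, sub_self]
      have h2 : hessian (V N γ) x (v - (f v / f y) • y) (v - (f v / f y) • y) =
          hessian (V N γ) x v v := by
        have h3 : ∀ w, hessian (V N γ) x w y = 0 := fun w ↦ by rw [hessian_symm]; exact hy w
        simp [hy, h3]
      have h3 : v - (f v / f y) • y ≠ 0 := by
        intro h0
        rw [h0] at h2
        simp only [map_zero] at h2
        exact hv.ne h2.symm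
      have := hf _ h1 h3
      rw [h2] at this
      exact lt_asymm this hv
  · by_cases hw0 : w = 0
    · simp [hw0]
    · exact (hf w hw hw0).le

theorem inner_fderiv_pos {c : S N} (h : ∀ k, 1 < 3 * coord c k ^ 2) {w : S N} (hw : w ≠ 0) :
    0 < inner ℝ (fderiv ℝ (fam N).G₀ c w) w := by
  rw [inner_fderiv_G₀]
  obtain ⟨k, hk⟩ : ∃ k, coord w k ≠ 0 := by
    by_contra! hcon
    exact hw (coord_ext fun i ↦ by simp [hcon i])
  refine Finset.sum_pos' (fun i _ ↦ ?_) ⟨k, Finset.mem_univ _, ?_⟩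
  · rw [mul_assoc]
    exact mul_nonneg (by linarith [h i]) (mul_self_nonneg _)
  · rw [mul_assoc]
    exact mul_pos (by linarith [h k]) (mul_self_pos.2 hk)

theorem inner_fderiv_pos_of_slice {c : S N} {i : Fin N} (h : ∀ k ≠ i, 1 < 3 * coord c k ^ 2)
    {w : S N} (hwi : coord w i = 0) (hw : w ≠ 0) : 0 < inner ℝ (fderiv ℝ (fam N).G₀ c w) w := by
  rw [inner_fderiv_G₀]
  obtain ⟨k, hk⟩ : ∃ k, coord w k ≠ 0 := by
    by_contra! hcon
    exact hw (coord_ext fun i ↦ by simp [hcon i])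
  have hki : k ≠ i := by rintro rfl; exact hk hwi
  refine Finset.sum_pos' (fun j _ ↦ ?_) ⟨k, Finset.mem_univ _, ?_⟩
  · by_cases hji : j = i
    · subst hji; simp [hwi]
    · rw [mul_assoc]
      exact mul_nonneg (by linarith [h j hji]) (mul_self_nonneg _)
  · rw [mul_assoc]
    exact mul_pos (by linarith [h k hki]) (mul_self_pos.2 hk)

/-- If less than a third of the coordinates is at the middle root, then the inverses of the diagonal
entries of the Hessian have a positive sum. -/
theorem sum_inv_pos {c : S N} {t m b : ℝ} (hbm : b < m) (hmt : m < t) (hsum : t + m + b = 0)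
    (hroot : t ^ 2 + t * m + m ^ 2 = 1) (hval : ∀ i, coord c i = t ∨ coord c i = m ∨ coord c i = b)
    (hn : 3 * (Finset.univ.filter fun k ↦ coord c k = m).card < N) :
    0 < ∑ k, (3 * coord c k ^ 2 - 1)⁻¹ := by
  set n := (Finset.univ.filter fun k ↦ coord c k = m).card with hnn
  set p := (Finset.univ.filter fun k ↦ coord c k = t).card with hpp
  set q := (Finset.univ.filter fun k ↦ coord c k = b).card with hqq
  have hform : ∀ f : ℝ → ℝ, ∑ k, f (coord c k) = n * f m + p * f t + q * f b := by
    intro f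
    have h1 : ∀ k, f (coord c k) = (if coord c k = m then f m else 0) +
        (if coord c k = t then f t else 0) + if coord c k = b then f b else 0 := by
      intro k
      rcases hval k with h | h | h <;> rw [h]
      · simp [hmt.ne', (hbm.trans hmt).ne']
      · simp [hmt.ne, hbm.ne']
      · simp [hbm.ne, (hbm.trans hmt).ne]
    simp only [h1, Finset.sum_add_distrib, ← Finset.sum_filter, Finset.sum_const, nsmul_eq_mul,
      hnn, hpp, hqq]
  have h0 : (n : ℝ) * m + p * t + q * b = 0 := by rw [← hform fun s ↦ s, sum_coord]
  have h1 : (n : ℝ) + p + q = N := by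
    have := hform fun _ ↦ 1
    simp at this
    linarith
  have hn' : 3 * (n : ℝ) < N := by exact_mod_cast hn
  have hb : b = -t - m := by linarith
  have hdt : 3 * t ^ 2 - 1 = (t - m) * (t - b) := by rw [hb]; linear_combination hroot
  have hdm : 3 * m ^ 2 - 1 = -((t - m) * (m - b)) := by rw [hb]; linear_combination hroot
  have hdb : 3 * b ^ 2 - 1 = (m - b) * (t - b) := by rw [hb]; linear_combination hroot
  have e1 : 0 < t - m := sub_pos.2 hmt
  have e2 : 0 < m - b := sub_pos.2 hbm
  have e3 : 0 < t - b := by linarith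
  -- Since `t > 0 > b`, the numbers `p - n` and `q - n` have the same sign; their sum `N - 3n` is
  -- positive, so both are.
  have hrel : ((p : ℝ) - n) * t + (q - n) * b = 0 := by
    rw [show m = -t - b by linarith] at h0; linear_combination h0
  have hqp : ((p : ℝ) - n) + (q - n) > 0 := by linarith
  have htpos : 0 < t := by linarith
  have hbneg : b < 0 := by linarith
  have hp : 0 < (p : ℝ) - n := by
    by_contra hcon
    push Not at hcon
    nlinarith
  have hq : 0 < (q : ℝ) - n := by
    by_contra hcon
    push Not at hcon
    nlinarith
  rw [hform fun s ↦ (3 * s ^ 2 - 1)⁻¹, hdt, hdm, hdb]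
  -- Partial fractions: the inverse of `(t - m)(m - b)` is the sum of the other two inverses, so
  -- each middle site cancels one site at either outer root.
  have : (n : ℝ) * (-((t - m) * (m - b)))⁻¹ + p * ((t - m) * (t - b))⁻¹ +
      q * ((m - b) * (t - b))⁻¹ = (p - n) / ((t - m) * (t - b)) + (q - n) / ((m - b) * (t - b)) := by
    rw [inv_neg]
    field_simp
    ring
  rw [this]
  positivity

/-- The direction of steepest descent in the hyperplane at a site. -/
def descentVec (c : S N) (i : Fin N) (hQ : 0 < ∑ k, (3 * coord c k ^ 2 - 1)⁻¹) : S N :=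
  ofCoords (fun l ↦ (if l = i then 1 else 0) -
    (∑ k, (3 * coord c k ^ 2 - 1)⁻¹)⁻¹ * (3 * coord c l ^ 2 - 1)⁻¹) (by
      rw [Finset.sum_sub_distrib, ← Finset.mul_sum, inv_mul_cancel₀ hQ.ne']; simp)

/-- The diagonal Hessian maps the vector at `i` to `d_i e_i` minus the constant `Q⁻¹`, and the
constant drops out against a zero-sum vector. -/
theorem inner_descentVec {c : S N} (hd : ∀ k, 3 * coord c k ^ 2 - 1 ≠ 0)
    (hQ : 0 < ∑ k, (3 * coord c k ^ 2 - 1)⁻¹) (i j : Fin N) :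
    inner ℝ (fderiv ℝ (fam N).G₀ c (descentVec c i hQ)) (descentVec c j hQ) =
      (if i = j then 3 * coord c i ^ 2 - 1 else 0) - (∑ k, (3 * coord c k ^ 2 - 1)⁻¹)⁻¹ := by
  rw [inner_fderiv_G₀]
  set Q := ∑ k, (3 * coord c k ^ 2 - 1)⁻¹ with hQdef
  have h1 : ∀ l, (3 * coord c l ^ 2 - 1) * coord (descentVec c i hQ) l *
      coord (descentVec c j hQ) l = (if l = i then if i = j then 3 * coord c i ^ 2 - 1 else 0 else 0)
      - (if l = i then Q⁻¹ else 0) - (if l = j then Q⁻¹ else 0) +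
      Q⁻¹ ^ 2 * (3 * coord c l ^ 2 - 1)⁻¹ := by
    intro l
    simp only [descentVec, coord_ofCoords, ← hQdef]
    have hdl := hd l
    have hdl' : (3 * coord c l ^ 2 - 1) * (3 * coord c l ^ 2 - 1)⁻¹ = 1 := mul_inv_cancel₀ hdl
    set e := (3 * coord c l ^ 2 - 1)⁻¹ with he
    by_cases hi : l = i
    · by_cases hj : l = j
      · have hij : i = j := hi.symm.trans hj
        rw [if_pos hi, if_pos hj, if_pos hij, if_pos hi, if_pos hi, if_pos hj, ← hi]
        linear_combination (-2 * Q⁻¹ + Q⁻¹ ^ 2 * e) * hdl'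
      · have hij : i ≠ j := fun h ↦ hj (hi.trans h)
        rw [if_pos hi, if_neg hj, if_neg hij, if_pos hi, if_pos hi, if_neg hj]
        linear_combination (-Q⁻¹ + Q⁻¹ ^ 2 * e) * hdl'
    · by_cases hj : l = j
      · rw [if_neg hi, if_pos hj, if_neg hi, if_neg hi, if_pos hj]
        linear_combination (-Q⁻¹ + Q⁻¹ ^ 2 * e) * hdl'
      · rw [if_neg hi, if_neg hj, if_neg hi, if_neg hi, if_neg hj]
        linear_combination (Q⁻¹ ^ 2 * e) * hdl'
  simp only [h1, Finset.sum_add_distrib, Finset.sum_sub_distrib, ← Finset.mul_sum, ← hQdef,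
    Finset.sum_ite_eq', Finset.mem_univ, if_true]
  field_simp
  ring

theorem IsGenericSaddle.one_lt {c : S N} {i : Fin N} {α β : ℝ} (h : IsGenericSaddle c i α β)
    {k : Fin N} (hk : k ≠ i) : 1 < 3 * coord c k ^ 2 := by
  have key : ∀ {a s : ℝ}, s ^ 2 + s * a + a ^ 2 = 1 → a ^ 2 < s ^ 2 → 1 < 3 * s ^ 2 := by
    intro a s h1 h2
    nlinarith [sq_nonneg (s - a)]
  rcases h.coord_ne k hk with h1 | h1 <;> rw [h1]
  · exact key h.root_alpha h.sq_lt_alpha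
  · exact key h.root_beta h.sq_lt_beta

theorem IsGenericSaddle.lt_one {c : S N} {i : Fin N} {α β : ℝ} (h : IsGenericSaddle c i α β) :
    3 * coord c i ^ 2 < 1 := by
  have h1 := h.root_beta
  have h2 := h.opposite
  rw [h.coord_site] at h1 ⊢
  have h3 : (α + β) ^ 2 ≤ -((α + β) * β) := by
    by_contra hcon
    push Not at hcon
    nlinarith [h.gap, mul_self_nonneg (α + 2 * β), mul_self_nonneg α]
  nlinarith [h.gap]

/-- Generic saddles are saddles. -/
theorem IsGenericSaddle.isSaddleAt {c : S N} {i : Fin N} {α β : ℝ} (h : IsGenericSaddle c i α β)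
    (hN : 3 < N) : (fam N).IsSaddleAt c (coordL N i) := by
  have hm : coord c i = -(α + β) := h.coord_site
  have hα := h.alpha_ne
  have hmα : -(α + β) ≠ α := fun h0 ↦ by
    have := h.sq_lt_alpha
    rw [hm, h0] at this
    exact lt_irrefl _ this
  have hmβ : -(α + β) ≠ β := fun h0 ↦ by
    have := h.sq_lt_beta
    rw [hm, h0] at this
    exact lt_irrefl _ this
  have hcard : (Finset.univ.filter fun k ↦ coord c k = -(α + β)).card ≤ 1 := by
    rw [← Finset.card_singleton i]
    refine Finset.card_le_card fun k hk ↦ ?_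
    simp only [Finset.mem_filter, Finset.mem_univ, true_and, Finset.mem_singleton] at hk ⊢
    by_contra hki
    rcases h.coord_ne k hki with h1 | h1
    · exact hmα (hk.symm.trans h1)
    · exact hmβ (hk.symm.trans h1)
  -- There is at most one middle coordinate, so `3 < N` is what the positivity of the sum of
  -- inverses requires. The vector at `i` then has Hessian value `3 c_i² - 1 - Q⁻¹ < 0`.
  have hQ : 0 < ∑ k, (3 * coord c k ^ 2 - 1)⁻¹ := by
    have hg := h.gap
    have ho := h.opposite
    have hmul := h.mul_neg
    rcases lt_or_ge 0 β with hβ | hβ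
    · refine sum_inv_pos (t := β) (m := -(α + β)) (b := α) ?_ ?_ (by ring)
        (by linear_combination h.root) (fun k ↦ ?_) (by omega)
      · have : α + β < 0 := by by_contra hcon; push Not at hcon; nlinarith
        have : α < 0 := by by_contra hcon; push Not at hcon; nlinarith
        linarith
      · nlinarith
      · by_cases hk : k = i
        · rw [hk]; exact Or.inr (Or.inl hm)
        · rcases h.coord_ne k hk with h1 | h1 <;> simp [h1]
    · have hβ0 : β < 0 := lt_of_le_of_ne hβ (by rintro rfl; simp at hmul)
      refine sum_inv_pos (t := α) (m := -(α + β)) (b := β) ?_ ?_ (by ring)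
        (by linear_combination h.root) (fun k ↦ ?_) (by omega)
      · nlinarith
      · have : 0 < α + β := by by_contra hcon; push Not at hcon; nlinarith
        have : 0 < α := by by_contra hcon; push Not at hcon; nlinarith
        linarith
      · by_cases hk : k = i
        · rw [hk]; exact Or.inr (Or.inl hm)
        · rcases h.coord_ne k hk with h1 | h1 <;> simp [h1]
  have hd : ∀ k, 3 * coord c k ^ 2 - 1 ≠ 0 := by
    intro k
    by_cases hk : k = i
    · subst hk
      have := h.lt_one
      exact (by linarith : 3 * coord c k ^ 2 - 1 < 0).ne
    · have := h.one_lt hk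
      exact (by linarith : 0 < 3 * coord c k ^ 2 - 1).ne'
  refine ⟨h.stationary, fun x y ↦ fderiv_G₀_symm c x y, fun w hw hw0 ↦
    inner_fderiv_pos_of_slice (fun k hk ↦ h.one_lt hk) hw hw0, descentVec c i hQ, ?_⟩
  rw [inner_descentVec hd, if_pos rfl]
  have := h.lt_one
  have h2 : 0 < (∑ k, (3 * coord c k ^ 2 - 1)⁻¹)⁻¹ := inv_pos.2 hQ
  linarith

end MassConserving

/-! ### Stationary points with two negative directions and the classification -/

namespace MassConserving

open Landscape GradFlow Metric

variable {N M : ℕ}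

theorem exists_neg_plane {c u v : S N} (h : ∀ x y : ℝ, (x ≠ 0 ∨ y ≠ 0) →
    inner ℝ (fderiv ℝ (fam N).G₀ c (x • u + y • v)) (x • u + y • v) < 0) :
    ∃ U : Submodule ℝ (S N), 2 ≤ Module.finrank ℝ U ∧
      ∀ w ∈ U, w ≠ 0 → inner ℝ (fderiv ℝ (fam N).G₀ c w) w < 0 := by
  have hli : LinearIndependent ℝ ![u, v] := by
    rw [LinearIndependent.pair_iff]
    intro x y hxy
    by_contra hcon
    have := h x y (by tauto)
    rw [hxy] at this
    simp at this
  refine ⟨Submodule.span ℝ (Set.range ![u, v]), by rw [finrank_span_eq_card hli]; simp, ?_⟩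
  intro w hw hw0
  simp only [Matrix.range_cons, Matrix.range_empty, union_empty, singleton_union] at hw
  obtain ⟨x, y, rfl⟩ := Submodule.mem_span_pair.1 hw
  refine h x y ?_
  by_contra! hcon
  simp [hcon.1, hcon.2] at hw0

/-- Differences of unit vectors at three middle sites span a plane of zero-sum vectors on which the
Hessian is the negative multiple `3m² - 1` of the norm squared. -/
theorem exists_neg_plane_of_three {c : S N} {i j l : Fin N} (hij : i ≠ j) (hil : i ≠ l)
    (hjl : j ≠ l) {m : ℝ} (hm : 3 * m ^ 2 < 1) (hi : coord c i = m) (hj : coord c j = m)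
    (hl : coord c l = m) :
    ∃ U : Submodule ℝ (S N), 2 ≤ Module.finrank ℝ U ∧
      ∀ w ∈ U, w ≠ 0 → inner ℝ (fderiv ℝ (fam N).G₀ c w) w < 0 := by
  refine exists_neg_plane (u := diffVec i j) (v := diffVec i l) fun x y hxy ↦ ?_
  set w := x • diffVec i j + y • diffVec i l with hw
  have hsupp : ∀ k, (3 * coord c k ^ 2 - 1) * coord w k * coord w k =
      (3 * m ^ 2 - 1) * coord w k ^ 2 := by
    intro k
    by_cases h1 : k = i
    · rw [h1, hi]; ring
    by_cases h2 : k = j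
    · rw [h2, hj]; ring
    by_cases h3 : k = l
    · rw [h3, hl]; ring
    have : coord w k = 0 := by simp [hw, coord_diffVec, h1, h2, h3]
    rw [this]; ring
  rw [inner_fderiv_G₀]
  simp only [hsupp]
  rw [← Finset.mul_sum, ← norm_sq_eq_sum]
  have hw0 : w ≠ 0 := by
    intro h0
    have h2 : coord w j = -x := by simp [hw, coord_diffVec, hij.symm, hjl]
    have h3 : coord w l = -y := by simp [hw, coord_diffVec, hil.symm, hjl.symm]
    rw [h0, coord_zero] at h2 h3
    rcases hxy with h | h
    · exact h (by linarith)
    · exact h (by linarith)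
  have : 0 < ‖w‖ := norm_pos_iff.2 hw0
  exact mul_neg_of_neg_of_pos (by linarith) (by positivity)

/-- On the span of the two descent vectors the form is `(3m² - 1)(x² + y²) - Q⁻¹ (x + y)²`. -/
theorem exists_neg_plane_of_two {c : S N} {i j : Fin N} (hij : i ≠ j) {m : ℝ} (hm : 3 * m ^ 2 < 1)
    (hi : coord c i = m) (hj : coord c j = m) (hd : ∀ k, 3 * coord c k ^ 2 - 1 ≠ 0)
    (hQ : 0 < ∑ k, (3 * coord c k ^ 2 - 1)⁻¹) :
    ∃ U : Submodule ℝ (S N), 2 ≤ Module.finrank ℝ U ∧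
      ∀ w ∈ U, w ≠ 0 → inner ℝ (fderiv ℝ (fam N).G₀ c w) w < 0 := by
  refine exists_neg_plane (u := descentVec c i hQ) (v := descentVec c j hQ) fun x y hxy ↦ ?_
  simp only [map_add, map_smul, inner_add_left, inner_add_right, inner_smul_left,
    inner_smul_right, conj_trivial, inner_descentVec hd, if_pos, if_neg hij, if_neg hij.symm,
    hi, hj]
  have h1 : 0 < (∑ k, (3 * coord c k ^ 2 - 1)⁻¹)⁻¹ := inv_pos.2 hQ
  set R := (∑ k, (3 * coord c k ^ 2 - 1)⁻¹)⁻¹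
  have h2 : 0 < x ^ 2 + y ^ 2 := by
    rcases hxy with h | h
    · positivity
    · positivity
  nlinarith [mul_nonneg h1.le (sq_nonneg (x + y)), mul_pos (sub_pos.2 hm) h2]

/-- Every stationary point of the uncoupled system is a nondegenerate local minimum, or a generic
saddle, or has index at least two. -/
theorem stationary_cases (hM : 4 ≤ M) (h3 : ¬ 3 ∣ 2 * M) {c : S (2 * M)}
    (hc : (fam (2 * M)).G₀ c = 0) :
    (∀ k, 1 < 3 * coord c k ^ 2) ∨ (∃ i α β, IsGenericSaddle c i α β) ∨
      ∃ U : Submodule ℝ (S (2 * M)), 2 ≤ Module.finrank ℝ U ∧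
        ∀ w ∈ U, w ≠ 0 → inner ℝ (fderiv ℝ (fam (2 * M)).G₀ c w) w < 0 := by
  by_cases hc0 : c = 0
  · right; right
    refine exists_neg_plane_of_three (c := c) (i := ⟨0, by omega⟩) (j := ⟨1, by omega⟩)
      (l := ⟨2, by omega⟩) (by simp) (by simp) (by simp) (m := 0) (by norm_num) ?_ ?_ ?_ <;>
      simp [hc0]
  obtain ⟨l, hl⟩ := (G₀_eq_zero_iff c).1 hc
  obtain ⟨t, m, b, hbm', hmt', hsum, hroot, -, hval⟩ := exists_roots hl hc0
  have hb : b = -t - m := by linarith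
  -- A degenerate configuration uses only a double root `u` and a simple root `-2u`. If the latter
  -- occurs `n` times, the zero sum gives `2M = 3n`: this is where divisibility by `3` is excluded.
  have hdouble : ∀ u v : ℝ, u ≠ 0 → v = -2 * u → (∀ i, coord c i = u ∨ coord c i = v) → False := by
    intro u v hu hv huv
    have huv' : v ≠ u := by rintro h; exact hu (by linarith)
    have h1 : ∀ i, coord c i = u + (v - u) * if coord c i = v then 1 else 0 := by
      intro i
      rcases huv i with h | h
      · rw [h, if_neg huv'.symm]; ring
      · rw [h, if_pos rfl]; ring
    have h2 := sum_coord c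
    rw [Finset.sum_congr rfl fun i _ ↦ h1 i, Finset.sum_add_distrib, ← Finset.mul_sum,
      Finset.sum_boole, Finset.sum_const, Finset.card_univ, Fintype.card_fin, nsmul_eq_mul, hv] at h2
    set n := (Finset.univ.filter fun i ↦ coord c i = -2 * u).card
    have h5 : u * (((2 * M : ℕ) : ℝ) - 3 * n) = 0 := by linear_combination h2
    rcases mul_eq_zero.1 h5 with h | h
    · exact hu h
    · have : ((2 * M : ℕ) : ℝ) = ((3 * n : ℕ) : ℝ) := by push_cast at h ⊢; linarith
      exact h3 ⟨n, by exact_mod_cast this⟩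
  have hbm : b < m := by
    refine lt_of_le_of_ne hbm' fun h ↦ ?_
    have ht : t = -2 * m := by linarith
    refine hdouble m t ?_ ht fun i ↦ ?_
    · rintro h0
      rw [h0] at ht hroot
      rw [ht] at hroot
      norm_num at hroot
    · rcases hval i with h1 | h1 | h1
      · exact Or.inr h1
      · exact Or.inl h1
      · exact Or.inl (h1.trans h)
  have hmt : m < t := by
    refine lt_of_le_of_ne hmt' fun h ↦ ?_
    have ht : b = -2 * m := by linarith
    refine hdouble m b ?_ ht fun i ↦ ?_
    · rintro h0
      rw [h0] at h hroot
      rw [← h] at hroot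
      norm_num at hroot
    · rcases hval i with h1 | h1 | h1
      · exact Or.inl (h1.trans h.symm)
      · exact Or.inl h1
      · exact Or.inr h1
  have hdt : 1 < 3 * t ^ 2 := by
    have : 3 * t ^ 2 - 1 = (t - m) * (t - b) := by rw [hb]; linear_combination hroot
    have h2 : 0 < (t - m) * (t - b) := mul_pos (by linarith) (by linarith)
    linarith
  have hdm : 3 * m ^ 2 < 1 := by
    have : 3 * m ^ 2 - 1 = -((t - m) * (m - b)) := by rw [hb]; linear_combination hroot
    have h2 : 0 < (t - m) * (m - b) := mul_pos (by linarith) (by linarith)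
    linarith
  have hdb : 1 < 3 * b ^ 2 := by
    have : 3 * b ^ 2 - 1 = (m - b) * (t - b) := by rw [hb]; linear_combination hroot
    have h2 : 0 < (m - b) * (t - b) := mul_pos (by linarith) (by linarith)
    linarith
  have hd : ∀ k, 3 * coord c k ^ 2 - 1 ≠ 0 := by
    intro k
    rcases hval k with h | h | h <;> rw [h]
    · exact (by linarith : 0 < 3 * t ^ 2 - 1).ne'
    · exact (by linarith : 3 * m ^ 2 - 1 < 0).ne
    · exact (by linarith : 0 < 3 * b ^ 2 - 1).ne'
  set F := Finset.univ.filter fun k ↦ coord c k = m with hF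
  have hmem : ∀ {k}, k ∈ F ↔ coord c k = m := by simp [hF]
  -- The number of coordinates at the middle root decides: none gives a minimum, one a generic
  -- saddle, two or more give two negative directions.
  have hcases : F.card = 0 ∨ F.card = 1 ∨ F.card = 2 ∨ 2 < F.card := by omega
  rcases hcases with h | h | h | h
  · left
    intro k
    rcases hval k with h1 | h1 | h1
    · rwa [h1]
    · rw [Finset.card_eq_zero] at h
      exact absurd (hmem.2 h1) (by rw [h]; exact Finset.notMem_empty k)
    · rwa [h1]
  · right; left
    obtain ⟨i, hi⟩ := Finset.card_eq_one.1 h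
    have him : coord c i = m := hmem.1 (by rw [hi]; exact Finset.mem_singleton_self i)
    have hik : ∀ k ≠ i, coord c k = t ∨ coord c k = b := by
      intro k hk
      rcases hval k with h1 | h1 | h1
      · exact Or.inl h1
      · exact absurd (by simpa [hi] using hmem.2 h1) hk
      · exact Or.inr h1
    set p := (Finset.univ.filter fun k ↦ k ≠ i ∧ coord c k = t).card with hp
    set q := (Finset.univ.filter fun k ↦ k ≠ i ∧ coord c k = b).card with hq
    have hform : ∀ f : ℝ → ℝ, ∑ k, f (coord c k) = f m + p * f t + q * f b := by
      intro f
      have h1 : ∀ k, f (coord c k) = (if k = i then f m else 0) +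
          (if k ≠ i ∧ coord c k = t then f t else 0) +
          if k ≠ i ∧ coord c k = b then f b else 0 := by
        intro k
        by_cases hki : k = i
        · simp [hki, him]
        · rcases hik k hki with h | h <;> rw [h]
          · simp [hki, (hbm.trans hmt).ne']
          · simp [hki, (hbm.trans hmt).ne]
      rw [Finset.sum_congr rfl fun k _ ↦ h1 k]
      simp only [Finset.sum_add_distrib, ← Finset.sum_filter, Finset.sum_const, nsmul_eq_mul,
        hp, hq]
      simp [Finset.filter_eq']
    have h0 : m + p * t + q * b = 0 := by rw [← hform fun s ↦ s, sum_coord]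
    have h1 : 1 + p + q = 2 * M := by
      have := hform fun _ ↦ 1
      simp only [Finset.sum_const, Finset.card_univ, Fintype.card_fin, nsmul_eq_mul, mul_one] at this
      exact_mod_cast this.symm
    have hrel : ((p : ℝ) - 1) * t + (q - 1) * b = 0 := by
      rw [show m = -t - b by linarith] at h0; linear_combination h0
    have htpos : 0 < t := by linarith
    have hbneg : b < 0 := by linarith
    -- The numbers of sites at the two outer roots differ because `1 + p + q` is even. The root with
    -- the smaller number is the minority root.
    have hpq : p < q ∨ q < p := by omega
    rcases hpq with hpq | hpq
    · have hpq' : (p : ℝ) < q := by exact_mod_cast hpq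
      have hq1 : (1 : ℝ) < q := by
        have : 1 < q := by omega
        exact_mod_cast this
      have hp1 : (1 : ℝ) < p := by
        by_contra hcon
        push Not at hcon
        nlinarith
      have hm0 : m < 0 := by
        by_contra hcon
        push Not at hcon
        nlinarith
      refine ⟨i, t, b, ?_, ?_, hik, ?_, ?_, ?_⟩
      · rw [him]; linarith
      · rw [hb]; linear_combination hroot
      · rw [show t + b = -m by linarith]; nlinarith
      · rw [show t + b = -m by linarith]; nlinarith
      · change 2 * p < 2 * M
        omega
    · have hpq' : (q : ℝ) < p := by exact_mod_cast hpq
      have hp1 : (1 : ℝ) < p := by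
        have : 1 < p := by omega
        exact_mod_cast this
      have hq1 : (1 : ℝ) < q := by
        by_contra hcon
        push Not at hcon
        nlinarith
      have hm0 : 0 < m := by
        by_contra hcon
        push Not at hcon
        nlinarith
      refine ⟨i, b, t, ?_, ?_, fun k hk ↦ (hik k hk).symm, ?_, ?_, ?_⟩
      · rw [him]; linarith
      · rw [hb]; linear_combination hroot
      · rw [show b + t = -m by linarith]; nlinarith
      · rw [show b + t = -m by linarith]; nlinarith
      · change 2 * q < 2 * M
        omega
  · right; right
    obtain ⟨i, j, hij, hFij⟩ := Finset.card_eq_two.1 h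
    exact exists_neg_plane_of_two hij hdm (hmem.1 (by simp [hFij])) (hmem.1 (by simp [hFij])) hd
      (sum_inv_pos hbm hmt hsum hroot hval (by rw [← hF, h]; omega))
  · right; right
    obtain ⟨i, j, k, hi, hj, hk, hij, hik, hjk⟩ := Finset.two_lt_card_iff.1 h
    exact exists_neg_plane_of_three hij hik hjk hdm (hmem.1 hi) (hmem.1 hj) (hmem.1 hk)

end MassConserving

/-! ## The families of stationary points of the uncoupled system -/

namespace MassConserving

open Landscape GradFlow Metric

variable {N M : ℕ}

theorem fam_G_zero : (fam N).G 0 = (fam N).G₀ := funext fun x ↦ by simp [Family.G]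

theorem mem_stationary_zero {x : S N} (h0 : (fam N).G₀ x = 0) (h : ∀ k, 1 < 3 * coord x k ^ 2) :
    x ∈ stationaryOfIndex (V N 0) 0 :=
  mem_stationary_zero_of_pos (by rw [fam_G_zero, h0]) fun w hw ↦ by
    rw [hessian_eq, fam_G_zero]; exact inner_fderiv_pos h hw

/-- Subtracting the cubic equations pairwise yields Vieta's relations, and the multiplicities turn
the zero sum into a linear relation between the roots. Together they determine the roots up to a
sign in the cases needed. -/
theorem HasTriple.exists_values {x : S N} {a : Fin 3 → ℕ} (h : HasTriple x a) :
    ∃ α : Fin 3 → ℝ, Function.Injective α ∧ α 0 + α 1 + α 2 = 0 ∧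
      α 1 ^ 2 + α 1 * α 2 + α 2 ^ 2 = 1 ∧ a 0 * α 0 + a 1 * α 1 + a 2 * α 2 = 0 ∧
      (∀ i, ∃ j, coord x i = α j) ∧ ∀ j, {i | coord x i = α j}.ncard = a j := by
  obtain ⟨l, α, hinj, hroot, hval, hcard⟩ := h
  have hpair : ∀ i j, i ≠ j → α i ^ 2 + α i * α j + α j ^ 2 = 1 := by
    intro i j hij
    have h1 : (α i - α j) * (α i ^ 2 + α i * α j + α j ^ 2 - 1) = 0 := by
      linear_combination hroot i - hroot j
    rcases mul_eq_zero.1 h1 with h | h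
    · exact absurd (hinj (sub_eq_zero.1 h)) hij
    · linarith
  have h01 := hpair 0 1 (by decide)
  have h02 := hpair 0 2 (by decide)
  have h12 := hpair 1 2 (by decide)
  refine ⟨α, hinj, ?_, h12, ?_, hval, hcard⟩
  · have h1 : (α 1 - α 2) * (α 0 + α 1 + α 2) = 0 := by linear_combination h01 - h02
    rcases mul_eq_zero.1 h1 with h | h
    · exact absurd (hinj (sub_eq_zero.1 h)) (by decide)
    · exact h
  · choose f hf using hval
    have h1 : ∀ i, coord x i = ∑ j, if coord x i = α j then α j else 0 := by
      intro i
      rw [Finset.sum_eq_single (f i)]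
      · rw [if_pos (hf i), ← hf i]
      · intro j _ hj
        rw [if_neg]
        rw [hf i]
        exact fun h ↦ hj (hinj h).symm
      · simp
    have h2 : ∀ j, ∑ i, (if coord x i = α j then α j else 0) = a j * α j := by
      intro j
      rw [← Finset.sum_filter, Finset.sum_const, nsmul_eq_mul, ← hcard j,
        Set.ncard_eq_toFinset_card']
      simp
    have h3 := sum_coord x
    rw [Finset.sum_congr rfl fun i _ ↦ h1 i, Finset.sum_comm] at h3
    simpa [h2, Fin.sum_univ_three] using h3

theorem notMem_of_ncard_eq_zero {A : Set (Fin N)} (h : A.ncard = 0) (i : Fin N) : i ∉ A := by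
  rw [Set.ncard_eq_zero] at h
  rw [h]
  exact notMem_empty i

theorem isSpin_of_mem_B (hM : 4 ≤ M) {a : S (2 * M)} (ha : a ∈ B M 0) : IsSpin a := by
  have hM' : (4 : ℝ) ≤ M := by exact_mod_cast hM
  obtain ⟨α, -, hsum, hroot, hlin, hval, hcard⟩ := ha.2.exists_values
  simp only [Matrix.cons_val_zero, Matrix.cons_val_one, Matrix.cons_val] at hlin
  have h0 : {i | coord a i = α 0}.ncard = 0 := hcard 0
  have h12 : α 2 = -α 1 := by
    have h1 : (M : ℝ) * (α 1 + α 2) = 0 := by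
      simp only [Nat.cast_zero, zero_mul, zero_add, tsub_zero, add_zero] at hlin
      linarith
    rcases mul_eq_zero.1 h1 with h | h <;> linarith
  have h1 : α 1 = 1 ∨ α 1 = -1 := by
    rw [h12] at hroot
    have : (α 1 - 1) * (α 1 + 1) = 0 := by linear_combination hroot
    rcases mul_eq_zero.1 this with h | h
    · exact Or.inl (by linarith)
    · exact Or.inr (by linarith)
  intro k
  obtain ⟨j, hj⟩ := hval k
  fin_cases j
  · exact absurd hj (notMem_of_ncard_eq_zero h0 k)
  · rw [show coord a k = α 1 from hj]; exact h1
  · rw [show coord a k = α 2 from hj, h12]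
    rcases h1 with h | h <;> simp [h]

theorem IsSpin.mem_B {a : S (2 * M)} (ha : IsSpin a) : a ∈ B M 0 := by
  refine ⟨mem_stationary_zero ha.stationary fun k ↦ by
    rcases ha k with h | h <;> rw [h] <;> norm_num, 0, ![0, 1, -1], ?_, ?_, ?_, ?_⟩
  · intro i j h
    fin_cases i <;> fin_cases j <;> simp_all <;> norm_num at h
  · intro j; fin_cases j <;> norm_num
  · intro i
    rcases ha i with h | h
    · exact ⟨1, by simpa using h⟩
    · exact ⟨2, by simpa using h⟩
  · have h1 : {i | coord a i = 1}.ncard = M := by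
      rw [Set.ncard_eq_toFinset_card']; simpa using ha.card_eq
    have h2 : {i | coord a i = -1}.ncard = M := by
      rw [Set.ncard_eq_toFinset_card']; simpa [neg_eq_iff_eq_neg] using ha.neg.card_eq
    have h0 : {i | coord a i = 0} = ∅ := by
      ext i
      rcases ha i with h | h <;> simp [h]
    intro j
    fin_cases j
    · simp [h0]
    · simpa using h1
    · simpa using h2

theorem finite_B (hM : 4 ≤ M) : (B M 0).Finite := by
  have : (coord '' B M 0).Finite := by
    refine (Set.Finite.pi' fun _ : Fin (2 * M) ↦ (Set.toFinite ({1, -1} : Set ℝ))).subset ?_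
    rintro _ ⟨a, ha, rfl⟩ k
    exact isSpin_of_mem_B hM ha k
  exact this.of_finite_image fun x _ y _ h ↦ coord_ext fun i ↦ congrFun h i

/-- Any of the `M + 1` sites at the majority root can serve as the decayed site `k`; the
configuration is then recovered by inverting the formula for `product`. -/
theorem exists_product_of_mem_B (hM : 4 ≤ M) {y : S (2 * M)} (hy : y ∈ B M 1) :
    ∃ a k, IsSpin a ∧ y = product a k := by
  have hM' : (4 : ℝ) ≤ M := by exact_mod_cast hM
  have hM0 : (M : ℝ) ≠ 0 := by linarith
  have hM1 : (M : ℝ) - 1 ≠ 0 := by linarith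
  have hσ := sigma_pos (M := M)
  obtain ⟨α, -, hsum, hroot, hlin, hval, hcard⟩ := hy.2.exists_values
  simp only [Matrix.cons_val_zero, Matrix.cons_val_one, Matrix.cons_val] at hlin
  have h0 : {i | coord y i = α 0}.ncard = 0 := hcard 0
  have h2 : {i | coord y i = α 2}.ncard = M + 1 := hcard 2
  rw [Nat.cast_sub (by omega)] at hlin
  push_cast at hlin
  -- The roots are known up to the factor `ε`, which the root equation shows to be a sign.
  set ε := -α 2 / ((M - 1) * sigma M) with hε
  have hα2 : α 2 = -((M - 1) * sigma M * ε) := by rw [hε]; field_simp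
  have hα1 : α 1 = (M + 1) * sigma M * ε := by
    have : ((M : ℝ) - 1) * (α 1 - (M + 1) * sigma M * ε) = 0 := by
      rw [hα2] at hlin; linear_combination hlin
    rcases mul_eq_zero.1 this with h | h
    · exact absurd h hM1
    · linarith
  have hε1 : ε = 1 ∨ ε = -1 := by
    rw [hα1, hα2] at hroot
    have : (ε - 1) * (ε + 1) = 0 := by linear_combination hroot - ε ^ 2 * sigma_sq (M := M)
    rcases mul_eq_zero.1 this with h | h
    · exact Or.inl (by linarith)
    · exact Or.inr (by linarith)
  obtain ⟨k, hk⟩ : ∃ k, coord y k = α 2 := by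
    by_contra! hcon
    have : {i | coord y i = α 2} = ∅ := by ext i; simp [hcon i]
    rw [this] at h2
    simp at h2
  set a := (M : ℝ)⁻¹ • ((sigma M)⁻¹ • y - (2 * ε) • bump k) with ha
  have hak : coord a k = ε := by
    simp only [ha, coord_smul, coord_sub, coord_bump, if_true, hk, hα2]
    field_simp; ring
  have hspin : ∀ l, coord a l = ε ∨ coord a l = -ε := by
    intro l
    by_cases hlk : l = k
    · exact Or.inl (hlk ▸ hak)
    obtain ⟨j, hj⟩ := hval l
    fin_cases j
    · exact absurd hj (notMem_of_ncard_eq_zero h0 l)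
    · left
      simp only [ha, coord_smul, coord_sub, coord_bump, if_neg hlk,
        show coord y l = α 1 from hj, hα1]
      field_simp; ring
    · right
      simp only [ha, coord_smul, coord_sub, coord_bump, if_neg hlk,
        show coord y l = α 2 from hj, hα2]
      field_simp; ring
  refine ⟨a, k, fun l ↦ ?_, ?_⟩
  · rcases hε1 with h | h <;> rcases hspin l with h' | h' <;> simp [h, h']
  · rw [product, hak, ha, smul_inv_smul₀ hM0, sub_add_cancel, smul_inv_smul₀ hσ.ne']

theorem exists_saddle_of_mem_C (hM : 4 ≤ M) {c : S (2 * M)} (hc : c ∈ C M 1) :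
    ∃ a k, IsSpin a ∧ c = saddle a k := by
  have hM' : (4 : ℝ) ≤ M := by exact_mod_cast hM
  have hM0 : (2 * M - 3 : ℝ) ≠ 0 := by linarith
  have hM1 : (M : ℝ) - 2 ≠ 0 := by linarith
  have hτ := tau_pos (M := M)
  obtain ⟨α, -, hsum, hroot, hlin, hval, hcard⟩ := hc.2.exists_values
  simp only [Matrix.cons_val_zero, Matrix.cons_val_one, Matrix.cons_val] at hlin
  have h0 : {i | coord c i = α 0}.ncard = 1 := hcard 0
  rw [Nat.cast_sub (by omega)] at hlin
  simp only [Nat.add_sub_cancel] at hlin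
  push_cast at hlin
  set ε := -α 2 / ((M - 2) * tau M) with hε
  have hα2 : α 2 = -((M - 2) * tau M * ε) := by rw [hε]; field_simp
  have hα1 : α 1 = (M - 1) * tau M * ε := by
    have : ((M : ℝ) - 2) * (α 1 - (M - 1) * tau M * ε) = 0 := by
      rw [show α 0 = -α 1 - α 2 by linarith, hα2] at hlin; linear_combination hlin
    rcases mul_eq_zero.1 this with h | h
    · exact absurd h hM1
    · linarith
  have hα0 : α 0 = -(tau M * ε) := by linear_combination hsum - hα1 - hα2
  have hε1 : ε = 1 ∨ ε = -1 := by
    rw [hα1, hα2] at hroot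
    have : (ε - 1) * (ε + 1) = 0 := by linear_combination hroot - ε ^ 2 * tau_sq (M := M)
    rcases mul_eq_zero.1 this with h | h
    · exact Or.inl (by linarith)
    · exact Or.inr (by linarith)
  obtain ⟨k, hk⟩ := Set.ncard_eq_one.1 h0
  have hkv : coord c k = α 0 := by
    have : k ∈ {i | coord c i = α 0} := by rw [hk]; exact mem_singleton k
    exact this
  set a := ((2 * M - 3) / 2 : ℝ)⁻¹ • ((tau M)⁻¹ • c - ε • bump k) with ha
  have hak : coord a k = ε := by
    simp only [ha, coord_smul, coord_sub, coord_bump, if_true, hkv, hα0]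
    field_simp; ring
  have hspin : ∀ l, coord a l = ε ∨ coord a l = -ε := by
    intro l
    by_cases hlk : l = k
    · exact Or.inl (hlk ▸ hak)
    obtain ⟨j, hj⟩ := hval l
    fin_cases j
    · have : l ∈ {i | coord c i = α 0} := hj
      rw [hk] at this
      exact absurd this hlk
    · left
      simp only [ha, coord_smul, coord_sub, coord_bump, if_neg hlk,
        show coord c l = α 1 from hj, hα1]
      field_simp; ring
    · right
      simp only [ha, coord_smul, coord_sub, coord_bump, if_neg hlk,
        show coord c l = α 2 from hj, hα2]
      field_simp; ring
  refine ⟨a, k, fun l ↦ ?_, ?_⟩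
  · rcases hε1 with h | h <;> rcases hspin l with h' | h' <;> simp [h, h']
  · rw [saddle, hak, ha, smul_inv_smul₀ (div_ne_zero hM0 two_ne_zero), sub_add_cancel,
      smul_inv_smul₀ hτ.ne']

theorem product_mem_B (hM : 4 ≤ M) {a : S (2 * M)} (ha : IsSpin a) (k : Fin (2 * M)) :
    product a k ∈ B M 1 := by
  have hM' : (4 : ℝ) ≤ M := by exact_mod_cast hM
  have hσ := sigma_pos (M := M)
  have hσ2 := sigma_sq (M := M)
  have hs := ha.mul_self k
  have hsne : coord a k ≠ 0 := by rintro h; simp [h] at hs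
  have hne : (M + 1) * sigma M * coord a k ≠ -((M - 1) * sigma M * coord a k) := by
    intro h
    have : 2 * M * sigma M * coord a k = 0 := by linear_combination h
    simp only [mul_eq_zero, hsne, hσ.ne', or_false] at this
    rcases this with h | h
    · norm_num at h
    · linarith
  have hval : ∀ l, (l ≠ k ∧ coord a l = coord a k ∧
      coord (product a k) l = (M + 1) * sigma M * coord a k) ∨
      coord (product a k) l = -((M - 1) * sigma M * coord a k) := by
    intro l
    by_cases hlk : l = k
    · right; rw [hlk, coord_product_self]
    rcases ha.eq_or k l with h | h
    · exact Or.inl ⟨hlk, h, coord_product_same hlk h⟩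
    · exact Or.inr (coord_product_opp ha h)
  have hsq1 : ((M + 1) * sigma M * coord a k) ^ 2 = (M + 1) ^ 2 * sigma M ^ 2 := by
    linear_combination (M + 1) ^ 2 * sigma M ^ 2 * hs
  have hsq2 : (-((M - 1) * sigma M * coord a k)) ^ 2 = (M - 1) ^ 2 * sigma M ^ 2 := by
    linear_combination (M - 1) ^ 2 * sigma M ^ 2 * hs
  have hσ0 : 0 < sigma M ^ 2 := by positivity
  have hcube1 : ((M + 1) * sigma M * coord a k) ^ 3 - (M + 1) * sigma M * coord a k =
      (2 * M ^ 2 - 2) * sigma M ^ 3 * coord a k := by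
    linear_combination (M + 1) ^ 3 * sigma M ^ 3 * coord a k * hs +
      (M + 1) * sigma M * coord a k * hσ2
  have hcube2 : (-((M - 1) * sigma M * coord a k)) ^ 3 - -((M - 1) * sigma M * coord a k) =
      (2 * M ^ 2 - 2) * sigma M ^ 3 * coord a k := by
    linear_combination (-(M - 1) ^ 3 * sigma M ^ 3 * coord a k) * hs -
      (M - 1) * sigma M * coord a k * hσ2
  have hcube0 : (-(2 * sigma M * coord a k)) ^ 3 - -(2 * sigma M * coord a k) =
      (2 * M ^ 2 - 2) * sigma M ^ 3 * coord a k := by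
    linear_combination (-8 * sigma M ^ 3 * coord a k) * hs - 2 * sigma M * coord a k * hσ2
  -- The third root is minus the sum of the two that occur, `-2σ` times the sign; it is not
  -- attained, but the definition of a triple requires it to be distinct from the others.
  refine ⟨mem_stationary_zero ((G₀_eq_zero_iff _).2 ⟨(2 * M ^ 2 - 2) * sigma M ^ 3 * coord a k,
    fun l ↦ ?_⟩) fun l ↦ ?_, (2 * M ^ 2 - 2) * sigma M ^ 3 * coord a k,
    ![-(2 * sigma M * coord a k), (M + 1) * sigma M * coord a k,
      -((M - 1) * sigma M * coord a k)], ?_, ?_, ?_, ?_⟩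
  · rcases hval l with ⟨-, -, h⟩ | h <;> rw [h]
    · exact hcube1
    · exact hcube2
  · rcases hval l with ⟨-, -, h⟩ | h <;> rw [h]
    · rw [hsq1]; nlinarith
    · rw [hsq2]; nlinarith [mul_pos hσ0 (by nlinarith : 0 < 2 * (M : ℝ) ^ 2 - 6 * M)]
  · have h01 : -(2 * sigma M * coord a k) ≠ (M + 1) * sigma M * coord a k := by
      intro h
      have : (M + 3) * sigma M * coord a k = 0 := by linear_combination -h
      simp only [mul_eq_zero, hsne, hσ.ne', or_false] at this
      linarith
    have h02 : -(2 * sigma M * coord a k) ≠ -((M - 1) * sigma M * coord a k) := by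
      intro h
      have : (M - 3) * sigma M * coord a k = 0 := by linear_combination h
      simp only [mul_eq_zero, hsne, hσ.ne', or_false] at this
      linarith
    intro i j h
    fin_cases i <;> fin_cases j
    · rfl
    · exact absurd h h01
    · exact absurd h h02
    · exact absurd h.symm h01
    · rfl
    · exact absurd h hne
    · exact absurd h.symm h02
    · exact absurd h.symm hne
    · rfl
  · intro j
    fin_cases j
    · exact hcube0
    · exact hcube1
    · exact hcube2
  · intro l
    rcases hval l with ⟨-, -, h⟩ | h
    · exact ⟨1, h⟩
    · exact ⟨2, h⟩
  · have h1 : {l | coord (product a k) l = (M + 1) * sigma M * coord a k}.ncard = M - 1 := by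
      have : {l | coord (product a k) l = (M + 1) * sigma M * coord a k} =
          ((Finset.univ.filter fun l ↦ coord a l = coord a k).erase k : Finset _) := by
        ext l
        simp only [mem_ofPred_eq, Finset.coe_erase, Finset.coe_filter, Finset.mem_univ, true_and,
          Set.mem_sdiff, mem_singleton_iff]
        constructor
        · intro h
          rcases hval l with h' | h'
          · exact ⟨h'.2.1, h'.1⟩
          · exact absurd (h.symm.trans h') hne
        · rintro ⟨h, h'⟩
          exact coord_product_same h' h
      rw [this, Set.ncard_coe_finset, Finset.card_erase_of_mem (by simp), ha.card_eq_site]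
    have h2 : {l | coord (product a k) l = -((M - 1) * sigma M * coord a k)}.ncard = M + 1 := by
      have h3 : {l | coord (product a k) l = -((M - 1) * sigma M * coord a k)} =
          {l | coord (product a k) l = (M + 1) * sigma M * coord a k}ᶜ := by
        ext l
        simp only [mem_ofPred_eq, mem_compl_iff]
        constructor
        · intro h h'
          exact hne (h'.symm.trans h)
        · intro h
          exact (hval l).resolve_left fun h' ↦ h h'.2.2
      have h4 := Set.ncard_add_ncard_compl
        {l | coord (product a k) l = (M + 1) * sigma M * coord a k}
      rw [← h3, h1, Nat.card_eq_fintype_card, Fintype.card_fin] at h4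
      omega
    have h0 : {l | coord (product a k) l = -(2 * sigma M * coord a k)}.ncard = 0 := by
      rw [Set.ncard_eq_zero]
      ext l
      simp only [mem_ofPred_eq, mem_empty_iff_false, iff_false]
      intro h
      rcases hval l with ⟨-, -, h'⟩ | h'
      · have : (M + 3) * sigma M * coord a k = 0 := by linear_combination h - h'
        simp only [mul_eq_zero, hsne, hσ.ne', or_false] at this
        linarith
      · have : (M - 3) * sigma M * coord a k = 0 := by linear_combination h' - h
        simp only [mul_eq_zero, hsne, hσ.ne', or_false] at this
        linarith
    intro j
    fin_cases j
    · exact h0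
    · exact h1
    · exact h2

/-- This is the mechanism of the transitions: the decayed site and the sites of opposite sign have
the same coordinate in the product state, so either may regain the lost sign. -/
theorem product_swap {a : S (2 * M)} {i j : Fin (2 * M)}
    (hij : coord a j = -coord a i) : product (permute (Equiv.swap i j) a) j = product a i := by
  refine coord_ext fun l ↦ ?_
  simp only [product, coord_smul, coord_add, coord_permute, coord_bump, Equiv.swap_apply_right]
  by_cases hi : l = i
  · subst hi
    by_cases hj : l = j
    · subst hj; simp
    · rw [Equiv.swap_apply_left, hij, if_neg hj, if_pos rfl]; ring
  · by_cases hj : l = j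
    · subst hj
      rw [Equiv.swap_apply_right, hij, if_neg hi, if_pos rfl]; ring
    · simp [hi, hj, Equiv.swap_apply_of_ne_of_ne hi hj]

theorem saddle_swap (a : S (2 * M)) (i j : Fin (2 * M)) :
    permute (Equiv.swap i j) (saddle a i) = saddle (permute (Equiv.swap i j) a) j := by
  refine coord_ext fun l ↦ ?_
  simp only [saddle, coord_smul, coord_add, coord_permute, coord_bump, Equiv.swap_apply_right]
  have : (Equiv.swap i j l = i) ↔ l = j := by
    rw [Equiv.swap_apply_eq_iff, Equiv.swap_apply_left]
  simp only [this]

end MassConserving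

/-! ## The interaction energy of configurations and saddles -/

namespace MassConserving

open Landscape GradFlow Metric

variable {N M : ℕ}

/-- The bilinear form of the interaction energy. -/
def couplingForm (x y : S N) : ℝ :=
  ∑ i, (coord x (finRotate N i) - coord x i) * (coord y (finRotate N i) - coord y i)

theorem couplingEnergy_eq (x : S N) : couplingEnergy N x = couplingForm x x / 4 := by
  simp only [couplingEnergy, couplingForm, sq]; ring

theorem couplingEnergy_combination (r s : ℝ) (x y : S N) : couplingEnergy N (r • x + s • y) =
    (r ^ 2 * couplingForm x x + 2 * r * s * couplingForm x y + s ^ 2 * couplingForm y y) / 4 := by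
  rw [couplingEnergy_eq]
  congr 1
  simp only [couplingForm, Finset.mul_sum, ← Finset.sum_add_distrib]
  refine Finset.sum_congr rfl fun i _ ↦ ?_
  simp only [coord_add, coord_smul]
  ring

/-- Only the peak of `bump k` contributes, so the form is `M` times the discrete Laplacian of `x` at
`k`; for a configuration it counts interfaces at `k`. -/
theorem couplingForm_bump (x : S (2 * M)) (k : Fin (2 * M)) : couplingForm x (bump k) =
    M * ((coord x (finRotate _ k) - coord x k) -
      (coord x k - coord x ((finRotate (2 * M)).symm k))) := by
  have h : ∀ i, (coord x (finRotate _ i) - coord x i) *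
      (coord (bump k) (finRotate _ i) - coord (bump k) i) =
      (if i = k then M * (coord x (finRotate _ k) - coord x k) else 0) -
        if i = (finRotate (2 * M)).symm k then
          M * (coord x k - coord x ((finRotate (2 * M)).symm k)) else 0 := by
    intro i
    simp only [coord_bump]
    have h1 : finRotate (2 * M) i = k ↔ i = (finRotate (2 * M)).symm k :=
      (Equiv.eq_symm_apply _).symm
    by_cases hi : i = k
    · rw [if_pos hi, if_pos hi]
      by_cases hi' : finRotate (2 * M) i = k
      · subst hi
        rw [if_pos hi', if_pos (h1.1 hi'), ← h1.1 hi', hi']; ring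
      · rw [if_neg hi', if_neg (mt h1.2 hi'), hi]; ring
    · rw [if_neg hi, if_neg hi]
      by_cases hi' : finRotate (2 * M) i = k
      · rw [if_pos hi', if_pos (h1.1 hi'), ← h1.1 hi', hi']; ring
      · rw [if_neg hi', if_neg (mt h1.2 hi')]; ring
  rw [couplingForm, Finset.sum_congr rfl fun i _ ↦ h i, Finset.sum_sub_distrib,
    Finset.sum_ite_eq', Finset.sum_ite_eq', if_pos (Finset.mem_univ _), if_pos (Finset.mem_univ _)]
  ring

theorem finRotate_ne (hM : 4 ≤ M) (k : Fin (2 * M)) : finRotate (2 * M) k ≠ k := by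
  obtain ⟨n, hn⟩ : ∃ n, 2 * M = n + 2 := ⟨2 * M - 2, by omega⟩
  revert k
  rw [hn]
  intro k
  rw [finRotate_apply]
  simp

theorem couplingForm_bump_self (hM : 4 ≤ M) (k : Fin (2 * M)) :
    couplingForm (bump k) (bump k) = 2 * (M : ℝ) ^ 2 := by
  have h2 : (finRotate (2 * M)).symm k ≠ k := fun h ↦
    finRotate_ne hM k (by rw [← h, Equiv.apply_symm_apply, h])
  rw [couplingForm_bump]
  simp only [coord_bump, if_pos, if_neg (finRotate_ne hM k), if_neg h2]
  ring

theorem IsSpin.couplingForm_self {a : S (2 * M)} (ha : IsSpin a) :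
    couplingForm a a = 4 * interfaces a := by
  have h : ∀ i, (coord a (finRotate _ i) - coord a i) * (coord a (finRotate _ i) - coord a i) =
      4 * if coord a i ≠ coord a (finRotate _ i) then 1 else 0 := by
    intro i
    rcases ha i with h | h <;> rcases ha (finRotate _ i) with h' | h' <;> rw [h, h'] <;> norm_num
  rw [couplingForm, Finset.sum_congr rfl fun i _ ↦ h i, ← Finset.mul_sum, Finset.sum_boole,
    interfaces, Set.ncard_eq_toFinset_card']
  simp

theorem IsSpin.couplingEnergy {a : S (2 * M)} (ha : IsSpin a) :
    couplingEnergy (2 * M) a = interfaces a := by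
  rw [couplingEnergy_eq, ha.couplingForm_self]; ring

theorem IsSpin.couplingForm_bump {a : S (2 * M)} (ha : IsSpin a) (k : Fin (2 * M)) :
    coord a k * couplingForm a (bump k) = -(2 * M) * interfacesAt a k := by
  rw [MassConserving.couplingForm_bump, interfacesAt]
  rcases ha k with h | h <;> rcases ha (finRotate _ k) with h1 | h1 <;>
    rcases ha ((finRotate (2 * M)).symm k) with h2 | h2 <;> rw [h, h1, h2] <;> norm_num <;> ring

/-- The first-order coefficient of the energy of the saddle at a site with `η` interfaces of a
configuration with `p` interfaces, relative to this configuration. -/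
def saddleSlope (M p η : ℕ) : ℝ :=
  (2 * (M : ℝ) ^ 2 - (4 * (M : ℝ) ^ 2 - 6 * M) * η - 3 * p) / (4 * ((M : ℝ) ^ 2 - 3 * M + 3))

/-- A saddle is a linear combination of `a` and `bump k`, so its interaction energy follows from
three values of the bilinear form: `4p`, the number of interfaces at `k`, and `2M²`. -/
theorem couplingEnergy_saddle (hM : 4 ≤ M) {a : S (2 * M)} (ha : IsSpin a) (k : Fin (2 * M)) :
    couplingEnergy (2 * M) (saddle a k) =
      interfaces a + saddleSlope M (interfaces a) (interfacesAt a k) := by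
  have hD : 0 < (M : ℝ) ^ 2 - 3 * M + 3 := by nlinarith [sq_nonneg ((M : ℝ) - 3 / 2)]
  have ht : tau M ^ 2 = 1 / ((M : ℝ) ^ 2 - 3 * M + 3) := by
    rw [eq_div_iff hD.ne', tau_sq]
  have h1 : saddle a k = (tau M * ((2 * M - 3) / 2)) • a + (tau M * coord a k) • bump k := by
    rw [saddle, smul_add, smul_smul, smul_smul]
  rw [h1, couplingEnergy_combination, ha.couplingForm_self, couplingForm_bump_self hM,
    saddleSlope]
  have h2 := ha.couplingForm_bump k
  have h3 := ha.mul_self k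
  have h4 : ((tau M * ((2 * M - 3) / 2)) ^ 2 * (4 * interfaces a) +
      2 * (tau M * ((2 * M - 3) / 2)) * (tau M * coord a k) * couplingForm a (bump k) +
      (tau M * coord a k) ^ 2 * (2 * (M : ℝ) ^ 2)) / 4 =
      tau M ^ 2 * ((2 * M - 3) ^ 2 * interfaces a - (2 * M - 3) * (2 * M) * interfacesAt a k +
        2 * (M : ℝ) ^ 2) / 4 := by
    linear_combination (tau M ^ 2 * (2 * M - 3) / 4) * h2 + (tau M ^ 2 * M ^ 2 / 2) * h3
  rw [h4, ht]
  generalize hDe : (M : ℝ) ^ 2 - 3 * M + 3 = D at hD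
  have hD0 := hD.ne'
  field_simp
  linear_combination (4 * (interfaces a : ℝ)) * hDe

theorem saddleLevel_eq : saddleLevel M = -(M : ℝ) / 2 + height0 M := by
  have hD : 0 < (M : ℝ) ^ 2 - 3 * M + 3 := by nlinarith [sq_nonneg ((M : ℝ) - 3 / 2)]
  have ht : tau M ^ 2 = 1 / ((M : ℝ) ^ 2 - 3 * M + 3) := by
    rw [eq_div_iff hD.ne', tau_sq]
  rw [saddleLevel, ht, height0]
  field_simp

end MassConserving

/-! ## Interchanges of a particle and a hole -/

namespace MassConserving

open Landscape GradFlow Metric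

variable {N M : ℕ}

theorem interfacesAt_le (x : S N) (i : Fin N) : interfacesAt x i ≤ 2 := by
  unfold interfacesAt
  split_ifs <;> norm_num

theorem couplingForm_add_smul (r s : ℝ) (x y z w : S N) :
    couplingForm (x + (r • y + s • z)) w =
      couplingForm x w + r * couplingForm y w + s * couplingForm z w := by
  simp only [couplingForm, Finset.mul_sum, ← Finset.sum_add_distrib]
  refine Finset.sum_congr rfl fun i _ ↦ ?_
  simp only [coord_add, coord_smul]
  ring

theorem couplingForm_comm (x y : S N) : couplingForm x y = couplingForm y x :=
  Finset.sum_congr rfl fun _ _ ↦ mul_comm _ _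

namespace IsInterchange

variable {a b : S (2 * M)} {i j : Fin (2 * M)}

theorem eq_permute (h : IsInterchange a b i j) : b = permute (Equiv.swap i j) a :=
  coord_ext fun k ↦ h.2.2 k

theorem ne_sites (h : IsInterchange a b i j) : i ≠ j := by
  rintro rfl
  have := h.1.symm.trans h.2.1
  norm_num at this

theorem isSpin (h : IsInterchange a b i j) (ha : IsSpin a) : IsSpin b := by
  rw [h.eq_permute]; exact ha.permute _

theorem coord_left (h : IsInterchange a b i j) : coord b i = -1 := by
  rw [h.2.2, Equiv.swap_apply_left, h.2.1]

theorem coord_right (h : IsInterchange a b i j) : coord b j = 1 := by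
  rw [h.2.2, Equiv.swap_apply_right, h.1]

theorem symm (h : IsInterchange a b i j) : IsInterchange b a j i := by
  refine ⟨h.coord_right, h.coord_left, fun k ↦ ?_⟩
  rw [h.2.2, Equiv.swap_comm j i, Equiv.swap_apply_self]

theorem ne (h : IsInterchange a b i j) : a ≠ b := by
  rintro rfl
  have := h.1.symm.trans h.coord_left
  norm_num at this

theorem product_left (h : IsInterchange a b i j) : product a i = product b j := by
  rw [h.eq_permute, product_swap (by rw [h.1, h.2.1])]

theorem product_right (h : IsInterchange a b i j) : product a j = product b i := by
  rw [h.eq_permute, Equiv.swap_comm, product_swap (by rw [h.1, h.2.1]; norm_num)]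

open Classical in
/-- The indicator function of nearest neighbours. -/
def _root_.MassConserving.adjacency (i j : Fin N) : ℕ := if Neighbours i j then 1 else 0

theorem couplingForm_bump_bump (hM : 4 ≤ M) (hij : i ≠ j) :
    couplingForm (bump i) (bump j) = -((M : ℝ) ^ 2 * adjacency i j) := by
  have e1 : ∀ x : Fin (2 * M), (finRotate (2 * M)).symm j = x ↔ j = finRotate (2 * M) x :=
    fun x ↦ Equiv.symm_apply_eq _
  -- With at least three sites on the cycle, two sites cannot be neighbours on both sides.
  have hN : ¬ (j = finRotate (2 * M) i ∧ i = finRotate (2 * M) j) := by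
    rintro ⟨h1, h2⟩
    obtain ⟨n, hn⟩ : ∃ n, 2 * M = n + 3 := ⟨2 * M - 3, by omega⟩
    revert i j
    rw [hn]
    intro i j _ _ h1 h2
    rw [finRotate_apply] at h1 h2
    rw [h1] at h2
    have h3 : (1 : Fin (n + 3)) + 1 = 0 := by
      have := h2.symm
      rwa [add_assoc, add_eq_left] at this
    have := congrArg Fin.val h3
    rw [Fin.val_add] at this
    simp only [Fin.val_one, Fin.val_zero] at this
    rw [Nat.mod_eq_of_lt (by omega)] at this
    omega
  rw [MassConserving.couplingForm_bump]
  simp only [coord_bump, if_neg hij.symm]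
  unfold adjacency
  by_cases h1 : j = finRotate (2 * M) i
  · have h2 : ¬ finRotate (2 * M) j = i := fun h ↦ hN ⟨h1, h.symm⟩
    rw [if_neg h2, if_pos ((e1 i).2 h1), if_pos (show Neighbours i j from Or.inl h1)]
    push_cast; ring
  · by_cases h2 : i = finRotate (2 * M) j
    · rw [if_pos h2.symm, if_neg (mt (e1 i).1 h1), if_pos (show Neighbours i j from Or.inr h2)]
      push_cast; ring
    · rw [if_neg (fun h ↦ h2 h.symm), if_neg (mt (e1 i).1 h1),
        if_neg (show ¬ Neighbours i j from fun h ↦ h.elim h1 h2)]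
      push_cast; ring

/-- Written in this way, the effect of an interchange on interfaces becomes a bilinear computation
instead of a case distinction on the neighbourhoods of `i` and `j`. -/
theorem eq_add (hM : 4 ≤ M) (h : IsInterchange a b i j) :
    b = a + ((2 / M : ℝ) • bump i + (-(2 / M) : ℝ) • bump j) := by
  have hM0 : (M : ℝ) ≠ 0 := by
    have : 0 < M := by omega
    exact_mod_cast this.ne'
  refine coord_ext fun k ↦ ?_
  simp only [coord_add, coord_smul, coord_bump]
  rw [h.2.2]
  by_cases hi : k = i
  · subst hi
    rw [Equiv.swap_apply_left, h.2.1, h.1, if_pos rfl, if_neg h.ne_sites]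
    field_simp; ring
  · by_cases hj : k = j
    · subst hj
      rw [Equiv.swap_apply_right, h.2.1, h.1, if_pos rfl, if_neg hi]
      field_simp; ring
    · rw [Equiv.swap_apply_of_ne_of_ne hi hj, if_neg hi, if_neg hj]
      ring

/-- The change of the number of interfaces at the second site. -/
theorem interfacesAt_right (hM : 4 ≤ M) (ha : IsSpin a) (h : IsInterchange a b i j) :
    interfacesAt b j + interfacesAt a j = 2 + adjacency i j := by
  have hM0 : (M : ℝ) ≠ 0 := by
    have : 0 < M := by omega
    exact_mod_cast this.ne'
  have h1 := (h.isSpin ha).couplingForm_bump j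
  have h2 := ha.couplingForm_bump j
  rw [h.2.1] at h2
  rw [h.coord_right, h.eq_add hM, couplingForm_add_smul, couplingForm_bump_bump hM h.ne_sites,
    couplingForm_bump_self hM, ← h.eq_add hM] at h1
  have h3 : (2 * M : ℝ) * ((interfacesAt b j : ℝ) + interfacesAt a j) =
      2 * M * (2 + adjacency i j) := by
    field_simp at h1
    linear_combination h1 + h2
  have h4 : (interfacesAt b j : ℝ) + interfacesAt a j = 2 + adjacency i j :=
    mul_left_cancel₀ (mul_ne_zero two_ne_zero hM0) h3
  exact_mod_cast h4

theorem adjacency_comm (i j : Fin N) : adjacency i j = adjacency j i := by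
  have e : Neighbours i j ↔ Neighbours j i := or_comm
  unfold adjacency
  by_cases h : Neighbours i j
  · rw [if_pos h, if_pos (e.1 h)]
  · rw [if_neg h, if_neg (mt e.2 h)]

/-- The change of the number of interfaces at the first site. -/
theorem interfacesAt_left (hM : 4 ≤ M) (ha : IsSpin a) (h : IsInterchange a b i j) :
    interfacesAt b i + interfacesAt a i = 2 + adjacency i j := by
  have := h.symm.interfacesAt_right hM (h.isSpin ha)
  rw [adjacency_comm]
  omega

/-- The change of the number of interfaces. -/
theorem interfaces_eq (hM : 4 ≤ M) (ha : IsSpin a) (h : IsInterchange a b i j) :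
    interfaces b + 2 * (interfacesAt a i + interfacesAt a j) =
      interfaces a + 4 + 2 * adjacency i j := by
  have hM0 : (M : ℝ) ≠ 0 := by
    have : 0 < M := by omega
    exact_mod_cast this.ne'
  have h1 := (h.isSpin ha).couplingForm_self
  have hi := ha.couplingForm_bump i
  have hj := ha.couplingForm_bump j
  have hbi := (h.isSpin ha).couplingForm_bump i
  have hbj := (h.isSpin ha).couplingForm_bump j
  have h0 := ha.couplingForm_self
  have ei := h.interfacesAt_left hM ha
  have ej := h.interfacesAt_right hM ha
  have ei' : (interfacesAt b i : ℝ) + interfacesAt a i = 2 + adjacency i j := by exact_mod_cast ei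
  have ej' : (interfacesAt b j : ℝ) + interfacesAt a j = 2 + adjacency i j := by exact_mod_cast ej
  rw [h.1] at hi
  rw [h.2.1] at hj
  rw [h.coord_left] at hbi
  rw [h.coord_right] at hbj
  -- The form is expanded in one argument at a time, so that the local interface counts of `b` and
  -- of `a` enter once each.
  have hb : couplingForm b b = couplingForm a b + 2 / M * couplingForm (bump i) b +
      -(2 / M) * couplingForm (bump j) b := by
    conv_lhs => arg 1; rw [h.eq_add hM]
    exact couplingForm_add_smul _ _ _ _ _ _
  have hab : couplingForm a b = couplingForm a a + 2 / M * couplingForm (bump i) a +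
      -(2 / M) * couplingForm (bump j) a := by
    rw [couplingForm_comm a b]
    conv_lhs => arg 1; rw [h.eq_add hM]
    exact couplingForm_add_smul _ _ _ _ _ _
  rw [couplingForm_comm (bump i), couplingForm_comm (bump j)] at hb hab
  have h3 : (4 : ℝ) * (interfaces b + 2 * (interfacesAt a i + interfacesAt a j)) =
      4 * (interfaces a + 4 + 2 * adjacency i j) := by
    have e : (4 : ℝ) * interfaces b = couplingForm b b := h1.symm
    field_simp at hb hab
    have h5 : (M : ℝ) * (4 * (interfaces b + 2 * (interfacesAt a i + interfacesAt a j)) -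
      4 * (interfaces a + 4 + 2 * adjacency i j)) = 0 := by
      linear_combination M * e + hb + hab + M * h0 + 2 * hi + 2 * hj - 2 * hbi - 2 * hbj +
        4 * M * ei' + 4 * M * ej'
    rcases mul_eq_zero.1 h5 with h | h
    · exact absurd h hM0
    · linarith
  have h4 := mul_left_cancel₀ (by norm_num : (4 : ℝ) ≠ 0) h3
  exact_mod_cast h4

theorem one_le_of_neighbours (h : IsInterchange a b i j) (hn : Neighbours i j) :
    1 ≤ interfacesAt a i ∧ 1 ≤ interfacesAt a j := by
  have hne : coord a i ≠ coord a j := by rw [h.1, h.2.1]; norm_num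
  have key : ∀ k, coord a k ≠ coord a (finRotate (2 * M) k) → 1 ≤ interfacesAt a k ∧
      1 ≤ interfacesAt a (finRotate (2 * M) k) := by
    refine fun k hk ↦ ⟨?_, ?_⟩ <;> unfold interfacesAt
    · rw [if_pos hk]
      omega
    · rw [Equiv.symm_apply_apply, if_pos hk]
      omega
  rcases hn with rfl | rfl
  · exact key _ hne
  · exact (key _ hne.symm).symm

end IsInterchange

/-- The first-order energy of a saddle. -/
def saddleEnergy (M p η : ℕ) : ℝ := p + saddleSlope M p η

/-- The coefficient `4M² - 6M` of the local interface number is positive, so isolated sites offer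
the lowest exits. -/
theorem saddleEnergy_le (hM : 4 ≤ M) {p η η' : ℕ} (h : η ≤ η') :
    saddleEnergy M p η' ≤ saddleEnergy M p η := by
  have hM' : (4 : ℝ) ≤ M := by exact_mod_cast hM
  have h' : (η : ℝ) ≤ η' := by exact_mod_cast h
  have hD : 0 < 4 * ((M : ℝ) ^ 2 - 3 * M + 3) := by nlinarith
  unfold saddleEnergy saddleSlope
  gcongr
  nlinarith

/-- The interchange of the particle of `a` at `i` and the hole at `j` has type `T`; the number of
interfaces of the result `b`, and the comparison of the first-order coefficient of the height with
the energies of the adjacent saddles. -/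
structure IsTransition (a b : S (2 * M)) (i j : Fin (2 * M)) (T : TransitionType) : Prop where
  isOfType : IsOfType a i j T
  interfaces_eq : (interfaces b : ℤ) = interfaces a + T.deltaP
  le_height :
    (saddleEnergy M (interfaces a) (interfacesAt a i) ≤
        interfaces a + T.height1 M (interfaces a) ∧
      saddleEnergy M (interfaces b) (interfacesAt b j) ≤
        interfaces a + T.height1 M (interfaces a)) ∨
    (saddleEnergy M (interfaces a) (interfacesAt a j) ≤
        interfaces a + T.height1 M (interfaces a) ∧
      saddleEnergy M (interfaces b) (interfacesAt b i) ≤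
        interfaces a + T.height1 M (interfaces a))
  height_eq :
    (T ≠ .III ∧ (interfaces a + T.height1 M (interfaces a) = saddleEnergy M (interfaces a) 2 ∨
      interfaces a + T.height1 M (interfaces a) = saddleEnergy M (interfaces b) 2)) ∨
    (T = .III ∧ interfaces a = interfaces b ∧ interfacesAt a i = 1 ∧ interfacesAt a j = 1 ∧
      interfaces a + T.height1 M (interfaces a) = saddleEnergy M (interfaces a) 1)

theorem IsTransition.sub_mem {a b : S (2 * M)} {i j : Fin (2 * M)} {T : TransitionType}
    (h : IsTransition a b i j T) :
    (interfaces b : ℤ) - interfaces a ∈ ({-4, -2, 0, 2, 4} : Set ℤ) := by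
  rw [h.interfaces_eq, add_sub_cancel_left]
  cases T <;> simp [TransitionType.deltaP]

/-- The two product states `product a i = product b j` and `product a j = product b i` offer two
routes, and the height is the maximum over the cheaper one. In all types but III this maximum is
attained at a site with two interfaces, in `a` or in `b`; in type III all four saddles have one
interface at their site and the same energy. -/
theorem IsInterchange.exists_isTransition (hM : 4 ≤ M) {a b : S (2 * M)} {i j : Fin (2 * M)}
    (ha : IsSpin a) (h : IsInterchange a b i j) : ∃ T, IsTransition a b i j T := by
  have hM' : (4 : ℝ) ≤ M := by exact_mod_cast hM
  have hD : 0 < 4 * ((M : ℝ) ^ 2 - 3 * M + 3) := by nlinarith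
  have hM2 : (4 : ℝ) * M ≤ M ^ 2 := by nlinarith
  have hM3 : (8 : ℝ) * M ≤ M ^ 2 + 16 := by nlinarith [sq_nonneg ((M : ℝ) - 4)]
  have e0 := h.interfaces_eq hM ha
  have ei := h.interfacesAt_left hM ha
  have ej := h.interfacesAt_right hM ha
  have li := interfacesAt_le a i
  have lj := interfacesAt_le a j
  -- Everything is put over the common denominator, so that comparisons become polynomial
  -- inequalities in `M`.
  have F : ∀ p η : ℕ, saddleEnergy M p η = (p * (4 * ((M : ℝ) ^ 2 - 3 * M + 3)) +
      (2 * (M : ℝ) ^ 2 - (4 * (M : ℝ) ^ 2 - 6 * M) * η - 3 * p)) /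
        (4 * ((M : ℝ) ^ 2 - 3 * M + 3)) := by
    intro p η
    rw [add_div, mul_div_cancel_right₀ _ hD.ne']
    rfl
  have G : ∀ (p : ℕ) (q : ℝ), p + q / (4 * ((M : ℝ) ^ 2 - 3 * M + 3)) =
      (p * (4 * ((M : ℝ) ^ 2 - 3 * M + 3)) + q) / (4 * ((M : ℝ) ^ 2 - 3 * M + 3)) := by
    intro p q
    rw [add_div, mul_div_cancel_right₀ _ hD.ne']
  have hp : (interfaces b : ℝ) = interfaces a + 4 + 2 * adjacency i j -
      2 * (interfacesAt a i + interfacesAt a j) := by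
    rw [eq_sub_iff_add_eq]; exact_mod_cast e0
  have hi : interfacesAt a i = 0 ∨ interfacesAt a i = 1 ∨ interfacesAt a i = 2 := by omega
  have hj : interfacesAt a j = 0 ∨ interfacesAt a j = 1 ∨ interfacesAt a j = 2 := by omega
  have hbi : (interfacesAt b i : ℝ) = 2 + adjacency i j - interfacesAt a i := by
    rw [eq_sub_iff_add_eq]; exact_mod_cast ei
  have hbj : (interfacesAt b j : ℝ) = 2 + adjacency i j - interfacesAt a j := by
    rw [eq_sub_iff_add_eq]; exact_mod_cast ej
  by_cases hn : Neighbours i j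
  · have hν : adjacency i j = 1 := if_pos hn
    have h1 := h.one_le_of_neighbours hn
    rcases hi with hi | hi | hi <;> rcases hj with hj | hj | hj <;> try omega
    -- Neighbouring sites share an interface, so only the counts `1` and `2` survive. Each `refine`
    -- leaves four goals: type, interface count, bound on one route, and identification of the
    -- height.
    on_goal 1 => refine ⟨.II, ?_, ?_, ?_, ?_⟩
    on_goal 5 => refine ⟨.IV, ?_, ?_, ?_, ?_⟩
    on_goal 9 => refine ⟨.IV, ?_, ?_, ?_, ?_⟩
    on_goal 13 => refine ⟨.V, ?_, ?_, ?_, ?_⟩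
    all_goals first
      | simp [IsOfType, hi, hj, hn]
        done
      | simp only [TransitionType.deltaP]
        omega
      | simp only [TransitionType.height1, G, F, hi, hj, hbi, hbj, hp, hν,
          div_le_div_iff_of_pos_right hD, div_left_inj' hD.ne']
        push_cast
        first
          | left; constructor <;> linarith
          | right; constructor <;> linarith
          | left; refine ⟨by simp, Or.inl ?_⟩; ring1
          | left; refine ⟨by simp, Or.inr ?_⟩; ring1
  · have hν : adjacency i j = 0 := if_neg hn
    rcases hi with hi | hi | hi <;> rcases hj with hj | hj | hj
    on_goal 1 => refine ⟨.I, ?_, ?_, ?_, ?_⟩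
    on_goal 5 => refine ⟨.II, ?_, ?_, ?_, ?_⟩
    on_goal 9 => refine ⟨.IV, ?_, ?_, ?_, ?_⟩
    on_goal 13 => refine ⟨.II, ?_, ?_, ?_, ?_⟩
    on_goal 17 => refine ⟨.III, ?_, ?_, ?_, ?_⟩
    -- Type III is the only case in which the height is not that of a saddle with two interfaces at
    -- its site.
    on_goal 20 => exact Or.inr ⟨rfl, by omega, hi, hj, by
      simp only [TransitionType.height1, G, F]; congr 1; push_cast; ring⟩
    on_goal 20 => refine ⟨.V, ?_, ?_, ?_, ?_⟩
    on_goal 24 => refine ⟨.IV, ?_, ?_, ?_, ?_⟩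
    on_goal 28 => refine ⟨.V, ?_, ?_, ?_, ?_⟩
    on_goal 32 => refine ⟨.VI, ?_, ?_, ?_, ?_⟩
    all_goals first
      | simp [IsOfType, hi, hj, hn]
        done
      | simp only [TransitionType.deltaP]
        omega
      | simp only [TransitionType.height1, G, F, hi, hj, hbi, hbj, hp, hν,
          div_le_div_iff_of_pos_right hD, div_left_inj' hD.ne']
        push_cast
        first
          | left; constructor <;> linarith
          | right; constructor <;> linarith
          | left; refine ⟨by simp, Or.inl ?_⟩; ring1
          | left; refine ⟨by simp, Or.inr ?_⟩; ring1

end MassConserving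

/-! ## Branches of minima and the dynamics near the saddles -/

namespace MassConserving

open Landscape GradFlow Metric

variable {N M : ℕ}

theorem _root_.Filter.Eventually.forall_closedBall {E : Type*} [PseudoMetricSpace E] {c : E}
    {p : E → Prop} (h : ∀ᶠ x in 𝓝 c, p x) : ∀ᶠ δ in 𝓝[>] (0 : ℝ), ∀ x ∈ closedBall c δ, p x := by
  obtain ⟨ε, hε, hsub⟩ := Metric.mem_nhds_iff.1 h
  filter_upwards [Ioo_mem_nhdsGT hε] with δ hδ x hx
  exact hsub (closedBall_subset_ball hδ.2 hx)

theorem _root_.Filter.Eventually.forall_Icc {p : ℝ → Prop} (h : ∀ᶠ γ in 𝓝[≥] (0 : ℝ), p γ) :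
    ∀ᶠ γ in 𝓝[≥] (0 : ℝ), ∀ g ∈ Icc 0 γ, p g := by
  obtain ⟨γ₁, hγ₁, hsub⟩ := mem_nhdsGE_iff_exists_Icc_subset.1 h
  filter_upwards [Icc_mem_nhdsGE hγ₁] with γ hγ g hg
  exact hsub ⟨hg.1, hg.2.trans hγ.2⟩

/-- Close to `c` every coordinate except the special one is strictly on its side of the middle root,
so the special coordinate alone decides membership. -/
theorem IsGenericSaddle.eventually_mem_region {c : S N} {i : Fin N} {α β : ℝ}
    (h : IsGenericSaddle c i α β) : ∀ᶠ x in 𝓝 c,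
      (0 < (β - coord c i) * (coord x i - coord c i) → x ∈ region c i α β) ∧
      (0 ≤ (β - coord c i) * (coord x i - coord c i) → x ∈ closedRegion c i α β) := by
  have key : ∀ᶠ x in 𝓝 c, ∀ k, k ≠ i →
      0 < (pattern c i α β k - coord c i) * (coord x k - coord c i) := by
    refine eventually_all.2 fun k ↦ ?_
    by_cases hk : k = i
    · exact Eventually.of_forall fun _ h ↦ absurd hk h
    have hpat : pattern c i α β k = coord c k := by
      rcases h.coord_ne k hk with e | e
      · rw [pattern_eq_alpha hk e, e]
      · rw [h.pattern_eq_beta e, e]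
    have hne : coord c k - coord c i ≠ 0 := by
      intro e
      rw [sub_eq_zero] at e
      rcases h.coord_ne k hk with e' | e'
      · exact absurd h.sq_lt_alpha (by rw [← e, e']; exact lt_irrefl _)
      · exact absurd h.sq_lt_beta (by rw [← e, e']; exact lt_irrefl _)
    have hcont : Continuous fun x : S N ↦
        (pattern c i α β k - coord c i) * (coord x k - coord c i) :=
      continuous_const.mul ((continuous_coord k).sub continuous_const)
    have h0 : 0 < (pattern c i α β k - coord c i) * (coord c k - coord c i) := by
      rw [hpat]; exact mul_self_pos.2 hne
    exact (hcont.tendsto c |>.eventually_const_lt h0).mono fun _ hx _ ↦ hx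
  filter_upwards [key] with x hx
  refine ⟨fun h0 k ↦ ?_, fun h0 k ↦ ?_⟩
  · by_cases hk : k = i
    · rw [hk, pattern_site]; exact h0
    · exact hx k hk
  · by_cases hk : k = i
    · rw [hk, pattern_site]; exact h0
    · exact (hx k hk).le

theorem eventually_mem_spinRegion (hM : 4 ≤ M) {a : S (2 * M)} (ha : IsSpin a) (k : Fin (2 * M)) :
    ∀ᶠ x in 𝓝 (saddle a k),
      (0 < coord a k * (coord x k - coord (saddle a k) k) → x ∈ spinRegion a) ∧
      (0 ≤ coord a k * (coord x k - coord (saddle a k) k) → x ∈ closedSpinRegion a) := by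
  have hM' : (4 : ℝ) ≤ M := by exact_mod_cast hM
  have ht : 0 < tau M := tau_pos
  have hkk := ha.mul_self k
  have h1 : ∀ᶠ x in 𝓝 (saddle a k), ∀ l, l ≠ k → -tau M < coord a l * coord x l := by
    refine eventually_all.2 fun l ↦ ?_
    by_cases hl : l = k
    · exact Eventually.of_forall fun _ h ↦ absurd hl h
    have hcont : Continuous fun x : S (2 * M) ↦ coord a l * coord x l :=
      continuous_const.mul (continuous_coord l)
    refine ((hcont.tendsto _).eventually_const_lt ?_).mono fun _ hx _ ↦ hx
    rcases ha.eq_or k l with h | h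
    · have e : coord a k * ((M - 1) * tau M * coord a k) = (M - 1) * tau M := by
        linear_combination ((M - 1) * tau M) * hkk
      rw [coord_saddle_same hl h, h, e]; nlinarith
    · have e : -coord a k * -((M - 2) * tau M * coord a k) = (M - 2) * tau M := by
        linear_combination ((M - 2) * tau M) * hkk
      rw [coord_saddle_opp ha h, h, e]; nlinarith
  have h2 : ∀ᶠ x in 𝓝 (saddle a k), ∀ i j, coord a i = 1 → coord a j = -1 →
      coord x j < coord x i := by
    refine eventually_all.2 fun i ↦ eventually_all.2 fun j ↦ ?_
    by_cases hi : coord a i = 1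
    swap
    · exact Eventually.of_forall fun _ h ↦ absurd h hi
    by_cases hj : coord a j = -1
    swap
    · exact Eventually.of_forall fun _ _ h ↦ absurd h hj
    have hlt : coord (saddle a k) j < coord (saddle a k) i := by
      rcases ha k with hk | hk
      · rw [coord_saddle_opp ha (hj.trans (by rw [hk])), hk]
        by_cases hik : i = k
        · rw [hik, coord_saddle_self, hk]; nlinarith
        · rw [coord_saddle_same hik (hi.trans hk.symm), hk]; nlinarith
      · rw [coord_saddle_opp ha (hi.trans (by rw [hk, neg_neg])), hk]
        by_cases hjk : j = k
        · rw [hjk, coord_saddle_self, hk]; nlinarith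
        · rw [coord_saddle_same hjk (hj.trans hk.symm), hk]; nlinarith
    exact (((continuous_coord j).tendsto (saddle a k)).eventually_lt
      ((continuous_coord i).tendsto (saddle a k)) hlt).mono fun _ hx _ _ ↦ hx
  have hself : ∀ x : S (2 * M), coord a k * (coord x k - coord (saddle a k) k) =
      coord a k * coord x k + tau M := by
    intro x
    rw [coord_saddle_self]
    linear_combination tau M * hkk
  filter_upwards [h1, h2] with x hx1 hx2
  rw [hself]
  refine ⟨fun h0 ↦ ⟨fun l ↦ ?_, hx2⟩, fun h0 ↦ ⟨fun l ↦ ?_, fun i j hi hj ↦ (hx2 i j hi hj).le⟩⟩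
  · by_cases hl : l = k
    · subst hl; linarith
    · exact hx1 l hl
  · by_cases hl : l = k
    · subst hl; linarith
    · exact (hx1 l hl).le

/-! ### Branches of minima -/

open Classical in
/-- The continuation of a stationary point of the uncoupled system. -/
def branch (c : S N) : ℝ → S N :=
  -- The constant path is only a default; at a nondegenerate minimum a branch exists.
  if h : ∃ ξ r γ₁ C, (fam N).IsBranch c ξ r γ₁ C then h.choose else fun _ ↦ c

/-- The nondegenerate minima of the uncoupled system. -/
structure IsMinimum (m : S N) : Prop where
  stationary : (fam N).G₀ m = 0
  one_lt : ∀ k, 1 < 3 * coord m k ^ 2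

theorem IsSpin.isMinimum {a : S (2 * M)} (ha : IsSpin a) : IsMinimum a :=
  ⟨ha.stationary, fun k ↦ by rw [sq, ha.mul_self]; norm_num⟩

theorem isMinimum_product (hM : 4 ≤ M) {a : S (2 * M)} (ha : IsSpin a) (k : Fin (2 * M)) :
    IsMinimum (product a k) := by
  have hM' : (4 : ℝ) ≤ M := by exact_mod_cast hM
  have h0 := (product_mem_B hM ha k).1.1.1
  rw [← fam_G, fam_G_zero] at h0
  refine ⟨h0, fun l ↦ ?_⟩
  have hs := sigma_sq (M := M)
  have hs0 := sq_nonneg (sigma M)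
  have hk : coord a k ^ 2 = 1 := by rw [sq, ha.mul_self]
  have key : coord (product a k) l ^ 2 = (M + 1) ^ 2 * sigma M ^ 2 ∨
      coord (product a k) l ^ 2 = (M - 1) ^ 2 * sigma M ^ 2 := by
    by_cases hl : l = k
    · right; rw [hl, coord_product_self]; linear_combination ((M - 1) ^ 2 * sigma M ^ 2) * hk
    rcases ha.eq_or k l with h | h
    · left; rw [coord_product_same hl h]; linear_combination ((M + 1) ^ 2 * sigma M ^ 2) * hk
    · right; rw [coord_product_opp ha h]; linear_combination ((M - 1) ^ 2 * sigma M ^ 2) * hk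
  have hpos : 0 < sigma M ^ 2 := pow_pos sigma_pos 2
  rcases key with e | e <;> rw [e, ← hs] <;> nlinarith

theorem IsMinimum.exists_isBranch {m : S N} (h : IsMinimum m) :
    ∃ r γ₁ C, (fam N).IsBranch m (branch m) r γ₁ C := by
  have hex : ∃ ξ r γ₁ C, (fam N).IsBranch m ξ r γ₁ C := by
    refine (fam N).exists_isBranch h.stationary ?_
    rw [injective_iff_map_eq_zero]
    intro w hw
    by_contra hne
    have := inner_fderiv_pos h.one_lt hne
    rw [hw, inner_zero_left] at this
    exact lt_irrefl _ this
  rw [branch, dif_pos hex]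
  exact hex.choose_spec

theorem IsMinimum.tendsto_branch {m : S N} (h : IsMinimum m) :
    Tendsto (branch m) (𝓝[≥] 0) (𝓝 m) := by
  obtain ⟨r, γ₁, C, hb⟩ := h.exists_isBranch
  exact hb.tendsto

theorem IsMinimum.eventually_pos {m : S N} (h : IsMinimum m) : ∃ r > 0,
    ∀ᶠ γ in 𝓝[≥] (0 : ℝ), ∀ x ∈ closedBall m r, ∀ w, w ≠ 0 → 0 < hessian (V N γ) x w w := by
  obtain ⟨r, hr, hev⟩ := eventually_definite m ⊤ (Or.inl rfl) (fun w _ hw ↦ by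
    rw [one_mul]; exact inner_fderiv_pos h.one_lt hw)
  refine ⟨r, hr, hev.mono fun γ hγ x hx w hw ↦ ?_⟩
  have := hγ x hx w trivial hw
  rwa [one_mul] at this

theorem IsMinimum.eventually_branch_mem {m : S N} (h : IsMinimum m) :
    ∀ᶠ γ in 𝓝[≥] (0 : ℝ), (fam N).G γ (branch m γ) = 0 ∧
      branch m γ ∈ stationaryOfIndex (V N γ) 0 := by
  obtain ⟨r, γ₁, C, hb⟩ := h.exists_isBranch
  obtain ⟨r', hr', hev⟩ := h.eventually_pos
  filter_upwards [hev, Icc_mem_nhdsGE hb.γ₁_pos,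
    h.tendsto_branch.eventually (closedBall_mem_nhds m hr')] with γ hγ hγ₁ hmem
  exact ⟨hb.zero γ hγ₁, mem_stationary_zero_of_pos (hb.zero γ hγ₁) (hγ _ hmem)⟩

/-- The branch consists of nondegenerate minima for small `γ`, so it is a continuation; local
uniqueness of stationary points makes every other continuous family follow it. -/
theorem IsMinimum.eventually_isContinuation {m : S N} (h : IsMinimum m) :
    ∀ᶠ γ in 𝓝[≥] (0 : ℝ), ∀ x, IsContinuation γ m x ↔ x = branch m γ := by
  obtain ⟨r, γ₁, C, hb⟩ := h.exists_isBranch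
  filter_upwards [h.eventually_branch_mem.forall_Icc, Icc_mem_nhdsGE hb.γ₁_pos,
    self_mem_nhdsWithin] with γ hγ hγ₁ hγ0 x
  constructor
  · rintro ⟨ξ, hξ, h0, rfl, hst⟩
    refine hb.eq_of_continuousOn hγ₁ hξ h0 fun g hg ↦ ?_
    rw [fam_G]
    exact (hst g hg).1
  · rintro rfl
    refine ⟨branch m, hb.continuousOn.mono (Icc_subset_Icc_right hγ₁.2), ?_, rfl,
      fun g hg ↦ (hγ g hg).2.1⟩
    have := hb.dist_le 0 ⟨le_rfl, hb.γ₁_pos.le⟩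
    rw [mul_zero] at this
    exact sub_eq_zero.1 (norm_le_zero_iff.1 this)

theorem finite_isSpin (hM : 4 ≤ M) : {a : S (2 * M) | IsSpin a}.Finite :=
  (finite_B hM).subset fun _ ha ↦ ha.mem_B

theorem eventually_forall_isSpin (hM : 4 ≤ M) {X : Type*} {l : Filter X}
    {p : S (2 * M) → X → Prop} (h : ∀ a, IsSpin a → ∀ᶠ x in l, p a x) :
    ∀ᶠ x in l, ∀ a, IsSpin a → p a x :=
  (eventually_all_finite (finite_isSpin hM)).2 h

/-- The minima of the families `B_0` and `B_1`. -/
def minima (M : ℕ) : Set (S (2 * M)) :=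
  {m | IsSpin m ∨ ∃ a k, IsSpin a ∧ m = product a k}

theorem finite_minima (hM : 4 ≤ M) : (minima M).Finite := by
  refine ((finite_isSpin hM).union
    (((finite_isSpin hM).prod (finite_univ (α := Fin (2 * M)))).image
      fun p ↦ product p.1 p.2)).subset ?_
  rintro m (h | ⟨a, k, ha, rfl⟩)
  · exact Or.inl h
  · exact Or.inr ⟨(a, k), ⟨ha, trivial⟩, rfl⟩

theorem isMinimum_of_mem (hM : 4 ≤ M) {m : S (2 * M)} (h : m ∈ minima M) : IsMinimum m := by
  rcases h with h | ⟨a, k, ha, rfl⟩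
  · exact h.isMinimum
  · exact isMinimum_product hM ha k

theorem eventually_branch_injOn (hM : 4 ≤ M) : ∀ᶠ γ in 𝓝[≥] (0 : ℝ), ∀ m ∈ minima M,
    ∀ m' ∈ minima M, branch m γ = branch m' γ → m = m' := by
  refine (eventually_all_finite (finite_minima hM)).2 fun m hm ↦
    (eventually_all_finite (finite_minima hM)).2 fun m' hm' ↦ ?_
  by_cases e : m = m'
  · exact Eventually.of_forall fun _ _ ↦ e
  · have := (isMinimum_of_mem hM hm).tendsto_branch.prodMk_nhds
      (isMinimum_of_mem hM hm').tendsto_branch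
    have hopen : IsOpen {p : S (2 * M) × S (2 * M) | p.1 ≠ p.2} :=
      isOpen_ne_fun continuous_fst continuous_snd
    exact (this.eventually (hopen.mem_nhds e)).mono fun γ h1 h2 ↦ absurd h2 h1

theorem eventually_mem_family_zero (hM : 4 ≤ M) : ∀ᶠ γ in 𝓝[≥] (0 : ℝ), ∀ x,
    x ∈ family M 0 γ ↔ ∃ a, IsSpin a ∧ x = branch a γ := by
  filter_upwards [eventually_forall_isSpin hM fun a ha ↦ ha.isMinimum.eventually_isContinuation]
    with γ hγ x
  exact ⟨fun ⟨a, ha, hx⟩ ↦ ⟨a, isSpin_of_mem_B hM ha, (hγ a (isSpin_of_mem_B hM ha) x).1 hx⟩,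
    fun ⟨a, ha, hx⟩ ↦ ⟨a, ha.mem_B, (hγ a ha x).2 hx⟩⟩

theorem eventually_mem_family_one (hM : 4 ≤ M) : ∀ᶠ γ in 𝓝[≥] (0 : ℝ), ∀ x,
    x ∈ family M 1 γ ↔ ∃ a k, IsSpin a ∧ x = branch (product a k) γ := by
  filter_upwards [eventually_forall_isSpin hM fun a ha ↦ eventually_all.2 fun k ↦
    (isMinimum_product hM ha k).eventually_isContinuation] with γ hγ x
  constructor
  · rintro ⟨y, hy, hx⟩
    obtain ⟨a, k, ha, rfl⟩ := exists_product_of_mem_B hM hy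
    exact ⟨a, k, ha, (hγ a ha k x).1 hx⟩
  · rintro ⟨a, k, ha, hx⟩
    exact ⟨_, product_mem_B hM ha k, (hγ a ha k x).2 hx⟩

end MassConserving

/-! ## The unstable manifolds of the saddles -/

namespace GradFlow

open Metric

variable {E : Type*} [NormedAddCommGroup E] [InnerProductSpace ℝ E] [CompleteSpace E]
  {P : Family E}

/-- A point of low energy on a small sphere around a saddle enters, on its side of the saddle, a
region below the level of the saddle. -/
theorem Family.SaddleNbhd.eventually_enter {c : E} {f : E →L[ℝ] ℝ} {ξ : ℝ → E}
    {r γ₁ C κ : ℝ} {v : E} (h : P.SaddleNbhd c f ξ r γ₁ C κ v) {δ : ℝ} (hδ0 : 0 < δ)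
    (hδr : 2 * δ ≤ r) {R : Set E} {s : ℝ}
    (hside : ∀ x ∈ closedBall c (2 * δ), 0 < s * (f x - f c) → x ∈ R) (C' : ℝ) :
    ∀ᶠ γ in 𝓝[≥] (0 : ℝ), ∀ q ∈ sphere c δ, P.V γ q ≤ P.V₀ c + C' * γ →
      0 < s * (f q - f c) → ∀ u, FwdOrbit (P.G γ) u → u 0 = q →
        ∃ T ≥ 0, P.V γ (u T) ≤ P.V₀ c - κ * δ ^ 2 / 32 ∧ u T ∈ R := by
  filter_upwards [h.eventually_drop hδ0 hδr C'] with γ hγ q hq hVq hs u hu hu0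
  obtain ⟨T, hT, hV, hmem, hpos⟩ := (hγ q hq hVq).2 u hu hu0
  refine ⟨T, hT, hV, hside _ hmem ?_⟩
  have h1 : 0 < (s * (f (u T) - f c)) * (f q - f c) ^ 2 := by
    have := mul_pos hpos hs
    nlinarith
  exact pos_of_mul_pos_left h1 (sq_nonneg _)

end GradFlow

namespace MassConserving

open Landscape GradFlow Metric

variable {N M : ℕ}

theorem IsGenericSaddle.exists_nbhd {c : S N} {i : Fin N} {α β : ℝ} (h : IsGenericSaddle c i α β)
    (hN : 3 < N) :
    ∃ ξ r γ₁ C κ v, (fam N).SaddleNbhd c (coordL N i) ξ r γ₁ C κ v :=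
  (h.isSaddleAt hN).exists_nbhd

/-- Since `M > 3`, the majority side of the saddle is the side away from the sign of `a` at `k`. -/
theorem isGenericSaddle_beta_sub (a : S (2 * M)) (k : Fin (2 * M)) (t : ℝ) :
    (-((M - 2) * tau M * coord a k) - coord (saddle a k) k) * t =
      (M - 3) * tau M * -(coord a k * t) := by
  rw [coord_saddle_self]; ring

/-- The limits of the points of low energy on a small sphere around a saddle of the family `C_1`. -/
theorem eventually_tendsto_of_side (hM : 4 ≤ M) :
    ∀ᶠ δ in 𝓝[>] (0 : ℝ), ∀ C' : ℝ, ∀ᶠ γ in 𝓝[≥] (0 : ℝ), ∀ a : S (2 * M), IsSpin a →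
      ∀ k, ∀ q ∈ sphere (saddle a k) δ, V (2 * M) γ q ≤ saddleLevel M + C' * γ →
      coord q k ≠ coord (saddle a k) k ∧ ∀ u, FwdOrbit ((fam (2 * M)).G γ) u → u 0 = q →
        (0 < coord a k * (coord q k - coord (saddle a k) k) →
          Tendsto u atTop (𝓝 (branch a γ))) ∧
        (coord a k * (coord q k - coord (saddle a k) k) < 0 →
          Tendsto u atTop (𝓝 (branch (product a k) γ))) := by
  have hM' : (4 : ℝ) ≤ M := by exact_mod_cast hM
  have key : ∀ᶠ δ in 𝓝[>] (0 : ℝ), ∀ a : S (2 * M), IsSpin a → ∀ k, ∀ C' : ℝ,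
      ∀ᶠ γ in 𝓝[≥] (0 : ℝ), ∀ q ∈ sphere (saddle a k) δ, V (2 * M) γ q ≤ saddleLevel M + C' * γ →
      coord q k ≠ coord (saddle a k) k ∧ ∀ u, FwdOrbit ((fam (2 * M)).G γ) u → u 0 = q →
        (0 < coord a k * (coord q k - coord (saddle a k) k) →
          Tendsto u atTop (𝓝 (branch a γ))) ∧
        (coord a k * (coord q k - coord (saddle a k) k) < 0 →
          Tendsto u atTop (𝓝 (branch (product a k) γ))) := by
    refine eventually_forall_isSpin hM fun a ha ↦ eventually_all.2 fun k ↦ ?_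
    have hc := isGenericSaddle_saddle hM ha k
    obtain ⟨ξ, r, γ₁, C, κ, v, hnb⟩ := hc.exists_nbhd (by omega)
    have h2 : Tendsto (fun δ : ℝ ↦ 2 * δ) (𝓝[>] 0) (𝓝[>] 0) := by
      refine tendsto_nhdsWithin_iff.2 ⟨?_, ?_⟩
      · have : Tendsto (fun δ : ℝ ↦ 2 * δ) (𝓝 0) (𝓝 (2 * 0)) :=
          (continuous_const.mul continuous_id).tendsto 0
        rw [mul_zero] at this
        exact this.mono_left nhdsWithin_le_nhds
      · filter_upwards [self_mem_nhdsWithin] with δ hδ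
        exact mul_pos (two_pos (α := ℝ)) hδ
    filter_upwards [h2.eventually (eventually_mem_spinRegion hM ha k).forall_closedBall,
      h2.eventually hc.eventually_mem_region.forall_closedBall,
      h2.eventually (Ioc_mem_nhdsGT hnb.branch.r_pos), self_mem_nhdsWithin]
      with δ hδ₁ hδ₂ hδr hδ0 C'
    replace hδ0 : 0 < δ := hδ0
    have hV0 : (fam (2 * M)).V₀ (saddle a k) = saddleLevel M := V_zero_saddle hM ha k
    have hpos : 0 < κ * δ ^ 2 / 32 := by have := hnb.κ_pos; positivity
    obtain ⟨r₁, g₁, C₁, hb₁⟩ := ha.isMinimum.exists_isBranch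
    obtain ⟨r₂, g₂, C₂, hb₂⟩ := (isMinimum_product hM ha k).exists_isBranch
    -- After the energy drop the orbit is below the boundary level of its region and converges to
    -- the continuation of the only low stationary point there. The same holds in `e2` for the
    -- region behind the saddle.
    have e1 := Family.eventually_tendsto (isOpen_spinRegion a) (isClosed_closedSpinRegion a)
      (spinRegion_subset a) (P := fam (2 * M)) (v₀ := saddleLevel M)
      (fun x hx hxR ↦ saddleLevel_le_of_front hM ha hx hxR) hb₁
      (fun x hx hG hV ↦ eq_of_mem_closedSpinRegion hM ha hx hG hV) hpos
    have e2 := Family.eventually_tendsto IsGenericSaddle.isOpen_region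
      IsGenericSaddle.isClosed_closedRegion IsGenericSaddle.region_subset
      (P := fam (2 * M)) (v₀ := saddleLevel M)
      (fun x hx hxR ↦ hV0 ▸ hc.le_V_zero_of_front hx hxR) hb₂
      (fun x hx hG hV ↦ eq_product_of_mem hM ha hx hG hV) hpos
    have d1 := hnb.eventually_enter hδ0 hδr.2 (R := spinRegion a) (s := coord a k)
      (fun x hx ↦ (hδ₁ x hx).1) C'
    have d2 := hnb.eventually_enter hδ0 hδr.2
      (R := IsGenericSaddle.region (saddle a k) k ((M - 1) * tau M * coord a k)
        (-((M - 2) * tau M * coord a k))) (s := -((M - 2) * tau M * coord a k) -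
          coord (saddle a k) k)
      (fun x hx ↦ (hδ₂ x hx).1) C'
    filter_upwards [e1, e2, d1, d2, hnb.eventually_drop hδ0 hδr.2 C']
      with γ he₁ he₂ hd₁ hd₂ hdrop q hq hVq
    rw [fam_V] at hd₁ hd₂ he₁ he₂ hdrop
    rw [hV0] at hd₁ hd₂ hdrop
    refine ⟨(hdrop q hq hVq).1, fun u hu hu0 ↦ ?_⟩
    constructor
    · intro hs
      obtain ⟨T, hT, hVT, hmem⟩ := hd₁ q hq hVq hs u hu hu0
      exact he₁ u hu T hT hmem hVT
    · intro hs
      obtain ⟨T, hT, hVT, hmem⟩ := hd₂ q hq hVq (by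
        simp only [coordL_apply]
        rw [isGenericSaddle_beta_sub]
        have := tau_pos (M := M)
        refine mul_pos (mul_pos (by linarith) this) (by linarith)) u hu hu0
      exact he₂ u hu T hT hmem hVT
  filter_upwards [key] with δ hδ C'
  exact eventually_forall_isSpin hM fun a ha ↦ eventually_all.2 fun k ↦ hδ a ha k C'

theorem hasOrbit_of_tendsto {γ : ℝ} {u : ℝ → S N} {z x : S N}
    (hu : ∀ t, HasDerivAt u (-(fam N).G γ (u t)) t) (hz : Tendsto u atBot (𝓝 z))
    (hx : Tendsto u atTop (𝓝 x)) : HasOrbit (V N γ) z x :=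
  ⟨u, fun t ↦ by rw [← fam_G]; exact hu t, hz, hx⟩

/-- The continuation of a saddle of the family `C_1` is a saddle that connects the configuration and
the product state; its energy to first order. -/
theorem exists_saddle_branch (hM : 4 ≤ M) {a : S (2 * M)} (ha : IsSpin a) (k : Fin (2 * M)) :
    ∃ (ζ : ℝ → S (2 * M)) (C : ℝ), ∀ᶠ γ in 𝓝[≥] (0 : ℝ),
      ζ γ ∈ stationaryOfIndex (V (2 * M) γ) 1 ∧ HasOrbit (V (2 * M) γ) (ζ γ) (branch a γ) ∧
      HasOrbit (V (2 * M) γ) (ζ γ) (branch (product a k) γ) ∧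
      V (2 * M) γ (ζ γ) ≤ saddleLevel M +
        γ * saddleEnergy M (interfaces a) (interfacesAt a k) + C * γ ^ 2 := by
  have hc := isGenericSaddle_saddle hM ha k
  obtain ⟨ξ, r, γ₁, C, κ, v, hnb⟩ := hc.exists_nbhd (by omega)
  have hV0 : (fam (2 * M)).V₀ (saddle a k) = saddleLevel M := V_zero_saddle hM ha k
  have hW : (fam (2 * M)).W (saddle a k) = saddleEnergy M (interfaces a) (interfacesAt a k) :=
    couplingEnergy_saddle hM ha k
  refine ⟨ξ, C, ?_⟩
  have hC0 := hnb.branch.C_nonneg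
  have hr : ∀ᶠ δ in 𝓝[>] (0 : ℝ), δ ∈ Ioc 0 r := Ioc_mem_nhdsGT hnb.branch.r_pos
  obtain ⟨δ, hδ, hδr⟩ := ((eventually_tendsto_of_side hM).and hr).exists
  have hδ0 : 0 < δ := hδr.1
  -- the index of the saddle
  obtain ⟨r₁, hr₁, hpos⟩ := eventually_definite (saddle a k) (coordL (2 * M) k).ker (s := 1)
    (Or.inl rfl) (fun w hw hw0 ↦ by rw [one_mul]; exact hnb.saddle.pos w hw hw0)
  obtain ⟨v', hv'⟩ := hnb.saddle.neg
  have hv'0 : v' ≠ 0 := by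
    rintro rfl
    simp at hv'
  obtain ⟨r₂, hr₂, hneg⟩ := eventually_definite (saddle a k) (ℝ ∙ v') (s := -1)
    (Or.inr rfl) (fun w hw hw0 ↦ by
      obtain ⟨t, rfl⟩ := Submodule.mem_span_singleton.1 hw
      have ht : t ≠ 0 := fun e ↦ hw0 (by rw [e, zero_smul])
      rw [map_smul, inner_smul_left, inner_smul_right]
      have : 0 < t * t := mul_self_pos.2 ht
      simp only [conj_trivial]
      nlinarith)
  filter_upwards [hδ ((fam (2 * M)).W (saddle a k) + C), hnb.eventually_side hδ0 hδr.2,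
    Icc_mem_nhdsGE hnb.branch.γ₁_pos, Icc_mem_nhdsGE (one_pos : (0 : ℝ) < 1),
    hnb.branch.tendsto.eventually (ball_mem_nhds _ hδ0),
    hnb.branch.tendsto.eventually (closedBall_mem_nhds _ hr₁),
    hnb.branch.tendsto.eventually (closedBall_mem_nhds _ hr₂), hpos, hneg]
    with γ h1 h2 h3 h4 h5 h6 h7 h8 h9
  have hen := hnb.branch.energy γ h3
  rw [hV0, fam_V] at hen
  rw [fam_V] at h2
  have hle : V (2 * M) γ (ξ γ) ≤ saddleLevel M + γ * (fam (2 * M)).W (saddle a k) + C * γ ^ 2 := by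
    linarith [(abs_le.1 hen).2]
  -- For `γ ≤ 1` the quadratic error is absorbed in a linear one, the form in which the statement on
  -- exit points is available.
  have hle' : V (2 * M) γ (ξ γ) ≤ saddleLevel M + ((fam (2 * M)).W (saddle a k) + C) * γ := by
    have : C * γ ^ 2 ≤ C * γ := mul_le_mul_of_nonneg_left (by nlinarith [h4.1, h4.2]) hC0
    linarith
  have hkk := ha.mul_self k
  -- The unstable branches are separated by the slice through the perturbed saddle;
  -- `eventually_side` translates this into sides of the unperturbed one.
  have orbit : ∀ σ : ℝ, (σ = 1 ∨ σ = -1) → ∃ u : ℝ → S (2 * M),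
      (∀ t, HasDerivAt u (-(fam (2 * M)).G γ (u t)) t) ∧ Tendsto u atBot (𝓝 (ξ γ)) ∧
      u 0 ∈ sphere (saddle a k) δ ∧ V (2 * M) γ (u 0) ≤ saddleLevel M +
        ((fam (2 * M)).W (saddle a k) + C) * γ ∧
      0 < σ * (coord (u 0) k - coord (saddle a k) k) := by
    intro σ hσ
    obtain ⟨u, hu, hz, hsph, hs, hE⟩ := hnb.exists_orbit h3 hδr.2 h5 hσ
    rw [fam_V] at hE
    refine ⟨u, hu, hz, hsph, hE.trans hle', ?_⟩
    have hne : coordL (2 * M) k (u 0) ≠ coordL (2 * M) k (ξ γ) := by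
      intro e
      rw [e, sub_self, mul_zero] at hs
      exact lt_irrefl _ hs
    have h10 := h2 _ hsph hE hne
    have h11 : 0 < (σ * (coordL (2 * M) k (u 0) - coordL (2 * M) k (saddle a k))) *
        (coordL (2 * M) k (u 0) - coordL (2 * M) k (ξ γ)) ^ 2 := by
      have := mul_pos h10 hs
      nlinarith
    exact pos_of_mul_pos_left h11 (sq_nonneg _)
  refine ⟨?_, ?_, ?_, ?_⟩
  · have hv := h9 _ h7 v' (Submodule.mem_span_singleton_self v') hv'0
    refine mem_stationary_one_of_slice (hnb.branch.zero γ h3) (coordL (2 * M) k) (v := v')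
      (fun w hw hw0 ↦ ?_) (by linarith)
    have := h8 _ h6 w hw hw0
    rwa [one_mul] at this
  · obtain ⟨u, hu, hz, hsph, hE, hs⟩ := orbit (coord a k) (ha k)
    exact hasOrbit_of_tendsto hu hz
      ((h1 a ha k _ hsph hE).2 u (fwdOrbit_of_hasDerivAt hu) rfl |>.1 hs)
  · obtain ⟨u, hu, hz, hsph, hE, hs⟩ := orbit (-coord a k) (by
      rcases ha k with h | h <;> simp [h])
    exact hasOrbit_of_tendsto hu hz
      ((h1 a ha k _ hsph hE).2 u (fwdOrbit_of_hasDerivAt hu) rfl |>.2 (by linarith))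
  · rwa [hW] at hle

end MassConserving

/-! ## The saddles that connect a configuration to a product state -/

namespace MassConserving

open Landscape GradFlow Metric

variable {N M : ℕ}

/-- If `p` and `x` both exceed `|c|` in absolute value and lie on the same side of `c`, they have
the same sign. Coordinates of minima exceed the middle root in this sense, so the region of a saddle
prescribes their signs. -/
theorem mul_pos_of_same_side {p x c : ℝ} (hp : c ^ 2 < p ^ 2) (hx : c ^ 2 < x ^ 2)
    (h : 0 ≤ (p - c) * (x - c)) : 0 < p * x := by
  rw [sq_lt_sq] at hp hx
  have h1 := le_abs_self c
  have h2 := neg_abs_le c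
  rcases lt_abs.1 hp with hp | hp <;> rcases lt_abs.1 hx with hx | hx <;> nlinarith [abs_nonneg c]

namespace IsGenericSaddle

variable {c : S N} {i : Fin N} {α β : ℝ}

theorem pattern_mul_pos (h : IsGenericSaddle c i α β) {x : S N} (hx : IsMinimum x)
    (hxR : x ∈ closedRegion c i α β) (k : Fin N) : 0 < pattern c i α β k * coord x k := by
  refine mul_pos_of_same_side (c := coord c i) ?_ ?_ (hxR k)
  · unfold pattern
    split_ifs
    · exact h.sq_lt_alpha
    · exact h.sq_lt_beta
  · linarith [hx.one_lt k, h.lt_one]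

theorem minority_iff (h : IsGenericSaddle c i α β) {x : S N} (hx : IsMinimum x)
    (hxR : x ∈ closedRegion c i α β) (k : Fin N) : minority c i α k ↔ 0 < α * coord x k := by
  have h1 := h.pattern_mul_pos hx hxR k
  have h2 := h.mul_neg
  unfold pattern at h1
  split_ifs at h1 with hk
  · exact ⟨fun _ ↦ h1, fun _ ↦ hk⟩
  · refine ⟨fun h3 ↦ absurd h3 hk, fun h3 ↦ ?_⟩
    have : 0 < (β * coord x k) * (α * coord x k) := mul_pos h1 h3
    nlinarith [sq_nonneg (coord x k)]

end IsGenericSaddle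

open IsGenericSaddle

/-- A configuration in the region would have its minority sign at exactly `M` sites, but a generic
saddle has fewer than `M` minority sites. -/
theorem IsGenericSaddle.spin_notMem {c a : S (2 * M)} {i : Fin (2 * M)} {α β : ℝ}
    (h : IsGenericSaddle c i α β) (ha : IsSpin a) : a ∉ closedRegion c i α β := by
  classical
  intro hR
  have h1 := h.minority_iff ha.isMinimum hR
  have hi : ¬ 0 < α * coord a i := fun h0 ↦ ((h1 i).2 h0).1 rfl
  have hα : α ≠ 0 := fun e ↦ by have := h.mul_neg; rw [e] at this; linarith
  have hset : (Finset.univ.filter fun k ↦ k ≠ i ∧ coord c k = α) =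
      Finset.univ.filter fun k ↦ ¬ coord a k = coord a i := by
    refine Finset.filter_congr fun k _ ↦ ?_
    rw [show (k ≠ i ∧ coord c k = α) ↔ _ from h1 k]
    constructor
    · intro h0 e
      rw [e] at h0
      exact hi h0
    · intro hne
      rw [(ha.eq_or i k).resolve_left hne]
      have : α * coord a i ≠ 0 := mul_ne_zero hα fun e ↦ by
        have := ha.mul_self i; rw [e] at this; norm_num at this
      rcases lt_or_gt_of_ne this with h2 | h2
      · linarith
      · exact absurd h2 hi
  have hcard := h.card_lt
  have hM := ha.card_eq_site i
  have hsum := Finset.card_filter_add_card_filter_not (s := (Finset.univ : Finset (Fin (2 * M))))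
    (fun k ↦ coord a k = coord a i)
  rw [Finset.card_univ, Fintype.card_fin, hM] at hsum
  rw [hset] at hcard
  omega

/-- A product state has `M - 1` sites of one sign and `M + 1` of the other. The minority of the
saddle must be the former, so the saddle has triple `(1, M - 1, M)`, and it is the saddle of the
configuration obtained from `a` by moving the decayed site from `k` to `i`. -/
theorem IsGenericSaddle.eq_saddle_of_product_mem (hM : 4 ≤ M) {c a : S (2 * M)}
    {i k : Fin (2 * M)} {α β : ℝ} (h : IsGenericSaddle c i α β) (ha : IsSpin a)
    (hR : product a k ∈ closedRegion c i α β) :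
    ∃ b, IsSpin b ∧ c = saddle b i ∧ product a k = product b i ∧ β * coord b i < 0 := by
  classical
  have hM' : (4 : ℝ) ≤ M := by exact_mod_cast hM
  have h1 := h.minority_iff (isMinimum_product hM ha k) hR
  have hkk := ha.mul_self k
  have hσ := sigma_pos (M := M)
  set s := coord a k with hs
  have hs0 : s ≠ 0 := fun e ↦ by rw [e] at hkk; norm_num at hkk
  have hα : α ≠ 0 := fun e ↦ by have := h.mul_neg; rw [e] at this; linarith
  set A := Finset.univ.filter fun l ↦ l ≠ k ∧ coord a l = s with hA
  have hAcard : A.card + 1 = M := by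
    have e : A = (Finset.univ.filter fun l ↦ coord a l = coord a k).erase k := by
      ext l
      simp [hA, hs]
    rw [e, Finset.card_erase_add_one (by simp)]
    exact ha.card_eq_site k
  -- the sign of the product state at a site
  have hmem : ∀ l ∈ A, coord (product a k) l = (M + 1) * sigma M * s := fun l hl ↦
    coord_product_same (Finset.mem_filter.1 hl).2.1 (Finset.mem_filter.1 hl).2.2
  have hnotmem : ∀ l, l ∉ A → coord (product a k) l = -((M - 1) * sigma M * s) := by
    intro l hl
    by_cases hlk : l = k
    · rw [hlk, coord_product_self]
    · exact coord_product_opp ha ((ha.eq_or k l).resolve_left fun e ↦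
        hl (Finset.mem_filter.2 ⟨Finset.mem_univ _, hlk, e⟩))
  -- With the opposite sign the minority would consist of `M + 1` sites.
  have hαs : 0 < α * s := by
    by_contra hneg
    have hneg' : α * s < 0 := lt_of_le_of_ne (not_lt.1 hneg) (mul_ne_zero hα hs0)
    have hset : (Finset.univ.filter fun l ↦ l ≠ i ∧ coord c l = α) =
        Finset.univ.filter fun l ↦ ¬ l ∈ A := by
      refine Finset.filter_congr fun l _ ↦ ?_
      rw [show (l ≠ i ∧ coord c l = α) ↔ _ from h1 l]
      constructor
      · intro h0 hl
        rw [hmem l hl] at h0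
        have : 0 < (M + 1) * sigma M := by positivity
        nlinarith
      · intro hl
        rw [hnotmem l hl]
        have : 0 < (M - 1) * sigma M := mul_pos (by linarith) hσ
        nlinarith
    have hcard := h.card_lt
    have hsum := Finset.card_filter_add_card_filter_not
      (s := (Finset.univ : Finset (Fin (2 * M)))) (fun l ↦ l ∈ A)
    rw [Finset.card_univ, Fintype.card_fin, Finset.filter_univ_mem] at hsum
    rw [hset] at hcard
    omega
  have hmin : ∀ l, minority c i α l ↔ l ∈ A := by
    intro l
    rw [h1 l]
    constructor
    · intro h0
      by_contra hl
      rw [hnotmem l hl] at h0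
      have : 0 < (M - 1) * sigma M := mul_pos (by linarith) hσ
      nlinarith
    · intro hl
      rw [hmem l hl]
      have : 0 < (M + 1) * sigma M := by positivity
      nlinarith
  have hiA : i ∉ A := fun hi ↦ ((hmin i).2 hi).1 rfl
  have hAc : ∀ l ∈ A, coord c l = α := fun l hl ↦ ((hmin l).2 hl).2
  have hAc' : ∀ l, l ∉ A → l ≠ i → coord c l = β := fun l hl hli ↦
    (h.coord_ne l hli).resolve_left fun e ↦ hl ((hmin l).1 ⟨hli, e⟩)
  have hsum : (M - 2) * α + (M - 1) * β = 0 := by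
    have h2 : ∀ l, coord c l = (if l ∈ A then α else β) - if l = i then α + 2 * β else 0 := by
      intro l
      by_cases hl : l ∈ A
      · rw [hAc l hl, if_pos hl, if_neg (show ¬ l = i from fun e ↦ hiA (e ▸ hl)), sub_zero]
      · by_cases hli : l = i
        · rw [hli, h.coord_site, if_neg hiA, if_pos rfl]; ring
        · rw [hAc' l hl hli, if_neg hl, if_neg hli, sub_zero]
    have h3 := sum_coord c
    rw [Finset.sum_congr rfl fun l _ ↦ h2 l, Finset.sum_sub_distrib, Finset.sum_ite_eq'
      Finset.univ i, if_pos (Finset.mem_univ _), Finset.sum_ite, Finset.sum_const,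
      Finset.sum_const, Finset.filter_univ_mem] at h3
    have h4 := Finset.card_filter_add_card_filter_not
      (s := (Finset.univ : Finset (Fin (2 * M)))) (fun l ↦ l ∈ A)
    rw [Finset.card_univ, Fintype.card_fin, Finset.filter_univ_mem] at h4
    have h5 : (A.card : ℝ) = M - 1 := by
      rw [eq_sub_iff_add_eq]; exact_mod_cast hAcard
    have h6 : ((Finset.univ.filter fun l ↦ l ∉ A).card : ℝ) = M + 1 := by
      have : (A.card : ℝ) + (Finset.univ.filter fun l ↦ l ∉ A).card = 2 * M := by exact_mod_cast h4
      linarith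
    rw [nsmul_eq_mul, nsmul_eq_mul, h5, h6] at h3
    linarith
  have hM1 : (M : ℝ) - 1 ≠ 0 := by linarith
  -- The zero sum fixes the ratio of `α` and `β`, and the root equation then fixes `|t| = τ`.
  obtain ⟨t, ht⟩ : ∃ t, α = (M - 1) * t := ⟨α / (M - 1), by field_simp⟩
  have hβ : β = -((M - 2) * t) := by
    apply mul_left_cancel₀ hM1
    rw [ht] at hsum
    linarith
  have hts : t * s = tau M := by
    have h2 : 0 < t * s := by
      rw [ht] at hαs
      have : 0 < ((M : ℝ) - 1) * (t * s) := by linarith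
      exact pos_of_mul_pos_right this (by linarith)
    have h3 : (t * s) ^ 2 = tau M ^ 2 := by
      have hD : (M : ℝ) ^ 2 - 3 * M + 3 ≠ 0 := by nlinarith
      apply mul_right_cancel₀ hD
      rw [tau_sq]
      have := h.root
      rw [ht, hβ] at this
      linear_combination this + t ^ 2 * (M ^ 2 - 3 * M + 3) * hkk
    exact (sq_eq_sq₀ h2.le tau_pos.le).1 h3
  have ht' : t = tau M * s := by linear_combination s * hts - t * hkk
  have hbi : coord (permute (Equiv.swap k i) a) i = s := by
    rw [coord_permute, Equiv.swap_apply_right]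
  refine ⟨permute (Equiv.swap k i) a, ha.permute _, coord_ext fun l ↦ ?_, ?_, ?_⟩
  · by_cases hli : l = i
    · rw [hli, h.coord_site, coord_saddle_self, hbi, ht, hβ, ht']; ring
    by_cases hl : l ∈ A
    · have hl' := (Finset.mem_filter.1 hl).2
      rw [hAc l hl, coord_saddle_same hli, hbi, ht, ht']
      · ring
      · rw [hbi, coord_permute, Equiv.swap_apply_of_ne_of_ne hl'.1 hli, hl'.2]
    · rw [hAc' l hl hli, coord_saddle_opp (ha.permute _), hbi, hβ, ht']
      · ring
      · rw [hbi, coord_permute]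
        have hAopp : ∀ m, m ∉ A → m ≠ k → coord a m = -s := fun m hm hmk ↦
          (ha.eq_or k m).resolve_left fun e ↦ hm (Finset.mem_filter.2 ⟨Finset.mem_univ _, hmk, e⟩)
        by_cases hlk : l = k
        · rw [hlk, Equiv.swap_apply_left]
          exact hAopp i hiA fun e ↦ hli (hlk.trans e.symm)
        · rw [Equiv.swap_apply_of_ne_of_ne hlk hli]
          exact hAopp l hl hlk
  · by_cases hik : i = k
    · subst hik
      congr 1
      refine coord_ext fun l ↦ ?_
      rw [coord_permute, Equiv.swap_self, Equiv.refl_apply]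
    · refine (product_swap ((ha.eq_or k i).resolve_left fun e ↦ hiA ?_)).symm
      exact Finset.mem_filter.2 ⟨Finset.mem_univ _, hik, e⟩
  · rw [hbi, hβ]
    have h2 : t * s * (M - 2) = tau M * (M - 2) := by rw [hts]
    have h3 : 0 < tau M * (M - 2) := mul_pos tau_pos (by linarith)
    linarith

theorem not_isSpin_product {a : S (2 * M)} (ha : IsSpin a) (k : Fin (2 * M)) :
    ¬ IsSpin (product a k) := by
  intro h
  have h1 := h.mul_self k
  rw [coord_product_self] at h1
  have h2 := sigma_sq (M := M)
  have h3 := pow_pos (sigma_pos (M := M)) 2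
  have h4 := ha.mul_self k
  have h5 : sigma M ^ 2 * (2 * M + 2) = 0 := by
    linear_combination h2 - h1 + ((M - 1) ^ 2 * sigma M ^ 2) * h4
  nlinarith

/-- Configurations with a common product state differ by an interchange. -/
theorem exists_isInterchange_of_product_eq (hM : 4 ≤ M) {a b : S (2 * M)} (ha : IsSpin a)
    (hb : IsSpin b) {k l : Fin (2 * M)} (h : product a k = product b l) (hne : a ≠ b) :
    ∃ i j, IsInterchange a b i j := by
  classical
  have hM' : (4 : ℝ) ≤ M := by exact_mod_cast hM
  have hσ := sigma_pos (M := M)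
  have hkk := ha.mul_self k
  have hll := hb.mul_self l
  have val : ∀ {a : S (2 * M)} (_ : IsSpin a) (k m : Fin (2 * M)),
      (m ≠ k ∧ coord a m = coord a k ∧ coord (product a k) m = (M + 1) * sigma M * coord a k) ∨
      ((m = k ∨ coord a m = -coord a k) ∧
        coord (product a k) m = -((M - 1) * sigma M * coord a k)) := by
    intro a ha k m
    by_cases hmk : m = k
    · exact Or.inr ⟨Or.inl hmk, by rw [hmk, coord_product_self]⟩
    rcases ha.eq_or k m with e | e
    · exact Or.inl ⟨hmk, e, coord_product_same hmk e⟩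
    · exact Or.inr ⟨Or.inr e, coord_product_opp ha e⟩
  -- The two coordinate values of a product state have different absolute values, so the minority
  -- sites and their sign can be read off from the state.
  have cross : ∀ {s t : ℝ}, s * s = 1 → t * t = 1 →
      (M + 1) * sigma M * s = -((M - 1) * sigma M * t) → False := by
    intro s t hs ht h0
    have h1 : sigma M * (((M : ℝ) + 1) * s + (M - 1) * t) = 0 := by linarith
    have h2 : ((M : ℝ) + 1) * s = -((M - 1) * t) := by
      have := (mul_eq_zero.1 h1).resolve_left hσ.ne'
      linarith
    have h3 : (((M : ℝ) + 1) * s) ^ 2 = ((M - 1) * t) ^ 2 := by rw [h2]; ring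
    have h4 : ((M : ℝ) + 1) ^ 2 * (s * s) = (M - 1) ^ 2 * (t * t) := by linear_combination h3
    rw [hs, ht] at h4
    linarith
  have hst : coord b l = coord a k := by
    obtain ⟨m, hm, hmk⟩ : ∃ m ∈ Finset.univ.filter fun m ↦ coord a m = coord a k, m ≠ k :=
      Finset.exists_mem_ne (by rw [ha.card_eq_site]; omega) k
    have hmk' := (Finset.mem_filter.1 hm).2
    have e1 := coord_product_same hmk hmk'
    rw [h] at e1
    rcases val hb l m with ⟨-, -, e2⟩ | ⟨-, e2⟩
    · have : (M + 1) * sigma M * (coord b l - coord a k) = 0 := by linarith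
      have h0 : ((M : ℝ) + 1) * sigma M ≠ 0 := by positivity
      linarith [(mul_eq_zero.1 this).resolve_left h0]
    · exact (cross hkk hll (e1.symm.trans e2)).elim
  have hiff : ∀ m, (m ≠ k ∧ coord a m = coord a k) ↔ (m ≠ l ∧ coord b m = coord a k) := by
    intro m
    have h0 : coord (product a k) m = coord (product b l) m := by rw [h]
    rcases val ha k m with ⟨h1, h2, h3⟩ | ⟨h1, h3⟩ <;>
      rcases val hb l m with ⟨h4, h5, h6⟩ | ⟨h4, h6⟩
    · exact ⟨fun _ ↦ ⟨h4, h5.trans hst⟩, fun _ ↦ ⟨h1, h2⟩⟩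
    · exact (cross hkk hll (h3.symm.trans (h0.trans h6))).elim
    · exact (cross hll hkk (h6.symm.trans (h0.symm.trans h3))).elim
    · have n1 : ¬ (m ≠ k ∧ coord a m = coord a k) := fun ⟨q1, q2⟩ ↦
        h1.elim q1 fun e ↦ ha.ne_neg k (q2.symm.trans e)
      have n2 : ¬ (m ≠ l ∧ coord b m = coord a k) := fun ⟨q1, q2⟩ ↦
        h4.elim q1 fun e ↦ hb.ne_neg l ((hst.trans q2.symm).trans e)
      exact ⟨fun q ↦ absurd q n1, fun q ↦ absurd q n2⟩
  have hbval : ∀ m, coord b m = coord a k ∨ coord b m = -coord a k := fun m ↦ by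
    rw [← hst]; exact hb.eq_or l m
  have hkl : k ≠ l := by
    rintro rfl
    refine hne (coord_ext fun m ↦ ?_)
    by_cases hm : m = k
    · rw [hm, hst]
    · rcases ha.eq_or k m with e | e
      · rw [e, ((hiff m).1 ⟨hm, e⟩).2]
      · rw [e]
        refine ((hbval m).resolve_left fun e' ↦ ?_).symm
        exact ha.ne_neg k (((hiff m).2 ⟨hm, e'⟩).2.symm.trans e)
  have hal : coord a l = -coord a k :=
    (ha.eq_or k l).resolve_left fun e ↦ ((hiff l).1 ⟨hkl.symm, e⟩).1 rfl
  have hbk : coord b k = -coord a k :=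
    (hbval k).resolve_left fun e ↦ ((hiff k).2 ⟨hkl, e⟩).1 rfl
  have hswap : ∀ m, coord b m = coord a (Equiv.swap k l m) := by
    intro m
    by_cases hmk : m = k
    · rw [hmk, Equiv.swap_apply_left, hbk, hal]
    by_cases hml : m = l
    · rw [hml, Equiv.swap_apply_right, hst]
    rw [Equiv.swap_apply_of_ne_of_ne hmk hml]
    rcases ha.eq_or k m with e | e
    · rw [e, ((hiff m).1 ⟨hmk, e⟩).2]
    · rw [e]
      refine (hbval m).resolve_left fun e' ↦ ?_
      exact ha.ne_neg k (((hiff m).2 ⟨hml, e'⟩).2.symm.trans e)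
  rcases ha k with hk | hk
  · exact ⟨k, l, hk, by rw [hal, hk], hswap⟩
  · exact ⟨l, k, by rw [hal, hk, neg_neg], hk, by rw [Equiv.swap_comm]; exact hswap⟩

/-- The two unstable branches leave on opposite sides. The one on the majority side stays in the
region behind the saddle, so its limit cannot be a configuration; it must be the product state. This
identifies `c` as a saddle of some configuration `b` in `C_1`, and the other branch then converges
to `b`, so `b = a`. -/
theorem IsGenericSaddle.eventually_common (hM : 4 ≤ M) {c : S (2 * M)} {i : Fin (2 * M)}
    {α β : ℝ} (h : IsGenericSaddle c i α β) :
    ∃ r > 0, ∀ᶠ γ in 𝓝[≥] (0 : ℝ), ∀ z ∈ closedBall c r, (fam (2 * M)).G γ z = 0 →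
      ∀ a, IsSpin a → ∀ a', IsSpin a' → ∀ k, HasOrbit (V (2 * M) γ) z (branch a γ) →
      HasOrbit (V (2 * M) γ) z (branch (product a' k) γ) → ∃ l, product a' k = product a l := by
  obtain ⟨ξ, r, γ₁, C, κ, v, hnb⟩ := h.exists_nbhd (by omega)
  have hC0 := hnb.branch.C_nonneg
  have hcmin : c ∈ (minima M)ᶜ := fun hc ↦ by
    have := (isMinimum_of_mem hM hc).one_lt i
    linarith [h.lt_one]
  have hc1 : ∀ᶠ δ in 𝓝[>] (0 : ℝ), ∀ x ∈ closedBall c δ, x ∈ (minima M)ᶜ :=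
    Eventually.forall_closedBall ((finite_minima hM).isClosed.isOpen_compl.mem_nhds hcmin)
  have hr : ∀ᶠ δ in 𝓝[>] (0 : ℝ), δ ∈ Ioc 0 (r / 2) := Ioc_mem_nhdsGT (half_pos hnb.branch.r_pos)
  obtain ⟨η, hη, hside⟩ := Metric.eventually_nhds_iff_ball.1 h.eventually_mem_region
  have hη' : ∀ᶠ δ in 𝓝[>] (0 : ℝ), δ ∈ Ioo 0 (η / 2) := Ioo_mem_nhdsGT (half_pos hη)
  obtain ⟨δ, ⟨⟨hδ, hδ1⟩, hδr⟩, hδη⟩ :=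
    (((eventually_tendsto_of_side hM).and hc1).and hr |>.and hη').exists
  have hδ0 : 0 < δ := hδr.1
  have hδr' : 2 * δ ≤ r := by linarith [hδr.2]
  set C' := (fam (2 * M)).W c + C
  have hside' : ∀ x ∈ closedBall c (2 * δ), 0 < (β - coord c i) *
      (coordL (2 * M) i x - coordL (2 * M) i c) → x ∈ region c i α β := fun x hx ↦
    (hside x (closedBall_subset_ball (by linarith [hδη.2]) hx)).1
  refine ⟨r, hnb.branch.r_pos, ?_⟩
  have hmin_out : ∀ᶠ γ in 𝓝[≥] (0 : ℝ), ∀ m ∈ minima M, branch m γ ∉ closedBall c δ :=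
    (eventually_all_finite (finite_minima hM)).2 fun m hm ↦
      (isMinimum_of_mem hM hm).tendsto_branch.eventually
        (isClosed_closedBall.isOpen_compl.mem_nhds fun hmc ↦ hδ1 m hmc hm)
  have hmin_reg : ∀ᶠ γ in 𝓝[≥] (0 : ℝ), ∀ m ∈ minima M,
      branch m γ ∈ closedRegion c i α β → m ∈ closedRegion c i α β := by
    refine (eventually_all_finite (finite_minima hM)).2 fun m hm ↦ ?_
    by_cases hmR : m ∈ closedRegion c i α β
    · exact Eventually.of_forall fun _ _ ↦ hmR
    · exact ((isMinimum_of_mem hM hm).tendsto_branch.eventually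
        (isClosed_closedRegion.isOpen_compl.mem_nhds hmR)).mono fun γ h1 h2 ↦ absurd h2 h1
  filter_upwards [hδ C', hnb.eventually_side hδ0 (hδr.2.trans (by linarith [hnb.branch.r_pos])),
    hnb.eventually_enter hδ0 hδr' hside' C', Icc_mem_nhdsGE hnb.branch.γ₁_pos,
    Icc_mem_nhdsGE (one_pos : (0 : ℝ) < 1), hnb.branch.tendsto.eventually (ball_mem_nhds _ hδ0),
    hmin_out, hmin_reg, eventually_branch_injOn hM]
    with γ hlim hsides henter hγ hγ1 hξ hout hreg hinj z hz hGz a ha a' ha' k ho₁ ho₂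
  obtain rfl := hnb.branch.unique γ hγ z hz hGz
  have ha₀ : a ∈ minima M := Or.inl ha
  have hp₀ : product a' k ∈ minima M := Or.inr ⟨a', k, ha', rfl⟩
  obtain ⟨u₁, hu₁, hz₁, hx₁⟩ := ho₁
  obtain ⟨u₂, hu₂, hz₂, hx₂⟩ := ho₂
  simp only [← fam_G] at hu₁ hu₂
  have hne : branch a γ ≠ branch (product a' k) γ := fun e ↦
    not_isSpin_product ha' k (hinj _ ha₀ _ hp₀ e ▸ ha)
  obtain ⟨s₁, s₂, hs₁, hs₂, hopp⟩ := hnb.opposite_sides hγ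
    (hδr.2.trans (by linarith [hnb.branch.r_pos])) hξ hne hu₁ hu₂ hz₁ hz₂ hx₁ hx₂
    (hout _ ha₀) (hout _ hp₀)
  have hE : ∀ {u : ℝ → S (2 * M)} (_ : ∀ t, HasDerivAt u (-(fam (2 * M)).G γ (u t)) t)
      (_ : Tendsto u atBot (𝓝 (ξ γ))) (s : ℝ),
      (fam (2 * M)).V γ (u s) ≤ (fam (2 * M)).V γ (ξ γ) := fun hu hz s ↦
    Family.energy_le_of_tendsto_atBot ((fam (2 * M)).hasGradientAt γ) hu hz s
  have hEξ : (fam (2 * M)).V γ (ξ γ) ≤ (fam (2 * M)).V₀ c + C' * γ := by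
    have h1 := (abs_le.1 (hnb.branch.energy γ hγ)).2
    have : C * γ ^ 2 ≤ C * γ := mul_le_mul_of_nonneg_left (by nlinarith [hγ1.1, hγ1.2]) hC0
    simp only [C']
    linarith
  -- an orbit on the side of the majority stays in the region
  have hmaj : ∀ {u : ℝ → S (2 * M)} (_ : ∀ t, HasDerivAt u (-(fam (2 * M)).G γ (u t)) t) {s : ℝ}
      (_ : u s ∈ sphere c δ) (_ : (fam (2 * M)).V γ (u s) ≤ (fam (2 * M)).V γ (ξ γ)) {m}
      (_ : m ∈ minima M) (_ : Tendsto u atTop (𝓝 (branch m γ)))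
      (_ : 0 < (β - coord c i) * (coord (u s) i - coord c i)), m ∈ closedRegion c i α β := by
    intro u hu s hs hVs m hm hx hpos
    have hw : FwdOrbit ((fam (2 * M)).G γ) fun t ↦ u (t + s) :=
      fwdOrbit_of_hasDerivAt (hasDerivAt_shift hu s)
    obtain ⟨T, hT, hVT, hTR⟩ := henter (u s) hs (hVs.trans hEξ) hpos _ hw (by simp)
    have hlt : (fam (2 * M)).V γ (u (T + s)) < (fam (2 * M)).V₀ c := by
      have : 0 < κ * δ ^ 2 / 32 := by have := hnb.κ_pos; positivity
      linarith
    have hw' := fwdOrbit_of_hasDerivAt (hasDerivAt_shift hu (T + s))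
    have hstay := Family.stays_of_energy_lt (P := fam (2 * M)) isOpen_region
      isClosed_closedRegion region_subset (v₀ := (fam (2 * M)).V₀ c)
      (fun x hx hxR ↦ h.le_V_zero_of_front hx hxR) hγ.1 hw'
      (by simpa using hTR) (by simpa using hlt)
    refine hreg m hm (isClosed_closedRegion.mem_of_tendsto
      (hx.comp (tendsto_atTop_add_const_right atTop (T + s) tendsto_id)) ?_)
    filter_upwards [eventually_ge_atTop 0] with t ht
    exact region_subset (hstay t ht)
  have hside₁ := hsides _ hs₁ (hE hu₁ hz₁ s₁) fun e ↦ by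
    rw [e, sub_self, zero_mul] at hopp; exact lt_irrefl _ hopp
  have hside₂ := hsides _ hs₂ (hE hu₂ hz₂ s₂) fun e ↦ by
    rw [e, sub_self, mul_zero] at hopp; exact lt_irrefl _ hopp
  simp only [coordL_apply] at hside₁ hside₂ hopp
  have hβ : 0 < (β - coord c i) * β := by
    nlinarith [h.sq_lt_beta, sq_nonneg (β - coord c i), sq_nonneg (β + coord c i)]
  have hβ0 : β - coord c i ≠ 0 := fun e ↦ by rw [e, zero_mul] at hβ; exact lt_irrefl _ hβ
  have hne₁ : coord (u₁ s₁) i - coord c i ≠ 0 := fun e ↦ by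
    rw [e, zero_mul] at hside₁; exact lt_irrefl _ hside₁
  have hopp' : (coord (u₁ s₁) i - coord c i) * (coord (u₂ s₂) i - coord c i) < 0 := by
    have h1 := mul_pos hside₁ hside₂
    by_contra h2
    nlinarith [mul_nonneg (not_lt.1 h2) (neg_nonneg.2 hopp.le)]
  -- The branch towards the configuration must leave on the minority side, since the region behind
  -- the saddle contains no configuration.
  rcases lt_or_gt_of_ne (mul_ne_zero hβ0 hne₁) with hneg | hpos
  swap
  · exact absurd (hmaj hu₁ hs₁ (hE hu₁ hz₁ s₁) ha₀ hx₁ hpos) (h.spin_notMem ha)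
  have hpos₂ : 0 < (β - coord c i) * (coord (u₂ s₂) i - coord c i) := by
    have h1 : 0 < (β - coord c i) ^ 2 := sq_pos_of_ne_zero hβ0
    by_contra h2
    nlinarith [mul_nonneg (neg_nonneg.2 hneg.le) (neg_nonneg.2 (not_lt.1 h2))]
  obtain ⟨b, hb, hcb, hprod, hβb⟩ :=
    h.eq_saddle_of_product_mem hM ha' (hmaj hu₂ hs₂ (hE hu₂ hz₂ s₂) hp₀ hx₂ hpos₂)
  refine ⟨i, ?_⟩
  have hw : FwdOrbit ((fam (2 * M)).G γ) fun t ↦ u₁ (t + s₁) :=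
    fwdOrbit_of_hasDerivAt (hasDerivAt_shift hu₁ s₁)
  have hVu : V (2 * M) γ (u₁ s₁) ≤ saddleLevel M + C' * γ := by
    rw [← V_zero_saddle hM hb i, ← hcb, ← fam_V]
    exact (hE hu₁ hz₁ s₁).trans hEξ
  have hbside : 0 < coord b i * (coord (u₁ s₁) i - coord c i) := by
    by_contra h2
    have h3 : 0 ≤ (β * coord b i) * ((coord (u₁ s₁) i - coord c i) * β) := by
      nlinarith [mul_nonneg (sq_nonneg β) (neg_nonneg.2 (not_lt.1 h2))]
    nlinarith
  have hb₁ := ((hlim b hb i (u₁ s₁) (hcb ▸ hs₁) hVu).2 _ hw (by simp)).1 (hcb ▸ hbside)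
  have heq := tendsto_nhds_unique
    (hx₁.comp (tendsto_atTop_add_const_right atTop s₁ tendsto_id)) hb₁
  rw [hinj _ ha₀ _ (Or.inl hb) heq, hprod]

end MassConserving

/-! ## The allowed transitions -/

namespace MassConserving

open Landscape GradFlow Metric

variable {N M : ℕ}

/-- Pairing the gradient with `x`, the coupling contributes a nonnegative term and the wells at
least `∑ (x_i² - 1)`. All stationary points thus lie in one ball for all `γ ≥ 0`. -/
theorem norm_sq_le_of_G_eq_zero {γ : ℝ} (hγ : 0 ≤ γ) {x : S N} (h : (fam N).G γ x = 0) :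
    ‖x‖ ^ 2 ≤ N := by
  have h1 := inner_G γ x x
  rw [h, inner_zero_left] at h1
  have h2 : 0 ≤ γ * (1 / 2 * ∑ i, (coord x (finRotate N i) - coord x i) *
      (coord x (finRotate N i) - coord x i)) :=
    mul_nonneg hγ (mul_nonneg (by norm_num) (Finset.sum_nonneg fun i _ ↦ mul_self_nonneg _))
  have h3 : ∑ i, (coord x i ^ 2 - 1) ≤ ∑ i, (coord x i ^ 3 - coord x i) * coord x i :=
    Finset.sum_le_sum fun i _ ↦ by nlinarith [sq_nonneg (coord x i ^ 2 - 1)]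
  rw [Finset.sum_sub_distrib, ← norm_sq_eq_sum] at h3
  simp only [Finset.sum_const, Finset.card_univ, Fintype.card_fin, nsmul_eq_mul, mul_one] at h3
  linarith

/-- By compactness it suffices to look near each point `c` of a fixed ball. A nonstationary `c` has
no stationary points nearby for small `γ`; near a minimum or a point with two negative directions
the index is not `1`; generic saddles are handled by `eventually_common`. -/
theorem eventually_exists_product_eq (hM : 4 ≤ M) (h3 : ¬ 3 ∣ 2 * M) :
    ∀ᶠ γ in 𝓝[≥] (0 : ℝ), ∀ z ∈ stationaryOfIndex (V (2 * M) γ) 1, ∀ a, IsSpin a →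
      ∀ a', IsSpin a' → ∀ k, HasOrbit (V (2 * M) γ) z (branch a γ) →
      HasOrbit (V (2 * M) γ) z (branch (product a' k) γ) → ∃ l, product a' k = product a l := by
  have key : ∀ᶠ γ in 𝓝[≥] (0 : ℝ), ∀ z ∈ closedBall (0 : S (2 * M)) √(2 * M : ℕ),
      (fam (2 * M)).G γ z = 0 → morseIndex (V (2 * M) γ) z = 1 → ∀ a, IsSpin a →
      ∀ a', IsSpin a' → ∀ k, HasOrbit (V (2 * M) γ) z (branch a γ) →
      HasOrbit (V (2 * M) γ) z (branch (product a' k) γ) → ∃ l, product a' k = product a l := by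
    refine (isCompact_closedBall _ _).eventually_forall fun c _ ↦ ?_
    by_cases hc : (fam (2 * M)).G₀ c = 0
    swap
    · have h1 : ∀ᶠ p in 𝓝 ((0 : ℝ), c), (fam (2 * M)).G p.1 p.2 ≠ 0 := by
        refine (fam (2 * M)).continuous_G_uncurry.continuousAt.eventually_ne ?_
        simpa [fam_G_zero] using hc
      rw [nhds_prod_eq] at h1
      exact (h1.filter_mono (prod_mono nhdsWithin_le_nhds le_rfl)).mono fun p hp h ↦ absurd h hp
    rcases stationary_cases hM h3 hc with h | ⟨i, α, β, h⟩ | ⟨U, hU, h⟩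
    · obtain ⟨r, hr, hev⟩ := IsMinimum.eventually_pos ⟨hc, h⟩
      refine (hev.prod_mk (closedBall_mem_nhds c hr)).mono fun p hp hG h1 ↦ ?_
      have := (mem_stationary_zero_of_pos hG (hp.1 _ hp.2)).2
      rw [h1] at this
      exact absurd this one_ne_zero
    · obtain ⟨r, hr, hev⟩ := h.eventually_common hM
      exact (hev.prod_mk (closedBall_mem_nhds c hr)).mono fun p hp hG _ ↦ hp.1 _ hp.2 hG
    · obtain ⟨r, hr, hev⟩ := eventually_definite c U (s := -1) (Or.inr rfl)
        (fun w hw hw0 ↦ by linarith [h w hw hw0])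
      refine (hev.prod_mk (closedBall_mem_nhds c hr)).mono fun p hp hG h1 ↦ ?_
      have := le_morseIndex U (V := V (2 * M) p.1) (x := p.2)
        (fun w hw hw0 ↦ by linarith [hp.1 _ hp.2 w hw hw0])
      omega
  filter_upwards [key, self_mem_nhdsWithin] with γ hγ hγ0 z hz
  have hG : (fam (2 * M)).G γ z = 0 := by rw [fam_G]; exact hz.1.1
  refine hγ z ?_ hG hz.2
  rw [mem_closedBall_zero_iff]
  exact Real.le_sqrt_of_sq_le (norm_sq_le_of_G_eq_zero hγ0 hG)

/-- The continuations of the saddles of the family `C_1`. -/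
theorem exists_saddle_branches (hM : 4 ≤ M) :
    ∃ (ζ : S (2 * M) → Fin (2 * M) → ℝ → S (2 * M)) (C : ℝ), ∀ᶠ γ in 𝓝[≥] (0 : ℝ),
      ∀ a, IsSpin a → ∀ k, ζ a k γ ∈ stationaryOfIndex (V (2 * M) γ) 1 ∧
      HasOrbit (V (2 * M) γ) (ζ a k γ) (branch a γ) ∧
      HasOrbit (V (2 * M) γ) (ζ a k γ) (branch (product a k) γ) ∧
      V (2 * M) γ (ζ a k γ) ≤ saddleLevel M +
        γ * saddleEnergy M (interfaces a) (interfacesAt a k) + C * γ ^ 2 := by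
  have hex : ∀ a k, ∃ (ζ : ℝ → S (2 * M)) (C : ℝ), IsSpin a → ∀ᶠ γ in 𝓝[≥] (0 : ℝ),
      ζ γ ∈ stationaryOfIndex (V (2 * M) γ) 1 ∧ HasOrbit (V (2 * M) γ) (ζ γ) (branch a γ) ∧
      HasOrbit (V (2 * M) γ) (ζ γ) (branch (product a k) γ) ∧
      V (2 * M) γ (ζ γ) ≤ saddleLevel M +
        γ * saddleEnergy M (interfaces a) (interfacesAt a k) + C * γ ^ 2 := by
    intro a k
    by_cases ha : IsSpin a
    · obtain ⟨ζ, C, h⟩ := exists_saddle_branch hM ha k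
      exact ⟨ζ, C, fun _ ↦ h⟩
    · exact ⟨fun _ ↦ 0, 0, fun h ↦ absurd h ha⟩
  choose ζ C hζ using hex
  obtain ⟨K, hK⟩ := (((finite_isSpin hM).prod (finite_univ (α := Fin (2 * M)))).image
    fun p ↦ C p.1 p.2).bddAbove
  refine ⟨ζ, K, ?_⟩
  refine eventually_forall_isSpin hM fun a ha ↦ eventually_all.2 fun k ↦ ?_
  filter_upwards [hζ a k ha] with γ hγ
  refine ⟨hγ.1, hγ.2.1, hγ.2.2.1, hγ.2.2.2.trans ?_⟩
  have : C a k ≤ K := hK ⟨(a, k), ⟨ha, trivial⟩, rfl⟩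
  gcongr

theorem eventually_branch_ne_product (hM : 4 ≤ M) : ∀ᶠ γ in 𝓝[≥] (0 : ℝ),
    ∀ a : S (2 * M), IsSpin a → ∀ a', IsSpin a' → ∀ k, branch a γ ≠ branch (product a' k) γ := by
  filter_upwards [eventually_branch_injOn hM] with γ hγ a ha a' ha' k e
  exact not_isSpin_product ha' k (hγ _ (Or.inl ha) _ (Or.inr ⟨a', k, ha', rfl⟩) e ▸ ha)

/-- The two edges at a common neighbour identify it as a product state of both configurations.
Conversely an interchange supplies a common product state, and the continued saddles supply the
edges. -/
theorem eventually_transitionPossible_iff (hM : 4 ≤ M) (h3 : ¬ 3 ∣ 2 * M) :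
    ∀ᶠ γ in 𝓝[≥] (0 : ℝ), ∀ a, IsSpin a → ∀ b, IsSpin b →
      (TransitionPossible M γ (branch a γ) (branch b γ) ↔ ∃ i j, IsInterchange a b i j) := by
  obtain ⟨ζ, C, hζ⟩ := exists_saddle_branches hM
  filter_upwards [hζ, eventually_exists_product_eq hM h3, eventually_branch_injOn hM,
    eventually_branch_ne_product hM, eventually_mem_family_one hM,
    eventually_forall_isSpin hM fun a ha ↦ ha.isMinimum.eventually_branch_mem,
    eventually_forall_isSpin hM fun a ha ↦ eventually_all.2 fun k ↦
      (isMinimum_product hM ha k).eventually_branch_mem] with γ h1 h2 h3 h4 h5 h6 h7 a ha b hb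
  constructor
  · rintro ⟨hne, y, hy, ⟨-, -, -, z, hz, hza, hzy⟩, -, -, -, z', hz', hzy', hzb⟩
    obtain ⟨d, k, hd, rfl⟩ := (h5 y).1 hy
    obtain ⟨i, hi⟩ := h2 z hz a ha d hd k hza hzy
    obtain ⟨j, hj⟩ := h2 z' hz' b hb d hd k hzb hzy'
    exact exists_isInterchange_of_product_eq hM ha hb (hi.symm.trans hj) fun e ↦ hne (by rw [e])
  · rintro ⟨i, j, hij⟩
    refine ⟨fun e ↦ hij.ne (h3 _ (Or.inl ha) _ (Or.inl hb) e), branch (product a i) γ,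
      (h5 _).2 ⟨a, i, ha, rfl⟩, ⟨h4 a ha a ha i, (h6 a ha).2, (h7 a ha i).2, ζ a i γ,
        (h1 a ha i).1, (h1 a ha i).2.1, (h1 a ha i).2.2.1⟩, ?_⟩
    rw [hij.product_left]
    exact ⟨(h4 b hb b hb j).symm, (h7 b hb j).2, (h6 b hb).2, ζ b j γ, (h1 b hb j).1,
      (h1 b hb j).2.2.1, (h1 b hb j).2.1⟩

end MassConserving

/-! ## Basins of attraction and the upper bound for the heights -/

namespace MassConserving

open Landscape GradFlow Metric

variable {N M : ℕ} {γ : ℝ}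

theorem mem_basin_iff {v x : S N} : v ∈ basin (V N γ) x ↔
    ∃ u, u 0 = v ∧ FwdOrbit ((fam N).G γ) u ∧ Tendsto u atTop (𝓝 x) := by
  refine exists_congr fun u ↦ and_congr_right fun _ ↦ and_congr_left fun _ ↦ ?_
  simp only [FwdOrbit, fam_G]

theorem eq_of_mem_basin {u : ℝ → S N} {x y : S N} (hu : FwdOrbit ((fam N).G γ) u)
    (hx : Tendsto u atTop (𝓝 x)) (hy : u 0 ∈ basin (V N γ) y) : y = x := by
  obtain ⟨w, h0, hw, hwy⟩ := mem_basin_iff.1 hy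
  have := FwdOrbit.eqOn ((fam N).hasGradientAt γ) ((fam N).contDiff_G γ) hw hu h0
  refine tendsto_nhds_unique (hwy.congr' ?_) hx
  filter_upwards [eventually_ge_atTop 0] with t ht using this t ht

theorem eq_of_stationary_mem_basin {z y : S N} (hz : (fam N).G γ z = 0)
    (hy : z ∈ basin (V N γ) y) : y = z := by
  refine eq_of_mem_basin (u := fun _ ↦ z) (fwdOrbit_of_hasDerivAt fun t ↦ ?_)
    tendsto_const_nhds hy
  rw [hz, neg_zero]
  exact hasDerivAt_const t z

theorem eq_of_mem_basin_of_hasDerivAt {u : ℝ → S N} {x y : S N}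
    (hu : ∀ t, HasDerivAt u (-gradient (V N γ) (u t)) t) (hx : Tendsto u atTop (𝓝 x)) (t : ℝ)
    (hy : u t ∈ basin (V N γ) y) : y = x := by
  simp only [← fam_G] at hu
  refine eq_of_mem_basin (fwdOrbit_of_hasDerivAt (hasDerivAt_shift hu t))
    (hx.comp (tendsto_atTop_add_const_right atTop t tendsto_id)) ?_
  rwa [zero_add]

/-- The path along the unstable manifolds of two saddles with a common product state. -/
theorem eventually_joinedIn (hM : 4 ≤ M) : ∃ C : ℝ, ∀ᶠ γ in 𝓝[≥] (0 : ℝ), ∀ a, IsSpin a →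
    ∀ b, IsSpin b → ∀ k l, product a k = product b l → ∀ h : ℝ,
      saddleEnergy M (interfaces a) (interfacesAt a k) ≤ h →
      saddleEnergy M (interfaces b) (interfacesAt b l) ≤ h →
      JoinedIn (directRegion M γ (branch a γ) (branch b γ) ∩
        {v | V (2 * M) γ v ≤ saddleLevel M + γ * h + C * γ ^ 2}) (branch a γ) (branch b γ) := by
  obtain ⟨ζ, C, hζ⟩ := exists_saddle_branches hM
  refine ⟨C, ?_⟩
  filter_upwards [hζ, eventually_branch_ne_product hM, eventually_mem_family_zero hM,
    eventually_forall_isSpin hM fun a ha ↦ ha.isMinimum.eventually_branch_mem,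
    eventually_forall_isSpin hM fun a ha ↦ eventually_all.2 fun k ↦
      (isMinimum_product hM ha k).eventually_branch_mem, self_mem_nhdsWithin]
    with γ h1 h2 h3 h4 h5 h6 a ha b hb k l hkl h hh₁ hh₂
  have hfam : ∀ x ∈ family M 0 γ, x ∈ stationaryOfIndex (V (2 * M) γ) 0 := by
    rintro x hx
    obtain ⟨d, hd, rfl⟩ := (h3 x).1 hx
    exact (h4 d hd).2
  have hVz : ∀ d, IsSpin d → ∀ m, saddleEnergy M (interfaces d) (interfacesAt d m) ≤ h →
      V (2 * M) γ (ζ d m γ) ≤ saddleLevel M + γ * h + C * γ ^ 2 := by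
    intro d hd m hm
    have := (h1 d hd m).2.2.2
    have h7 := mul_le_mul_of_nonneg_left hm h6
    linarith
  set D := directRegion M γ (branch a γ) (branch b γ) with hD
  -- A point on an orbit belongs only to the basin of the limit of this orbit, and the limits along
  -- the path are the two endpoints and the product state. The saddles are stationary points of
  -- index `1`, hence in no basin of a configuration.
  have htarget : ∀ x, (x = branch a γ ∨ x = branch b γ ∨ x = branch (product a k) γ) →
      ∀ y ∈ family M 0 γ, y ≠ branch a γ → y ≠ branch b γ → y ≠ x := by
    rintro x (rfl | rfl | rfl) y hy hya hyb
    · exact hya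
    · exact hyb
    · obtain ⟨d, hd, rfl⟩ := (h3 y).1 hy
      exact h2 d hd a ha k
  have hzero : ∀ x, (x = branch a γ ∨ x = branch b γ ∨ x = branch (product a k) γ) →
      (fam (2 * M)).G γ x = 0 := by
    rintro x (rfl | rfl | rfl)
    · exact (h4 a ha).1
    · exact (h4 b hb).1
    · exact (h5 a ha k).1
  have hjoin : ∀ d, IsSpin d → ∀ m, saddleEnergy M (interfaces d) (interfacesAt d m) ≤ h →
      ∀ x, (x = branch a γ ∨ x = branch b γ ∨ x = branch (product a k) γ) →
      HasOrbit (V (2 * M) γ) (ζ d m γ) x →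
      JoinedIn (D ∩ {v | V (2 * M) γ v ≤ saddleLevel M + γ * h + C * γ ^ 2}) (ζ d m γ) x := by
    intro d hd m hm x hx horb
    have hbot : ∀ u : ℝ → S (2 * M), (∀ t, HasDerivAt u (-gradient (V (2 * M) γ) (u t)) t) →
        Tendsto u atBot (𝓝 (ζ d m γ)) → ∀ t, V (2 * M) γ (u t) ≤ V (2 * M) γ (ζ d m γ) := by
      intro u hu hbot t
      simp only [← fam_G] at hu
      have := Family.energy_le_of_tendsto_atBot ((fam (2 * M)).hasGradientAt γ) hu hbot t
      rwa [fam_V] at this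
    refine joinedIn_of_hasOrbit (fun u hu hub hut t ↦ ⟨fun y hy hya hyb hmem ↦ ?_,
      (hbot u hu hub t).trans (hVz d hd m hm)⟩) ⟨fun y hy _ _ hmem ↦ ?_, hVz d hd m hm⟩
      ⟨fun y hy hya hyb hmem ↦ ?_, ?_⟩ horb
    · exact htarget x hx y hy hya hyb (eq_of_mem_basin_of_hasDerivAt hu hut t hmem)
    · have hz := (h1 d hd m).1
      have e := eq_of_stationary_mem_basin (by rw [fam_G]; exact hz.1.1) hmem
      have hy0 := (hfam y hy).2
      rw [e, hz.2] at hy0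
      exact one_ne_zero hy0
    · exact htarget x hx y hy hya hyb (eq_of_stationary_mem_basin (hzero x hx) hmem)
    · obtain ⟨u, hu, hub, hut⟩ := horb
      simp only [← fam_G] at hu
      have h7 := Family.energy_le_of_tendsto_atTop ((fam (2 * M)).hasGradientAt γ) hu hut 0
      have h8 := Family.energy_le_of_tendsto_atBot ((fam (2 * M)).hasGradientAt γ) hu hub 0
      rw [fam_V] at h7 h8
      exact (h7.trans h8).trans (hVz d hd m hm)
  have ja := hjoin a ha k hh₁ _ (Or.inl rfl) (h1 a ha k).2.1
  have jay := hjoin a ha k hh₁ _ (Or.inr (Or.inr rfl)) (h1 a ha k).2.2.1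
  have jb := hjoin b hb l hh₂ _ (Or.inr (Or.inl rfl)) (h1 b hb l).2.1
  have jby := hjoin b hb l hh₂ _ (Or.inr (Or.inr rfl)) (by rw [hkl]; exact (h1 b hb l).2.2.1)
  exact (ja.symm.trans jay).trans (jby.symm.trans jb)

/-- The energy of the configurations to first order. -/
theorem exists_energy_branch (hM : 4 ≤ M) : ∃ C : ℝ, ∀ᶠ γ in 𝓝[≥] (0 : ℝ), ∀ a, IsSpin a →
    |V (2 * M) γ (branch a γ) - (-(M : ℝ) / 2 + γ * interfaces a)| ≤ C * γ ^ 2 := by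
  have hex : ∀ a : S (2 * M), ∃ C : ℝ, IsSpin a → ∀ᶠ γ in 𝓝[≥] (0 : ℝ),
      |V (2 * M) γ (branch a γ) - (-(M : ℝ) / 2 + γ * interfaces a)| ≤ C * γ ^ 2 := by
    intro a
    by_cases ha : IsSpin a
    · obtain ⟨r, γ₁, C, hb⟩ := ha.isMinimum.exists_isBranch
      refine ⟨C, fun _ ↦ ?_⟩
      filter_upwards [Icc_mem_nhdsGE hb.γ₁_pos] with γ hγ
      have := hb.energy γ hγ
      rw [fam_V, show (fam (2 * M)).V₀ a = _ from ha.V_zero,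
        show (fam (2 * M)).W a = _ from ha.couplingEnergy] at this
      exact this
    · exact ⟨0, fun h ↦ absurd h ha⟩
  choose C hC using hex
  obtain ⟨K, hK⟩ := ((finite_isSpin hM).image C).bddAbove
  refine ⟨K, eventually_forall_isSpin hM fun a ha ↦ ?_⟩
  filter_upwards [hC a ha] with γ hγ
  refine hγ.trans ?_
  have : C a ≤ K := hK ⟨a, ha, rfl⟩
  gcongr

end MassConserving

/-! ## The lower bound for the heights -/

/-- At the last time in the closed region the path cannot be in the open one, since it would remain
there a little longer. Everything after this time is outside. -/
theorem exists_last_exit {E : Type*} [TopologicalSpace E] {f : ℝ → E} (hf : Continuous f)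
    {R Rc : Set E} (hR : IsOpen R) (hRc : IsClosed Rc) (hsub : R ⊆ Rc) (h0 : f 0 ∈ Rc)
    (h1 : f 1 ∉ Rc) : ∃ t ∈ Ico (0 : ℝ) 1, f t ∈ Rc ∧ f t ∉ R ∧ ∀ s ∈ Ioc t 1, f s ∉ Rc := by
  obtain ⟨t, ⟨htI, htR⟩, hmax⟩ := (isCompact_Icc.inter_right (hRc.preimage hf)).exists_isGreatest
    ⟨(0 : ℝ), (left_mem_Icc.2 zero_le_one : (0 : ℝ) ∈ Icc 0 1), h0⟩
  have ht1 : t < 1 := lt_of_le_of_ne htI.2 fun e ↦ h1 (e ▸ htR)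
  have hlast : ∀ s ∈ Ioc t 1, f s ∉ Rc := fun s hs hsR ↦
    not_lt.2 (hmax ⟨⟨htI.1.trans hs.1.le, hs.2⟩, hsR⟩) hs.1
  refine ⟨t, ⟨htI.1, ht1⟩, htR, fun htR' ↦ ?_, hlast⟩
  have h2 : ∀ᶠ s in 𝓝[>] t, f s ∈ R :=
    (hf.continuousAt.eventually (hR.mem_nhds htR')).filter_mono nhdsWithin_le_nhds
  obtain ⟨s, hsR, hs⟩ := (h2.and (Ioc_mem_nhdsGT ht1)).exists
  exact hlast s hs (hsub hsR)

namespace MassConserving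

open Landscape GradFlow Metric

variable {N M : ℕ} {γ : ℝ}

theorem le_couplingEnergy (c x : S N) :
    couplingEnergy N c + inner ℝ (couplingL N c) (x - c) ≤ couplingEnergy N x := by
  have h1 := couplingEnergy_combination 1 1 c (x - c)
  rw [one_smul, one_smul, add_sub_cancel] at h1
  have h2 : 0 ≤ couplingForm (x - c) (x - c) := Finset.sum_nonneg fun i _ ↦ mul_self_nonneg _
  have h3 : inner ℝ (couplingL N c) (x - c) = 1 / 2 * couplingForm c (x - c) :=
    inner_couplingL c (x - c)
  rw [h1, h3, couplingEnergy_eq]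
  linarith

/-- Near a saddle the growth `ρ ‖x - c‖²` of `V_0` dominates the linear variation of the interaction
energy up to an error of order `γ²`, by convexity of the latter. Away from the saddles the boundary
is higher by a fixed amount, which beats any multiple of `γ`. -/
theorem exists_front_bound (hM : 4 ≤ M) : ∃ K : ℝ, ∀ δ > 0, ∀ᶠ γ in 𝓝[≥] (0 : ℝ), ∀ a, IsSpin a →
    ∀ x ∈ closedSpinRegion a, x ∉ spinRegion a →
      (∃ k, x ∈ ball (saddle a k) δ ∧ saddleLevel M +
        γ * saddleEnergy M (interfaces a) (interfacesAt a k) - K * γ ^ 2 ≤ V (2 * M) γ x) ∨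
      saddleLevel M + γ * saddleEnergy M (interfaces a) 0 ≤ V (2 * M) γ x := by
  obtain ⟨ρ, hρ, hfront⟩ := exists_spin_front_bound hM
  obtain ⟨K, hK⟩ := (((finite_isSpin hM).prod (finite_univ (α := Fin (2 * M)))).image
    fun p ↦ ‖couplingL (2 * M) (saddle p.1 p.2)‖ ^ 2 / (4 * ρ)).bddAbove
  refine ⟨K, fun δ hδ ↦ eventually_forall_isSpin hM fun a ha ↦ ?_⟩
  have hsmall : ∀ ρ' > 0, ∀ᶠ γ in 𝓝[≥] (0 : ℝ), γ * saddleEnergy M (interfaces a) 0 < ρ' := by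
    intro ρ' hρ'
    have h1 : Tendsto (fun γ : ℝ ↦ γ * saddleEnergy M (interfaces a) 0) (𝓝 0)
        (𝓝 (0 * saddleEnergy M (interfaces a) 0)) :=
      (continuous_id.mul continuous_const).tendsto 0
    rw [zero_mul] at h1
    exact (h1.mono_left nhdsWithin_le_nhds).eventually_lt_const hρ'
  filter_upwards [hsmall ρ hρ, hsmall (ρ * δ ^ 2) (by positivity), self_mem_nhdsWithin]
    with γ h1 h2 h3 x hx hxR
  have hVx : V (2 * M) 0 x ≤ V (2 * M) γ x := by
    have := (fam (2 * M)).V₀_le_V h3 x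
    rwa [fam_V] at this
  rcases hfront a ha x hx hxR with ⟨k, hk⟩ | hk
  swap
  · right; linarith
  by_cases hd : x ∈ ball (saddle a k) δ
  swap
  · right
    rw [mem_ball_iff_norm, not_lt] at hd
    have : δ ^ 2 ≤ ‖x - saddle a k‖ ^ 2 := by gcongr
    nlinarith
  · left
    refine ⟨k, hd, ?_⟩
    set c := saddle a k with hc
    have hKc : ‖couplingL (2 * M) c‖ ^ 2 / (4 * ρ) ≤ K := hK ⟨(a, k), ⟨ha, trivial⟩, rfl⟩
    have hW : couplingEnergy (2 * M) c = saddleEnergy M (interfaces a) (interfacesAt a k) :=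
      couplingEnergy_saddle hM ha k
    have h4 := le_couplingEnergy c x
    have h5 := abs_le.1 (abs_real_inner_le_norm (couplingL (2 * M) c) (x - c))
    have h6 : γ * couplingEnergy (2 * M) c - γ * (‖couplingL (2 * M) c‖ * ‖x - c‖) ≤
        γ * couplingEnergy (2 * M) x := by
      rw [← mul_sub]
      exact mul_le_mul_of_nonneg_left (by linarith [h5.1]) h3
    -- Completing the square produces the constant `‖L c‖² / (4ρ)` in front of `γ²`.
    have h7 : γ * (‖couplingL (2 * M) c‖ * ‖x - c‖) ≤
        ρ * ‖x - c‖ ^ 2 + ‖couplingL (2 * M) c‖ ^ 2 / (4 * ρ) * γ ^ 2 := by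
      rw [div_mul_eq_mul_div, ← sub_nonneg, show ρ * ‖x - c‖ ^ 2 +
        ‖couplingL (2 * M) c‖ ^ 2 * γ ^ 2 / (4 * ρ) - γ * (‖couplingL (2 * M) c‖ * ‖x - c‖) =
        (2 * ρ * ‖x - c‖ - γ * ‖couplingL (2 * M) c‖) ^ 2 / (4 * ρ) by field_simp; ring]
      positivity
    have h8 := mul_le_mul_of_nonneg_right hKc (sq_nonneg γ)
    rw [V_eq, ← hW]
    linarith

theorem IsSpin.notMem_closedSpinRegion (hM : 4 ≤ M) {a b : S (2 * M)} (ha : IsSpin a)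
    (hb : IsSpin b) (hne : a ≠ b) : b ∉ closedSpinRegion a := by
  intro h
  refine hne (coord_ext fun k ↦ ?_)
  have h1 := h.1 k
  have h2 := tau_sq_le hM
  have h3 := tau_pos (M := M)
  have h4 : tau M < 1 := by nlinarith
  rcases ha k with e | e <;> rcases hb k with e' | e' <;> rw [e, e'] at h1 ⊢ <;> linarith

theorem eventually_mem_spinRegions (hM : 4 ≤ M) : ∀ᶠ γ in 𝓝[≥] (0 : ℝ), ∀ a : S (2 * M), IsSpin a →
    branch a γ ∈ spinRegion a ∧ ∀ b, IsSpin b → a ≠ b → branch b γ ∉ closedSpinRegion a := by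
  refine eventually_forall_isSpin hM fun a ha ↦ ?_
  refine (ha.isMinimum.tendsto_branch.eventually
    ((isOpen_spinRegion a).mem_nhds ha.mem_spinRegion)).and
    (eventually_forall_isSpin hM fun b hb ↦ ?_)
  by_cases e : a = b
  · exact Eventually.of_forall fun _ h ↦ absurd e h
  · exact (hb.isMinimum.tendsto_branch.eventually
      ((isClosed_closedSpinRegion a).isOpen_compl.mem_nhds
      (ha.notMem_closedSpinRegion hM hb e))).mono fun _ h _ ↦ h

/-- A path that leaves the region of a configuration crosses the level of its lowest saddle. -/
theorem exists_le_of_leave (hM : 4 ≤ M) : ∃ K : ℝ, ∀ᶠ γ in 𝓝[≥] (0 : ℝ), ∀ a, IsSpin a →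
    ∀ b, IsSpin b → a ≠ b → ∀ η, (∀ k, interfacesAt a k ≤ η) →
    ∀ f : ℝ → S (2 * M), Continuous f → f 0 = branch a γ → f 1 = branch b γ →
      ∃ t ∈ Icc (0 : ℝ) 1, saddleLevel M + γ * saddleEnergy M (interfaces a) η - K * γ ^ 2 ≤
        V (2 * M) γ (f t) := by
  obtain ⟨K, hK⟩ := exists_front_bound hM
  refine ⟨max K 0, ?_⟩
  filter_upwards [hK 1 one_pos, eventually_mem_spinRegions hM, self_mem_nhdsWithin]
    with γ h1 h2 h3 a ha b hb hne η hη f hf hf0 hf1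
  replace h3 : 0 ≤ γ := h3
  obtain ⟨t, ht, htR, htR', -⟩ := exists_last_exit hf (isOpen_spinRegion a)
    (isClosed_closedSpinRegion a) (spinRegion_subset a)
    (by rw [hf0]; exact spinRegion_subset a (h2 a ha).1)
    (by rw [hf1]; exact (h2 a ha).2 b hb hne)
  refine ⟨t, Ico_subset_Icc_self ht, ?_⟩
  have h4 : K * γ ^ 2 ≤ max K 0 * γ ^ 2 :=
    mul_le_mul_of_nonneg_right (le_max_left _ _) (sq_nonneg _)
  have h5 : 0 ≤ max K 0 * γ ^ 2 := mul_nonneg (le_max_right _ _) (sq_nonneg _)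
  -- The exit is near a saddle with at most `η` interfaces at its site, or it is above the level for
  -- zero interfaces; monotonicity covers both.
  rcases h1 a ha _ htR htR' with ⟨k, -, hk⟩ | hk
  · have := mul_le_mul_of_nonneg_left (saddleEnergy_le hM (hη k) (p := interfaces a)) h3
    linarith
  · have := mul_le_mul_of_nonneg_left (saddleEnergy_le hM (Nat.zero_le η) (p := interfaces a)) h3
    linarith

end MassConserving

/-! ## Direct paths between configurations with isolated sites -/

namespace MassConserving

open Landscape GradFlow Metric

variable {N M : ℕ} {γ : ℝ}

theorem IsGenericSaddle.region_swap {c : S N} {i j : Fin N} {α β : ℝ}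
    (h : IsGenericSaddle c i α β) (hj : coord c j = β) :
    region (permute (Equiv.swap i j) c) j α β = region c i α β := by
  ext x
  refine forall_congr' fun k ↦ ?_
  rw [h.pattern_swap hj, coord_permute, Equiv.swap_apply_right]

theorem not_isSpin_saddle (hM : 4 ≤ M) {a : S (2 * M)} (ha : IsSpin a) (k : Fin (2 * M)) :
    ¬ IsSpin (saddle a k) := by
  intro h
  have h1 := h.mul_self k
  rw [coord_saddle_self] at h1
  have h2 := tau_sq_le hM
  have h3 := ha.mul_self k
  have h4 : tau M ^ 2 = 1 := by linear_combination h1 - tau M ^ 2 * h3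
  linarith

/-- Near the saddles, the side of the special coordinate determines the region. -/
theorem eventually_sides (hM : 4 ≤ M) : ∀ᶠ δ in 𝓝[>] (0 : ℝ), ∀ a : S (2 * M), IsSpin a → ∀ k,
    ∀ x ∈ closedBall (saddle a k) δ, ¬ IsSpin x ∧
      (0 < coord a k * (coord x k - coord (saddle a k) k) → x ∈ spinRegion a) ∧
      (0 ≤ coord a k * (coord x k - coord (saddle a k) k) → x ∈ closedSpinRegion a) ∧
      (coord a k * (coord x k - coord (saddle a k) k) < 0 →
        x ∈ IsGenericSaddle.region (saddle a k) k ((M - 1) * tau M * coord a k)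
          (-((M - 2) * tau M * coord a k))) ∧
      (coord a k * (coord x k - coord (saddle a k) k) ≤ 0 →
        x ∈ IsGenericSaddle.closedRegion (saddle a k) k ((M - 1) * tau M * coord a k)
          (-((M - 2) * tau M * coord a k))) := by
  have hM' : (4 : ℝ) ≤ M := by exact_mod_cast hM
  have ht : 0 < (M - 3) * tau M := mul_pos (by linarith) tau_pos
  refine eventually_forall_isSpin hM fun a ha ↦ eventually_all.2 fun k ↦ ?_
  have hspin : ∀ᶠ x in 𝓝 (saddle a k), ¬ IsSpin x :=
    (finite_isSpin hM).isClosed.isOpen_compl.mem_nhds (not_isSpin_saddle hM ha k)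
  filter_upwards [hspin.forall_closedBall, (eventually_mem_spinRegion hM ha k).forall_closedBall,
    (isGenericSaddle_saddle hM ha k).eventually_mem_region.forall_closedBall]
    with δ h1 h2 h3 x hx
  have h4 := h3 x hx
  rw [isGenericSaddle_beta_sub] at h4
  exact ⟨h1 x hx, (h2 x hx).1, (h2 x hx).2, fun h ↦ h4.1 (mul_pos ht (by linarith)),
    fun h ↦ h4.2 (mul_nonneg ht.le (by linarith))⟩

/-- Points of low energy on the boundary of the region behind a saddle are close to a saddle that
leads to the same product state, with the special site possibly moved to another majority site. -/
theorem eventually_near_of_front (hM : 4 ≤ M) {a : S (2 * M)} (ha : IsSpin a) {δ : ℝ}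
    (hδ : 0 < δ) (C : ℝ) : ∀ᶠ γ in 𝓝[≥] (0 : ℝ), ∀ k,
      ∀ x ∈ IsGenericSaddle.closedRegion (saddle a k) k ((M - 1) * tau M * coord a k)
        (-((M - 2) * tau M * coord a k)),
      x ∉ IsGenericSaddle.region (saddle a k) k ((M - 1) * tau M * coord a k)
        (-((M - 2) * tau M * coord a k)) → V (2 * M) γ x ≤ saddleLevel M + C * γ →
      ∃ l, (l = k ∨ coord (saddle a k) l = -((M - 2) * tau M * coord a k)) ∧
        x ∈ ball (saddle (permute (Equiv.swap k l) a) l) δ := by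
  refine eventually_all.2 fun k ↦ ?_
  obtain ⟨ρ, hρ, hfront⟩ := (isGenericSaddle_saddle hM ha k).exists_front_bound
  have hsmall : ∀ ρ' > 0, ∀ᶠ γ in 𝓝[≥] (0 : ℝ), C * γ < ρ' := by
    intro ρ' hρ'
    have h1 : Tendsto (fun γ : ℝ ↦ C * γ) (𝓝 0) (𝓝 (C * 0)) :=
      (continuous_const.mul continuous_id).tendsto 0
    rw [mul_zero] at h1
    exact (h1.mono_left nhdsWithin_le_nhds).eventually_lt_const hρ'
  filter_upwards [hsmall ρ hρ, hsmall (ρ * δ ^ 2) (by positivity), self_mem_nhdsWithin]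
    with γ h1 h2 h3 x hx hxR hV
  have hVx : V (2 * M) 0 x ≤ V (2 * M) γ x := by
    have := (fam (2 * M)).V₀_le_V h3 x
    rwa [fam_V] at this
  have hf := hfront x hx hxR
  rw [V_zero_saddle hM ha k] at hf
  rcases hf with ⟨l, hl, hle⟩ | hle
  · refine ⟨l, hl, ?_⟩
    rw [saddle_swap] at hle
    rw [mem_ball_iff_norm]
    by_contra hd
    have : δ ^ 2 ≤ ‖x - saddle (permute (Equiv.swap k l) a) l‖ ^ 2 := by
      have := not_lt.1 hd
      gcongr
    nlinarith
  · linarith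

/-- A direct path between configurations that differ by the interchange of two sites with one
interface crosses the level of the saddles at these sites. -/
theorem exists_le_of_direct (hM : 4 ≤ M) {a b : S (2 * M)} {i j : Fin (2 * M)} (ha : IsSpin a)
    (h : IsInterchange a b i j) (hi : interfacesAt a i = 1) (hj : interfacesAt a j = 1) :
    ∃ K : ℝ, ∀ᶠ γ in 𝓝[≥] (0 : ℝ), ∀ f : ℝ → S (2 * M), Continuous f → f 0 = branch a γ →
      f 1 = branch b γ →
      (∀ t ∈ Icc (0 : ℝ) 1, f t ∈ directRegion M γ (branch a γ) (branch b γ)) →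
      ∃ t ∈ Icc (0 : ℝ) 1, saddleLevel M + γ * saddleEnergy M (interfaces a) 1 - K * γ ^ 2 ≤
        V (2 * M) γ (f t) := by
  have hb := h.isSpin ha
  obtain ⟨K, hK⟩ := exists_front_bound hM
  obtain ⟨δ, ⟨hδ, hsides⟩, hδ0⟩ := (((eventually_tendsto_of_side hM).and
    (eventually_sides hM)).and self_mem_nhdsWithin).exists
  replace hδ0 : 0 < δ := hδ0
  have hb_ball : ∀ᶠ γ in 𝓝[≥] (0 : ℝ), ∀ d, IsSpin d → ∀ m,
      branch b γ ∉ closedBall (saddle d m) δ :=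
    eventually_forall_isSpin hM fun d hd ↦ eventually_all.2 fun m ↦
      hb.isMinimum.tendsto_branch.eventually (isClosed_closedBall.isOpen_compl.mem_nhds
        fun hmem ↦ (hsides d hd m b hmem).1 hb)
  have hb_reg : ∀ᶠ γ in 𝓝[≥] (0 : ℝ), ∀ k, branch b γ ∉ IsGenericSaddle.closedRegion (saddle a k) k
      ((M - 1) * tau M * coord a k) (-((M - 2) * tau M * coord a k)) :=
    eventually_all.2 fun k ↦ hb.isMinimum.tendsto_branch.eventually
      (IsGenericSaddle.isClosed_closedRegion.isOpen_compl.mem_nhds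
        ((isGenericSaddle_saddle hM ha k).spin_notMem hb))
  refine ⟨max K 0, ?_⟩
  filter_upwards [hK δ hδ0, eventually_mem_spinRegions hM,
    hδ (saddleEnergy M (interfaces a) 1), hb_ball, hb_reg,
    eventually_near_of_front hM ha hδ0 (saddleEnergy M (interfaces a) 1),
    eventually_branch_injOn hM, eventually_mem_family_zero hM, self_mem_nhdsWithin]
    with γ h1 h2 h3 h4 h5 h6 h7 h8 hγ f hf hf0 hf1 hD
  replace hγ : 0 ≤ γ := hγ
  -- Suppose the path stays below the level for one interface. It will be shown to get stuck behind
  -- a saddle at an isolated site.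
  by_contra! hno
  have h9 : K * γ ^ 2 ≤ max K 0 * γ ^ 2 :=
    mul_le_mul_of_nonneg_right (le_max_left _ _) (sq_nonneg _)
  have h10 : 0 ≤ max K 0 * γ ^ 2 := mul_nonneg (le_max_right _ _) (sq_nonneg _)
  have hV : ∀ t ∈ Icc (0 : ℝ) 1,
      V (2 * M) γ (f t) ≤ saddleLevel M + saddleEnergy M (interfaces a) 1 * γ := fun t ht ↦ by
    linarith [hno t ht]
  obtain ⟨t₀, ht₀, htR, htR', hlast⟩ := exists_last_exit hf (isOpen_spinRegion a)
    (isClosed_closedSpinRegion a) (spinRegion_subset a)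
    (by rw [hf0]; exact spinRegion_subset a (h2 a ha).1)
    (by rw [hf1]; exact (h2 a ha).2 b hb h.ne)
  have hno₀ := hno t₀ (Ico_subset_Icc_self ht₀)
  obtain ⟨k, hkball, hkV⟩ : ∃ k, f t₀ ∈ ball (saddle a k) δ ∧ saddleLevel M +
      γ * saddleEnergy M (interfaces a) (interfacesAt a k) - K * γ ^ 2 ≤ V (2 * M) γ (f t₀) := by
    refine (h1 a ha _ htR htR').resolve_right fun hle ↦ ?_
    have := mul_le_mul_of_nonneg_left (saddleEnergy_le hM zero_le_one (p := interfaces a)) hγ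
    linarith
  -- So low an exit from the region of `a` must be at a site with two interfaces, which is neither
  -- `i` nor `j`.
  have hηk : 1 < interfacesAt a k := by
    by_contra hle
    have := mul_le_mul_of_nonneg_left (saddleEnergy_le hM (not_lt.1 hle) (p := interfaces a)) hγ
    linarith
  have hki : k ≠ i := fun e ↦ by rw [e, hi] at hηk; exact lt_irrefl _ hηk
  have hkj : k ≠ j := fun e ↦ by rw [e, hj] at hηk; exact lt_irrefl _ hηk
  have hgen := isGenericSaddle_saddle hM ha k
  set α : ℝ := (M - 1) * tau M * coord a k with hα
  set β : ℝ := -((M - 2) * tau M * coord a k) with hβ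
  -- The trap: the closed region behind the saddle at `k`, enlarged by small balls around the other
  -- saddles that lead to the same product state. After its last exit from the region of `a` the
  -- path never leaves this set.
  set A : Set (S (2 * M)) := IsGenericSaddle.closedRegion (saddle a k) k α β ∪
    ⋃ l ∈ {l | l ≠ k ∧ coord (saddle a k) l = β},
      closedBall (saddle (permute (Equiv.swap k l) a) l) δ with hA
  have hAclosed : IsClosed A := IsGenericSaddle.isClosed_closedRegion.union
    ((toFinite _).isClosed_biUnion fun l _ ↦ isClosed_closedBall)
  have hballA : ∀ l, l ≠ k → coord (saddle a k) l = β →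
      closedBall (saddle (permute (Equiv.swap k l) a) l) δ ⊆ A := fun l hl hlβ x hx ↦
    Or.inr (mem_iUnion₂.2 ⟨l, ⟨hl, hlβ⟩, hx⟩)
  have hregA : IsGenericSaddle.region (saddle a k) k α β ⊆ A :=
    IsGenericSaddle.region_subset.trans subset_union_left
  have hopen : ∀ {t : ℝ} {U : Set (S (2 * M))} (_ : IsOpen U) (_ : U ⊆ A) (_ : f t ∈ U),
      {t | f t ∈ A} ∈ 𝓝[>] t := fun hU hUA ht ↦
    ((hf.continuousAt.eventually (hU.mem_nhds ht)).filter_mono nhdsWithin_le_nhds).mono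
      fun _ hs ↦ hUA hs
  have hstart : f t₀ ∈ A := by
    have hs := hsides a ha k _ (ball_subset_closedBall hkball)
    exact Or.inl (hs.2.2.2.2 (not_lt.1 fun hpos ↦ htR' (hs.2.1 hpos)))
  have hstep : ∀ t ∈ {t | f t ∈ A} ∩ Ico t₀ 1, {t | f t ∈ A} ∈ 𝓝[>] t := by
    rintro t ⟨htA, ht⟩
    have htI : t ∈ Icc (0 : ℝ) 1 := ⟨ht₀.1.trans ht.1, ht.2.le⟩
    rcases htA with htA | htA
    · by_cases htreg : f t ∈ IsGenericSaddle.region (saddle a k) k α β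
      · exact hopen IsGenericSaddle.isOpen_region hregA htreg
      obtain ⟨l, hl, hball⟩ := h6 k (f t) htA htreg (hV t htI)
      by_cases hlk : l = k
      · have e : permute (Equiv.swap k l) a = a := coord_ext fun m ↦ by
          rw [coord_permute, hlk, Equiv.swap_self, Equiv.refl_apply]
        rw [e, hlk] at hball
        -- Near the saddle at `k` itself, turning back would mean re-entering the closed region of
        -- `a` after the last exit.
        filter_upwards [(hf.continuousAt.eventually (isOpen_ball.mem_nhds hball)).filter_mono
          nhdsWithin_le_nhds, Ioc_mem_nhdsGT ht.2] with s hs hst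
        have hss := hsides a ha k _ (ball_subset_closedBall hs)
        refine hregA (hss.2.2.2.1 (not_le.1 fun hnn ↦ ?_))
        exact hlast s ⟨ht.1.trans_lt hst.1, hst.2⟩ (hss.2.2.1 hnn)
      · exact hopen isOpen_ball
          (ball_subset_closedBall.trans (hballA l hlk (hl.resolve_left hlk))) hball
    · obtain ⟨l, ⟨hlk, hlβ⟩, hball⟩ := mem_iUnion₂.1 htA
      set d := permute (Equiv.swap k l) a with hd
      have hdS : IsSpin d := ha.permute _
      have hdl : coord d l = coord a k := by rw [hd, coord_permute, Equiv.swap_apply_right]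
      have hal : coord a l = -coord a k := (ha.eq_or k l).resolve_left fun e ↦
        hgen.alpha_ne ((coord_saddle_same hlk e).symm.trans hlβ)
      have hdk : coord d k = -coord a k := by rw [hd, coord_permute, Equiv.swap_apply_left, hal]
      by_cases hin : f t ∈ ball (saddle d l) δ
      · exact hopen isOpen_ball (ball_subset_closedBall.trans (hballA l hlk hlβ)) hin
      have hsph : f t ∈ sphere (saddle d l) δ :=
        le_antisymm hball (not_lt.1 hin)
      obtain ⟨hne, horb⟩ := h3 d hdS l (f t) hsph (hV t htI)
      have hdl0 : coord d l ≠ 0 := fun e ↦ by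
        have := hdS.mul_self l; rw [e] at this; norm_num at this
      -- On the sphere around the saddle of `d` the point is on one of two sides. On one it is back
      -- in the region behind the saddles; on the other it flows to the continuation of `d`. The
      -- configuration `d` differs at `k` from both `a` and `b`, as `k` is neither `i` nor `j`, so a
      -- direct path may not enter this basin.
      rcases lt_or_gt_of_ne (mul_ne_zero hdl0 (sub_ne_zero.2 hne)) with hneg | hpos
      · have := (hsides d hdS l _ hball).2.2.2.1 hneg
        rw [hdl, ← hα, ← hβ, hd, ← saddle_swap, hgen.region_swap hlβ] at this
        exact hopen IsGenericSaddle.isOpen_region hregA this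
      · obtain ⟨u, hu0, hu⟩ := exists_fwdOrbit ((fam (2 * M)).hasGradientAt γ)
          ((fam (2 * M)).contDiff_G γ) ((fam (2 * M)).bdd_V hγ) (f t)
        refine absurd (mem_basin_iff.2 ⟨u, hu0, hu, (horb u hu hu0).1 hpos⟩)
          (hD t htI _ ((h8 _).2 ⟨d, hdS, rfl⟩) (fun e ↦ ?_) fun e ↦ ?_)
        · have e' := h7 _ (Or.inl hdS) _ (Or.inl ha) e
          rw [e'] at hdk
          exact ha.ne_neg k hdk
        · have e' := h7 _ (Or.inl hdS) _ (Or.inl hb) e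
          rw [e', h.2.2, Equiv.swap_apply_of_ne_of_ne hki hkj] at hdk
          exact ha.ne_neg k hdk
  have hall := IsClosed.Icc_subset_of_forall_mem_nhdsWithin
    ((hAclosed.preimage hf).inter isClosed_Icc) hstart hstep
  have h1A : f 1 ∈ A := hall (right_mem_Icc.2 ht₀.2.le)
  rw [hf1] at h1A
  rcases h1A with h1A | h1A
  · exact h5 k h1A
  · obtain ⟨l, -, hball⟩ := mem_iUnion₂.1 h1A
    exact h4 _ (ha.permute _) l hball

end MassConserving

/-! ## The communication heights -/

namespace MassConserving

open Landscape GradFlow Metric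

variable {M : ℕ}

theorem sub_le_commHeightIn {E : Type*} [NormedAddCommGroup E] {V : E → ℝ} (hV : Continuous V)
    {D : Set E} {x y : E} {B : ℝ} (hj : JoinedIn D x y)
    (hlow : ∀ f : ℝ → E, Continuous f → f 0 = x → f 1 = y → (∀ t ∈ Icc (0 : ℝ) 1, f t ∈ D) →
      ∃ t ∈ Icc (0 : ℝ) 1, B ≤ V (f t)) : B - V x ≤ commHeightIn V D x {y} := by
  refine le_commHeightIn hj fun p hp ↦ ?_
  obtain ⟨t, ht, hB⟩ := hlow p.extend p.continuous_extend p.extend_zero p.extend_one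
    fun t ht ↦ by rw [p.extend_apply ht]; exact hp _
  rw [p.extend_apply ht] at hB
  exact hB.trans (le_ciSup_path hV p _)

theorem interfacesAt_le_one {N : ℕ} {a : S N} (h : ¬ HasIsolatedSite a) (k : Fin N) :
    interfacesAt a k ≤ 1 := by
  have h1 := interfacesAt_le a k
  have h2 : interfacesAt a k ≠ 2 := fun e ↦ h ⟨k, e⟩
  omega

theorem continuous_V {N : ℕ} (γ : ℝ) : Continuous (V N γ) := by
  rw [← fam_V]; exact (fam N).continuous_V γ

/-- The lower bound along arbitrary paths. -/
theorem IsTransition.exists_le (hM : 4 ≤ M) {a b : S (2 * M)} {i j : Fin (2 * M)}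
    {T : TransitionType} (ha : IsSpin a) (h : IsInterchange a b i j) (hT : IsTransition a b i j T)
    (hcond : T ≠ .III ∨ ¬ HasIsolatedSite a ∨ ¬ HasIsolatedSite b) :
    ∃ K : ℝ, ∀ᶠ γ in 𝓝[≥] (0 : ℝ), ∀ f : ℝ → S (2 * M), Continuous f → f 0 = branch a γ →
      f 1 = branch b γ → ∃ t ∈ Icc (0 : ℝ) 1,
        saddleLevel M + γ * (interfaces a + T.height1 M (interfaces a)) - K * γ ^ 2 ≤
          V (2 * M) γ (f t) := by
  have hb := h.isSpin ha
  obtain ⟨K, hK⟩ := exists_le_of_leave hM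
  -- The height is the level of the lowest possible exit of one endpoint: `η = 2` in all types but
  -- III, and `η = 1` in type III if that endpoint has no isolated site.
  have key : ∃ η, ((∀ k, interfacesAt a k ≤ η) ∧
        interfaces a + T.height1 M (interfaces a) = saddleEnergy M (interfaces a) η) ∨
      ((∀ k, interfacesAt b k ≤ η) ∧
        interfaces a + T.height1 M (interfaces a) = saddleEnergy M (interfaces b) η) := by
    rcases hT.height_eq with ⟨-, e | e⟩ | ⟨hIII, hab, -, -, e⟩
    · exact ⟨2, Or.inl ⟨interfacesAt_le a, e⟩⟩
    · exact ⟨2, Or.inr ⟨interfacesAt_le b, e⟩⟩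
    · rcases hcond with h1 | h1 | h1
      · exact absurd hIII h1
      · exact ⟨1, Or.inl ⟨interfacesAt_le_one h1, e⟩⟩
      · exact ⟨1, Or.inr ⟨interfacesAt_le_one h1, by rw [e, hab]⟩⟩
  refine ⟨K, hK.mono fun γ hγ f hf hf0 hf1 ↦ ?_⟩
  obtain ⟨η, ⟨hη, e⟩ | ⟨hη, e⟩⟩ := key
  · rw [e]
    exact hγ a ha b hb h.ne η hη f hf hf0 hf1
  · rw [e]
    -- The bound at the second endpoint is obtained by running the path backwards.
    obtain ⟨t, ht, hle⟩ := hγ b hb a ha h.ne.symm η hη (fun t ↦ f (1 - t))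
      (hf.comp (continuous_const.sub continuous_id)) (by rw [sub_zero, hf1]) (by rw [sub_self, hf0])
    exact ⟨1 - t, ⟨by linarith [ht.2], by linarith [ht.1]⟩, hle⟩

/-- The heights of a transition to first order. -/
theorem IsTransition.exists_height (hM : 4 ≤ M) {a b : S (2 * M)} {i j : Fin (2 * M)}
    {T : TransitionType} (ha : IsSpin a) (h : IsInterchange a b i j)
    (hT : IsTransition a b i j T) : ∃ K : ℝ, ∀ᶠ γ in 𝓝[≥] (0 : ℝ),
      |transitionHeight M γ (branch a γ) (branch b γ) -
        (height0 M + γ * T.height1 M (interfaces a))| ≤ K * γ ^ 2 ∧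
      (T ≠ .III ∨ ¬ HasIsolatedSite a ∨ ¬ HasIsolatedSite b →
        |commHeight (V (2 * M) γ) (branch a γ) {branch b γ} -
          (height0 M + γ * T.height1 M (interfaces a))| ≤ K * γ ^ 2) := by
  have hb := h.isSpin ha
  obtain ⟨C₁, hC₁⟩ := eventually_joinedIn hM
  obtain ⟨C₂, hC₂⟩ := exists_energy_branch hM
  set L : ℝ := interfaces a + T.height1 M (interfaces a) with hL
  have hjoin : ∀ᶠ γ in 𝓝[≥] (0 : ℝ),
      JoinedIn (directRegion M γ (branch a γ) (branch b γ) ∩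
        {v | V (2 * M) γ v ≤ saddleLevel M + γ * L + C₁ * γ ^ 2}) (branch a γ) (branch b γ) := by
    filter_upwards [hC₁] with γ hγ
    -- One of the two common product states gives a route on which both saddles are below the
    -- claimed level.
    rcases hT.le_height with ⟨h1, h2⟩ | ⟨h1, h2⟩
    · exact hγ a ha b hb i j h.product_left L h1 h2
    · exact hγ a ha b hb j i h.product_right L h1 h2
  -- The route avoids third basins, so it bounds the restricted and the unrestricted height at the
  -- same time, whence the general domain `D`.
  have hupper : ∀ᶠ γ in 𝓝[≥] (0 : ℝ), ∀ D, directRegion M γ (branch a γ) (branch b γ) ⊆ D →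
      commHeightIn (V (2 * M) γ) D (branch a γ) {branch b γ} ≤
        height0 M + γ * T.height1 M (interfaces a) + (C₁ + C₂) * γ ^ 2 := by
    filter_upwards [hjoin, hC₂] with γ hγ hE D hD
    have h1 := commHeightIn_le (continuous_V γ) (hγ.mono (inter_subset_inter_left _ hD))
    have h2 := (abs_le.1 (hE a ha)).1
    rw [saddleLevel_eq, hL] at h1
    linarith
  have hlower : ∀ {K : ℝ} {D : ℝ → Set (S (2 * M))}
      (_ : ∀ γ, directRegion M γ (branch a γ) (branch b γ) ⊆ D γ)
      (_ : ∀ᶠ γ in 𝓝[≥] (0 : ℝ), ∀ f : ℝ → S (2 * M), Continuous f → f 0 = branch a γ →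
        f 1 = branch b γ → (∀ t ∈ Icc (0 : ℝ) 1, f t ∈ D γ) → ∃ t ∈ Icc (0 : ℝ) 1,
          saddleLevel M + γ * L - K * γ ^ 2 ≤ V (2 * M) γ (f t)),
      ∀ᶠ γ in 𝓝[≥] (0 : ℝ), height0 M + γ * T.height1 M (interfaces a) - (K + C₂) * γ ^ 2 ≤
        commHeightIn (V (2 * M) γ) (D γ) (branch a γ) {branch b γ} := by
    intro K D hD hlow
    filter_upwards [hlow, hjoin, hC₂] with γ hγ hj hE
    have h1 := sub_le_commHeightIn (continuous_V γ)
      (hj.mono (inter_subset_left.trans (hD γ))) hγ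
    have h2 := (abs_le.1 (hE a ha)).2
    rw [saddleLevel_eq, hL] at h1
    linarith
  by_cases hcond : T ≠ .III ∨ ¬ HasIsolatedSite a ∨ ¬ HasIsolatedSite b
  · obtain ⟨K, hK⟩ := hT.exists_le hM ha h hcond
    have low₁ := hlower (D := fun γ ↦ directRegion M γ (branch a γ) (branch b γ))
      (fun _ ↦ Subset.rfl) (hK.mono fun γ hγ f hf h0 h1 _ ↦ hγ f hf h0 h1)
    have low₂ := hlower (D := fun _ ↦ univ)
      (fun _ ↦ subset_univ _) (hK.mono fun γ hγ f hf h0 h1 _ ↦ hγ f hf h0 h1)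
    refine ⟨max C₁ K + C₂, ?_⟩
    filter_upwards [low₁, low₂, hupper] with γ h1 h2 h3
    have e1 : C₁ * γ ^ 2 ≤ max C₁ K * γ ^ 2 :=
      mul_le_mul_of_nonneg_right (le_max_left _ _) (sq_nonneg _)
    have e2 : K * γ ^ 2 ≤ max C₁ K * γ ^ 2 :=
      mul_le_mul_of_nonneg_right (le_max_right _ _) (sq_nonneg _)
    have u1 := h3 _ Subset.rfl
    have u2 := h3 univ (subset_univ _)
    unfold transitionHeight commHeight
    exact ⟨abs_le.2 ⟨by linarith, by linarith⟩, fun _ ↦ abs_le.2 ⟨by linarith, by linarith⟩⟩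
  · have hIII : T = .III := by
      by_contra e
      exact hcond (Or.inl e)
    obtain ⟨-, -, hi, hj, e⟩ := hT.height_eq.resolve_left fun e ↦ e.1 hIII
    obtain ⟨K, hK⟩ := exists_le_of_direct hM ha h hi hj
    rw [← e] at hK
    have low₁ := hlower (D := fun γ ↦ directRegion M γ (branch a γ) (branch b γ))
      (fun _ ↦ Subset.rfl) hK
    refine ⟨max C₁ K + C₂, ?_⟩
    filter_upwards [low₁, hupper] with γ h1 h3
    have e1 : C₁ * γ ^ 2 ≤ max C₁ K * γ ^ 2 :=
      mul_le_mul_of_nonneg_right (le_max_left _ _) (sq_nonneg _)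
    have e2 : K * γ ^ 2 ≤ max C₁ K * γ ^ 2 :=
      mul_le_mul_of_nonneg_right (le_max_right _ _) (sq_nonneg _)
    have u1 := h3 _ Subset.rfl
    unfold transitionHeight
    exact ⟨abs_le.2 ⟨by linarith, by linarith⟩, fun h ↦ absurd h hcond⟩

/-- The allowed transitions, their types and their heights, with a uniform constant. -/
theorem exists_uniform_height (hM : 4 ≤ M) : ∃ K : ℝ, ∀ᶠ γ in 𝓝[≥] (0 : ℝ), ∀ a : S (2 * M),
    IsSpin a → ∀ b i j, IsInterchange a b i j → ∃ T, IsTransition a b i j T ∧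
      |transitionHeight M γ (branch a γ) (branch b γ) -
        (height0 M + γ * T.height1 M (interfaces a))| ≤ K * γ ^ 2 ∧
      (T ≠ .III ∨ ¬ HasIsolatedSite a ∨ ¬ HasIsolatedSite b →
        |commHeight (V (2 * M) γ) (branch a γ) {branch b γ} -
          (height0 M + γ * T.height1 M (interfaces a))| ≤ K * γ ^ 2) := by
  have hex : ∀ (a : S (2 * M)) (i j : Fin (2 * M)), ∃ K : ℝ, IsSpin a → ∀ b,
      IsInterchange a b i j → ∃ T, IsTransition a b i j T ∧ ∀ᶠ γ in 𝓝[≥] (0 : ℝ),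
      |transitionHeight M γ (branch a γ) (branch b γ) -
        (height0 M + γ * T.height1 M (interfaces a))| ≤ K * γ ^ 2 ∧
      (T ≠ .III ∨ ¬ HasIsolatedSite a ∨ ¬ HasIsolatedSite b →
        |commHeight (V (2 * M) γ) (branch a γ) {branch b γ} -
          (height0 M + γ * T.height1 M (interfaces a))| ≤ K * γ ^ 2) := by
    intro a i j
    by_cases h : IsSpin a ∧ ∃ b, IsInterchange a b i j
    · obtain ⟨ha, b, hb⟩ := h
      obtain ⟨T, hT⟩ := hb.exists_isTransition hM ha
      obtain ⟨K, hK⟩ := hT.exists_height hM ha hb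
      refine ⟨K, fun _ b' hb' ↦ ?_⟩
      obtain rfl : b' = b := hb'.eq_permute.trans hb.eq_permute.symm
      exact ⟨T, hT, hK⟩
    · exact ⟨0, fun ha b hb ↦ absurd ⟨ha, b, hb⟩ h⟩
  choose K hK using hex
  -- There are finitely many configurations and pairs of sites, so one constant serves all
  -- transitions.
  obtain ⟨K', hK'⟩ := (((finite_isSpin hM).prod
    (finite_univ (α := Fin (2 * M) × Fin (2 * M)))).image fun p ↦ K p.1 p.2.1 p.2.2).bddAbove
  refine ⟨K', eventually_forall_isSpin hM fun a ha ↦ ?_⟩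
  have key : ∀ᶠ γ in 𝓝[≥] (0 : ℝ), ∀ i j, ∀ b, IsSpin b → IsInterchange a b i j →
      ∃ T, IsTransition a b i j T ∧
      |transitionHeight M γ (branch a γ) (branch b γ) -
        (height0 M + γ * T.height1 M (interfaces a))| ≤ K' * γ ^ 2 ∧
      (T ≠ .III ∨ ¬ HasIsolatedSite a ∨ ¬ HasIsolatedSite b →
        |commHeight (V (2 * M) γ) (branch a γ) {branch b γ} -
          (height0 M + γ * T.height1 M (interfaces a))| ≤ K' * γ ^ 2) := by
    refine eventually_all.2 fun i ↦ eventually_all.2 fun j ↦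
      eventually_forall_isSpin hM fun b _ ↦ ?_
    by_cases hb : IsInterchange a b i j
    swap
    · exact Eventually.of_forall fun _ h ↦ absurd h hb
    obtain ⟨T, hT, hev⟩ := hK a i j ha b hb
    have hle : ∀ γ : ℝ, K a i j * γ ^ 2 ≤ K' * γ ^ 2 := fun γ ↦
      mul_le_mul_of_nonneg_right (hK' ⟨(a, i, j), ⟨ha, trivial⟩, rfl⟩) (sq_nonneg _)
    exact hev.mono fun γ hγ _ ↦ ⟨T, hT, hγ.1.trans (hle γ), fun hc ↦ (hγ.2 hc).trans (hle γ)⟩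
  exact key.mono fun γ hγ b i j hb ↦ hγ i j b (hb.isSpin ha) hb

end MassConserving

end

theorem proposition4p6 (M : ℕ) (hM : 4 ≤ M) (h3 : ¬ 3 ∣ 2 * M) :
    -- the zeroth-order term is the height of the saddles `C_1` above the minima `B_0` at `γ = 0`
    (∀ b ∈ B M 0, ∀ c ∈ C M 1, V (2 * M) 0 c - V (2 * M) 0 b = height0 M) ∧
    ∃ γ₀ > (0 : ℝ), ∃ K : ℝ, ∀ γ ∈ Set.Ico 0 γ₀,
      -- every configuration of the uncoupled system persists
      (∀ a ∈ B M 0, ∃! x, IsContinuation γ a x) ∧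
      ∀ a₁ ∈ B M 0, ∀ a₂ ∈ B M 0, ∀ x₁ x₂ : S (2 * M),
        IsContinuation γ a₁ x₁ → IsContinuation γ a₂ x₂ →
        -- allowed transitions
        (TransitionPossible M γ x₁ x₂ ↔ ∃ i j, IsInterchange a₁ a₂ i j) ∧
        ∀ i j, IsInterchange a₁ a₂ i j →
          (interfaces a₂ : ℤ) - interfaces a₁ ∈ ({-4, -2, 0, 2, 4} : Set ℤ) ∧
          ∃ T : TransitionType, IsOfType a₁ i j T ∧
            (interfaces a₂ : ℤ) = interfaces a₁ + T.deltaP ∧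
            |transitionHeight M γ x₁ x₂ - (height0 M + γ * T.height1 M (interfaces a₁))|
              ≤ K * γ ^ 2 ∧
            -- the unrestricted communication height
            (T ≠ .III ∨ ¬ HasIsolatedSite a₁ ∨ ¬ HasIsolatedSite a₂ →
              |commHeight (V (2 * M) γ) x₁ {x₂}
                - (height0 M + γ * T.height1 M (interfaces a₁))| ≤ K * γ ^ 2) := by
  refine ⟨fun b hb c hc ↦ ?_, ?_⟩
  · obtain ⟨a, k, ha, rfl⟩ := exists_saddle_of_mem_C hM hc
    rw [V_zero_saddle hM ha k, (isSpin_of_mem_B hM hb).V_zero, saddleLevel_eq]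
    ring
  obtain ⟨K, hK⟩ := exists_uniform_height hM
  -- All assertions hold eventually as `γ ↓ 0`; their intersection contains an interval starting at
  -- `0`.
  obtain ⟨γ₀, hγ₀, hsub⟩ := mem_nhdsGE_iff_exists_Icc_subset.1
    ((hK.and (eventually_transitionPossible_iff hM h3)).and
      (eventually_forall_isSpin hM fun a ha ↦ ha.isMinimum.eventually_isContinuation))
  refine ⟨γ₀, hγ₀, K, fun γ hγ ↦ ?_⟩
  obtain ⟨⟨hheight, hposs⟩, hcont⟩ := hsub ⟨hγ.1, hγ.2.le⟩
  refine ⟨fun a ha ↦ ?_, fun a₁ h₁ a₂ h₂ x₁ x₂ hx₁ hx₂ ↦ ?_⟩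
  · have h := hcont a (isSpin_of_mem_B hM ha)
    exact ⟨branch a γ, (h _).2 rfl, fun y hy ↦ (h y).1 hy⟩
  have hs₁ := isSpin_of_mem_B hM h₁
  have hs₂ := isSpin_of_mem_B hM h₂
  obtain rfl := (hcont a₁ hs₁ x₁).1 hx₁
  obtain rfl := (hcont a₂ hs₂ x₂).1 hx₂
  refine ⟨hposs a₁ hs₁ a₂ hs₂, fun i j hij ↦ ?_⟩
  obtain ⟨T, hT, htr, hcomm⟩ := hheight a₁ hs₁ a₂ i j hij
  exact ⟨hT.sub_mem, T, hT.isOfType, hT.interfaces_eq, htr, hcomm⟩
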